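/- **Setting.** $\mathbb{GT}_n$ is the set of signatures $\lambda=(\lambda_1\ge\dots\ge\lambda_n)\in\mathbb Z^n$ and $s_\lambda(x_1,\dots,x_n)$ is the Schur Laurent polynomial. For a probability measure $\tau$ on $\prod_{h=1}^H\mathbb{GT}_{n_h}$ its Schur generating function (SGF) is $$S_\tau(x)=\sum_{\lambda^1,\dots,\lambda^H}\tau(\lambda^1,\dots,\lambda^H)\prod_{h=1}^H \frac{s_{\lambda^h}(x^h_1,\dots,x^h_{n_h})}{s_{\lambda^h}(1^{n_h})};$$ $\tau$ is *smooth* if $\sum \tau(\lambda^1,\dots,\lambda^H)\, r^{\sum_{h,i}|\lambda^h_i|}<\infty$ for some $r>1$. Smooth measures $\tau_L$ on $\prod_h \mathbb{GT}_{n_h(L)}$, $L=1,2,\dots$, are *CLT-appropriate* if there are real numbers $c_{k,h}$, $d_{k,h;m,f}$ ($k,m\ge1$) such that, as $L\to\infty$, (1) $\frac1{n_h}\partial_{x_i^h}^k\ln S_{\tau_L}|_{x=1}\to c_{k,h}$; (2) $\partial_{x_i^h}^k\partial_{x_j^f}^m\ln S_{\tau_L}|_{x=1}\to d_{k,h;m,f}$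 whenever $(i,h)\ne(j,f)$; (3) every fixed mixed partial derivative of $\ln S_{\tau_L}$ at $x=1$ that involves at least three distinct variables tends to $0$. The case $H=1$ gives the notion for measures on a single $\mathbb{GT}_{n(L)}$. Let $N_h=N_h(L)$ with $N_h/L\to\mathcal N_h>0$, $h=1,\dots,H$; let $0<a_{h,1}\le\dots\le a_{h,M}=1$ and $n_{h,m}=\lfloor a_{h,m}N_h\rfloor$. Let $\rho_L$ be smooth CLT-appropriate probability measures on $\prod_h\mathbb{GT}_{N_h}$, and, for each $h$ and $1\le m\le M-1$, let $g_{h,m}=g_{h,m}^{(L)}$ be the SGFs of smooth CLT-appropriate probability measures on $\mathbb{GT}_{n_{h,m}}$. For $\lambda\in\mathbb{GT}_{n_{h,m+1}}$, $\mu\in\mathbb{GT}_{n_{h,m}}$ define $\mathfrak p_{m+1\to m;h}(\lambda\to\mu)$ by the absolutely convergent expansion on the torus $|x_1|=\dots=|x_{n_{h,m}}|=1$ $$\frac{s_\lambda(x_1,\dots,x_{n_{h,m}},1^{n_{h,m+1}-n_{h,m}})}{s_\lambda(1^{n_{h,m+1}})}\,g_{h,m}(x_1,\dots,x_{n_{h,m}})=\sum_{\mu\in\mathbb{GT}_{n_{h,m}}}\mathfrak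 p_{m+1\to m;h}(\lambda\to\mu)\frac{s_\mu(x_1,\dots,x_{n_{h,m}})}{s_\mu(1^{n_{h,m}})},$$ and give $(\lambda^h[m])_{h\le H,\,m\le M}\in\prod_{h,m}\mathbb{GT}_{n_{h,m}}$ the law $$\mathrm{Prob}(\lambda)=\rho_L(\lambda^1[M],\dots,\lambda^H[M])\prod_{h=1}^H\prod_{m=1}^{M-1}\mathfrak p_{m+1\to m;h}(\lambda^h[m+1]\to\lambda^h[m]),$$ expectations of functions $f$ being $\mathbb E f=\sum_\lambda \mathrm{Prob}(\lambda)f(\lambda)$. Put $$p^L_{k;h,m}=\sum_{i=1}^{n_{h,m}}\Big(\frac{\lambda^h_i[m]+n_{h,m}-i}{n_{h,m}}\Big)^k .$$ **Theorem 3.10.** The expansions defining $\mathfrak p_{m+1\to m;h}$ exist, the weights $\mathrm{Prob}$ sum to $1$, the sums defining the joint moments of the $p^L_{k;h,m}$ converge absolutely, and the following limits exist for $k,k'\ge1$, all $h,h',m,m'$ and (fixed) indices $i,i'$ with $(i,h)\neq(i',h')$, and do not depend on $i,i'$: $$c_{k;h,m}=\lim_{L\to\infty}\frac1{a_{h,m}N_h}\,\partial_{x^h_i}^k\Big[\ln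 S_{\rho_L}+\sum_{q=m}^{M-1}\ln g_{h,q}(x^h_1,x^h_2,\dots)\Big]_{x=1},$$ $$d_{k,h,m;k',h',m'}=\lim_{L\to\infty}\partial_{x^h_i}^k\,\partial_{x^{h'}_{i'}}^{k'}\Big[\ln S_{\rho_L}+\delta_{h=h'}\sum_{q=\max(m,m')}^{M-1}\ln g_{h,q}(x^h_1,x^h_2,\dots)\Big]_{x=1}.$$ Moreover: (A) For all $k\ge1$, $h$, $m$: $\lim_{L\to\infty}\frac1{a_{h,m}N_h}\mathbb E[p^L_{k;h,m}]=\mathfrak p(k;h,m)$. (B) For all $k_1,k_2\ge1$ and all $h_1,m_1,h_2,m_2$, with $m_1\le m_2$ in case $h_1=h_2$ (no loss, as the covariance is symmetric): $\lim_{L\to\infty}\big(\mathbb E[p^L_{k_1;h_1,m_1}p^L_{k_2;h_2,m_2}]-\mathbb E[p^L_{k_1;h_1,m_1}]\,\mathbb E[p^L_{k_2;h_2,m_2}]\big)=\mathfrak{cov}(k_1,h_1,m_1;k_2,h_2,m_2)$. (C) For each $r>2$ and any $(k_1,h_1,m_1),\dots,(k_r,h_r,m_r)$ with all $k_j\ge1$,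 the joint cumulant $$\sum_{\{U_1,\dots,U_t\}}(-1)^{t-1}(t-1)!\prod_{s=1}^t\mathbb E\Big[\prod_{j\in U_s}p^L_{k_j;h_j,m_j}\Big]$$ (the sum is over set partitions of $\{1,\dots,r\}$) tends to $0$ as $L\to\infty$. Here, with $F_{h,m}(z)=(1+z)\Big(\frac1z+\sum_{a\ge1}\frac{c_{a;h,m}z^{a-1}}{(a-1)!}\Big)$, $$\mathfrak p(k;h,m)=[z^{-1}]\,\frac{F_{h,m}(z)^{k+1}}{(k+1)(1+z)},$$ $$\mathfrak{cov}(k_1,h_1,m_1;k_2,h_2,m_2)=[z^{-1}w^{-1}]\;F_{h_1,m_1}(z)^{k_1}F_{h_2,m_2}(w)^{k_2}\Big(\delta_{h_1=h_2}\Big(\sum_{a\ge0}\frac{z^a}{w^{1+a}}\Big)^2+\sum_{a,b\ge1}\frac{d_{a,h_1,m_1;b,h_2,m_2}}{(a-1)!(b-1)!}z^{a-1}w^{b-1}\Big),$$ where $[z^{-1}]$ and $[z^{-1}w^{-1}]$ denote coefficients in the formal Laurent series (in $z$ over Laurent series in $w$). -/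

import Mathlib

open Filter Topology
open scoped BigOperators

noncomputable section

/-- Signatures of length `n`: weakly decreasing `n`-tuples of integers (`i : Fin n` is 0-based). -/
abbrev Sig (n : ℕ) : Type := {lam : Fin n → ℤ // Antitone lam}

/-- The Schur Laurent polynomial `s_λ(x₀, …, x_{n-1})` as a function of the variables `x 0, x 1, …`
(only the first `n` of them are used), by the combinatorial formula as a sum over
Gelfand–Tsetlin patterns, organised one row at a time:
`s_λ(x₀, …, x_n) = ∑_{μ ≺ λ} s_μ(x₀, …, x_{n-1}) x_n ^ (|λ| - |μ|)`, where `μ ≺ λ` means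
`λ₀ ≥ μ₀ ≥ λ₁ ≥ ⋯ ≥ μ_{n-1} ≥ λ_n`. -/
def schurFun : (n : ℕ) → (Fin n → ℤ) → (ℕ → ℂ) → ℂ
  | 0, _, _ => 1
  | n + 1, lam, x =>
      ∑ mu ∈ Fintype.piFinset (fun i : Fin n => Finset.Icc (lam i.succ) (lam i.castSucc)),
        schurFun n mu x * x n ^ ((∑ i, lam i) - ∑ i, mu i)

/-- The normalized Schur function `s_λ(x₀, …, x_{n-1}) / s_λ(1, …, 1)`. -/
def normSchur {n : ℕ} (lam : Sig n) (x : ℕ → ℂ) : ℂ :=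
  schurFun n lam.1 x / schurFun n lam.1 (fun _ => 1)

/-- The multi-dimensional Schur generating function of a probability measure on
`∏_h GT_{n h}`; the variable `x_i^h` is `x (h, i)`, with `i` counted from `0`. -/
def multiSGF {ι : Type} [Fintype ι] {n : ι → ℕ} (rho : PMF ((h : ι) → Sig (n h)))
    (x : ι × ℕ → ℂ) : ℂ :=
  ∑' lam : (h : ι) → Sig (n h),
    ((rho lam).toReal : ℂ) * ∏ h, normSchur (lam h) (fun i => x (h, i))

/-- The Schur generating function of a probability measure on `GT_n`. -/
def sgf {n : ℕ} (sigma : PMF (Sig n)) (x : ℕ → ℂ) : ℂ :=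
  ∑' lam : Sig n, ((sigma lam).toReal : ℂ) * normSchur lam x

/-- Smooth probability measures on `∏_h GT_{n h}`. -/
def IsSmoothMulti {ι : Type} [Fintype ι] {n : ι → ℕ} (rho : PMF ((h : ι) → Sig (n h))) : Prop :=
  ∃ r : ℝ, 1 < r ∧
    Summable fun lam : (h : ι) → Sig (n h) => (rho lam).toReal * r ^ (∑ h, ∑ i, |(lam h).1 i|)

/-- Smooth probability measures on `GT_n`. -/
def IsSmooth {n : ℕ} (sigma : PMF (Sig n)) : Prop :=
  ∃ r : ℝ, 1 < r ∧ Summable fun lam : Sig n => (sigma lam).toReal * r ^ (∑ i, |lam.1 i|)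

/-- The partial derivative `∂F/∂x_j`, as a function of `x`. -/
def partialDeriv {J : Type} [DecidableEq J] (j : J) (F : (J → ℂ) → ℂ) : (J → ℂ) → ℂ :=
  fun x => deriv (fun t => F (Function.update x j t)) (x j)

/-- The iterated partial derivative of `F` in the variables listed in `l` (with multiplicities),
evaluated at the point all of whose coordinates are `1`. -/
def derivAtOne {J : Type} [DecidableEq J] (l : List J) (F : (J → ℂ) → ℂ) : ℂ :=
  (l.foldr partialDeriv F) (fun _ => 1)

/-- CLT-appropriateness, in terms of the Schur generating functions `S L` of probability measures
on `∏_h GT_{n L h}`: the first derivatives in one variable of `ln S L` at `1` grow linearly,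
the mixed derivatives in two distinct variables converge, and those involving at least
three distinct variables tend to `0`. -/
def CLTAppropriate {ι : Type} [DecidableEq ι] (n : ℕ → ι → ℕ)
    (S : ℕ → (ι × ℕ → ℂ) → ℂ) : Prop :=
  ∃ (c : ℕ → ι → ℝ) (d : ℕ → ι → ℕ → ι → ℝ),
    (∀ k, 1 ≤ k → ∀ (h : ι) (i : ℕ),
      Tendsto (fun L => (1 / (n L h : ℂ)) *
          derivAtOne (List.replicate k (h, i)) (fun x => Complex.log (S L x)))
        atTop (𝓝 (c k h : ℂ))) ∧
    (∀ k m, 1 ≤ k → 1 ≤ m → ∀ (h f : ι) (i j : ℕ), (h, i) ≠ (f, j) →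
      Tendsto (fun L =>
          derivAtOne (List.replicate k (h, i) ++ List.replicate m (f, j))
            (fun x => Complex.log (S L x)))
        atTop (𝓝 (d k h m f : ℂ))) ∧
    (∀ l : List (ι × ℕ), 3 ≤ l.toFinset.card →
      Tendsto (fun L => derivAtOne l (fun x => Complex.log (S L x))) atTop (𝓝 0))

/-- `P` is the family of coefficients of the (absolutely convergent) expansion of the symmetric
function `F` of `x₀, …, x_{k-1}` in normalized Schur functions, on the torus `|x_i| = 1`. By
orthogonality of the Schur functions on the torus there is at most one such `P`. -/
def IsSchurExpansion {k : ℕ} (F : (ℕ → ℂ) → ℂ) (P : Sig k → ℝ) : Prop :=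
  ∀ x : ℕ → ℂ, (∀ i, ‖x i‖ = 1) → HasSum (fun mu : Sig k => (P mu : ℂ) * normSchur mu x) (F x)

/-- The function `s_λ(x₀, …, x_{k-1}, 1, …, 1) / s_λ(1, …, 1) ⬝ g(x₀, …, x_{k-1})`. -/
def branchFun {n : ℕ} (k : ℕ) (g : (ℕ → ℂ) → ℂ) (lam : Sig n) (x : ℕ → ℂ) : ℂ :=
  normSchur lam (fun i => if i < k then x i else 1) * g x

/-- The transition coefficients `𝔭(λ → μ)`: the coefficients of the expansion of `branchFun k g λ`
in normalized Schur functions. -/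
def transCoeff {n k : ℕ} (g : (ℕ → ℂ) → ℂ) (lam : Sig n) : Sig k → ℝ :=
  Classical.epsilon (IsSchurExpansion (branchFun k g lam))

/-- Joint configurations `(λ^h[m])` with `λ^h[m] ∈ GT_{n h m}`, for `M + 1` levels
`m = 0, …, M` in each coordinate `h`. -/
abbrev Config {H M : ℕ} (n : Fin H → Fin (M + 1) → ℕ) : Type :=
  (h : Fin H) → (m : Fin (M + 1)) → Sig (n h m)

/-- The probability of a configuration: the top levels `λ^h[M]` are jointly distributed according
to `rho`, and then each coordinate is projected down level by level,
independently of the others, with the transition coefficients given by `g h m`. -/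
def chainProb {H M : ℕ} {n : Fin H → Fin (M + 1) → ℕ}
    (rho : PMF ((h : Fin H) → Sig (n h (Fin.last M))))
    (g : Fin H → Fin M → (ℕ → ℂ) → ℂ) (om : Config n) : ℝ :=
  (rho fun h => om h (Fin.last M)).toReal *
    ∏ h, ∏ m : Fin M, transCoeff (g h m) (om h m.succ) (om h m.castSucc)

/-- The expectation of a function on a discrete space under the law with weights `w`. -/
def expect {Om : Type} (w : Om → ℝ) (f : Om → ℝ) : ℝ := ∑' om, w om * f om

/-- The joint cumulant of a tuple of random variables, as a sum over set partitions. -/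
def jointCumulant {Om : Type} (w : Om → ℝ) {r : ℕ} (xi : Fin r → Om → ℝ) : ℝ :=
  ∑ pi : Finpartition (Finset.univ : Finset (Fin r)),
    (-1 : ℝ) ^ (pi.parts.card - 1) * (Nat.factorial (pi.parts.card - 1) : ℝ) *
      ∏ U ∈ pi.parts, expect w (fun om => ∏ j ∈ U, xi j om)

/-- The random power sum `p_{k;h,m} = ∑_i ((λ_i^h[m] + n - i) / n)^k`, `n = n h m`, with `i` running
from `1` to `n` (here the index is 0-based, whence `i + 1`). -/
def powerSum {H M : ℕ} {n : Fin H → Fin (M + 1) → ℕ} (k : ℕ) (h : Fin H) (m : Fin (M + 1))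
    (om : Config n) : ℝ :=
  ∑ i : Fin (n h m), ((((om h m).1 i : ℝ) + (n h m : ℝ) - ((i : ℕ) + 1 : ℝ)) / (n h m : ℝ)) ^ k

/-- The formal Laurent series `(1 + z) (1/z + ∑_{a ≥ 1} c_a z^{a-1} / (a-1)!)`. -/
def laurentF {K : Type} [Field K] (c : ℕ → K) : LaurentSeries K :=
  (1 + HahnSeries.single (1 : ℤ) (1 : K)) *
    (HahnSeries.single (-1 : ℤ) (1 : K) +
      HahnSeries.ofPowerSeries ℤ K
        (PowerSeries.mk fun a => c (a + 1) / (Nat.factorial a : K)))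

/-- The limiting mean: `[z^{-1}] (1 / ((k+1)(1+z))) ((1+z)(1/z + ∑_a c_a z^{a-1}/(a-1)!))^{k+1}`. -/
def limitMean (c : ℕ → ℝ) (k : ℕ) : ℝ :=
  1 / ((k : ℝ) + 1) *
    ((1 + HahnSeries.single (1 : ℤ) (1 : ℝ))⁻¹ * laurentF c ^ (k + 1)).coeff (-1)

/-- The series `∑_{a ≥ 0} z^a / w^{1+a}`, as a Laurent series in `z` whose coefficients are
Laurent series in `w`. -/
def geomKernel : LaurentSeries (LaurentSeries ℝ) :=
  HahnSeries.ofPowerSeries ℤ (LaurentSeries ℝ)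
    (PowerSeries.mk fun a => HahnSeries.single (-1 - (a : ℤ)) (1 : ℝ))

/-- The series `∑_{a,b ≥ 1} d_{a,b} z^{a-1} w^{b-1} / ((a-1)! (b-1)!)`. -/
def doubleSeries (d : ℕ → ℕ → ℝ) : LaurentSeries (LaurentSeries ℝ) :=
  HahnSeries.ofPowerSeries ℤ (LaurentSeries ℝ)
    (PowerSeries.mk fun a => HahnSeries.ofPowerSeries ℤ ℝ
      (PowerSeries.mk fun b =>
        d (a + 1) (b + 1) / ((Nat.factorial a : ℝ) * (Nat.factorial b : ℝ))))

/-- The limiting covariance: the coefficient of `z^{-1} w^{-1}` in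
`F₁(z)^{k₁} F₂(w)^{k₂} (δ (∑_a z^a / w^{1+a})² + ∑_{a,b} d_{a,b} z^{a-1} w^{b-1} / ((a-1)!(b-1)!))`,
where `F_i = laurentF c_i` and `δ` is `1` if `same` holds and `0` otherwise. The computation takes
place in the ring of Laurent series in `z` over Laurent series in `w`. -/
def limitCov (c₁ c₂ : ℕ → ℝ) (d : ℕ → ℕ → ℝ) (same : Prop) [Decidable same] (k₁ k₂ : ℕ) : ℝ :=
  ((laurentF (fun a => (HahnSeries.C (c₁ a) : LaurentSeries ℝ)) ^ k₁ *
      HahnSeries.C (laurentF c₂ ^ k₂) *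
      ((if same then geomKernel ^ 2 else 0) + doubleSeries d)).coeff (-1)).coeff (-1)

end

/-! Write `V` for the Vandermonde product and `l_i = λ_i + n - i`. By the bialternant formula
(`vdm_mul_schurFun`), `V s_λ` is an alternating sum of monomials with exponents `l ∘ τ`. Conjugating
`∑_i x_i^k ∂_i^k` by `V` therefore gives an operator with every Schur function as an eigenfunction,
the eigenvalue being the factorial power sum of `l` (`eulerSum_vdm_mul_jetSchur`). A power sum under
the expectation thus becomes a differential operator on a generating function, while a step down the
chain sets the superfluous variables to one and multiplies by the functions `g`
(`hasJet_weightGF_push`). The expectation is finally read off at the point where all variables are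
one. The transition weights may be negative, so convergence rests on absolute bounds with
exponential tails: `exists_schur_expansion`, `IsSchurExpansion.unique`, `exists_chain_weights`.

For the asymptotics only Taylor series at one matter, written in `X = x - 1` and taken modulo high
degree. Every generating function that occurs has the form `s · Y`, where `s` belongs to the bare
chain at that level and `Y` is a polynomial in the power sums of the `X`. Forgetting variables sends
power sums to power sums (`restr_realize`), so `Y` can be kept in one ring `PSRing` for all levels
and all `L`. On this ring each power sum of the chain acts by an explicit operator `popOp`: the
derivatives of `V` are eliminated by a partial fraction identity (`vdmSeries_mul_esymmGen`) and
Newton's identities, those of `s` by the expansion of `log s` in power sums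
(`ordGE_sub_realize_gammaPoly`). Joint moments become values at the origin of products of such
operators applied to `1`, operators of lower levels acting last (`hasSum_chainWeight_mul`).

With `η = 1/n`, the CLT conditions give `popOp = a_L + X_L`, where `a_L` is a scalar of order `n`
and `X_L` tends to an operator `Z y = s y + α y + β y` (`exists_popOp_expansion`). Here `β` is a
derivation with constant coefficients and `α` has degree at most one in the power sums, so that each
`β_i α_j` is a scalar. The numbers `a_L` yield the law of large numbers. They do not affect
cumulants of order at least two (`cumulant_opMoment_shift`), for which the operators `Z` alone are
responsible. As `β_i` commutes with `Z_j` up to the scalar `β_i α_j`, the moments of the `Z` obey a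
Wick formula (`opMoment_wick`): covariances are the contractions `β_i α_j`, and cumulants of order
at least three vanish (`cumulant_wick`).

It remains to recognise the limits. The binomial theorem turns the coefficients of `a_L`, `α`, `β`
into coefficients of powers of the Laurent series `F` (`leadCoeff_cPoly`,
`limitCov_eq_contraction`). In a contraction, `α` comes from the operator that acts first, that is,
from the higher level; this is why the second-order data enter at `max m m'`. -/

noncomputable section

set_option linter.unusedSectionVars false

section

open Finset Function

/-! ### Formal Taylor series at the point with all coordinates one -/

section Jets

open MvPowerSeries

variable {J : Type} [DecidableEq J]

/-- The polydisc of radius `δ` around the point all of whose coordinates are `1`. -/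
def polydisc (J : Type) (δ : ℝ) : Set (J → ℂ) := {x | ∀ j, ‖x j - 1‖ < δ}

theorem one_mem_polydisc {δ : ℝ} (hδ : 0 < δ) : (fun _ => 1) ∈ polydisc J δ := by
  intro j; simpa using hδ

theorem polydisc_mono {δ δ' : ℝ} (h : δ' ≤ δ) : polydisc J δ' ⊆ polydisc J δ :=
  fun _ hx j => (hx j).trans_le h

theorem eventually_update_mem_polydisc {δ : ℝ} {x : J → ℂ} (hx : x ∈ polydisc J δ) (j : J) :
    ∀ᶠ t in 𝓝 (x j), update x j t ∈ polydisc J δ := by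
  have h : ∀ᶠ t in 𝓝 (x j), ‖t - 1‖ < δ :=
    (continuous_id.sub continuous_const).norm.continuousAt.eventually_lt continuousAt_const (hx j)
  filter_upwards [h] with t ht i
  by_cases hij : i = j
  · subst hij; simpa using ht
  · simpa [hij] using hx i

/-- `F` is partially differentiable up to order `n` on the polydisc, and the partial derivatives
at `1` are those of the formal power series `f`. -/
def JetUpTo (δ : ℝ) : ℕ → ((J → ℂ) → ℂ) → MvPowerSeries J ℂ → Prop
  | 0, F, f => F (fun _ => 1) = constantCoeff f
  | n + 1, F, f => F (fun _ => 1) = constantCoeff f ∧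
      ∀ j, (∀ x ∈ polydisc J δ, DifferentiableAt ℂ (fun t => F (update x j t)) (x j)) ∧
        JetUpTo δ n (partialDeriv j F) (pderiv ℂ j f)

theorem JetUpTo.pred {δ : ℝ} {n : ℕ} : ∀ {F : (J → ℂ) → ℂ} {f : MvPowerSeries J ℂ},
    JetUpTo δ (n + 1) F f → JetUpTo δ n F f := by
  induction n with
  | zero => intro F f h; exact h.1
  | succ n ih => intro F f h; exact ⟨h.1, fun j => ⟨(h.2 j).1, ih (h.2 j).2⟩⟩

theorem JetUpTo.shrink {δ δ' : ℝ} (hδ : δ' ≤ δ) {n : ℕ} :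
    ∀ {F : (J → ℂ) → ℂ} {f : MvPowerSeries J ℂ}, JetUpTo δ n F f → JetUpTo δ' n F f := by
  induction n with
  | zero => intro F f h; exact h
  | succ n ih =>
    intro F f h
    exact ⟨h.1, fun j => ⟨fun x hx => (h.2 j).1 x (polydisc_mono hδ hx), ih (h.2 j).2⟩⟩

theorem partialDeriv_congr {δ : ℝ} {F G : (J → ℂ) → ℂ} (hFG : ∀ x ∈ polydisc J δ, F x = G x)
    (j : J) : ∀ x ∈ polydisc J δ, partialDeriv j F x = partialDeriv j G x := by
  intro x hx
  refine Filter.EventuallyEq.deriv_eq ?_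
  filter_upwards [eventually_update_mem_polydisc hx j] with t ht using hFG _ ht

theorem JetUpTo.congr {δ : ℝ} (hδ : 0 < δ) {n : ℕ} : ∀ {F G : (J → ℂ) → ℂ}
    {f : MvPowerSeries J ℂ}, (∀ x ∈ polydisc J δ, F x = G x) → JetUpTo δ n F f →
    JetUpTo δ n G f := by
  induction n with
  | zero => intro F G f hFG h; exact (hFG _ (one_mem_polydisc hδ)).symm.trans h
  | succ n ih =>
    intro F G f hFG h
    refine ⟨(hFG _ (one_mem_polydisc hδ)).symm.trans h.1, fun j => ⟨fun x hx => ?_, ?_⟩⟩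
    · refine ((h.2 j).1 x hx).congr_of_eventuallyEq ?_
      filter_upwards [eventually_update_mem_polydisc hx j] with t ht using (hFG _ ht).symm
    · exact ih (partialDeriv_congr hFG j) (h.2 j).2

theorem partialDeriv_eq {F : (J → ℂ) → ℂ} {j : J} {x : J → ℂ} {d : ℂ}
    (h : HasDerivAt (fun t => F (update x j t)) d (x j)) : partialDeriv j F x = d :=
  h.deriv

theorem hasDerivAt_partialDeriv {F : (J → ℂ) → ℂ} {j : J} {x : J → ℂ}
    (h : DifferentiableAt ℂ (fun t => F (update x j t)) (x j)) :
    HasDerivAt (fun t => F (update x j t)) (partialDeriv j F x) (x j) :=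
  h.hasDerivAt

theorem JetUpTo.add {δ : ℝ} (hδ : 0 < δ) {n : ℕ} : ∀ {F G : (J → ℂ) → ℂ}
    {f g : MvPowerSeries J ℂ}, JetUpTo δ n F f → JetUpTo δ n G g →
    JetUpTo δ n (fun x => F x + G x) (f + g) := by
  induction n with
  | zero => simp_all [JetUpTo]
  | succ n ih =>
    intro F G f g hF hG
    refine ⟨by simpa using congrArg₂ (· + ·) hF.1 hG.1, fun j => ⟨fun x hx => ?_, ?_⟩⟩
    · exact ((hF.2 j).1 x hx).add ((hG.2 j).1 x hx)
    · rw [map_add]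
      refine (ih (hF.2 j).2 (hG.2 j).2).congr hδ fun x hx => ?_
      exact (partialDeriv_eq ((hasDerivAt_partialDeriv ((hF.2 j).1 x hx)).add
        (hasDerivAt_partialDeriv ((hG.2 j).1 x hx)))).symm

theorem jetUpTo_const {δ : ℝ} (c : ℂ) {n : ℕ} : JetUpTo (J := J) δ n (fun _ => c) (C c) := by
  induction n generalizing c with
  | zero => simp [JetUpTo]
  | succ n ih =>
    refine ⟨by simp, fun j => ⟨fun x _ => differentiableAt_const _, ?_⟩⟩
    have h1 : partialDeriv j (fun _ : J → ℂ => c) = fun _ => 0 := by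
      funext x; simp [partialDeriv]
    rw [h1, pderiv_C]
    simpa using ih 0

theorem JetUpTo.mul {δ : ℝ} (hδ : 0 < δ) {n : ℕ} : ∀ {F G : (J → ℂ) → ℂ}
    {f g : MvPowerSeries J ℂ}, JetUpTo δ n F f → JetUpTo δ n G g →
    JetUpTo δ n (fun x => F x * G x) (f * g) := by
  induction n with
  | zero => simp_all [JetUpTo]
  | succ n ih =>
    intro F G f g hF hG
    refine ⟨by simpa using congrArg₂ (· * ·) hF.1 hG.1, fun j => ⟨fun x hx => ?_, ?_⟩⟩
    · exact ((hF.2 j).1 x hx).mul ((hG.2 j).1 x hx)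
    · rw [Derivation.leibniz, smul_eq_mul, smul_eq_mul]
      refine ((ih hF.pred (hG.2 j).2).add hδ (ih hG.pred (hF.2 j).2)).congr hδ fun x hx => ?_
      rw [partialDeriv_eq (F := fun x => F x * G x) ((hasDerivAt_partialDeriv ((hF.2 j).1 x hx)).mul
        (hasDerivAt_partialDeriv ((hG.2 j).1 x hx)))]
      simp only [Function.update_eq_self]
      ring

theorem jetUpTo_coord {δ : ℝ} (i : J) (n : ℕ) :
    JetUpTo δ n (fun x : J → ℂ => x i) (1 + X i) := by
  cases n with
  | zero => simp [JetUpTo]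
  | succ n =>
    refine ⟨by simp, fun j => ?_⟩
    by_cases hij : i = j
    · subst hij
      refine ⟨fun x _ => by simp, ?_⟩
      have h1 : partialDeriv i (fun x : J → ℂ => x i) = fun _ => 1 := by
        funext x; simp [partialDeriv]
      rw [h1]
      simpa [pderiv_X_self] using jetUpTo_const (J := J) (δ := δ) 1 (n := n)
    · refine ⟨fun x _ => by simp [hij], ?_⟩
      have h1 : partialDeriv j (fun x : J → ℂ => x i) = fun _ => 0 := by
        funext x; simp [partialDeriv, hij]
      rw [h1]
      simpa [pderiv_X_of_ne hij] using jetUpTo_const (J := J) (δ := δ) 0 (n := n)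

theorem JetUpTo.inv {δ : ℝ} (hδ : 0 < δ) {F : (J → ℂ) → ℂ} {f : MvPowerSeries J ℂ}
    (hF0 : ∀ x ∈ polydisc J δ, F x ≠ 0) {n : ℕ} (hF : JetUpTo δ n F f) :
    JetUpTo δ n (fun x => (F x)⁻¹) f⁻¹ := by
  induction n with
  | zero => simpa [JetUpTo] using congrArg (·⁻¹) hF
  | succ n ih =>
    refine ⟨by simpa using congrArg (·⁻¹) hF.1, fun j => ⟨fun x hx => ?_, ?_⟩⟩
    · exact ((hF.2 j).1 x hx).inv (by simpa using hF0 x hx)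
    · have hI := ih hF.pred
      rw [pderiv_inv']
      have := ((jetUpTo_const (J := J) (δ := δ) (-1) (n := n)).mul hδ (hI.mul hδ hI)).mul hδ
        (hF.2 j).2
      have e : (C (-1 : ℂ) : MvPowerSeries J ℂ) * (f⁻¹ * f⁻¹) * pderiv ℂ j f
          = -f⁻¹ ^ 2 * pderiv ℂ j f := by simp [sq]
      rw [e] at this
      refine this.congr hδ fun x hx => ?_
      have h0 : F (update x j (x j)) ≠ 0 := by simpa using hF0 x hx
      rw [partialDeriv_eq (F := fun x => (F x)⁻¹) ((hasDerivAt_partialDeriv ((hF.2 j).1 x hx)).inv h0)]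
      grind [Function.update_eq_self]

/-- `f` is the formal Taylor series of `F` at the point all of whose coordinates are `1`. -/
def HasJet (F : (J → ℂ) → ℂ) (f : MvPowerSeries J ℂ) : Prop :=
  ∃ δ : ℝ, 0 < δ ∧ ∀ n, JetUpTo δ n F f

theorem HasJet.add {F G : (J → ℂ) → ℂ} {f g : MvPowerSeries J ℂ} (hF : HasJet F f)
    (hG : HasJet G g) : HasJet (fun x => F x + G x) (f + g) := by
  obtain ⟨δ₁, h₁, hF⟩ := hF
  obtain ⟨δ₂, h₂, hG⟩ := hG
  exact ⟨min δ₁ δ₂, lt_min h₁ h₂, fun n => ((hF n).shrink (min_le_left _ _)).add (lt_min h₁ h₂)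
    ((hG n).shrink (min_le_right _ _))⟩

theorem HasJet.mul {F G : (J → ℂ) → ℂ} {f g : MvPowerSeries J ℂ} (hF : HasJet F f)
    (hG : HasJet G g) : HasJet (fun x => F x * G x) (f * g) := by
  obtain ⟨δ₁, h₁, hF⟩ := hF
  obtain ⟨δ₂, h₂, hG⟩ := hG
  exact ⟨min δ₁ δ₂, lt_min h₁ h₂, fun n => ((hF n).shrink (min_le_left _ _)).mul (lt_min h₁ h₂)
    ((hG n).shrink (min_le_right _ _))⟩

theorem hasJet_const (c : ℂ) : HasJet (J := J) (fun _ => c) (C c) :=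
  ⟨1, one_pos, fun _ => jetUpTo_const c⟩

theorem hasJet_coord (i : J) : HasJet (fun x : J → ℂ => x i) (1 + X i) :=
  ⟨1, one_pos, fun n => jetUpTo_coord i n⟩

theorem HasJet.sum {ι : Type*} (s : Finset ι) {F : ι → (J → ℂ) → ℂ} {f : ι → MvPowerSeries J ℂ}
    (h : ∀ i ∈ s, HasJet (F i) (f i)) : HasJet (fun x => ∑ i ∈ s, F i x) (∑ i ∈ s, f i) := by
  classical
  induction s using Finset.induction_on with
  | empty => simpa using hasJet_const (J := J) 0
  | insert a s ha ih => simp_all [sum_insert, add]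

theorem HasJet.prod {ι : Type*} (s : Finset ι) {F : ι → (J → ℂ) → ℂ} {f : ι → MvPowerSeries J ℂ}
    (h : ∀ i ∈ s, HasJet (F i) (f i)) : HasJet (fun x => ∏ i ∈ s, F i x) (∏ i ∈ s, f i) := by
  classical
  induction s using Finset.induction_on with
  | empty => simpa using hasJet_const (J := J) 1
  | insert a s ha ih => simp_all [prod_insert, mul]

theorem HasJet.value {F : (J → ℂ) → ℂ} {f : MvPowerSeries J ℂ} (h : HasJet F f) :
    F (fun _ => 1) = constantCoeff f := by
  obtain ⟨δ, _, h⟩ := h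
  exact h 0

theorem HasJet.deriv {F : (J → ℂ) → ℂ} {f : MvPowerSeries J ℂ} (h : HasJet F f) (j : J) :
    HasJet (partialDeriv j F) (pderiv ℂ j f) := by
  obtain ⟨δ, hδ, h⟩ := h
  exact ⟨δ, hδ, fun n => ((h (n + 1)).2 j).2⟩

theorem HasJet.derivAtOne_eq {F : (J → ℂ) → ℂ} {f : MvPowerSeries J ℂ} (h : HasJet F f)
    (l : List J) : derivAtOne l F = constantCoeff (l.foldr (fun j => pderiv ℂ j) f) := by
  have key : HasJet (l.foldr partialDeriv F) (l.foldr (fun j => pderiv ℂ j) f) := by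
    induction l with
    | nil => exact h
    | cons j l ih => exact ih.deriv j
  exact key.value

/-- The product of the factorials of the entries of a multi-index. -/
def multiFactorial (α : J →₀ ℕ) : ℂ := α.prod fun _ k => (k.factorial : ℂ)

theorem multiFactorial_ne_zero (α : J →₀ ℕ) : multiFactorial α ≠ 0 :=
  prod_ne_zero_iff.2 fun _ _ => Nat.cast_ne_zero.2 (Nat.factorial_ne_zero _)

theorem multiFactorial_add_single (α : J →₀ ℕ) (j : J) :
    multiFactorial (α + Finsupp.single j 1) = multiFactorial α * (α j + 1) := by
  unfold multiFactorial
  have h1 : ∀ β : J →₀ ℕ, β.support ⊆ insert j α.support →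
      β.prod (fun _ k => (k.factorial : ℂ)) = ∏ i ∈ insert j α.support, ((β i).factorial : ℂ) :=
    fun β hβ => Finsupp.prod_of_support_subset _ hβ _ (by simp)
  rw [h1 _ (subset_insert _ _), h1 (α + Finsupp.single j 1)]
  · rw [← mul_prod_erase _ _ (mem_insert_self j _),
      ← mul_prod_erase (insert j α.support) (fun i => ((α i).factorial : ℂ))
        (mem_insert_self j _)]
    have : ∏ x ∈ (insert j α.support).erase j, (((α + Finsupp.single j 1 : J →₀ ℕ) x).factorial : ℂ)
        = ∏ x ∈ (insert j α.support).erase j, ((α x).factorial : ℂ) := by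
      refine prod_congr rfl fun x hx => ?_
      simp_all
    rw [this]
    simp [Nat.factorial_succ]
    ring
  · refine Finsupp.support_add.trans (union_subset (subset_insert _ _) ?_)
    simp

/-- The multi-index recording the multiplicities of the entries of a list. -/
def listIndex (l : List J) : J →₀ ℕ := (l.map fun j => Finsupp.single j 1).sum

/-- With the multifactorials on both sides, each differentiation is a pure shift of the index, so
the induction carries no combinatorial factors. -/
theorem coeff_foldr_pderiv (l : List J) (f : MvPowerSeries J ℂ) (β : J →₀ ℕ) :
    multiFactorial β * coeff β (l.foldr (fun j => pderiv ℂ j) f)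
      = multiFactorial (β + listIndex l) * coeff (β + listIndex l) f := by
  induction l generalizing β with
  | nil => simp [listIndex]
  | cons j l ih =>
    grind [Finsupp.single, multiFactorial_add_single, coeff_pderiv, listIndex, add_assoc]

theorem HasJet.derivAtOne_coeff {F : (J → ℂ) → ℂ} {f : MvPowerSeries J ℂ} (h : HasJet F f)
    (l : List J) : derivAtOne l F = multiFactorial (listIndex l) * coeff (listIndex l) f := by
  have := coeff_foldr_pderiv l f 0
  rw [h.derivAtOne_eq]
  simpa [multiFactorial] using this

theorem listIndex_toList (α : J →₀ ℕ) : listIndex (Finsupp.toMultiset α).toList = α := by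
  have h : ∀ l : List J, listIndex l = Multiset.toFinsupp (l : Multiset J) := by
    intro l
    induction l with
    | nil => simp [listIndex]
    | cons j l ih =>
      have : listIndex (j :: l) = Finsupp.single j 1 + listIndex l := by simp [listIndex]
      rw [this, ih, ← Multiset.cons_coe, ← Multiset.singleton_add, map_add,
        Multiset.toFinsupp_singleton]
  simp_all

/-- Every coefficient is an iterated derivative divided by a nonzero multifactorial. This is the
device by which identities between functions near one become identities between formal power series.
-/
theorem HasJet.unique {F : (J → ℂ) → ℂ} {f g : MvPowerSeries J ℂ} (hf : HasJet F f)
    (hg : HasJet F g) : f = g := by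
  ext α
  have h1 := hf.derivAtOne_coeff (Finsupp.toMultiset α).toList
  have h2 := hg.derivAtOne_coeff (Finsupp.toMultiset α).toList
  grind [listIndex_toList, mul_left_cancel₀, multiFactorial_ne_zero]

theorem HasJet.congr {F G : (J → ℂ) → ℂ} {f : MvPowerSeries J ℂ} (hF : HasJet F f) {δ : ℝ}
    (hδ : 0 < δ) (h : ∀ x ∈ polydisc J δ, F x = G x) : HasJet G f := by
  obtain ⟨δ', hδ', hF⟩ := hF
  refine ⟨min δ δ', lt_min hδ hδ', fun n => ((hF n).shrink (min_le_right _ _)).congr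
    (lt_min hδ hδ') fun x hx => h x (polydisc_mono (min_le_left _ _) hx)⟩

/-- Serves both for permutations of the variables and for embedding the variables of one coordinate
among those of all coordinates. -/
theorem derivAtOne_comp {J' : Type} [DecidableEq J'] {e : J' → J} (he : Injective e)
    (l : List J') (F : (J' → ℂ) → ℂ) :
    derivAtOne (l.map e) (fun x => F (x ∘ e)) = derivAtOne l F := by
  have key : (l.map e).foldr partialDeriv (fun x => F (x ∘ e))
      = fun x => (l.foldr partialDeriv F) (x ∘ e) := by
    induction l with
    | nil => rfl
    | cons j l ih =>
      rw [List.map_cons, List.foldr_cons, ih]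
      funext x
      simp only [partialDeriv, List.foldr_cons, Function.comp_apply]
      congr 1
      funext t
      refine congrArg (l.foldr partialDeriv F) (funext fun i => ?_)
      grind
  unfold derivAtOne
  rw [key]
  rfl

theorem listIndex_map {J' : Type} [DecidableEq J'] (e : J' → J) (l : List J') :
    listIndex (l.map e) = (listIndex l).mapDomain e := by
  induction l with
  | nil => simp [listIndex]
  | cons j l ih =>
    grind [listIndex, Finsupp.single, Finsupp.mapDomain_add, Finsupp.mapDomain_single]

theorem multiFactorial_mapDomain {J' : Type} [DecidableEq J'] {e : J' → J}
    (he : Injective e) (α : J' →₀ ℕ) :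
    multiFactorial (α.mapDomain e) = multiFactorial α := by
  unfold multiFactorial
  rw [Finsupp.prod_mapDomain_index_inj he]

/-- The Taylor coefficients of a function invariant under a permutation of the variables are
invariant, too. -/
theorem HasJet.coeff_mapDomain {F : (J → ℂ) → ℂ} {f : MvPowerSeries J ℂ} (h : HasJet F f)
    (e : J ≃ J) (he : ∀ x, F (x ∘ e) = F x) (α : J →₀ ℕ) :
    coeff (α.mapDomain e) f = coeff α f := by
  have h1 := derivAtOne_comp e.injective (Finsupp.toMultiset α).toList F
  have h3 : (fun x => F (x ∘ e)) = F := funext he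
  rw [h3, h.derivAtOne_coeff, h.derivAtOne_coeff, listIndex_map, listIndex_toList,
    multiFactorial_mapDomain e.injective] at h1
  exact mul_left_cancel₀ (multiFactorial_ne_zero α) h1

/-- The Euler operator. -/
def eulerOp (f : MvPowerSeries J ℂ) : MvPowerSeries J ℂ := fun α => (α.degree : ℂ) * coeff α f

theorem coeff_eulerOp (f : MvPowerSeries J ℂ) (α : J →₀ ℕ) :
    coeff α (eulerOp f) = (α.degree : ℂ) * coeff α f := rfl

theorem eulerOp_mul (f g : MvPowerSeries J ℂ) :
    eulerOp (f * g) = eulerOp f * g + f * eulerOp g := by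
  ext α
  rw [map_add, coeff_eulerOp, coeff_mul, coeff_mul, coeff_mul, mul_sum,
    ← sum_add_distrib]
  refine sum_congr rfl fun p hp => ?_
  rw [coeff_eulerOp, coeff_eulerOp, ← (mem_antidiagonal.1 hp), map_add]
  push_cast
  ring

theorem pderiv_eulerOp (f : MvPowerSeries J ℂ) (j : J) :
    pderiv ℂ j (eulerOp f) = eulerOp (pderiv ℂ j f) + pderiv ℂ j f := by
  ext α
  rw [map_add, coeff_pderiv, coeff_eulerOp, coeff_eulerOp, coeff_pderiv, map_add,
    Finsupp.degree_single]
  push_cast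
  ring

/-- The formal logarithm of a power series. -/
theorem exists_formal_log (s : MvPowerSeries J ℂ) (hs : constantCoeff s ≠ 0) :
    ∃ g : MvPowerSeries J ℂ, constantCoeff g = 0 ∧ ∀ j, pderiv ℂ j g = s⁻¹ * pderiv ℂ j s := by
  -- The Euler operator `E` multiplies the part of degree `m` by `m`. The logarithm must satisfy `E
  -- g = s⁻¹ E s`, and `E` is inverted degree by degree; in degree zero both sides vanish.
  let q : MvPowerSeries J ℂ := s⁻¹ * eulerOp s
  let g : MvPowerSeries J ℂ := fun α => coeff α q / (α.degree : ℂ)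
  have hq0 : constantCoeff q = 0 := by
    have : constantCoeff (eulerOp s) = 0 := by
      rw [← coeff_zero_eq_constantCoeff_apply, coeff_eulerOp]; simp
    simp [q, this]
  have hg : eulerOp g = q := by
    ext α
    rw [coeff_eulerOp]
    by_cases h0 : α = 0
    · subst h0; simp [hq0]
    · have : (α.degree : ℂ) ≠ 0 := by
        simpa [Finsupp.degree_eq_zero_iff] using h0
      change (α.degree : ℂ) * (coeff α q / (α.degree : ℂ)) = _
      field_simp
  have hsi : s * s⁻¹ = 1 := MvPowerSeries.mul_inv_cancel s hs
  refine ⟨g, ?_, fun j => ?_⟩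
  · rw [← coeff_zero_eq_constantCoeff_apply]
    change coeff 0 q / _ = 0
    simp
  -- Moving a partial derivative past `E` produces `E + 1`, which is injective because `m + 1` never
  -- vanishes.
  · have inj : ∀ a b : MvPowerSeries J ℂ, eulerOp a + a = eulerOp b + b → a = b := by
      intro a b hab
      ext α
      have := congrArg (coeff α) hab
      rw [map_add, map_add, coeff_eulerOp, coeff_eulerOp] at this
      have h1 : ((α.degree : ℂ) + 1) ≠ 0 := by exact_mod_cast Nat.succ_ne_zero α.degree
      grind
    apply inj
    rw [← pderiv_eulerOp, hg]
    have e1 : s * eulerOp (s⁻¹ * pderiv ℂ j s) =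
        eulerOp (pderiv ℂ j s) - eulerOp s * (s⁻¹ * pderiv ℂ j s) := by
      have h := eulerOp_mul s (s⁻¹ * pderiv ℂ j s)
      grind
    have hs0 : s ≠ 0 := by rintro rfl; simp at hs
    grind [mul_left_cancel₀, mul_add, Derivation.leibniz, pderiv_inv', pderiv_eulerOp, smul_eq_mul,
        eulerOp, pderiv]

theorem JetUpTo.log {δ : ℝ} (hδ : 0 < δ) {F : (J → ℂ) → ℂ} {s g : MvPowerSeries J ℂ}
    (hF0 : ∀ x ∈ polydisc J δ, F x ∈ Complex.slitPlane) (hF1 : F (fun _ => 1) = 1)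
    (hg0 : constantCoeff g = 0) (hg : ∀ j, pderiv ℂ j g = s⁻¹ * pderiv ℂ j s) {n : ℕ}
    (hF : JetUpTo δ n F s) : JetUpTo δ n (fun x => Complex.log (F x)) g := by
  cases n with
  | zero => simp [JetUpTo, hF1, hg0]
  | succ n =>
    refine ⟨by simp [hF1, hg0], fun j => ⟨fun x hx => ?_, ?_⟩⟩
    · exact ((hF.2 j).1 x hx).clog (by simpa using hF0 x hx)
    · rw [hg]
      refine ((hF.pred.inv hδ fun x hx => Complex.slitPlane_ne_zero (hF0 x hx)).mul hδ
        (hF.2 j).2).congr hδ fun x hx => ?_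
      have h0 : F (update x j (x j)) ∈ Complex.slitPlane := by simpa using hF0 x hx
      rw [partialDeriv_eq (F := fun x => Complex.log (F x))
        ((hasDerivAt_partialDeriv ((hF.2 j).1 x hx)).clog h0)]
      simp only [Function.update_eq_self]
      rw [div_eq_inv_mul]

theorem HasJet.log {F : (J → ℂ) → ℂ} {s : MvPowerSeries J ℂ} (hF : HasJet F s) {δ : ℝ}
    (hδ : 0 < δ) (hF0 : ∀ x ∈ polydisc J δ, F x ∈ Complex.slitPlane) (hF1 : F (fun _ => 1) = 1) :
    ∃ g : MvPowerSeries J ℂ, HasJet (fun x => Complex.log (F x)) g ∧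
      ∀ j, pderiv ℂ j s = s * pderiv ℂ j g := by
  have hs : constantCoeff s = 1 := hF.value.symm.trans hF1
  obtain ⟨g, hg0, hg⟩ := exists_formal_log s (by simp [hs])
  obtain ⟨δ', hδ', hF⟩ := hF
  refine ⟨g, ⟨min δ δ', lt_min hδ hδ', fun n => ((hF n).shrink (min_le_right _ _)).log
    (lt_min hδ hδ') (fun x hx => hF0 x (polydisc_mono (min_le_left _ _) hx)) hF1 hg0 hg⟩,
    fun j => ?_⟩
  rw [hg, ← mul_assoc, MvPowerSeries.mul_inv_cancel s (by simp [hs]), one_mul]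

end Jets

end

section

open Finset Function

/-! ### Absolutely convergent sums of Laurent monomials in infinitely many variables -/

section LaurentSums

theorem HasSum.congr_arg {ι M : Type*} [AddCommMonoid M] [TopologicalSpace M] {f g : ι → M} {a : M}
    (h : HasSum f a) (hfg : ∀ i, g i = f i) : HasSum g a := by
  rwa [show g = f from funext hfg]

open MvPowerSeries

variable {J : Type} [DecidableEq J]

/-- The Laurent monomial `x ^ w`. -/
def mon (w : J →₀ ℤ) (x : J → ℂ) : ℂ := w.prod fun j e => x j ^ e

/-- The `ℓ¹`-norm of an exponent. -/
def wnorm (w : J →₀ ℤ) : ℕ := w.sum fun _ e => e.natAbs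

/-- The polyannulus `r⁻¹ ≤ |x_j| ≤ r`. -/
def annulus (J : Type) (r : ℝ) : Set (J → ℂ) := {x | ∀ j, r⁻¹ ≤ ‖x j‖ ∧ ‖x j‖ ≤ r}

theorem annulus_mono {r r' : ℝ} (hr : 0 < r') (h : r' ≤ r) : annulus J r' ⊆ annulus J r :=
  fun _ hx j => ⟨(inv_anti₀ hr h).trans (hx j).1, (hx j).2.trans h⟩

theorem ne_zero_of_mem_annulus {r : ℝ} (hr : 0 < r) {x : J → ℂ} (hx : x ∈ annulus J r) (j : J) :
    x j ≠ 0 := by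
  have := (hx j).1
  grind [inv_pos, norm_pos_iff]

theorem one_mem_annulus {r : ℝ} (hr : 1 ≤ r) : (fun _ => 1) ∈ annulus J r := by
  intro j; simp_all [inv_le_one_of_one_le₀]

theorem mon_one (w : J →₀ ℤ) : mon w (fun _ => 1) = 1 := by simp [mon]

theorem mon_add {x : J → ℂ} (hx : ∀ j, x j ≠ 0) (w w' : J →₀ ℤ) :
    mon (w + w') x = mon w x * mon w' x :=
  Finsupp.prod_add_index' (fun _ => zpow_zero _) fun j _ _ => zpow_add₀ (hx j) _ _

theorem mon_eq_mul_erase (w : J →₀ ℤ) (x : J → ℂ) (j : J) :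
    mon w x = x j ^ (w j) * mon (w.erase j) x :=
  (Finsupp.mul_prod_erase' w j (fun i e => x i ^ e) fun _ => zpow_zero _).symm

theorem mon_erase_update (w : J →₀ ℤ) (x : J → ℂ) (j : J) (t : ℂ) :
    mon (w.erase j) (update x j t) = mon (w.erase j) x := by
  refine prod_congr rfl fun i hi => ?_
  grind

theorem mon_update (w : J →₀ ℤ) (x : J → ℂ) (j : J) (t : ℂ) :
    mon w (update x j t) = t ^ (w j) * mon (w.erase j) x := by
  rw [mon_eq_mul_erase w _ j, mon_erase_update, update_self]

theorem wnorm_add_le (w w' : J →₀ ℤ) : wnorm (w + w') ≤ wnorm w + wnorm w' := by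
  unfold wnorm
  rw [Finsupp.sum_of_support_subset (w + w') Finsupp.support_add _ (by simp),
    Finsupp.sum_of_support_subset w (subset_union_left (s₂ := w'.support)) _ (by simp),
    Finsupp.sum_of_support_subset w' (subset_union_right (s₁ := w.support)) _ (by simp),
    ← sum_add_distrib]
  exact sum_le_sum fun j _ => Int.natAbs_add_le _ _

theorem wnorm_neg (w : J →₀ ℤ) : wnorm (-w) = wnorm w := by
  simp [wnorm, Finsupp.sum, Finsupp.support_neg]

theorem wnorm_single (j : J) (e : ℤ) : wnorm (Finsupp.single j e) = e.natAbs := by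
  simp [wnorm]

theorem natAbs_le_wnorm (w : J →₀ ℤ) (j : J) : (w j).natAbs ≤ wnorm w := by
  by_cases h : j ∈ w.support
  · exact single_le_sum (f := fun j => (w j).natAbs) (fun _ _ => Nat.zero_le _) h
  grind

theorem norm_zpow_le {r : ℝ} (hr : 0 < r) {z : ℂ} (hz : r⁻¹ ≤ ‖z‖ ∧ ‖z‖ ≤ r) (e : ℤ) :
    ‖z ^ e‖ ≤ r ^ e.natAbs := by
  obtain ⟨n, rfl | rfl⟩ := e.eq_nat_or_neg
  · simpa using pow_le_pow_left₀ (norm_nonneg _) hz.2 n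
  · have : ‖z‖⁻¹ ≤ r := inv_le_of_inv_le₀ hr hz.1
    simpa using pow_le_pow_left₀ (inv_nonneg.2 (norm_nonneg z)) this n

theorem norm_mon_le {r : ℝ} (hr : 0 < r) {x : J → ℂ} (hx : x ∈ annulus J r) (w : J →₀ ℤ) :
    ‖mon w x‖ ≤ r ^ wnorm w := by
  unfold mon wnorm Finsupp.prod Finsupp.sum
  rw [norm_prod, ← prod_pow_eq_pow_sum]
  exact Finset.prod_le_prod (fun _ _ => norm_nonneg _) fun j _ => norm_zpow_le hr (hx j) _

/-- Polynomials are dominated by exponentials. -/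
theorem exists_poly_mul_pow_le (k d : ℕ) {a b : ℝ} (ha : 0 < a) (hab : a < b) :
    ∃ K : ℝ, 0 ≤ K ∧ ∀ m : ℕ, ((m : ℝ) + d) ^ k * a ^ m ≤ K * b ^ m := by
  have hb : 0 < b := ha.trans hab
  have h1 := tendsto_pow_const_mul_const_pow_of_abs_lt_one k (r := a / b)
    (by simp_all [abs_of_pos, div_lt_one])
  have h2 := h1.comp (tendsto_add_atTop_nat d)
  obtain ⟨K, hK⟩ := h2.bddAbove_range
  refine ⟨max 0 (K * (b / a) ^ d), le_max_left _ _, fun m => ?_⟩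
  have h3 : (((m + d : ℕ) : ℝ) ^ k * (a / b) ^ (m + d)) ≤ K := hK ⟨m, rfl⟩
  have h4 : ((m : ℝ) + d) ^ k * a ^ m
      = (((m + d : ℕ) : ℝ) ^ k * (a / b) ^ (m + d)) * (b / a) ^ d * b ^ m := by
    have e1 : (a / b) ^ d * (b / a) ^ d = 1 := by
      rw [← mul_pow]; field_simp; simp
    have e2 : (a / b) ^ m * b ^ m = a ^ m := by rw [← mul_pow]; field_simp
    grind
  rw [h4]
  have h5 : 0 ≤ (b / a) ^ d := by positivity
  simp_all [mul_le_mul_of_nonneg_right]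

/-- Generalised binomial coefficients. -/
def chooseC (z : ℂ) (k : ℕ) : ℂ := (∏ i ∈ range k, (z - i)) / (k.factorial : ℂ)

@[simp] theorem chooseC_zero (z : ℂ) : chooseC z 0 = 1 := by simp [chooseC]

theorem chooseC_succ (z : ℂ) (k : ℕ) :
    chooseC z (k + 1) * (k + 1) = z * chooseC (z - 1) k := by
  have hk : (k.factorial : ℂ) ≠ 0 := Nat.cast_ne_zero.2 (Nat.factorial_ne_zero _)
  have hk' : ((k : ℂ) + 1) ≠ 0 := by exact_mod_cast Nat.succ_ne_zero k
  unfold chooseC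
  rw [prod_range_succ', Nat.factorial_succ]
  grind

theorem norm_chooseC_le (e : ℤ) (k : ℕ) : ‖chooseC e k‖ ≤ ((e.natAbs : ℝ) + k) ^ k := by
  unfold chooseC
  rw [norm_div, norm_prod]
  have h1 : (1 : ℝ) ≤ ‖(k.factorial : ℂ)‖ := by
    rw [Complex.norm_natCast]; exact_mod_cast Nat.one_le_iff_ne_zero.2 (Nat.factorial_ne_zero _)
  refine (div_le_self (prod_nonneg fun _ _ => norm_nonneg _) h1).trans ?_
  have h2 : ∀ i ∈ range k, ‖((e : ℂ) - i)‖ ≤ (e.natAbs : ℝ) + k := by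
    intro i hi
    refine (norm_sub_le _ _).trans ?_
    rw [Complex.norm_intCast, Complex.norm_natCast]
    have h3 : (i : ℝ) ≤ k := by exact_mod_cast (mem_range.1 hi).le
    simp_all
  simpa using Finset.prod_le_prod (fun _ _ => norm_nonneg _) h2

/-- The Taylor coefficients of a Laurent monomial at `1`. -/
def jetCoeff (w : J →₀ ℤ) (α : J →₀ ℕ) : ℂ := α.prod fun j k => chooseC (w j) k

theorem jetCoeff_zero (w : J →₀ ℤ) : jetCoeff w 0 = 1 := by simp [jetCoeff]

theorem jetCoeff_add_single (w : J →₀ ℤ) (α : J →₀ ℕ) (j : J) :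
    jetCoeff w (α + Finsupp.single j 1) * (α j + 1)
      = w j * jetCoeff (w - Finsupp.single j 1) α := by
  unfold jetCoeff
  rw [← Finsupp.mul_prod_erase' (α + Finsupp.single j 1) j (fun j k => chooseC (w j) k) (by simp),
    ← Finsupp.mul_prod_erase' α j (fun i k => chooseC ((w - Finsupp.single j 1 : J →₀ ℤ) i) k)
      (by simp)]
  have h1 : (α + Finsupp.single j 1).erase j = α.erase j := by simp
  have h2 : (α.erase j).prod (fun i k => chooseC ((w - Finsupp.single j 1 : J →₀ ℤ) i) k)
      = (α.erase j).prod (fun i k => chooseC (w i) k) := by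
    refine prod_congr rfl fun i hi => ?_
    simp_all
  have h3 := chooseC_succ (w j) (α j)
  rw [h1, h2]
  simp only [Finsupp.add_apply, Finsupp.single_eq_same, Finsupp.sub_apply, Int.cast_sub,
    Int.cast_one]
  grind

theorem norm_jetCoeff_le (w : J →₀ ℤ) (α : J →₀ ℕ) :
    ‖jetCoeff w α‖ ≤ ((wnorm w : ℝ) + α.degree) ^ α.degree := by
  have : ((wnorm w : ℝ) + α.degree) ^ α.degree
      = ∏ j ∈ α.support, ((wnorm w : ℝ) + α.degree) ^ (α j) := by
    rw [prod_pow_eq_pow_sum, Finsupp.degree_apply]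
  rw [this]
  unfold jetCoeff Finsupp.prod
  rw [norm_prod]
  refine Finset.prod_le_prod (fun _ _ => norm_nonneg _) fun j _ => ?_
  refine (norm_chooseC_le _ _).trans (pow_le_pow_left₀ (by positivity) ?_ _)
  have h1 : ((w j).natAbs : ℝ) ≤ wnorm w := by exact_mod_cast natAbs_le_wnorm w j
  have h2 : (α j : ℝ) ≤ α.degree := by exact_mod_cast Finsupp.le_degree j α
  linarith

/-- The Taylor series at `1` of a sum of Laurent monomials. -/
def laurentJet {I : Type} (c : I → ℝ) (w : I → J →₀ ℤ) : MvPowerSeries J ℂ :=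
  fun α => ∑' i, (c i : ℂ) * jetCoeff (w i) α

theorem coeff_laurentJet {I : Type} (c : I → ℝ) (w : I → J →₀ ℤ) (α : J →₀ ℕ) :
    coeff α (laurentJet c w) = ∑' i, (c i : ℂ) * jetCoeff (w i) α := rfl

theorem pderiv_laurentJet {I : Type} (c : I → ℝ) (w : I → J →₀ ℤ) (j : J) :
    pderiv ℂ j (laurentJet c w)
      = laurentJet (fun i => c i * w i j) fun i => w i - Finsupp.single j 1 := by
  ext α
  rw [coeff_pderiv, coeff_laurentJet, coeff_laurentJet, ← tsum_mul_right]
  simp [mul_assoc, jetCoeff_add_single]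

/-- `F` is the sum of the Laurent monomials `c_i x ^ (w i)`, absolutely convergent on the
polyannulus of radius `r`. -/
structure LaurentRep {I : Type} (r : ℝ) (c : I → ℝ) (w : I → J →₀ ℤ) (F : (J → ℂ) → ℂ) : Prop where
  summable : Summable fun i => |c i| * r ^ wnorm (w i)
  hasSum : ∀ x ∈ annulus J r, HasSum (fun i => (c i : ℂ) * mon (w i) x) (F x)

theorem LaurentRep.norm_term_le {I : Type} {r : ℝ} (hr : 0 < r) (c : I → ℝ) (w : I → J →₀ ℤ)
    {x : J → ℂ} (hx : x ∈ annulus J r) (i : I) :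
    ‖(c i : ℂ) * mon (w i) x‖ ≤ |c i| * r ^ wnorm (w i) := by
  rw [norm_mul, Complex.norm_real, Real.norm_eq_abs]
  exact mul_le_mul_of_nonneg_left (norm_mon_le hr hx _) (abs_nonneg _)

theorem update_mem_annulus {r : ℝ} {x : J → ℂ} (hx : x ∈ annulus J r) (j : J) {t : ℂ}
    (ht : r⁻¹ ≤ ‖t‖ ∧ ‖t‖ ≤ r) : update x j t ∈ annulus J r := by
  intro i
  by_cases h : i = j
  · subst h; simpa using ht
  · simpa [h] using hx i

/-- Weierstrass' theorem in the single variable `x_j`, the others being frozen. The smaller closed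
annulus is needed so that `x_j` is an interior point of the annulus of radius `r`. -/
theorem LaurentRep.hasSum_deriv {I : Type} {r r' : ℝ} (hr' : 1 < r') (hrr : r' < r) {c : I → ℝ}
    {w : I → J →₀ ℤ} {F : (J → ℂ) → ℂ} (h : LaurentRep r c w F) (j : J) {x : J → ℂ}
    (hx : x ∈ annulus J r') :
    DifferentiableAt ℂ (fun t => F (update x j t)) (x j) ∧
    HasSum (fun i => ((c i * w i j : ℝ) : ℂ) * mon (w i - Finsupp.single j 1) x)
      (partialDeriv j F x) := by
  have hr0 : 0 < r' := one_pos.trans hr'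
  have hr1 : 0 < r := hr0.trans hrr
  let U : Set ℂ := {t | r⁻¹ < ‖t‖ ∧ ‖t‖ < r}
  have hU : IsOpen U :=
    (isOpen_lt continuous_const continuous_norm).inter (isOpen_lt continuous_norm continuous_const)
  have hxU : x j ∈ U :=
    ⟨(inv_strictAnti₀ hr0 hrr).trans_le (hx j).1, (hx j).2.trans_lt hrr⟩
  have hx' := annulus_mono hr0 hrr.le hx
  have hmem : ∀ t ∈ U, update x j t ∈ annulus J r := fun t ht =>
    update_mem_annulus hx' j ⟨ht.1.le, ht.2.le⟩
  let f : I → ℂ → ℂ := fun i t => (c i : ℂ) * mon (w i) (update x j t)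
  have hder : ∀ i, ∀ t ∈ U, HasDerivAt (f i)
      ((c i : ℂ) * ((w i j) * t ^ (w i j - 1) * mon ((w i).erase j) x)) t := by
    intro i t ht
    have ht0 : t ≠ 0 := norm_pos_iff.1 ((inv_pos.2 hr1).trans ht.1)
    have := ((hasDerivAt_zpow (w i j) t (Or.inl ht0)).mul_const
      (mon ((w i).erase j) x)).const_mul (c i : ℂ)
    grind [Eventually.of_forall, mon_update]
  have hbd : ∀ i, ∀ t ∈ U, ‖f i t‖ ≤ |c i| * r ^ wnorm (w i) := fun i t ht =>
    LaurentRep.norm_term_le hr1 c w (hmem t ht) i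
  have hd : ∀ i, DifferentiableOn ℂ (f i) U := fun i t ht =>
    (hder i t ht).differentiableAt.differentiableWithinAt
  have h1 := Complex.hasSum_deriv_of_summable_norm h.summable hd hU hbd hxU
  have h2 := Complex.differentiableOn_tsum_of_summable_norm h.summable hd hU hbd
  have hev : (fun t => F (update x j t)) =ᶠ[𝓝 (x j)] fun t => ∑' i, f i t := by
    filter_upwards [hU.mem_nhds hxU] with t ht
    exact (h.hasSum _ (hmem t ht)).tsum_eq.symm
  refine ⟨(h2.differentiableAt (hU.mem_nhds hxU)).congr_of_eventuallyEq hev, ?_⟩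
  unfold partialDeriv
  rw [hev.deriv_eq]
  refine h1.congr_arg fun i => ?_
  rw [(hder i _ hxU).deriv]
  have hx0 := ne_zero_of_mem_annulus hr0 hx
  have e1 : mon (w i - Finsupp.single j 1) x = x j ^ (w i j - 1) * mon ((w i).erase j) x := by
    rw [mon_eq_mul_erase _ x j]
    simp
  rw [e1]
  push_cast
  ring

/-- Differentiation costs a factor linear in the exponent; an arbitrarily small loss of radius
absorbs it. -/
theorem LaurentRep.deriv {I : Type} {r r' : ℝ} (hr' : 1 < r') (hrr : r' < r) {c : I → ℝ}
    {w : I → J →₀ ℤ} {F : (J → ℂ) → ℂ} (h : LaurentRep r c w F) (j : J) :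
    LaurentRep r' (fun i => c i * w i j) (fun i => w i - Finsupp.single j 1)
      (partialDeriv j F) := by
  have hr0 : 0 < r' := one_pos.trans hr'
  refine ⟨?_, fun x hx => (h.hasSum_deriv hr' hrr j hx).2⟩
  obtain ⟨K, hK0, hK⟩ := exists_poly_mul_pow_le 1 0 hr0 hrr
  refine Summable.of_nonneg_of_le (fun i => by positivity) (fun i => ?_)
    (h.summable.mul_left (K * r'))
  have h1 : wnorm (w i - Finsupp.single j 1) ≤ wnorm (w i) + 1 := by
    grind [sub_eq_add_neg, wnorm_add_le, wnorm_neg, wnorm_single]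
  have h2 : |(w i j : ℝ)| ≤ wnorm (w i) := by
    have : |(w i j : ℝ)| = (w i j).natAbs := by rw [Nat.cast_natAbs]; simp
    rw [this]; exact_mod_cast natAbs_le_wnorm (w i) j
  have h3 := hK (wnorm (w i))
  simp only [pow_one, Nat.cast_zero, add_zero] at h3
  calc |c i * w i j| * r' ^ wnorm (w i - Finsupp.single j 1)
      ≤ (|c i| * wnorm (w i)) * r' ^ (wnorm (w i) + 1) := by
        rw [abs_mul]
        exact mul_le_mul (mul_le_mul_of_nonneg_left h2 (abs_nonneg _))
          (pow_le_pow_right₀ hr'.le h1) (by positivity) (by positivity)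
    _ = |c i| * r' * (wnorm (w i) * r' ^ wnorm (w i)) := by rw [pow_succ]; ring
    _ ≤ |c i| * r' * (K * r ^ wnorm (w i)) := mul_le_mul_of_nonneg_left h3 (by positivity)
    _ = K * r' * (|c i| * r ^ wnorm (w i)) := by ring

theorem polydisc_subset_annulus {r : ℝ} (hr : 1 < r) :
    polydisc J (1 - r⁻¹) ⊆ annulus J r := by
  intro x hx j
  have h1 := hx j
  have h2 : ‖(1 : ℂ)‖ - ‖x j‖ ≤ ‖x j - 1‖ := by
    rw [norm_sub_rev]; exact norm_sub_norm_le _ _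
  have h3 : ‖x j‖ - ‖(1 : ℂ)‖ ≤ ‖x j - 1‖ := norm_sub_norm_le _ _
  rw [norm_one] at h2 h3
  refine ⟨by linarith, ?_⟩
  have h4 : 2 ≤ r + r⁻¹ := by
    have : 0 < r := by linarith
    have h5 : r + r⁻¹ - 2 = (r - 1) ^ 2 / r := by field_simp; ring
    have : 0 ≤ (r - 1) ^ 2 / r := by positivity
    linarith
  linarith

theorem LaurentRep.hasJet {I : Type} {r : ℝ} (hr : 1 < r) {c : I → ℝ}
    {w : I → J →₀ ℤ} {F : (J → ℂ) → ℂ} (h : LaurentRep r c w F) :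
    HasJet F (laurentJet c w) := by
  -- Every differentiation shrinks the radius, but all radii can be kept above this fixed `r₀`. The
  -- polydisc therefore does not depend on the order of differentiation.
  obtain ⟨r₀, h1, h0⟩ := exists_between hr
  have hδ : 0 < 1 - r₀⁻¹ := by
    have := inv_lt_one_of_one_lt₀ h1; linarith
  refine ⟨1 - r₀⁻¹, hδ, fun n => ?_⟩
  clear hr
  induction n generalizing r c w F with
  | zero =>
    have := (h.hasSum _ (one_mem_annulus (h1.trans h0).le)).tsum_eq
    change F _ = _
    rw [← coeff_zero_eq_constantCoeff_apply, coeff_laurentJet, ← this]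
    exact tsum_congr fun i => by rw [mon_one, jetCoeff_zero]
  | succ n ih =>
    obtain ⟨r₁, h2, h3⟩ := exists_between h0
    refine ⟨?_, fun j => ⟨fun x hx => ?_, ?_⟩⟩
    · have := (h.hasSum _ (one_mem_annulus (h1.trans h0).le)).tsum_eq
      rw [← coeff_zero_eq_constantCoeff_apply, coeff_laurentJet, ← this]
      exact tsum_congr fun i => by rw [mon_one, jetCoeff_zero]
    · exact (h.hasSum_deriv h1 h0 j (polydisc_subset_annulus h1 hx)).1
    · rw [pderiv_laurentJet]
      exact ih (h.deriv (h1.trans h2) h3 j) h2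

theorem LaurentRep.summable_jetCoeff {I : Type} {r : ℝ} (hr : 1 < r) {c : I → ℝ}
    {w : I → J →₀ ℤ} {F : (J → ℂ) → ℂ} (h : LaurentRep r c w F) (α : J →₀ ℕ) :
    Summable fun i => (c i : ℂ) * jetCoeff (w i) α := by
  obtain ⟨K, hK0, hK⟩ := exists_poly_mul_pow_le α.degree α.degree one_pos hr
  refine Summable.of_norm_bounded (h.summable.mul_left K) fun i => ?_
  rw [norm_mul, Complex.norm_real, Real.norm_eq_abs]
  have h1 := (norm_jetCoeff_le (w i) α).trans (by simpa using hK (wnorm (w i)))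
  calc |c i| * ‖jetCoeff (w i) α‖ ≤ |c i| * (K * r ^ wnorm (w i)) :=
        mul_le_mul_of_nonneg_left h1 (abs_nonneg _)
    _ = _ := by ring

theorem norm_pow_sub_one_le {ρ : ℝ} {z : ℂ} (h0 : ‖z‖ ≤ ρ) (h1 : ‖z - 1‖ ≤ ρ - 1) (n : ℕ) :
    ‖z ^ n - 1‖ ≤ ρ ^ n - 1 := by
  induction n with
  | zero => simp
  | succ n ih =>
    have e : z ^ (n + 1) - 1 = z * (z ^ n - 1) + (z - 1) := by ring
    rw [e]
    refine (norm_add_le _ _).trans ?_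
    rw [norm_mul]
    have hρ : 0 ≤ ρ := (norm_nonneg _).trans h0
    have := mul_le_mul h0 ih (norm_nonneg _) hρ
    calc _ ≤ ρ * (ρ ^ n - 1) + (ρ - 1) := add_le_add this h1
      _ = _ := by ring

theorem norm_mon_sub_one_le {ρ : ℝ} (hρ : 1 ≤ ρ) {x : J → ℂ} (hx : x ∈ annulus J ρ)
    (h1 : ∀ j, ‖x j - 1‖ ≤ ρ - 1) (h2 : ∀ j, ‖(x j)⁻¹ - 1‖ ≤ ρ - 1) (w : J →₀ ℤ) :
    ‖mon w x - 1‖ ≤ ρ ^ wnorm w - 1 := by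
  have hρ0 : 0 < ρ := by linarith
  have hz : ∀ j (e : ℤ), ‖x j ^ e - 1‖ ≤ ρ ^ e.natAbs - 1 := by
    intro j e
    obtain ⟨n, rfl | rfl⟩ := e.eq_nat_or_neg
    · simpa using norm_pow_sub_one_le (hx j).2 (h1 j) n
    · have := norm_pow_sub_one_le (z := (x j)⁻¹) (ρ := ρ)
        (by rw [norm_inv]; exact inv_le_of_inv_le₀ hρ0 (hx j).1) (h2 j) n
      simpa using this
  unfold mon wnorm Finsupp.prod Finsupp.sum
  generalize w.support = s
  induction s using Finset.induction_on with
  | empty => simp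
  | insert a s ha ih =>
    rw [prod_insert ha, sum_insert ha]
    have e : x a ^ w a * ∏ j ∈ s, x j ^ w j - 1
        = x a ^ w a * (∏ j ∈ s, x j ^ w j - 1) + (x a ^ w a - 1) := by ring
    rw [e, pow_add]
    refine (norm_add_le _ _).trans ?_
    rw [norm_mul]
    have := mul_le_mul (norm_zpow_le hρ0 (hx a) (w a)) ih (norm_nonneg _) (by positivity)
    grind

theorem pow_sub_one_le {ρ : ℝ} (hρ : 1 ≤ ρ) (n : ℕ) : ρ ^ n - 1 ≤ (ρ - 1) * (n * ρ ^ n) := by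
  induction n with
  | zero => simp
  | succ n ih =>
    have h1 : (1 : ℝ) ≤ ρ ^ n := one_le_pow₀ hρ
    rw [pow_succ]
    push_cast
    nlinarith [mul_nonneg (sub_nonneg.2 hρ) (sub_nonneg.2 h1),
      mul_nonneg (sub_nonneg.2 hρ) (by positivity : (0 : ℝ) ≤ n * ρ ^ n),
      mul_nonneg (mul_nonneg (sub_nonneg.2 hρ) (sub_nonneg.2 hρ))
        (by positivity : (0 : ℝ) ≤ n * ρ ^ n),
      mul_nonneg (mul_nonneg (sub_nonneg.2 hρ) (sub_nonneg.2 hρ))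
        (by positivity : (0 : ℝ) ≤ ρ ^ n)]

/-- The polydisc allows all of the infinitely many variables to move at once, so a bound uniform in
them is required: `|x^w - 1| ≤ ρ^|w| - 1 ≤ (ρ - 1) |w| ρ^|w|`. Summed against the coefficients this
is `O(ρ - 1)`, so that `|F - 1| < 1` for `ρ` near one. -/
theorem LaurentRep.exists_mem_slitPlane {I : Type} {r : ℝ} (hr : 1 < r) {c : I → ℝ}
    {w : I → J →₀ ℤ} {F : (J → ℂ) → ℂ} (h : LaurentRep r c w F) (hF : F (fun _ => 1) = 1) :
    ∃ δ : ℝ, 0 < δ ∧ ∀ x ∈ polydisc J δ, F x ∈ Complex.slitPlane := by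
  obtain ⟨r₀, h1, h0⟩ := exists_between hr
  obtain ⟨K, hK0, hK⟩ := exists_poly_mul_pow_le 1 0 (one_pos.trans h1) h0
  simp only [pow_one, Nat.cast_zero, add_zero] at hK
  set S := ∑' i, |c i| * r ^ wnorm (w i) with hS
  have hS0 : 0 ≤ S := tsum_nonneg fun i => by positivity
  have hden : 0 < K * S + 1 := by positivity
  -- Chosen so that the total deviation `(ρ - 1) K S` stays below one, `K S` bounding the sum of
  -- `|c_i| |w_i| r₀^|w_i|`.
  set ρ : ℝ := min r₀ (1 + 1 / (2 * (K * S + 1))) with hρdef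
  have hρ1 : 1 < ρ := lt_min h1 (by simp_all)
  have hρr : ρ ≤ r₀ := min_le_left _ _
  have hρ2 : (ρ - 1) * (K * S) < 1 := by
    have h3 : ρ - 1 ≤ 1 / (2 * (K * S + 1)) := by grind
    have h4 : 0 ≤ K * S := by positivity
    calc (ρ - 1) * (K * S) ≤ 1 / (2 * (K * S + 1)) * (K * S) := mul_le_mul_of_nonneg_right h3 h4
      _ < 1 := by grind
  have hρ0 : 0 < ρ := by linarith
  refine ⟨1 - ρ⁻¹, by have := inv_lt_one_of_one_lt₀ hρ1; linarith, fun x hx => ?_⟩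
  have hxA : x ∈ annulus J ρ := polydisc_subset_annulus hρ1 hx
  have hx1 : ∀ j, ‖x j - 1‖ ≤ ρ - 1 := by
    intro j
    have := (hx j).le
    have h5 : 1 - ρ⁻¹ ≤ ρ - 1 := by
      have h6 : ρ - 1 - (1 - ρ⁻¹) = (ρ - 1) ^ 2 / ρ := by field_simp
      have : 0 ≤ (ρ - 1) ^ 2 / ρ := by positivity
      linarith
    linarith
  have hx2 : ∀ j, ‖(x j)⁻¹ - 1‖ ≤ ρ - 1 := by
    intro j
    have hxj := ne_zero_of_mem_annulus hρ0 hxA j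
    have e : (x j)⁻¹ - 1 = (x j)⁻¹ * (1 - x j) := by field_simp
    rw [e, norm_mul, norm_inv, norm_sub_rev]
    have h7 : ‖x j‖⁻¹ ≤ ρ := inv_le_of_inv_le₀ hρ0 (hxA j).1
    calc ‖x j‖⁻¹ * ‖x j - 1‖ ≤ ρ * (1 - ρ⁻¹) :=
          mul_le_mul h7 (hx j).le (norm_nonneg _) hρ0.le
      _ = ρ - 1 := by field_simp
  have hxr : x ∈ annulus J r := annulus_mono hρ0 (hρr.trans h0.le) hxA
  have hs1 := h.hasSum x hxr
  have hs2 := h.hasSum _ (one_mem_annulus hr.le)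
  have hs3 := hs1.sub hs2
  have hbd : ∀ i, ‖(c i : ℂ) * mon (w i) x - (c i : ℂ) * mon (w i) (fun _ => 1)‖
      ≤ (ρ - 1) * K * (|c i| * r ^ wnorm (w i)) := by
    intro i
    rw [mon_one, ← mul_sub, norm_mul, Complex.norm_real, Real.norm_eq_abs]
    have h8 := (norm_mon_sub_one_le hρ1.le hxA hx1 hx2 (w i)).trans (pow_sub_one_le hρ1.le _)
    have h9 : (wnorm (w i) : ℝ) * ρ ^ wnorm (w i) ≤ K * r ^ wnorm (w i) :=
      (mul_le_mul_of_nonneg_left (pow_le_pow_left₀ hρ0.le hρr _) (by positivity)).trans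
        (hK (wnorm (w i)))
    calc |c i| * ‖mon (w i) x - 1‖ ≤ |c i| * ((ρ - 1) * (K * r ^ wnorm (w i))) :=
          mul_le_mul_of_nonneg_left (h8.trans
            (mul_le_mul_of_nonneg_left h9 (by linarith))) (abs_nonneg _)
      _ = _ := by ring
  have hfin := hs3.norm_le_of_bounded (h.summable.hasSum.mul_left ((ρ - 1) * K)) hbd
  rw [hF] at hfin
  have hlt : ‖F x - 1‖ < 1 := lt_of_le_of_lt hfin (by rw [← hS]; linarith)
  have hre : |(F x - 1).re| < 1 := (Complex.abs_re_le_norm _).trans_lt hlt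
  simp_all [Complex.mem_slitPlane_iff, Complex.sub_re, Complex.one_re, abs_lt]

/-- `F` is a sum of Laurent monomials with norm at most `B` on the polyannulus of radius `r`. -/
def IsLaurent (r B : ℝ) (F : (J → ℂ) → ℂ) : Prop :=
  ∃ (I : Type) (c : I → ℝ) (w : I → J →₀ ℤ), LaurentRep r c w F ∧
    ∑' i, |c i| * r ^ wnorm (w i) ≤ B

theorem IsLaurent.bound_nonneg {r B : ℝ} (hr : 0 ≤ r) {F : (J → ℂ) → ℂ} (h : IsLaurent r B F) :
    0 ≤ B := by
  obtain ⟨I, c, w, _, hB⟩ := h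
  exact (tsum_nonneg fun i => by positivity).trans hB

theorem IsLaurent.exists_hasJet {r B : ℝ} (hr : 1 < r) {F : (J → ℂ) → ℂ} (h : IsLaurent r B F) :
    ∃ f, HasJet F f := by
  obtain ⟨I, c, w, h, _⟩ := h
  exact ⟨_, h.hasJet hr⟩

theorem IsLaurent.weaken {r B B' : ℝ} (hB : B ≤ B') {F : (J → ℂ) → ℂ} (h : IsLaurent r B F) :
    IsLaurent r B' F := by
  obtain ⟨I, c, w, h, h'⟩ := h
  exact ⟨I, c, w, h, h'.trans hB⟩

theorem IsLaurent.shrink {r r' B : ℝ} (hr : 0 < r') (hrr : r' ≤ r) {F : (J → ℂ) → ℂ}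
    (h : IsLaurent r B F) : IsLaurent r' B F := by
  obtain ⟨I, c, w, h, h'⟩ := h
  have hle : ∀ i, |c i| * r' ^ wnorm (w i) ≤ |c i| * r ^ wnorm (w i) := fun i =>
    mul_le_mul_of_nonneg_left (pow_le_pow_left₀ hr.le hrr _) (abs_nonneg _)
  have hs : Summable fun i => |c i| * r' ^ wnorm (w i) :=
    Summable.of_nonneg_of_le (fun i => by positivity) hle h.summable
  exact ⟨I, c, w, ⟨hs, fun x hx => h.hasSum x (annulus_mono hr hrr hx)⟩,
    (hs.tsum_le_tsum hle h.summable).trans h'⟩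

theorem IsLaurent.congr {r B : ℝ} {F G : (J → ℂ) → ℂ} (h : IsLaurent r B F)
    (hFG : ∀ x ∈ annulus J r, F x = G x) : IsLaurent r B G := by
  obtain ⟨I, c, w, h, h'⟩ := h
  exact ⟨I, c, w, ⟨h.summable, fun x hx => hFG x hx ▸ h.hasSum x hx⟩, h'⟩

theorem isLaurent_mon {r : ℝ} (w : J →₀ ℤ) : IsLaurent r (r ^ wnorm w) (mon w) :=
  ⟨Unit, fun _ => 1, fun _ => w, ⟨(hasSum_fintype _).summable, fun x _ => by
    simp⟩, by simp⟩

theorem isLaurent_one {r : ℝ} : IsLaurent (J := J) r 1 (fun _ => 1) :=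
  ((isLaurent_mon (J := J) (r := r) 0).congr fun x _ => by simp [mon]).weaken (by simp [wnorm])

theorem IsLaurent.mul {r B B' : ℝ} (hr : 1 ≤ r) {F G : (J → ℂ) → ℂ} (hF : IsLaurent r B F)
    (hG : IsLaurent r B' G) : IsLaurent r (B * B') (fun x => F x * G x) := by
  have hr0 : 0 < r := one_pos.trans_le hr
  have hB0 := hF.bound_nonneg hr0.le
  obtain ⟨I, c, w, h, hB⟩ := hF
  obtain ⟨I', c', w', h', hB'⟩ := hG
  let a : I → ℝ := fun i => |c i| * r ^ wnorm (w i)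
  let b : I' → ℝ := fun i => |c' i| * r ^ wnorm (w' i)
  have ha : Summable a := h.summable
  have hb : Summable b := h'.summable
  have ha0 : ∀ i, 0 ≤ a i := fun i => by positivity
  have hb0 : ∀ i, 0 ≤ b i := fun i => by positivity
  have hle : ∀ p : I × I', |c p.1 * c' p.2| * r ^ wnorm (w p.1 + w' p.2) ≤ a p.1 * b p.2 := by
    intro p
    calc _ ≤ |c p.1 * c' p.2| * r ^ (wnorm (w p.1) + wnorm (w' p.2)) :=
          mul_le_mul_of_nonneg_left (pow_le_pow_right₀ hr (wnorm_add_le _ _)) (abs_nonneg _)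
      _ = a p.1 * b p.2 := by grind
  have s12 : Summable fun p : I × I' => a p.1 * b p.2 := ha.mul_of_nonneg hb ha0 hb0
  have hs : Summable fun p : I × I' => |c p.1 * c' p.2| * r ^ wnorm (w p.1 + w' p.2) :=
    Summable.of_nonneg_of_le (fun p => by positivity) hle s12
  refine ⟨I × I', fun p => c p.1 * c' p.2, fun p => w p.1 + w' p.2, ⟨hs, fun x hx => ?_⟩, ?_⟩
  · have hx0 := ne_zero_of_mem_annulus hr0 hx
    have n1 : Summable fun i => ‖(c i : ℂ) * mon (w i) x‖ :=
      Summable.of_nonneg_of_le (fun _ => norm_nonneg _) (LaurentRep.norm_term_le hr0 c w hx) ha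
    have n2 : Summable fun i => ‖(c' i : ℂ) * mon (w' i) x‖ :=
      Summable.of_nonneg_of_le (fun _ => norm_nonneg _) (LaurentRep.norm_term_le hr0 c' w' hx) hb
    have := HasSum.mul (f := fun i => (c i : ℂ) * mon (w i) x)
      (g := fun i => (c' i : ℂ) * mon (w' i) x) (h.hasSum x hx) (h'.hasSum x hx)
      (summable_mul_of_summable_norm (f := fun i => (c i : ℂ) * mon (w i) x)
        (g := fun i => (c' i : ℂ) * mon (w' i) x) n1 n2)
    refine this.congr_arg fun p => ?_
    rw [mon_add hx0]
    push_cast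
    ring
  · refine (hs.tsum_le_tsum hle s12).trans ?_
    have e : (∑' i, a i) * (∑' j, b j) = ∑' p : I × I', a p.1 * b p.2 := ha.tsum_mul_tsum hb s12
    grind [mul_le_mul, tsum_nonneg]

end LaurentSums

end

section

open Finset Function

/-! ### Operations on Laurent sums: superposition, restriction, continuity, logarithm -/

section LaurentClosure

open MvPowerSeries

variable {J : Type} [DecidableEq J]

/-- Superpositions of sums of Laurent monomials. -/
theorem IsLaurent.family {Λ : Type} {r : ℝ} (hr : 0 < r) {W B : Λ → ℝ} {F : Λ → (J → ℂ) → ℂ}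
    (hF : ∀ l, IsLaurent r (B l) (F l)) (hs : Summable fun l => |W l| * B l) :
    (∀ x ∈ annulus J r, HasSum (fun l => (W l : ℂ) * F l x) (∑' l, (W l : ℂ) * F l x)) ∧
    IsLaurent r (∑' l, |W l| * B l) (fun x => ∑' l, (W l : ℂ) * F l x) ∧
    (1 < r → ∀ f : Λ → MvPowerSeries J ℂ, (∀ l, HasJet (F l) (f l)) →
      ∃ g, HasJet (fun x => ∑' l, (W l : ℂ) * F l x) g ∧
        ∀ α, HasSum (fun l => (W l : ℂ) * coeff α (f l)) (coeff α g)) := by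
  choose I c w h hB using hF
  let C : (Σ l, I l) → ℝ := fun p => W p.1 * c p.1 p.2
  let E : (Σ l, I l) → J →₀ ℤ := fun p => w p.1 p.2
  have hnn : ∀ p, 0 ≤ |C p| * r ^ wnorm (E p) := fun p => by positivity
  have hterm : ∀ l i, |C ⟨l, i⟩| * r ^ wnorm (E ⟨l, i⟩)
      = |W l| * (|c l i| * r ^ wnorm (w l i)) := fun l i => by grind
  have hs1 : ∀ l, Summable fun i => |C ⟨l, i⟩| * r ^ wnorm (E ⟨l, i⟩) := fun l => by
    simp only [hterm]; exact (h l).summable.mul_left _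
  have hts : ∀ l, ∑' i, |C ⟨l, i⟩| * r ^ wnorm (E ⟨l, i⟩) ≤ |W l| * B l := fun l => by
    simp_all [tsum_mul_left, mul_le_mul_of_nonneg_left, abs_nonneg]
  have hs2 : Summable fun l => ∑' i, |C ⟨l, i⟩| * r ^ wnorm (E ⟨l, i⟩) :=
    Summable.of_nonneg_of_le (fun l => tsum_nonneg fun i => hnn _) hts hs
  have hS : Summable fun p => |C p| * r ^ wnorm (E p) :=
    (summable_sigma_of_nonneg hnn).2 ⟨hs1, hs2⟩
  have hsum : ∀ x ∈ annulus J r, ∃ a, HasSum (fun p => (C p : ℂ) * mon (E p) x) a ∧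
      HasSum (fun l => (W l : ℂ) * F l x) a := by
    intro x hx
    have h1 : Summable fun p => (C p : ℂ) * mon (E p) x :=
      Summable.of_norm_bounded hS fun p => LaurentRep.norm_term_le hr C E hx p
    refine ⟨_, h1.hasSum, h1.hasSum.sigma fun l => ?_⟩
    refine (((h l).hasSum x hx).mul_left (W l : ℂ)).congr_arg fun i => ?_
    simp only [C, E]
    push_cast
    ring
  have hrep : LaurentRep r C E (fun x => ∑' l, (W l : ℂ) * F l x) := by
    refine ⟨hS, fun x hx => ?_⟩
    obtain ⟨a, h1, h2⟩ := hsum x hx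
    rwa [h2.tsum_eq]
  refine ⟨fun x hx => ?_, ⟨_, C, E, hrep, ?_⟩, fun hr1 f hf => ?_⟩
  · obtain ⟨a, h1, h2⟩ := hsum x hx
    exact h2.summable.hasSum
  · rw [hS.tsum_sigma]
    exact hs2.tsum_le_tsum hts hs
  · refine ⟨_, hrep.hasJet hr1, fun α => ?_⟩
    have h1 := hrep.summable_jetCoeff hr1 α
    refine h1.hasSum.sigma fun l => ?_
    have h2 : f l = laurentJet (c l) (w l) := (hf l).unique ((h l).hasJet hr1)
    rw [h2, coeff_laurentJet]
    refine (((h l).summable_jetCoeff hr1 α).hasSum.mul_left (W l : ℂ)).congr_arg fun i => ?_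
    simp only [C, E]
    push_cast
    ring

theorem IsLaurent.sum {ι : Type} (s : Finset ι) {r : ℝ} (hr : 0 < r) {B : ι → ℝ}
    {F : ι → (J → ℂ) → ℂ} (hF : ∀ i ∈ s, IsLaurent r (B i) (F i)) :
    IsLaurent r (∑ i ∈ s, B i) (fun x => ∑ i ∈ s, F i x) := by
  have h := (IsLaurent.family (Λ := {i // i ∈ s}) (W := fun _ => 1) (B := fun i => B i)
    (F := fun i => F i) hr (fun i => hF i i.2) (hasSum_fintype _).summable).2.1
  simp only [tsum_fintype, abs_one, one_mul, Complex.ofReal_one] at h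
  grind [sum_coe_sort]

theorem IsLaurent.smul {r B : ℝ} (hr : 0 < r) {F : (J → ℂ) → ℂ} (hF : IsLaurent r B F) (a : ℝ) :
    IsLaurent r (|a| * B) (fun x => (a : ℂ) * F x) := by
  have h := (IsLaurent.family (Λ := Unit) (W := fun _ => a) (B := fun _ => B)
    (F := fun _ => F) hr (fun _ => hF) (hasSum_fintype _).summable).2.1
  simpa using h

theorem IsLaurent.prod {ι : Type} (s : Finset ι) {r : ℝ} (hr : 1 ≤ r) {B : ι → ℝ}
    {F : ι → (J → ℂ) → ℂ} (hF : ∀ i ∈ s, IsLaurent r (B i) (F i)) :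
    IsLaurent r (∏ i ∈ s, B i) (fun x => ∏ i ∈ s, F i x) := by
  classical
  induction s using Finset.induction_on with
  | empty => simpa using isLaurent_one
  | insert a s ha ih => simp_all [prod_insert, mul]

theorem mon_mapDomain {J' : Type} {e : J' → J} (he : Injective e)
    (w : J' →₀ ℤ) (x : J → ℂ) : mon (w.mapDomain e) x = mon w (x ∘ e) :=
  Finsupp.prod_mapDomain_index_inj he

theorem wnorm_mapDomain {J' : Type} {e : J' → J} (he : Injective e)
    (w : J' →₀ ℤ) : wnorm (w.mapDomain e) = wnorm w :=
  Finsupp.sum_mapDomain_index_inj he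

theorem IsLaurent.comp {J' : Type} {e : J' → J} (he : Injective e) {r B : ℝ}
    {F : (J' → ℂ) → ℂ} (hF : IsLaurent r B F) : IsLaurent r B (fun x : J → ℂ => F (x ∘ e)) := by
  obtain ⟨I, c, w, h, hB⟩ := hF
  refine ⟨I, c, fun i => (w i).mapDomain e, ⟨?_, fun x hx => ?_⟩, ?_⟩
  · simpa only [wnorm_mapDomain he] using h.summable
  · simp only [mon_mapDomain he]
    exact h.hasSum (x ∘ e) fun j => hx (e j)
  simp_all [wnorm_mapDomain]

/-- Setting the variables outside `p` equal to one. -/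
def setOne (p : J → Prop) [DecidablePred p] (x : J → ℂ) : J → ℂ := fun j => if p j then x j else 1

theorem mon_filter (p : J → Prop) [DecidablePred p] (w : J →₀ ℤ) (x : J → ℂ) :
    mon (w.filter p) x = mon w (setOne p x) := by
  unfold mon Finsupp.prod
  rw [Finsupp.support_filter, prod_filter]
  refine prod_congr rfl fun j _ => ?_
  simp_all [setOne]

theorem wnorm_filter_le (p : J → Prop) [DecidablePred p] (w : J →₀ ℤ) :
    wnorm (w.filter p) ≤ wnorm w := by
  unfold wnorm Finsupp.sum
  rw [Finsupp.support_filter, sum_filter]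
  refine sum_le_sum fun j _ => ?_
  by_cases h : p j <;> simp [h]

theorem setOne_mem_annulus (p : J → Prop) [DecidablePred p] {r : ℝ} (hr : 1 ≤ r) {x : J → ℂ}
    (hx : x ∈ annulus J r) : setOne p x ∈ annulus J r := by
  intro j
  by_cases h : p j
  · simpa [setOne, h] using hx j
  · simpa [setOne, h] using one_mem_annulus (J := J) hr j

theorem LaurentRep.setOne (p : J → Prop) [DecidablePred p] {r : ℝ} (hr : 1 ≤ r)
    {I : Type} {c : I → ℝ} {w : I → J →₀ ℤ}
    {F : (J → ℂ) → ℂ} (h : LaurentRep r c w F) :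
    LaurentRep r c (fun i => (w i).filter p) (fun x => F (setOne p x)) := by
  refine ⟨Summable.of_nonneg_of_le (fun i => by positivity) (fun i => ?_) h.summable,
    fun x hx => ?_⟩
  · exact mul_le_mul_of_nonneg_left (pow_le_pow_right₀ hr (wnorm_filter_le p _)) (abs_nonneg _)
  · simp only [mon_filter]
    exact h.hasSum _ (setOne_mem_annulus p hr hx)

theorem IsLaurent.setOne (p : J → Prop) [DecidablePred p] {r B : ℝ} (hr : 1 ≤ r)
    {F : (J → ℂ) → ℂ} (hF : IsLaurent r B F) :
    IsLaurent r B (fun x => F (setOne p x)) := by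
  obtain ⟨I, c, w, h, hB⟩ := hF
  refine ⟨I, c, _, h.setOne p hr, ((h.setOne p hr).summable.tsum_le_tsum (fun i => ?_)
    h.summable).trans hB⟩
  exact mul_le_mul_of_nonneg_left (pow_le_pow_right₀ hr (wnorm_filter_le p _)) (abs_nonneg _)

/-- The restriction of a formal power series to the variables in `p`. -/
def restr (p : J → Prop) [DecidablePred p] : MvPowerSeries J ℂ →+* MvPowerSeries J ℂ :=
  rescale fun j => if p j then 1 else 0

theorem chooseC_zero_left {k : ℕ} (hk : k ≠ 0) : chooseC 0 k = 0 := by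
  unfold chooseC
  rw [prod_eq_zero (i := 0) (mem_range.2 (Nat.pos_of_ne_zero hk)) (by simp), zero_div]

/-- In the Taylor variables `X = x - 1`, the substitution `x_j = 1` is `X_j = 0`, a rescaling by
zero. On the level of monomials this holds because `choose 0 k = 0` for `k ≠ 0`. -/
theorem HasJet.setOne (p : J → Prop) [DecidablePred p] {r B : ℝ} (hr : 1 < r)
    {F : (J → ℂ) → ℂ} (hF : IsLaurent r B F) {f : MvPowerSeries J ℂ} (hf : HasJet F f) :
    HasJet (fun x => F (setOne p x)) (restr p f) := by
  obtain ⟨I, c, w, h, hB⟩ := hF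
  have h1 := (h.setOne p hr.le).hasJet hr
  rw [hf.unique (h.hasJet hr)]
  convert h1 using 1
  ext α
  rw [restr, coeff_rescale, coeff_laurentJet, coeff_laurentJet, ← tsum_mul_left]
  refine tsum_congr fun i => ?_
  have : jetCoeff ((w i).filter p) α
      = (α.prod fun s m => (if p s then (1 : ℂ) else 0) ^ m) * jetCoeff (w i) α := by
    unfold jetCoeff Finsupp.prod
    rw [← prod_mul_distrib]
    refine prod_congr rfl fun j hj => ?_
    have hj : α j ≠ 0 := Finsupp.mem_support_iff.1 hj
    by_cases hp : p j
    · simp [hp]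
    · simp [hp, hj, chooseC_zero_left hj]
  rw [this]
  ring

theorem continuous_mon {X : Type*} [TopologicalSpace X] {γ : X → J → ℂ}
    (hγ : ∀ j, Continuous fun t => γ t j) (h0 : ∀ t j, γ t j ≠ 0) (w : J →₀ ℤ) :
    Continuous fun t => mon w (γ t) :=
  continuous_finsetProd _ fun j _ => (hγ j).zpow₀ _ fun t => Or.inl (h0 t j)

theorem IsLaurent.continuous {X : Type*} [TopologicalSpace X] {γ : X → J → ℂ} {r B : ℝ}
    (hr : 0 < r) (hγ : ∀ j, Continuous fun t => γ t j) (hγr : ∀ t, γ t ∈ annulus J r)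
    {F : (J → ℂ) → ℂ} (hF : IsLaurent r B F) : Continuous fun t => F (γ t) := by
  obtain ⟨I, c, w, h, hB⟩ := hF
  have e : (fun t => F (γ t)) = fun t => ∑' i, (c i : ℂ) * mon (w i) (γ t) :=
    funext fun t => (h.hasSum _ (hγr t)).tsum_eq.symm
  rw [e]
  exact continuous_tsum (fun i => continuous_const.mul (continuous_mon hγ
    (fun t j => ne_zero_of_mem_annulus hr (hγr t) j) (w i))) h.summable
    fun i t => LaurentRep.norm_term_le hr c w (hγr t) i

theorem IsLaurent.norm_le {r B : ℝ} (hr : 0 < r) {F : (J → ℂ) → ℂ} (hF : IsLaurent r B F)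
    {x : J → ℂ} (hx : x ∈ annulus J r) : ‖F x‖ ≤ B := by
  obtain ⟨I, c, w, h, hB⟩ := hF
  exact ((h.hasSum x hx).norm_le_of_bounded h.summable.hasSum
    fun i => LaurentRep.norm_term_le hr c w hx i).trans hB

theorem IsLaurent.exists_log {r B : ℝ} (hr : 1 < r) {F : (J → ℂ) → ℂ} (hF : IsLaurent r B F)
    (hF1 : F (fun _ => 1) = 1) {s : MvPowerSeries J ℂ} (hs : HasJet F s) :
    ∃ g : MvPowerSeries J ℂ, HasJet (fun x => Complex.log (F x)) g ∧
      ∀ j, pderiv ℂ j s = s * pderiv ℂ j g := by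
  obtain ⟨I, c, w, h, _⟩ := hF
  obtain ⟨δ, hδ, hδ'⟩ := h.exists_mem_slitPlane hr hF1
  exact hs.log hδ hδ' hF1

end LaurentClosure

/-! ### Alternants, Vandermonde product and interlacing -/

section Schur

/-- The size of a signature. -/
def sigNorm {n : ℕ} (lam : Fin n → ℤ) : ℕ := ∑ i, (lam i).natAbs

/-- The alternant `det (x_j ^ (l_i))`. -/
def alternant {n : ℕ} (l : Fin n → ℤ) (x : ℕ → ℂ) : ℂ :=
  Matrix.det (Matrix.of fun i j : Fin n => x (j : ℕ) ^ l i)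

/-- The Vandermonde product. -/
def vdm (n : ℕ) (x : ℕ → ℂ) : ℂ :=
  ∏ a ∈ range n, ∏ b ∈ range a, (x b - x a)

/-- The shifted coordinates `lam_i + n - 1 - i`. -/
def shifted {n : ℕ} (lam : Fin n → ℤ) (i : Fin n) : ℤ := lam i + n - 1 - i

/-- The set of sequences interlacing with `lam`. -/
abbrev interlacing {n : ℕ} (lam : Fin (n + 1) → ℤ) : Finset (Fin n → ℤ) :=
  Fintype.piFinset fun i : Fin n => Finset.Icc (lam i.succ) (lam i.castSucc)

theorem antitone_of_mem_interlacing {n : ℕ} {lam : Fin (n + 1) → ℤ} {mu : Fin n → ℤ}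
    (hmu : mu ∈ interlacing lam) : Antitone mu := by
  rw [Fintype.mem_piFinset] at hmu
  cases n with
  | zero => intro i; exact i.elim0
  | succ n => grind [Fin.antitone_iff_succ_le]

/-- Telescoping sum of a geometric progression. -/
theorem sum_Icc_geom {z : ℂ} (hz : z ≠ 0) {a b : ℤ} (hab : a ≤ b) (c : ℤ) :
    (z - 1) * ∑ m ∈ Finset.Icc a b, z ^ (m + c) = z ^ (b + 1 + c) - z ^ (a + c) := by
  obtain ⟨k, rfl⟩ := Int.le.dest hab
  clear hab
  induction k with
  | zero => grind [Nat.cast_zero, add_zero, Finset.Icc_self, sum_singleton, zpow_add_one₀]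
  | succ k ih =>
    have e : Finset.Icc a (a + ((k + 1 : ℕ) : ℤ)) =
        insert (a + (k : ℤ) + 1) (Finset.Icc a (a + (k : ℤ))) := by grind
    rw [e, sum_insert (by simp), mul_add, ih]
    push_cast
    rw [show a + (k + 1 : ℤ) + 1 + c = (a + k + 1 + c) + 1 by ring, zpow_add_one₀ hz]
    ring

end Schur

end

section

open Finset Function
open Equiv (Perm)

/-! ### The bialternant formula, bounds and symmetry of Schur functions -/

section SchurAlternant

/-- Subtracting from each row the multiple of the preceding row that kills its last entry leaves a
single nonzero entry in the last column, along which the determinant is expanded. -/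
theorem alternant_row_reduce {n : ℕ} (l : Fin (n + 1) → ℤ) {x : ℕ → ℂ} (hx : ∀ j, x j ≠ 0) :
    alternant l x = (-1) ^ n * x n ^ l 0 * Matrix.det (Matrix.of fun i j : Fin n =>
      x (j : ℕ) ^ l i.succ - x n ^ (l i.succ - l i.castSucc) * x (j : ℕ) ^ l i.castSucc) := by
  let B : Matrix (Fin (n + 1)) (Fin (n + 1)) ℂ := Matrix.of fun i j =>
    Fin.cases (x (j : ℕ) ^ l 0) (fun i => x (j : ℕ) ^ l i.succ
      - x n ^ (l i.succ - l i.castSucc) * x (j : ℕ) ^ l i.castSucc) i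
  have h1 : alternant l x = B.det := by
    refine Matrix.det_eq_of_forall_row_eq_smul_add_pred
      (fun i => x n ^ (l i.succ - l i.castSucc)) (fun j => rfl) fun i j => ?_
    simp [B]
  rw [h1, Matrix.det_succ_column B (Fin.last n), sum_eq_single 0]
  · aesop
  · intro i _ hi
    obtain ⟨i, rfl⟩ := Fin.exists_succ_eq.2 hi
    have : B i.succ (Fin.last n) = 0 := by
      simp only [B, Matrix.of_apply, Fin.cases_succ, Fin.val_last]
      rw [← zpow_add₀ (hx n)]
      simp
    rw [this]; simp
  · simp

theorem sum_shifted {n : ℕ} (lam : Fin n → ℤ) :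
    ∑ i, shifted lam i = ∑ i, lam i + ∑ i : Fin n, ((n : ℤ) - 1 - (i : ℤ)) := by
  rw [← sum_add_distrib]
  exact sum_congr rfl fun i _ => by unfold shifted; ring

theorem alternant_scale {n : ℕ} (l : Fin n → ℤ) (x : ℕ → ℂ) {y : ℂ} (hy : y ≠ 0) :
    alternant l (fun j => x j / y) = y ^ (-∑ i, l i) * alternant l x := by
  unfold alternant
  have : (Matrix.of fun i j : Fin n => (x (j : ℕ) / y) ^ l i)
      = Matrix.of fun i j => y ^ (-l i) * (Matrix.of fun i j : Fin n => x (j : ℕ) ^ l i) i j := by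
    ext i j
    simp only [Matrix.of_apply]
    rw [div_zpow, zpow_neg, div_eq_inv_mul]
  rw [this, Matrix.det_mul_column]
  congr 1
  rw [← sum_neg_distrib]
  exact (map_sum_zpow hy _).symm
where
  map_sum_zpow {y : ℂ} (hy : y ≠ 0) {ι : Type} [Fintype ι] (f : ι → ℤ) :
      y ^ (∑ i, f i) = ∏ i, y ^ f i := by
    classical
    generalize (univ : Finset ι) = s
    induction s using Finset.induction_on with
    | empty => simp
    | insert a s ha ih => rw [sum_insert ha, prod_insert ha, zpow_add₀ hy, ih]

theorem vdm_succ (n : ℕ) (x : ℕ → ℂ) :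
    vdm (n + 1) x = vdm n x * ∏ b ∈ range n, (x b - x n) := by
  unfold vdm; rw [prod_range_succ]

/-- The bialternant formula. -/
theorem vdm_mul_schurFun : ∀ (n : ℕ) {lam : Fin n → ℤ}, Antitone lam → ∀ {x : ℕ → ℂ},
    (∀ j, x j ≠ 0) → vdm n x * schurFun n lam x = alternant (shifted lam) x
  | 0, lam, _, x, _ => by simp [vdm, schurFun, alternant]
  | n + 1, lam, hlam, x, hx => by
    have hy := hx n
    set y := x n with hydef
    rw [alternant_row_reduce _ hx, ← hydef]
    have hstep : ∀ i : Fin n, lam i.succ ≤ lam i.castSucc := fun i =>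
      hlam (Fin.castSucc_lt_succ).le
    -- After the row reduction the entries are telescoped geometric sums in `x_j / y` over the
    -- interlacing interval of the row. The factors depending only on the row or only on the column
    -- are pulled out; the column factors are those by which the Vandermonde product grows.
    have h1 : (Matrix.of fun i j : Fin n => x (j : ℕ) ^ shifted lam i.succ
        - y ^ (shifted lam i.succ - shifted lam i.castSucc) * x (j : ℕ) ^ shifted lam i.castSucc)
        = Matrix.of fun i j : Fin n => (y ^ (shifted lam i.succ - 1)) *
          (Matrix.of fun i j : Fin n => (y - x (j : ℕ)) *
            (Matrix.of fun i j : Fin n => ∑ m ∈ Finset.Icc (lam i.succ) (lam i.castSucc),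
              (x (j : ℕ) / y) ^ (m + ((n : ℤ) - 1 - i))) i j) i j := by
      ext i j
      simp only [Matrix.of_apply]
      have hz : x (j : ℕ) / y ≠ 0 := div_ne_zero (hx j) hy
      have hg := sum_Icc_geom hz (hstep i) ((n : ℤ) - 1 - i)
      have e1 : lam i.castSucc + 1 + ((n : ℤ) - 1 - i) = shifted lam i.castSucc := by
        grind [shifted, Fin.val_castSucc]
      have e2 : lam i.succ + ((n : ℤ) - 1 - i) = shifted lam i.succ := by
        grind [shifted]
      rw [e1, e2] at hg
      have e3 : y - x (j : ℕ) = -y * (x (j : ℕ) / y - 1) := by field_simp; ring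
      rw [e3, mul_assoc (-y), hg, zpow_sub_one₀ hy, div_zpow, div_zpow, zpow_sub₀ hy]
      field_simp
      ring
    rw [h1, Matrix.det_mul_column, Matrix.det_mul_row]
    -- Multilinearity in the rows: one summation index per row runs over its interlacing interval,
    -- so the choices of indices are exactly the interlacing sequences, and each choice gives the
    -- alternant for `n` variables.
    have h2 : Matrix.det (Matrix.of fun i j : Fin n =>
        ∑ m ∈ Finset.Icc (lam i.succ) (lam i.castSucc),
          (x (j : ℕ) / y) ^ (m + ((n : ℤ) - 1 - i)))
        = ∑ mu ∈ interlacing lam, alternant (shifted mu) (fun j => x j / y) := by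
      have := (Matrix.detRowAlternating (R := ℂ) (n := Fin n)).toMultilinearMap.map_sum_finset
        (fun i m => fun j : Fin n => (x (j : ℕ) / y) ^ (m + ((n : ℤ) - 1 - (i : ℕ))))
        (fun i : Fin n => Finset.Icc (lam i.succ) (lam i.castSucc))
      have e1 : (Matrix.of fun i j : Fin n => ∑ m ∈ Finset.Icc (lam i.succ) (lam i.castSucc),
          (x (j : ℕ) / y) ^ (m + ((n : ℤ) - 1 - i)))
          = fun i : Fin n => ∑ m ∈ Finset.Icc (lam i.succ) (lam i.castSucc),
            fun j : Fin n => (x (j : ℕ) / y) ^ (m + ((n : ℤ) - 1 - (i : ℕ))) := by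
        ext i j; simp
      rw [e1]
      refine this.trans (sum_congr rfl fun mu _ => ?_)
      change Matrix.det _ = Matrix.det _
      congr 1
      ext i j
      grind [shifted, Matrix.of_apply]
    rw [h2, schurFun, vdm_succ, mul_sum, mul_sum, mul_sum, mul_sum]
    refine sum_congr rfl fun mu hmu => ?_
    rw [alternant_scale _ _ hy, ← vdm_mul_schurFun n (antitone_of_mem_interlacing hmu) hx,
      ← prod_range (fun b => y - x b)]
    have e4 : ∏ b ∈ range n, (x b - y)
        = (-1) ^ n * ∏ b ∈ range n, (y - x b) := by
      have : ((-1 : ℂ)) ^ n = ∏ _b ∈ range n, (-1 : ℂ) := by simp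
      rw [this, ← prod_mul_distrib]
      simp
    rw [e4, ← alternant_scale.map_sum_zpow hy]
    have e5 : y ^ (∑ i, lam i - ∑ i, mu i)
        = y ^ shifted lam 0 * (y ^ (∑ i : Fin n, (shifted lam i.succ - 1))
          * y ^ (-∑ i, shifted mu i)) := by
      rw [← zpow_add₀ hy, ← zpow_add₀ hy]
      congr 1
      have := sum_shifted lam
      rw [Fin.sum_univ_succ] at this
      rw [sum_shifted mu, sum_sub_distrib]
      have e6 : ∑ i : Fin (n + 1), (((n + 1 : ℕ) : ℤ) - 1 - (i : ℤ))
          = n + ∑ i : Fin n, ((n : ℤ) - 1 - (i : ℤ)) := by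
        rw [Fin.sum_univ_succ]
        congr 1
        · simp
        grind
      rw [e6] at this
      simp only [sum_const, card_univ, Fintype.card_fin, nsmul_eq_mul, mul_one]
      linarith
    rw [e5]
    ring

/-- The number of Gelfand–Tsetlin patterns with a given top row. -/
def gtCount : (n : ℕ) → (Fin n → ℤ) → ℕ
  | 0, _ => 1
  | n + 1, lam => ∑ mu ∈ interlacing lam, gtCount n mu

theorem schurFun_one : ∀ (n : ℕ) (lam : Fin n → ℤ), schurFun n lam (fun _ => 1) = gtCount n lam
  | 0, _ => by simp [schurFun, gtCount]
  | n + 1, lam => by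
    rw [schurFun, gtCount]
    push_cast
    exact sum_congr rfl fun mu _ => by rw [schurFun_one n mu]; simp

theorem interlacing_nonempty {n : ℕ} {lam : Fin (n + 1) → ℤ} (h : Antitone lam) :
    (interlacing lam).Nonempty := by
  refine ⟨fun i => lam i.castSucc, Fintype.mem_piFinset.2 fun i => mem_Icc.2 ⟨?_, le_rfl⟩⟩
  exact h (Fin.castSucc_lt_succ).le

theorem gtCount_pos : ∀ (n : ℕ) {lam : Fin n → ℤ}, Antitone lam → 0 < gtCount n lam
  | 0, _, _ => by simp [gtCount]
  | n + 1, lam, h => by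
    rw [gtCount]
    exact sum_pos (fun mu hmu => gtCount_pos n (antitone_of_mem_interlacing hmu))
      (interlacing_nonempty h)

/-- Interlacing does not increase the size, even after adding the size of the difference. -/
theorem sigNorm_add_le_of_mem_interlacing {n : ℕ} {lam : Fin (n + 1) → ℤ} {mu : Fin n → ℤ}
    (hmu : mu ∈ interlacing lam) :
    sigNorm mu + (∑ i, lam i - ∑ i, mu i).natAbs ≤ sigNorm lam := by
  have hI : ∀ i : Fin n, lam i.succ ≤ mu i ∧ mu i ≤ lam i.castSucc := fun i =>
    mem_Icc.1 (Fintype.mem_piFinset.1 hmu i)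
  -- With positive part `P` and negative part `N`, the size is `P + N` and the sum is `P - N`.
  -- Interlacing increases neither `P` nor `N`, and the claim is linear arithmetic in these.
  have key : ∀ {m : ℕ} (v : Fin m → ℤ), (sigNorm v : ℤ) = ∑ i, max (v i) 0 + ∑ i, max (-v i) 0 ∧
      ∑ i, v i = ∑ i, max (v i) 0 - ∑ i, max (-v i) 0 := by
    intro m v
    rw [← sum_add_distrib, ← sum_sub_distrib]
    constructor
    · unfold sigNorm; simp
    simp
  have hP : ∑ i, max (mu i) 0 ≤ ∑ i, max (lam i) 0 := by
    rw [Fin.sum_univ_castSucc]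
    have h1 : ∑ i, max (mu i) 0 ≤ ∑ i : Fin n, max (lam i.castSucc) 0 :=
      sum_le_sum fun i _ => max_le_max (hI i).2 le_rfl
    omega
  have hN : ∑ i, max (-mu i) 0 ≤ ∑ i, max (-lam i) 0 := by
    rw [Fin.sum_univ_succ]
    have h1 : ∑ i, max (-mu i) 0 ≤ ∑ i : Fin n, max (-lam i.succ) 0 :=
      sum_le_sum fun i _ => max_le_max (neg_le_neg (hI i).1) le_rfl
    omega
  have h1 := key lam
  have h2 := key mu
  omega

theorem sigNorm_le_of_mem_interlacing {n : ℕ} {lam : Fin (n + 1) → ℤ} {mu : Fin n → ℤ}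
    (hmu : mu ∈ interlacing lam) : sigNorm mu ≤ sigNorm lam :=
  (Nat.le_add_right _ _).trans (sigNorm_add_le_of_mem_interlacing hmu)

theorem gtCount_le : ∀ (n : ℕ) (lam : Fin n → ℤ), gtCount n lam ≤ (2 * sigNorm lam + 1) ^ (n * n)
  | 0, _ => by simp [gtCount]
  | n + 1, lam => by
    rw [gtCount]
    have hcard : (interlacing lam).card ≤ (2 * sigNorm lam + 1) ^ n := by
      rw [Fintype.card_piFinset]
      refine (prod_le_prod' (g := fun _ => 2 * sigNorm lam + 1) fun i _ => ?_).trans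
        (by simp)
      rw [Int.card_Icc]
      have h1 : ∀ j, (lam j).natAbs ≤ sigNorm lam := fun j =>
        single_le_sum (f := fun j => (lam j).natAbs) (fun _ _ => Nat.zero_le _)
          (mem_univ j)
      grind
    have h2 : ∀ mu ∈ interlacing lam, gtCount n mu ≤ (2 * sigNorm lam + 1) ^ (n * n) :=
      fun mu hmu => (gtCount_le n mu).trans (Nat.pow_le_pow_left
        (by have := sigNorm_le_of_mem_interlacing hmu; omega) _)
    calc ∑ mu ∈ interlacing lam, gtCount n mu
        ≤ (interlacing lam).card * (2 * sigNorm lam + 1) ^ (n * n) := by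
          simpa using sum_le_card_nsmul _ _ _ h2
      _ ≤ (2 * sigNorm lam + 1) ^ n * (2 * sigNorm lam + 1) ^ (n * n) :=
          Nat.mul_le_mul_right _ hcard
      _ ≤ (2 * sigNorm lam + 1) ^ ((n + 1) * (n + 1)) := by
          rw [← pow_add]
          exact Nat.pow_le_pow_right (by omega) (by nlinarith)

/-- One monomial for each Gelfand–Tsetlin pattern, of total degree at most the size of the top row
because interlacing keeps size plus increment bounded. After normalization only `r` to the power of
the size remains, uniformly in the number of patterns. -/
theorem isLaurent_schurFun {r : ℝ} (hr : 1 ≤ r) : ∀ (n : ℕ) (lam : Fin n → ℤ),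
    IsLaurent r (gtCount n lam * r ^ sigNorm lam) (schurFun n lam)
  | 0, lam => by simp [schurFun, gtCount, sigNorm, isLaurent_one]
  | n + 1, lam => by
    have h1 : ∀ mu ∈ interlacing lam, IsLaurent r (gtCount n mu * r ^ sigNorm lam)
        (fun x => schurFun n mu x * x n ^ (∑ i, lam i - ∑ i, mu i)) := by
      intro mu hmu
      have h2 := (isLaurent_schurFun hr n mu).mul hr
        (isLaurent_mon (r := r) (Finsupp.single n (∑ i, lam i - ∑ i, mu i)))
      have h3 : ∀ x, mon (Finsupp.single n (∑ i, lam i - ∑ i, mu i)) x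
          = x n ^ (∑ i, lam i - ∑ i, mu i) := fun x =>
        Finsupp.prod_single_index (zpow_zero _)
      simp only [h3, wnorm_single] at h2
      refine h2.weaken ?_
      rw [mul_assoc, ← pow_add]
      grind [mul_le_mul_of_nonneg_left, pow_le_pow_right₀, sigNorm_add_le_of_mem_interlacing,
          Nat.cast_nonneg]
    have h4 := IsLaurent.sum (interlacing lam) (by linarith : 0 < r) h1
    rw [← sum_mul, ← Nat.cast_sum] at h4
    exact h4

theorem normSchur_eq {n : ℕ} (lam : Sig n) (x : ℕ → ℂ) :
    normSchur lam x = (((gtCount n lam.1 : ℝ)⁻¹ : ℝ) : ℂ) * schurFun n lam.1 x := by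
  simp [normSchur, schurFun_one, div_eq_inv_mul]

theorem isLaurent_normSchur {r : ℝ} (hr : 1 ≤ r) {n : ℕ} (lam : Sig n) :
    IsLaurent r (r ^ sigNorm lam.1) (normSchur lam) := by
  have h := (isLaurent_schurFun hr n lam.1).smul (by linarith) (gtCount n lam.1 : ℝ)⁻¹
  have h0 : (0 : ℝ) < gtCount n lam.1 := by exact_mod_cast gtCount_pos n lam.2
  rw [abs_of_pos (inv_pos.2 h0), ← mul_assoc, inv_mul_cancel₀ h0.ne', one_mul] at h
  exact h.congr fun x _ => (normSchur_eq lam x).symm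

theorem normSchur_one {n : ℕ} (lam : Sig n) : normSchur lam (fun _ => 1) = 1 := by
  grind [normSchur, schurFun_one, div_self, Nat.cast_ne_zero, gtCount_pos]

theorem schurFun_congr : ∀ (n : ℕ) (lam : Fin n → ℤ) {x y : ℕ → ℂ},
    (∀ i < n, x i = y i) → schurFun n lam x = schurFun n lam y
  | 0, _, _, _, _ => rfl
  | n + 1, lam, x, y, h => by
    rw [schurFun, schurFun]
    refine sum_congr rfl fun mu _ => ?_
    rw [schurFun_congr n mu fun i hi => h i (by omega), h n (by omega)]

theorem normSchur_congr {n : ℕ} (lam : Sig n) {x y : ℕ → ℂ} (h : ∀ i < n, x i = y i) :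
    normSchur lam x = normSchur lam y := by
  unfold normSchur; rw [schurFun_congr n lam.1 h]

/-- A curve through a point of the polyannulus along which the coordinates become distinct. -/
def twist (x : ℕ → ℂ) (t : ℝ) : ℕ → ℂ := fun j => x j * Complex.exp (((t * j : ℝ) : ℂ) * Complex.I)

theorem twist_mem_annulus {r : ℝ} {x : ℕ → ℂ} (hx : x ∈ annulus ℕ r) (t : ℝ) :
    twist x t ∈ annulus ℕ r := by
  intro j
  unfold twist
  rw [norm_mul, Complex.norm_exp_ofReal_mul_I, mul_one]
  exact hx j

theorem continuous_twist (x : ℕ → ℂ) (j : ℕ) : Continuous fun t => twist x t j := by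
  unfold twist; fun_prop

/-- Coordinates that differ remain different for small `t`. Two equal ones separate at once, because
their difference has derivative `x_a (b - a) i ≠ 0` at `t = 0`. -/
theorem eventually_vdm_twist_ne_zero (n : ℕ) {x : ℕ → ℂ} (hx : ∀ j, x j ≠ 0) :
    ∀ᶠ t in 𝓝[≠] (0 : ℝ), vdm n (twist x t) ≠ 0 := by
  have h1 : ∀ a b : ℕ, b < a → ∀ᶠ t in 𝓝[≠] (0 : ℝ), twist x t b - twist x t a ≠ 0 := by
    intro a b hab
    by_cases hxy : x b = x a
    · have hd : ∀ j : ℕ, HasDerivAt (fun t : ℝ => twist x t j) (x j * (j * Complex.I)) 0 := by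
        intro j
        have h2 : HasDerivAt (fun t : ℝ => ((t * j : ℝ) : ℂ) * Complex.I) (j * Complex.I) 0 := by
          have := ((hasDerivAt_id (0 : ℝ)).mul_const (j : ℝ)).ofReal_comp.mul_const Complex.I
          simpa using this
        simpa [twist] using h2.cexp.const_mul (x j)
      refine ((hd b).sub (hd a)).eventually_ne ?_
      rw [hxy, ← mul_sub, ← sub_mul]
      refine mul_ne_zero (hx a) (mul_ne_zero ?_ Complex.I_ne_zero)
      rw [sub_ne_zero]
      exact_mod_cast hab.ne
    · have hc : Continuous fun t => twist x t b - twist x t a :=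
        (continuous_twist x b).sub (continuous_twist x a)
      refine (hc.continuousAt.eventually_ne ?_).filter_mono nhdsWithin_le_nhds
      simpa [twist, sub_ne_zero] using hxy
  have h2 : ∀ᶠ t in 𝓝[≠] (0 : ℝ), ∀ a ∈ range n, ∀ b ∈ range a,
      twist x t b - twist x t a ≠ 0 := by
    refine (Finset.eventually_all _).2 fun a _ => (Finset.eventually_all _).2 fun b hb => ?_
    exact h1 a b (mem_range.1 hb)
  filter_upwards [h2] with t ht
  exact prod_ne_zero_iff.2 fun a ha => prod_ne_zero_iff.2 fun b hb => ht a ha b hb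

/-- Bialternant arguments only determine a function after division by the Vandermonde product.
Continuity along the curve `twist` extends identities across the diagonals. -/
theorem IsLaurent.eq_of_vdm_ne_zero (n : ℕ) {r B B' : ℝ} (hr : 0 < r) {F G : (ℕ → ℂ) → ℂ}
    (hF : IsLaurent r B F) (hG : IsLaurent r B' G)
    (h : ∀ x ∈ annulus ℕ r, vdm n x ≠ 0 → F x = G x) : ∀ x ∈ annulus ℕ r, F x = G x := by
  intro x hx
  have e0 : twist x 0 = x := by funext j; simp [twist]
  have cF := (hF.continuous hr (continuous_twist x) (twist_mem_annulus hx)).tendsto 0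
  have cG := (hG.continuous hr (continuous_twist x) (twist_mem_annulus hx)).tendsto 0
  rw [e0] at cF cG
  have h1 : ∀ᶠ t in 𝓝[≠] (0 : ℝ), F (twist x t) = G (twist x t) := by
    filter_upwards [eventually_vdm_twist_ne_zero n (ne_zero_of_mem_annulus hr hx)] with t ht
    exact h _ (twist_mem_annulus hx t) ht
  exact tendsto_nhds_unique ((cF.mono_left nhdsWithin_le_nhds).congr' h1)
    (cG.mono_left nhdsWithin_le_nhds)

theorem exists_perm_fin {n : ℕ} (σ : Perm ℕ) (hσ : ∀ i, n ≤ i → σ i = i) :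
    ∃ τ : Perm (Fin n), ∀ i, ((τ i : Fin n) : ℕ) = σ i := by
  have hlt : ∀ i : Fin n, σ i < n := by
    intro i
    by_contra h
    have h1 := hσ _ (not_lt.1 h)
    have h2 := σ.injective h1
    omega
  let f : Fin n → Fin n := fun i => ⟨σ i, hlt i⟩
  have hf : Injective f := fun i j hij => by aesop
  exact ⟨Equiv.ofBijective f (Finite.injective_iff_bijective.1 hf), fun i => rfl⟩

theorem alternant_perm {n : ℕ} (l : Fin n → ℤ) (x y : ℕ → ℂ) (τ : Perm (Fin n))
    (hy : ∀ i : Fin n, y i = x (τ i)) :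
    alternant l y = (Perm.sign τ : ℤ) * alternant l x := by
  unfold alternant
  rw [← Matrix.det_permute' τ]
  congr 1
  ext i j
  simp [hy]

theorem schurFun_zero : ∀ (n : ℕ) (x : ℕ → ℂ), schurFun n (fun _ => 0) x = 1
  | 0, _ => rfl
  | n + 1, x => by
    rw [schurFun, sum_eq_single (fun _ => 0)]
    · rw [schurFun_zero n]; simp
    · simp
    simp

/-- The exponents of the Vandermonde determinant. -/
abbrev delta (n : ℕ) : Fin n → ℤ := shifted fun _ => 0

theorem vdm_eq_alternant {n : ℕ} {x : ℕ → ℂ} (hx : ∀ j, x j ≠ 0) :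
    vdm n x = alternant (delta n) x := by
  rw [← vdm_mul_schurFun n antitone_const hx, schurFun_zero, mul_one]

/-- Off the diagonals the Schur function is a quotient of two alternants, both of which change by
the sign of the permutation. -/
theorem schurFun_perm {n : ℕ} {lam : Fin n → ℤ} (hlam : Antitone lam) {σ : Perm ℕ}
    (hσ : ∀ i, n ≤ i → σ i = i) {r : ℝ} (hr : 1 ≤ r) {x : ℕ → ℂ} (hx : x ∈ annulus ℕ r) :
    schurFun n lam (x ∘ σ) = schurFun n lam x := by
  have hr0 : 0 < r := by linarith
  refine IsLaurent.eq_of_vdm_ne_zero n hr0 ((isLaurent_schurFun hr n lam).comp σ.injective)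
    (isLaurent_schurFun hr n lam) (fun x hx hv => ?_) x hx
  have hx0 := ne_zero_of_mem_annulus hr0 hx
  obtain ⟨τ, hτ⟩ := exists_perm_fin σ hσ
  have hy : ∀ i : Fin n, (x ∘ σ) i = x (τ i) := fun i => by simp [hτ]
  have h1 := vdm_mul_schurFun n hlam (x := x ∘ σ) fun j => hx0 _
  rw [vdm_eq_alternant (x := x ∘ σ) (fun j => hx0 _), alternant_perm _ x _ τ hy, alternant_perm _ x _ τ hy,
    ← vdm_eq_alternant hx0, ← vdm_mul_schurFun n hlam hx0, mul_assoc] at h1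
  simp_all

theorem normSchur_perm {n : ℕ} (lam : Sig n) {σ : Perm ℕ}
    (hσ : ∀ i, n ≤ i → σ i = i) {r : ℝ} (hr : 1 ≤ r) {x : ℕ → ℂ} (hx : x ∈ annulus ℕ r) :
    normSchur lam (x ∘ σ) = normSchur lam x := by grind [normSchur, schurFun_perm]

end SchurAlternant

end

section

open Finset Function
open Equiv (Perm)

/-! ### Existence of Schur expansions of symmetric Laurent sums -/

section SchurExpansion

/-- The monomial `∏ x_j ^ (u_j)` in the first `k` variables. -/
def monFin {k : ℕ} (u : Fin k → ℤ) (x : ℕ → ℂ) : ℂ := ∏ j : Fin k, x j ^ u j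

theorem mon_filter_lt (k : ℕ) (w : ℕ →₀ ℤ) (x : ℕ → ℂ) :
    mon (w.filter (· < k)) x = monFin (fun j : Fin k => w j) x := by
  unfold mon monFin
  rw [Finsupp.prod_of_support_subset _ (s := range k) _ _ (by simp)]
  · rw [prod_range]
    simp
  grind [Finsupp.support_filter]

theorem wnorm_filter_lt (k : ℕ) (w : ℕ →₀ ℤ) :
    wnorm (w.filter (· < k)) = sigNorm (fun j : Fin k => w j) := by
  unfold wnorm sigNorm
  rw [Finsupp.sum_of_support_subset _ (s := range k) _ _ (by simp)]
  · rw [sum_range]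
    simp
  grind [Finsupp.support_filter]

theorem alternant_eq_sum {k : ℕ} (l : Fin k → ℤ) (x : ℕ → ℂ) :
    alternant l x = ∑ τ : Perm (Fin k), (Perm.sign τ : ℤ) * monFin (l ∘ τ) x := by
  unfold alternant
  rw [Matrix.det_apply']
  rfl

theorem alternant_eq_sum' {k : ℕ} (l : Fin k → ℤ) (x : ℕ → ℂ) :
    alternant l x
      = ∑ τ : Perm (Fin k), (Perm.sign τ : ℤ) * ∏ j : Fin k, x (τ j : ℕ) ^ l j := by
  unfold alternant
  rw [← Matrix.det_transpose, Matrix.det_apply']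
  rfl

theorem sigNorm_comp_perm {k : ℕ} (l : Fin k → ℤ) (σ : Perm (Fin k)) :
    sigNorm (l ∘ σ) = sigNorm l := Equiv.sum_comp σ fun i => (l i).natAbs

theorem sigNorm_add_le {k : ℕ} (l m : Fin k → ℤ) : sigNorm (l + m) ≤ sigNorm l + sigNorm m := by
  unfold sigNorm
  rw [← sum_add_distrib]
  exact sum_le_sum fun i _ => Int.natAbs_add_le _ _

theorem sigNorm_delta_le (k : ℕ) : sigNorm (delta k) ≤ k * k := by
  unfold sigNorm
  refine (sum_le_card_nsmul _ _ k fun i _ => ?_).trans (by simp)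
  simp only [delta, shifted]
  omega

/-- Every alternant is zero or up to sign the alternant of a signature. -/
theorem exists_sort {k : ℕ} (l : Fin k → ℤ) : ∃ (mu : Sig k) (ε : ℝ), |ε| ≤ 1 ∧
    sigNorm mu.1 ≤ sigNorm l + k * k ∧
    ∀ x : ℕ → ℂ, (∀ j, x j ≠ 0) → alternant l x = ε * (vdm k x * schurFun k mu.1 x) := by
  by_cases hl : Injective l
  · let σ := Tuple.sort (fun i => -l i)
    have hmono : Antitone (l ∘ σ) := fun i j hij => by
      have := Tuple.monotone_sort (fun i => -l i) hij
      exact neg_le_neg_iff.1 this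
    have hinj : Injective (l ∘ σ) := hl.comp σ.injective
    let mu : Fin k → ℤ := fun i => l (σ i) - (k - 1 - i)
    have hmu : Antitone mu := by
      cases k with
      | zero => intro i; exact i.elim0
      | succ n =>
        rw [Fin.antitone_iff_succ_le]
        intro i
        have h1 : (l ∘ σ) i.succ ≤ (l ∘ σ) i.castSucc := hmono (Fin.castSucc_lt_succ).le
        have h2 : (l ∘ σ) i.succ ≠ (l ∘ σ) i.castSucc := fun h =>
          (Fin.castSucc_lt_succ (i := i)).ne' (hinj h)
        grind
    have hsh : shifted mu = l ∘ σ := by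
      funext i; simp only [shifted, mu, Function.comp_apply]; ring
    have hmud : mu = l ∘ σ + fun i => -delta k i := by
      funext i; simp only [mu, delta, shifted, Pi.add_apply, Function.comp_apply]; ring
    refine ⟨⟨mu, hmu⟩, (Perm.sign σ : ℤ), ?_, ?_, fun x hx => ?_⟩
    · rcases Int.units_eq_one_or (Perm.sign σ) with h | h <;> simp [h]
    · change sigNorm mu ≤ _
      rw [hmud]
      refine (sigNorm_add_le _ _).trans ?_
      rw [sigNorm_comp_perm]
      have : sigNorm (fun i => -delta k i) = sigNorm (delta k) := by simp [sigNorm]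
      simp_all [sigNorm_delta_le]
    · have h1 := vdm_mul_schurFun k hmu hx
      rw [hsh] at h1
      have h2 : alternant (l ∘ σ) x = (Perm.sign σ : ℤ) * alternant l x := by
        unfold alternant
        rw [← Matrix.det_permute]
        rfl
      rw [h1, h2]
      rcases Int.units_eq_one_or (Perm.sign σ) with h | h <;> simp [h]
  · refine ⟨⟨fun _ => 0, antitone_const⟩, 0, by simp, by simp [sigNorm], fun x _ => ?_⟩
    simp only [Injective, not_forall] at hl
    obtain ⟨i, j, hij, hne⟩ := hl
    unfold alternant
    rw [Matrix.det_zero_of_row_eq hne (by funext m; simp [hij])]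
    simp

/-- Regrouping a family of weighted signatures. -/
theorem exists_regroup {k : ℕ} {Λ : Type} {r : ℝ} (hr : 1 ≤ r) (W : Λ → ℝ) (mu : Λ → Sig k)
    (hW : Summable fun p => |W p| * r ^ sigNorm (mu p).1) :
    ∃ P : Sig k → ℝ, Summable (fun m => |P m| * r ^ sigNorm m.1) ∧
      ∑' m, |P m| * r ^ sigNorm m.1 ≤ ∑' p, |W p| * r ^ sigNorm (mu p).1 ∧
      ∀ x ∈ annulus ℕ r, HasSum (fun m => (P m : ℂ) * normSchur m x)
        (∑' p, (W p : ℂ) * normSchur (mu p) x) := by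
  have hr0 : 0 < r := by linarith
  let e := Equiv.sigmaFiberEquiv mu
  have hW1 : Summable fun p => |W p| :=
    Summable.of_nonneg_of_le (fun _ => abs_nonneg _)
      (fun p => le_mul_of_one_le_right (abs_nonneg _) (one_le_pow₀ hr)) hW
  let T : (Σ m, {p // mu p = m}) → ℝ := fun q => |W q.2.1| * r ^ sigNorm q.1.1
  have hTe : ∀ q, T q = |W (e q)| * r ^ sigNorm (mu (e q)).1 := by
    rintro ⟨m, p, rfl⟩; rfl
  have hT : Summable T := by
    have := e.summable_iff.2 hW
    exact this.congr fun q => by grind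
  have hTs := (summable_sigma_of_nonneg (fun q => by positivity)).1 hT
  let P : Sig k → ℝ := fun m => ∑' p : {p // mu p = m}, W p.1
  have hsub : ∀ m, Summable fun p : {p // mu p = m} => |W p.1| := fun m => hW1.subtype _
  have hP : ∀ m, |P m| * r ^ sigNorm m.1 ≤ ∑' p : {p // mu p = m}, T ⟨m, p⟩ := by
    intro m
    simp only [T]
    rw [tsum_mul_right]
    refine mul_le_mul_of_nonneg_right ?_ (by positivity)
    have := norm_tsum_le_tsum_norm (f := fun p : {p // mu p = m} => W p.1)
      (by simp_all)
    omega
  have hPs : Summable fun m => |P m| * r ^ sigNorm m.1 :=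
    Summable.of_nonneg_of_le (fun m => by positivity) hP hTs.2
  refine ⟨P, hPs, ?_, fun x hx => ?_⟩
  · refine (hPs.tsum_le_tsum hP hTs.2).trans (le_of_eq ?_)
    rw [← hT.tsum_sigma, ← e.tsum_eq]
    exact tsum_congr hTe
  · have hbd : ∀ p, ‖(W p : ℂ) * normSchur (mu p) x‖ ≤ |W p| * r ^ sigNorm (mu p).1 := by
      intro p
      rw [norm_mul, Complex.norm_real, Real.norm_eq_abs]
      exact mul_le_mul_of_nonneg_left ((isLaurent_normSchur hr (mu p)).norm_le hr0 hx)
        (abs_nonneg _)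
    have h1 : HasSum (fun p => (W p : ℂ) * normSchur (mu p) x)
        (∑' p, (W p : ℂ) * normSchur (mu p) x) := (Summable.of_norm_bounded hW hbd).hasSum
    have h2 := e.hasSum_iff.2 h1
    refine h2.sigma fun m => ?_
    have h3 : HasSum (fun p : {p // mu p = m} => (W p.1 : ℂ)) (P m : ℂ) := by
      have h4 : Summable fun p : {p // mu p = m} => W p.1 := (hsub m).of_abs
      exact (Complex.hasSum_ofReal).2 h4.hasSum
    refine (h3.mul_right (normSchur m x)).congr_arg fun p => ?_
    obtain ⟨p, rfl⟩ := p
    rfl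

theorem pow_mul_le_exp {k : ℕ} {r₁ r : ℝ} (hr₁ : 1 ≤ r₁) (hrr : r₁ < r) :
    ∃ K : ℝ, 0 ≤ K ∧ ∀ mu : Fin k → ℤ,
      (gtCount k mu : ℝ) * r₁ ^ sigNorm mu ≤ K * r ^ sigNorm mu := by
  obtain ⟨K, hK0, hK⟩ := exists_poly_mul_pow_le (k * k) 1 (by linarith : 0 < r₁) hrr
  refine ⟨2 ^ (k * k) * K, by positivity, fun mu => ?_⟩
  have h1 : (gtCount k mu : ℝ) ≤ 2 ^ (k * k) * ((sigNorm mu : ℝ) + (1 : ℕ)) ^ (k * k) := by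
    rw [← mul_pow]
    have h2 : (gtCount k mu : ℝ) ≤ ((2 * sigNorm mu + 1 : ℕ) : ℝ) ^ (k * k) := by
      exact_mod_cast gtCount_le k mu
    refine h2.trans (pow_le_pow_left₀ (by positivity) ?_ _)
    push_cast; linarith
  calc (gtCount k mu : ℝ) * r₁ ^ sigNorm mu
      ≤ 2 ^ (k * k) * ((sigNorm mu : ℝ) + (1 : ℕ)) ^ (k * k) * r₁ ^ sigNorm mu :=
        mul_le_mul_of_nonneg_right h1 (by positivity)
    _ = 2 ^ (k * k) * (((sigNorm mu : ℝ) + (1 : ℕ)) ^ (k * k) * r₁ ^ sigNorm mu) := by ring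
    _ ≤ 2 ^ (k * k) * (K * r ^ sigNorm mu) := mul_le_mul_of_nonneg_left (hK _) (by positivity)
    _ = _ := by ring

/-- Symmetric functions given by absolutely convergent sums of Laurent monomials expand in
normalized Schur functions, with control of the coefficients. -/
theorem exists_schur_expansion (k : ℕ) {r₁ r : ℝ} (hr₁ : 1 ≤ r₁) (hrr : r₁ < r) :
    ∃ C : ℝ, 0 ≤ C ∧ ∀ (B : ℝ) (F : (ℕ → ℂ) → ℂ), IsLaurent r B F →
      (∀ x, F (setOne (· < k) x) = F x) →
      (∀ σ : Perm ℕ, (∀ i, k ≤ i → σ i = i) → ∀ x ∈ annulus ℕ r, F (x ∘ σ) = F x) →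
      ∃ P : Sig k → ℝ, Summable (fun m => |P m| * r₁ ^ sigNorm m.1) ∧
        ∑' m, |P m| * r₁ ^ sigNorm m.1 ≤ C * B ∧
        ∀ x ∈ annulus ℕ r₁, HasSum (fun m => (P m : ℂ) * normSchur m x) (F x) := by
  have hr : 1 < r := hr₁.trans_lt hrr
  have hr0 : 0 < r := by linarith
  have hr10 : 0 < r₁ := by linarith
  obtain ⟨K, hK0, hK⟩ := pow_mul_le_exp (k := k) hr₁ hrr
  -- One `k * k` bounds the size of the staircase `delta k`, the other the change of size on passing
  -- from a sorted exponent to a signature.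
  set D := k * k + k * k with hD
  have hfact : (0 : ℝ) < (k.factorial : ℝ) := by positivity
  refine ⟨(k.factorial : ℝ) * (K * r ^ D), by positivity, fun B F hF hF1 hFsym => ?_⟩
  obtain ⟨I, c, w, hrep, hB⟩ := hF
  have hrep' := hrep.setOne (· < k) hr.le
  have hFe : (fun x => F (setOne (· < k) x)) = F := funext hF1
  rw [hFe] at hrep'
  let u : I → Fin k → ℤ := fun i j => w i j
  have hu : ∀ i, sigNorm (u i) ≤ wnorm (w i) := fun i => by
    rw [← wnorm_filter_lt]; exact wnorm_filter_le _ _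
  have hsumu : Summable fun i => |c i| * r ^ sigNorm (u i) := by
    simpa only [wnorm_filter_lt] using hrep'.summable
  have hFu : ∀ x ∈ annulus ℕ r, HasSum (fun i => (c i : ℂ) * monFin (u i) x) (F x) := by
    intro x hx
    simpa only [mon_filter_lt] using hrep'.hasSum x hx
  -- Multiplying the monomial of index `i` by the Vandermonde determinant gives the exponents `u i +
  -- delta ∘ τ`. After antisymmetrization each becomes an alternant, hence zero or, up to sign, `V`
  -- times a Schur function; the weights `W` below record the resulting coefficients.
  let L : I × Perm (Fin k) → Fin k → ℤ := fun p => delta k ∘ p.2 + u p.1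
  choose mu ε hε hmuL hmu using fun p => exists_sort (L p)
  have hmun : ∀ p, sigNorm (mu p).1 ≤ sigNorm (u p.1) + D := by
    intro p
    refine (hmuL p).trans ?_
    have h1 := sigNorm_add_le (delta k ∘ p.2) (u p.1)
    grind [sigNorm_comp_perm, sigNorm_delta_le]
  let W : I × Perm (Fin k) → ℝ := fun p =>
    c p.1 * (Perm.sign p.2 : ℤ) * ε p / k.factorial * gtCount k (mu p).1
  have hWb : ∀ p, |W p| * r₁ ^ sigNorm (mu p).1
      ≤ (K * r ^ D / k.factorial) * (|c p.1| * r ^ sigNorm (u p.1)) := by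
    intro p
    have hs : |((Perm.sign p.2 : ℤ) : ℝ)| = 1 := by
      rcases Int.units_eq_one_or (Perm.sign p.2) with h | h <;> simp [h]
    have h1 : |W p| ≤ |c p.1| / k.factorial * gtCount k (mu p).1 := by
      grind [mul_one, Nat.abs_cast, mul_le_mul_of_nonneg_right, Nat.cast_nonneg,
          div_le_div_of_nonneg_right, mul_le_of_le_one_right, abs_nonneg]
    calc |W p| * r₁ ^ sigNorm (mu p).1
        ≤ (|c p.1| / k.factorial * gtCount k (mu p).1) * r₁ ^ sigNorm (mu p).1 :=
          mul_le_mul_of_nonneg_right h1 (by positivity)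
      _ = |c p.1| / k.factorial * (gtCount k (mu p).1 * r₁ ^ sigNorm (mu p).1) := by ring
      _ ≤ |c p.1| / k.factorial * (K * r ^ sigNorm (mu p).1) :=
          mul_le_mul_of_nonneg_left (hK _) (by positivity)
      _ ≤ |c p.1| / k.factorial * (K * r ^ (sigNorm (u p.1) + D)) := by
          refine mul_le_mul_of_nonneg_left (mul_le_mul_of_nonneg_left ?_ hK0) (by positivity)
          exact pow_le_pow_right₀ hr.le (hmun p)
      _ = _ := by rw [pow_add]; ring
  have hprod : Summable fun p : I × Perm (Fin k) =>
      (K * r ^ D / k.factorial) * (|c p.1| * r ^ sigNorm (u p.1)) := by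
    have h1 := hsumu.mul_of_nonneg (g := fun _ : Perm (Fin k) => (1 : ℝ))
      (hasSum_fintype _).summable (fun _ => by positivity) (fun _ => zero_le_one)
    simp only [mul_one] at h1
    exact h1.mul_left _
  have hWs : Summable fun p => |W p| * r₁ ^ sigNorm (mu p).1 :=
    Summable.of_nonneg_of_le (fun _ => by positivity) hWb hprod
  have hWle : ∑' p, |W p| * r₁ ^ sigNorm (mu p).1 ≤ (k.factorial : ℝ) * (K * r ^ D) * B := by
    refine (hWs.tsum_le_tsum hWb hprod).trans ?_
    rw [hprod.tsum_prod]
    simp only [tsum_fintype, sum_const, card_univ, Fintype.card_perm,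
      Fintype.card_fin, nsmul_eq_mul]
    rw [tsum_mul_left, tsum_mul_left]
    have h1 : ∑' i, |c i| * r ^ sigNorm (u i) ≤ B := by
      refine (hsumu.tsum_le_tsum (fun i => ?_) hrep.summable).trans hB
      exact mul_le_mul_of_nonneg_left (pow_le_pow_right₀ hr.le (hu i)) (abs_nonneg _)
    have hB0 : 0 ≤ B := (tsum_nonneg fun i => by positivity).trans hB
    have h2 : (1 : ℝ) ≤ k.factorial := by exact_mod_cast Nat.factorial_pos k
    have h3 : (k.factorial : ℝ) * (K * r ^ D / k.factorial * ∑' i, |c i| * r ^ sigNorm (u i))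
        = (K * r ^ D) * ∑' i, |c i| * r ^ sigNorm (u i) := by field_simp
    rw [h3]
    calc (K * r ^ D) * ∑' i, |c i| * r ^ sigNorm (u i) ≤ (K * r ^ D) * B :=
          mul_le_mul_of_nonneg_left h1 (by positivity)
      _ ≤ (k.factorial : ℝ) * ((K * r ^ D) * B) :=
          le_mul_of_one_le_left (by positivity) h2
      _ = _ := by ring
  -- the expansion away from the diagonals
  have hfam := IsLaurent.family (W := W) (B := fun p => r₁ ^ sigNorm (mu p).1)
    (F := fun p => normSchur (mu p)) hr10 (fun p => isLaurent_normSchur hr₁ (mu p)) hWs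
  have hoff : ∀ x ∈ annulus ℕ r₁, vdm k x ≠ 0 → F x = ∑' p, (W p : ℂ) * normSchur (mu p) x := by
    intro x hx1 hv
    have hx := annulus_mono hr10 hrr.le hx1
    have hx0 := ne_zero_of_mem_annulus hr0 hx
    -- Since `F` is symmetric and `V` antisymmetric, `V F` is unchanged if `x` is permuted by `π`
    -- and the sign of `π` is inserted. Summing these expansions over all `π` produces alternants
    -- and accounts for the factor `k!` in `W`.
    have hperm : ∀ π : Perm (Fin k), HasSum
        (fun i => (c i : ℂ) * ∑ τ : Perm (Fin k), ((Perm.sign τ : ℤ) : ℂ) *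
          (((Perm.sign π : ℤ) : ℂ) * ∏ j : Fin k, x (π j : ℕ) ^ L (i, τ) j))
        (vdm k x * F x) := by
      intro π
      let σ : Perm ℕ := π.extendDomain Fin.equivSubtype
      have hσ1 : ∀ j : Fin k, σ j = π j := fun j =>
        Perm.extendDomain_apply_image π Fin.equivSubtype j
      have hσ2 : ∀ i, k ≤ i → σ i = i := fun i hi =>
        Perm.extendDomain_apply_not_subtype π Fin.equivSubtype (by simpa using hi)
      have hxσ : x ∘ σ ∈ annulus ℕ r := fun j => hx _
      have h1 := (hFu _ hxσ).mul_left (((Perm.sign π : ℤ) : ℂ) * vdm k (x ∘ σ))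
      have h2 : vdm k (x ∘ σ) = ((Perm.sign π : ℤ) : ℂ) * vdm k x := by
        grind [vdm_eq_alternant, alternant_perm]
      have h3 : ((Perm.sign π : ℤ) : ℂ) * ((Perm.sign π : ℤ) : ℂ) = 1 := by
        rcases Int.units_eq_one_or (Perm.sign π) with h | h <;> simp [h]
      have h4 : ((Perm.sign π : ℤ) : ℂ) * vdm k (x ∘ σ) * F (x ∘ σ) = vdm k x * F x := by grind
      rw [h4] at h1
      refine h1.congr_arg fun i => ?_
      rw [vdm_eq_alternant (x := x ∘ σ) (fun j => hx0 _), alternant_eq_sum, mul_sum,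
        mul_sum, sum_mul]
      refine sum_congr rfl fun τ _ => ?_
      have h5 : ∏ j : Fin k, x (π j : ℕ) ^ L (i, τ) j
          = monFin (delta k ∘ τ) (x ∘ σ) * monFin (u i) (x ∘ σ) := by
        unfold monFin
        rw [← prod_mul_distrib]
        refine prod_congr rfl fun j _ => ?_
        rw [Function.comp_apply, hσ1, ← zpow_add₀ (hx0 _)]
        rfl
      rw [h5]
      ring
    have hall := hasSum_sum (s := (univ : Finset (Perm (Fin k))))
      fun π _ => hperm π
    rw [sum_const, card_univ, Fintype.card_perm, Fintype.card_fin,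
      nsmul_eq_mul] at hall
    have hG := (hfam.1 x hx1).prod_fiberwise fun i => hasSum_fintype _
    have hGv := hG.mul_left ((k.factorial : ℂ) * vdm k x)
    have heq : ∀ i, ((k.factorial : ℂ) * vdm k x) *
        ∑ τ : Perm (Fin k), (W (i, τ) : ℂ) * normSchur (mu (i, τ)) x
        = ∑ π : Perm (Fin k), (c i : ℂ) * ∑ τ : Perm (Fin k),
          ((Perm.sign τ : ℤ) : ℂ) * (((Perm.sign π : ℤ) : ℂ) *
            ∏ j : Fin k, x (π j : ℕ) ^ L (i, τ) j) := by
      intro i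
      rw [← mul_sum, sum_comm, mul_sum, mul_sum]
      refine sum_congr rfl fun τ _ => ?_
      rw [← mul_sum, ← alternant_eq_sum', hmu (i, τ) x hx0, normSchur_eq]
      have hg : (gtCount k (mu (i, τ)).1 : ℂ) ≠ 0 :=
        Nat.cast_ne_zero.2 (gtCount_pos k (mu (i, τ)).2).ne'
      have hf : (k.factorial : ℂ) ≠ 0 := Nat.cast_ne_zero.2 (Nat.factorial_ne_zero k)
      simp only [W]
      push_cast
      field_simp
    have hGv' := hGv.congr_arg fun i => (heq i).symm
    have hfin := hall.unique hGv'
    grind [Nat.cast_ne_zero, mul_assoc, mul_left_cancel₀, mul_ne_zero]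
  have hFL : IsLaurent r₁ B F := IsLaurent.shrink hr10 hrr.le ⟨I, c, w, hrep, hB⟩
  have hEq := IsLaurent.eq_of_vdm_ne_zero k hr10 hFL hfam.2.1 hoff
  obtain ⟨P, hP1, hP2, hP3⟩ := exists_regroup hr₁ W mu hWs
  exact ⟨P, hP1, hP2.trans hWle, fun x hx => by rw [hEq x hx]; exact hP3 x hx⟩

end SchurExpansion

end

section

open Finset
open Equiv (Perm)

/-! ### Uniqueness of Schur expansions on the torus -/

section Uniqueness

theorem sum_rootOfUnity_zpow {N : ℕ} (hN : 0 < N) (v : ℤ) :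
    ∑ a ∈ range N, (Complex.exp (2 * Real.pi * Complex.I / N) ^ a) ^ v
      = if (N : ℤ) ∣ v then (N : ℂ) else 0 := by
  have hζ := Complex.isPrimitiveRoot_exp N hN.ne'
  set ζ := Complex.exp (2 * Real.pi * Complex.I / N) with hζd
  have h0 : ζ ≠ 0 := Complex.exp_ne_zero _
  have h1 : ∀ a : ℕ, (ζ ^ a) ^ v = (ζ ^ v) ^ a := fun a => by
    rw [← zpow_natCast, ← zpow_natCast, ← zpow_mul, ← zpow_mul, mul_comm]
  simp only [h1]
  split_ifs with h
  · rw [(hζ.zpow_eq_one_iff_dvd v).2 h]; simp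
  · have h2 : ζ ^ v ≠ 1 := fun h3 => h ((hζ.zpow_eq_one_iff_dvd v).1 h3)
    rw [geom_sum_eq h2]
    have h3 : (ζ ^ v) ^ N = 1 := by
      rw [← h1, hζ.pow_eq_one, one_zpow]
    rw [h3]; simp

/-- The coefficients of an absolutely convergent Laurent series vanish if its sum vanishes on
the torus. -/
theorem eq_zero_of_torus {k : ℕ} {I : Type} {c : I → ℂ} (hc : Summable fun i => ‖c i‖)
    (u : I → Fin k → ℤ)
    (h : ∀ x : ℕ → ℂ, (∀ i, ‖x i‖ = 1) → HasSum (fun i => c i * monFin (u i) x) 0)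
    (i₀ : I) (hi₀ : ∀ i, u i = u i₀ → i = i₀) : c i₀ = 0 := by
  classical
  let v : I → Fin k → ℤ := fun i j => u i j - u i₀ j
  have hv : ∀ x : ℕ → ℂ, (∀ i, ‖x i‖ = 1) → HasSum (fun i => c i * monFin (v i) x) 0 := by
    intro x hx
    have h0 : ∀ j, x j ≠ 0 := fun j h => by have := hx j; rw [h] at this; simp at this
    have h1 := (h x hx).mul_left (monFin (fun j => - u i₀ j) x)
    rw [mul_zero] at h1
    refine h1.congr_arg fun i => ?_
    have : monFin (v i) x = monFin (fun j => - u i₀ j) x * monFin (u i) x := by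
      unfold monFin
      rw [← prod_mul_distrib]
      refine prod_congr rfl fun j _ => ?_
      grind [zpow_add₀]
    rw [this]; ring
  -- Averaging over the `N`-th roots of unity in every variable retains exactly the exponents
  -- divisible by `N`, a discrete substitute for integration over the torus.
  have havg : ∀ N : ℕ, 0 < N →
      HasSum (fun i => c i * if ∀ j, (N : ℤ) ∣ v i j then 1 else 0) 0 := by
    intro N hN
    set ζ := Complex.exp (2 * Real.pi * Complex.I / N) with hζd
    have hnorm : ‖ζ‖ = 1 := by
      rw [hζd]
      have : 2 * (Real.pi : ℂ) * Complex.I / N = ((2 * Real.pi / N : ℝ) : ℂ) * Complex.I := by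
        push_cast; ring
      rw [this, Complex.norm_exp_ofReal_mul_I]
    let pt : (Fin k → ℕ) → ℕ → ℂ := fun a j => if hj : j < k then ζ ^ a ⟨j, hj⟩ else 1
    have hpt : ∀ a j, ‖pt a j‖ = 1 := by aesop
    have hs := hasSum_sum (s := Fintype.piFinset fun _ : Fin k => range N)
      fun a _ => hv (pt a) (hpt a)
    have hs2 := hs.mul_left (((N : ℂ) ^ k)⁻¹)
    rw [sum_const_zero, mul_zero] at hs2
    refine hs2.congr_arg fun i => ?_
    rw [← mul_sum]
    have h2 : ∑ a ∈ Fintype.piFinset (fun _ : Fin k => range N), monFin (v i) (pt a)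
        = ∏ j : Fin k, ∑ a ∈ range N, (ζ ^ a) ^ v i j := by
      rw [prod_univ_sum]
      refine sum_congr rfl fun a _ => ?_
      unfold monFin
      grind
    rw [h2]
    have hN0 : (N : ℂ) ≠ 0 := Nat.cast_ne_zero.2 hN.ne'
    have h3 : ∏ j : Fin k, ∑ a ∈ range N, (ζ ^ a) ^ v i j
        = (N : ℂ) ^ k * if ∀ j, (N : ℤ) ∣ v i j then 1 else 0 := by
      rw [prod_congr rfl fun j _ => sum_rootOfUnity_zpow hN (v i j)]
      split_ifs with hall
      · simp_all
      · push Not at hall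
        obtain ⟨j, hj⟩ := hall
        rw [prod_eq_zero (mem_univ j) (if_neg hj), mul_zero]
    rw [h3]
    field_simp
  -- A nonzero exponent is not divisible by `N + 1` once `N` is large, so by dominated convergence
  -- only the index `i₀` survives. The shift by one avoids the modulus zero.
  have hlim : Tendsto (fun N : ℕ => ∑' i, c i * if ∀ j, ((N + 1 : ℕ) : ℤ) ∣ v i j then 1 else 0)
      atTop (𝓝 (∑' i, c i * if i = i₀ then 1 else 0)) := by
    refine tendsto_tsum_of_dominated_convergence hc (fun i => ?_)
      (Eventually.of_forall fun N i => ?_)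
    · refine tendsto_const_nhds.congr' ?_
      by_cases hi : i = i₀
      · aesop
      · have hne : ∃ j, v i j ≠ 0 := by
          by_contra hcon
          push Not at hcon
          exact hi (hi₀ i (funext fun j => by grind))
        obtain ⟨j, hj⟩ := hne
        filter_upwards [eventually_ge_atTop (v i j).natAbs] with N hN
        have : ¬ ∀ j, ((N + 1 : ℕ) : ℤ) ∣ v i j := fun hall => by
          have h4 := Int.natAbs_dvd_natAbs.2 (hall j)
          have h5 := Nat.le_of_dvd (Int.natAbs_pos.2 hj) h4
          omega
        rw [if_neg hi, if_neg this]
    · split_ifs <;> simp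
  have hz : ∀ N : ℕ, ∑' i, c i * (if ∀ j, ((N + 1 : ℕ) : ℤ) ∣ v i j then (1 : ℂ) else 0) = 0 :=
    fun N => (havg (N + 1) N.succ_pos).tsum_eq
  simp_all

theorem strictAnti_shifted {n : ℕ} {lam : Fin n → ℤ} (h : Antitone lam) :
    StrictAnti (shifted lam) := by
  intro i j hij
  have h1 := h hij.le
  grind [shifted]

theorem eq_of_strictAnti_comp_perm {n : ℕ} {f g : Fin n → ℤ} (hf : StrictAnti f)
    (hg : StrictAnti g) (σ : Perm (Fin n)) (h : f ∘ σ = g) : σ = 1 := by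
  have hs : StrictMono σ := by
    intro i j hij
    have h1 := hg hij
    rw [← h] at h1
    exact hf.lt_iff_gt.1 h1
  have h2 : Set.range σ = Set.range (id : Fin n → Fin n) := by simp [σ.surjective.range_eq]
  have h3 := StrictMono.range_inj hs strictMono_id
  aesop

/-- After multiplication by the Vandermonde product the expansion is one in monomials with exponents
`shifted m ∘ τ`. These vectors are strictly decreasing only for `τ = 1`, so the coefficient of the
exponent `shifted m` comes from `m` alone. -/
theorem IsSchurExpansion.unique {k : ℕ} {F : (ℕ → ℂ) → ℂ} {P P' : Sig k → ℝ}
    (h : IsSchurExpansion F P) (h' : IsSchurExpansion F P') : P = P' := by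
  let D : Sig k → ℝ := fun m => P m - P' m
  have hD : ∀ x : ℕ → ℂ, (∀ i, ‖x i‖ = 1) → HasSum (fun m => (D m : ℂ) * normSchur m x) 0 := by
    intro x hx
    have := (h x hx).sub (h' x hx)
    rw [sub_self] at this
    refine this.congr_arg fun m => ?_
    simp only [D]; push_cast; ring
  have hDs : Summable fun m => ‖(D m : ℂ)‖ := by
    have := (hD (fun _ => 1) (by simp)).summable
    simp only [normSchur_one, mul_one] at this
    exact this.norm
  let c : Sig k × Perm (Fin k) → ℂ := fun p =>
    (D p.1 : ℂ) * (gtCount k p.1.1 : ℂ)⁻¹ * ((Perm.sign p.2 : ℤ) : ℂ)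
  let u : Sig k × Perm (Fin k) → Fin k → ℤ := fun p => shifted p.1.1 ∘ p.2
  have hcb : ∀ p, ‖c p‖ ≤ ‖(D p.1 : ℂ)‖ * 1 := by
    intro p
    have h1 : ‖((Perm.sign p.2 : ℤ) : ℂ)‖ = 1 := by
      rcases Int.units_eq_one_or (Perm.sign p.2) with h | h <;> simp [h]
    have h2 : ‖(gtCount k p.1.1 : ℂ)⁻¹‖ ≤ 1 := by
      rw [norm_inv, Complex.norm_natCast]
      exact inv_le_one_of_one_le₀ (by exact_mod_cast gtCount_pos k p.1.2)
    simp only [c]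
    rw [norm_mul, norm_mul, h1, mul_one]
    exact mul_le_mul_of_nonneg_left h2 (norm_nonneg _)
  have hc : Summable fun p => ‖c p‖ := by
    refine Summable.of_nonneg_of_le (fun _ => norm_nonneg _) hcb ?_
    exact hDs.mul_of_nonneg (g := fun _ : Perm (Fin k) => (1 : ℝ))
      (hasSum_fintype _).summable (fun _ => norm_nonneg _) (fun _ => zero_le_one)
  have hzero : ∀ x : ℕ → ℂ, (∀ i, ‖x i‖ = 1) → HasSum (fun p => c p * monFin (u p) x) 0 := by
    intro x hx
    have h0 : ∀ j, x j ≠ 0 := fun j h => by have := hx j; rw [h] at this; simp at this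
    have hmon : ∀ l : Fin k → ℤ, ‖monFin l x‖ = 1 := fun l => by
      simp_all [monFin, norm_prod, prod_eq_one, norm_zpow, one_zpow]
    have hsum : Summable fun p => c p * monFin (u p) x :=
      Summable.of_norm (by simp_all)
    have h1 := (hD x hx).mul_left (vdm k x)
    rw [mul_zero] at h1
    have h2 := hsum.hasSum.prod_fiberwise fun m => hasSum_fintype _
    have h3 : ∀ m, ∑ τ : Perm (Fin k), c (m, τ) * monFin (u (m, τ)) x
        = vdm k x * ((D m : ℂ) * normSchur m x) := by
      intro m
      rw [normSchur_eq]
      have : vdm k x * ((D m : ℂ) * ((((gtCount k m.1 : ℝ)⁻¹ : ℝ) : ℂ) * schurFun k m.1 x))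
          = (D m : ℂ) * (gtCount k m.1 : ℂ)⁻¹ * (vdm k x * schurFun k m.1 x) := by
        push_cast; ring
      rw [this, vdm_mul_schurFun k m.2 h0, alternant_eq_sum, mul_sum]
      grind
    have h4 := h2.congr_arg fun m => (h3 m).symm
    have h5 := hsum.hasSum
    rwa [← h1.unique h4] at h5
  funext m
  have hm : c (m, 1) = 0 := by
    refine eq_zero_of_torus hc u hzero (m, 1) fun p hp => ?_
    obtain ⟨m', τ⟩ := p
    have hp' : shifted m'.1 ∘ τ = shifted m.1 := hp
    have hτ := eq_of_strictAnti_comp_perm (strictAnti_shifted m'.2) (strictAnti_shifted m.2) τ hp'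
    subst hτ
    have : m' = m := Subtype.ext (funext fun i => by
      have := congrFun hp' i
      simp only [shifted, Function.comp_apply, Perm.coe_one, id] at this
      omega)
    rw [this]
  have hg : (gtCount k m.1 : ℂ) ≠ 0 := Nat.cast_ne_zero.2 (gtCount_pos k m.2).ne'
  have : (D m : ℂ) = 0 := by simpa [c, hg] using hm
  have h5 : D m = 0 := by exact_mod_cast this
  exact sub_eq_zero.1 h5

end Uniqueness

/-! ### Transition coefficients and their bounds -/

section Transition

theorem zpow_sum_abs {r : ℝ} {n : ℕ} (lam : Fin n → ℤ) : r ^ (∑ i, |lam i|) = r ^ sigNorm lam := by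
  have : ∑ i, |lam i| = ((sigNorm lam : ℕ) : ℤ) := by
    unfold sigNorm; push_cast; rfl
  rw [this, zpow_natCast]

theorem sgf_spec {n : ℕ} {σ : PMF (Sig n)} (hσ : IsSmooth σ) :
    ∃ R : ℝ, 1 < R ∧ (∃ G, IsLaurent R G (sgf σ)) := by
  obtain ⟨R, hR, hs⟩ := hσ
  simp only [zpow_sum_abs] at hs
  refine ⟨R, hR, _, (IsLaurent.family (W := fun lam => (σ lam).toReal) (by linarith)
    (fun lam => isLaurent_normSchur hR.le lam) ?_).2.1⟩
  simp_all

theorem sgf_one {n : ℕ} (σ : PMF (Sig n)) : sgf σ (fun _ => 1) = 1 := by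
  unfold sgf
  simp only [normSchur_one, mul_one]
  rw [← Complex.ofReal_tsum, ← ENNReal.tsum_toReal_eq (fun a => σ.apply_ne_top a), σ.tsum_coe]
  simp

theorem sgf_congr {n : ℕ} (σ : PMF (Sig n)) {x y : ℕ → ℂ} (h : ∀ i < n, x i = y i) :
    sgf σ x = sgf σ y :=
  tsum_congr fun lam => by rw [normSchur_congr lam h]

theorem sgf_perm {n : ℕ} (s : PMF (Sig n)) {σ : Perm ℕ}
    (hσ : ∀ i, n ≤ i → σ i = i) {r : ℝ} (hr : 1 ≤ r) {x : ℕ → ℂ} (hx : x ∈ annulus ℕ r) :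
    sgf s (x ∘ σ) = sgf s x :=
  tsum_congr fun lam => by rw [normSchur_perm lam hσ hr hx]

theorem isLaurent_branchFun {n k : ℕ} {r G : ℝ} (hr : 1 ≤ r) {g : (ℕ → ℂ) → ℂ}
    (hg : IsLaurent r G g) (lam : Sig n) :
    IsLaurent r (r ^ sigNorm lam.1 * G) (branchFun k g lam) :=
  ((isLaurent_normSchur hr lam).setOne (· < k) hr).mul hr hg

/-- Apart from existence, the point is the uniformity of `C` in `lam`: at the price of passing from
`r₁` to a slightly larger `r`, the transition kernel preserves exponentially decaying weights. The
radius `R` is where the Laurent expansion of `g` converges. -/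
theorem transCoeff_spec {n k : ℕ} (hk : k ≤ n) {s : PMF (Sig k)} (hs : IsSmooth s) :
    ∃ R : ℝ, 1 < R ∧ ∀ r₁ r, 1 ≤ r₁ → r₁ < r → r ≤ R → ∃ C : ℝ, 0 ≤ C ∧ ∀ lam : Sig n,
      Summable (fun m : Sig k => |transCoeff (sgf s) lam m| * r₁ ^ sigNorm m.1) ∧
      ∑' m : Sig k, |transCoeff (sgf s) lam m| * r₁ ^ sigNorm m.1 ≤ C * r ^ sigNorm lam.1 ∧
      ∀ x ∈ annulus ℕ r₁, HasSum (fun m : Sig k => (transCoeff (sgf s) lam m : ℂ) * normSchur m x)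
        (branchFun k (sgf s) lam x) := by
  obtain ⟨R, hR, G, hG⟩ := sgf_spec hs
  refine ⟨R, hR, fun r₁ r hr₁ hrr hrR => ?_⟩
  have hr : 1 < r := hr₁.trans_lt hrr
  have hGr := hG.shrink (by linarith) hrR
  obtain ⟨C, hC, hexp⟩ := exists_schur_expansion k hr₁ hrr
  refine ⟨C * G, mul_nonneg hC (hG.bound_nonneg (by linarith)), fun lam => ?_⟩
  have hset : ∀ x, branchFun k (sgf s) lam (setOne (· < k) x) = branchFun k (sgf s) lam x := by
    simp_all [branchFun, setOne, sgf_congr]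
  have hperm : ∀ σ : Perm ℕ, (∀ i, k ≤ i → σ i = i) → ∀ x ∈ annulus ℕ r,
      branchFun k (sgf s) lam (x ∘ σ) = branchFun k (sgf s) lam x := by
    intro σ hσ x hx
    unfold branchFun
    rw [sgf_perm s hσ hr.le hx]
    congr 1
    have h1 : (fun i => if i < k then (x ∘ σ) i else 1)
        = (fun i => if i < k then x i else 1) ∘ σ := by
      funext i
      by_cases hi : i < k
      · have : σ i < k := by
          by_contra hcon
          have h2 := hσ _ (not_lt.1 hcon)
          have h3 := σ.injective h2
          omega
        simp [hi, this]
      grind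
    rw [h1]
    exact normSchur_perm lam (fun i hi => hσ i (hk.trans hi)) hr.le
      (setOne_mem_annulus (· < k) hr.le hx)
  obtain ⟨P, hP1, hP2, hP3⟩ := hexp _ _ (isLaurent_branchFun hr.le hGr lam) hset hperm
  have htorus : ∀ x : ℕ → ℂ, (∀ i, ‖x i‖ = 1) → x ∈ annulus ℕ r₁ := fun x hx j => by
    simp_all [inv_le_one_of_one_le₀]
  have hPexp : IsSchurExpansion (branchFun k (sgf s) lam) P := fun x hx => hP3 x (htorus x hx)
  have heq : transCoeff (sgf s) lam = P :=
    IsSchurExpansion.unique (Classical.epsilon_spec (p := IsSchurExpansion _) ⟨P, hPexp⟩) hPexp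
  rw [heq]
  grind

theorem isSchurExpansion_transCoeff {n k : ℕ} (hk : k ≤ n) {s : PMF (Sig k)} (hs : IsSmooth s)
    (lam : Sig n) : IsSchurExpansion (k := k) (branchFun k (sgf s) lam) (transCoeff (sgf s) lam) := by
  obtain ⟨R, hR, h⟩ := transCoeff_spec hk hs (n := n)
  obtain ⟨C, _, h⟩ := h 1 R le_rfl hR le_rfl
  refine fun x hx => (h lam).2.2 x fun j => ?_
  rw [hx j]; simp

end Transition

end

section

open Finset

/-! ### Absolutely convergent sums over product spaces -/

section PiSums

theorem hasSum_pi_prod {𝕜 : Type*} [NormedField 𝕜] [CompleteSpace 𝕜] :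
    ∀ {n : ℕ} {α : Fin n → Type} {f : ∀ h, α h → 𝕜} {a : Fin n → 𝕜}
      (_ : ∀ h, Summable fun x => ‖f h x‖) (_ : ∀ h, HasSum (f h) (a h)),
      (Summable fun x : ∀ h, α h => ‖∏ h, f h (x h)‖) ∧
        HasSum (fun x : ∀ h, α h => ∏ h, f h (x h)) (∏ h, a h)
  | 0, α, f, a, _, _ => by
    have : Fintype (∀ h : Fin 0, α h) := Fintype.ofSubsingleton default
    refine ⟨(hasSum_fintype _).summable, ?_⟩
    simp
  | n + 1, α, f, a, hf, ha => by
    obtain ⟨h1, h2⟩ := hasSum_pi_prod (f := fun i : Fin n => f i.succ) (a := fun i => a i.succ)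
      (fun i => hf i.succ) (fun i => ha i.succ)
    have e : ∀ p, (fun x : ∀ h, α h => ∏ h, f h (x h)) (Fin.consEquiv α p)
        = f 0 p.1 * ∏ i : Fin n, f i.succ (p.2 i) := by
      intro p
      simp [Fin.prod_univ_succ, Fin.consEquiv]
    have hs := summable_mul_of_summable_norm (hf 0) h1
    have hs' : Summable fun p : α 0 × (∀ i : Fin n, α i.succ) =>
        ‖f 0 p.1 * ∏ i : Fin n, f i.succ (p.2 i)‖ := by
      have := (hf 0).mul_of_nonneg h1 (fun _ => norm_nonneg _) (fun _ => norm_nonneg _)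
      aesop
    constructor
    · rw [← (Fin.consEquiv α).summable_iff]
      exact hs'.congr fun p => congrArg norm (e p).symm
    · rw [← (Fin.consEquiv α).hasSum_iff, Fin.prod_univ_succ]
      exact ((ha 0).mul h2 hs).congr_arg e

end PiSums

/-! ### Exponentially decaying signed weights and kernels along a chain -/

section Chain

/-- Signed weights with exponentially decaying tails. -/
def SmoothWeight {Ω : Type} (z : Ω → ℕ) (W : Ω → ℝ) : Prop :=
  ∃ r : ℝ, 1 < r ∧ Summable fun ω => |W ω| * r ^ z ω

/-- Functions of subexponential growth. -/
def Tempered {Ω : Type} (z : Ω → ℕ) (f : Ω → ℝ) : Prop :=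
  ∀ r : ℝ, 1 < r → ∃ C : ℝ, 0 ≤ C ∧ ∀ ω, |f ω| ≤ C * r ^ z ω

/-- Kernels mapping exponentially decaying weights to such weights. -/
def SmoothKernel {Ω Ω' : Type} (z : Ω → ℕ) (z' : Ω' → ℕ) (Q : Ω → Ω' → ℝ) : Prop :=
  ∃ R : ℝ, 1 < R ∧ ∀ r₁ r, 1 ≤ r₁ → r₁ < r → r ≤ R → ∃ C : ℝ, 0 ≤ C ∧ ∀ ω,
    (Summable fun μ => |Q ω μ| * r₁ ^ z' μ) ∧ ∑' μ, |Q ω μ| * r₁ ^ z' μ ≤ C * r ^ z ω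

theorem Tempered.abs {Ω : Type} {z : Ω → ℕ} {f : Ω → ℝ} (h : Tempered z f) :
    Tempered z fun ω => |f ω| := by
  intro r hr
  aesop

theorem tempered_one {Ω : Type} {z : Ω → ℕ} : Tempered z fun _ => 1 := fun r hr =>
  ⟨1, zero_le_one, fun ω => by simpa using one_le_pow₀ hr.le⟩

theorem Tempered.mul {Ω : Type} {z : Ω → ℕ} {f g : Ω → ℝ} (hf : Tempered z f)
    (hg : Tempered z g) : Tempered z fun ω => f ω * g ω := by
  intro r hr
  have hs : 1 < Real.sqrt r := Real.lt_sqrt_of_sq_lt (by simpa using hr)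
  obtain ⟨C, hC, h⟩ := hf _ hs
  obtain ⟨D, hD, h'⟩ := hg _ hs
  refine ⟨C * D, mul_nonneg hC hD, fun ω => ?_⟩
  rw [abs_mul]
  calc |f ω| * |g ω| ≤ (C * Real.sqrt r ^ z ω) * (D * Real.sqrt r ^ z ω) :=
        mul_le_mul (h ω) (h' ω) (abs_nonneg _) (by positivity)
    _ = C * D * (Real.sqrt r * Real.sqrt r) ^ z ω := by rw [mul_pow]; ring
    _ = _ := by grind

theorem Tempered.sum {Ω ι : Type} {z : Ω → ℕ} (s : Finset ι) {f : ι → Ω → ℝ}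
    (hf : ∀ i ∈ s, Tempered z (f i)) : Tempered z fun ω => ∑ i ∈ s, f i ω := by
  intro r hr
  choose! C hC h using fun i hi => hf i hi r hr
  refine ⟨∑ i ∈ s, C i, sum_nonneg hC, fun ω => ?_⟩
  rw [sum_mul]
  exact (abs_sum_le_sum_abs _ _).trans (sum_le_sum fun i hi => h i hi ω)

theorem Tempered.prod {Ω ι : Type} {z : Ω → ℕ} (s : Finset ι) {f : ι → Ω → ℝ}
    (hf : ∀ i ∈ s, Tempered z (f i)) : Tempered z fun ω => ∏ i ∈ s, f i ω := by
  classical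
  induction s using Finset.induction_on with
  | empty => simpa using tempered_one
  | insert a s ha ih => simp_all [prod_insert, mul]

theorem SmoothWeight.mul_tempered {Ω : Type} {z : Ω → ℕ} {W f : Ω → ℝ} (hW : SmoothWeight z W)
    (hf : Tempered z f) : SmoothWeight z fun ω => W ω * f ω := by
  obtain ⟨r, hr, hs⟩ := hW
  -- The decay rate `r` is split evenly: one factor `√r` pays for the growth of `f`, the other
  -- remains as decay of the product.
  have hq : 1 < Real.sqrt r := Real.lt_sqrt_of_sq_lt (by simpa using hr)
  obtain ⟨C, hC, h⟩ := hf _ hq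
  refine ⟨Real.sqrt r, hq, Summable.of_nonneg_of_le (fun _ => by positivity) (fun ω => ?_)
    (hs.mul_left C)⟩
  rw [abs_mul]
  calc |W ω| * |f ω| * Real.sqrt r ^ z ω
      ≤ |W ω| * (C * Real.sqrt r ^ z ω) * Real.sqrt r ^ z ω := by
        simp_all [mul_le_mul_of_nonneg_right, mul_le_mul_of_nonneg_left, abs_nonneg]
    _ = C * (|W ω| * (Real.sqrt r * Real.sqrt r) ^ z ω) := by rw [mul_pow]; ring
    _ = _ := by grind

theorem SmoothWeight.summable {Ω : Type} {z : Ω → ℕ} {W : Ω → ℝ} (hW : SmoothWeight z W) :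
    Summable W := by
  obtain ⟨r, hr, hs⟩ := hW
  grind [Summable.of_abs, Summable.of_nonneg_of_le, abs_nonneg, le_mul_of_one_le_right, one_le_pow₀]

theorem SmoothKernel.abs {Ω Ω' : Type} {z : Ω → ℕ} {z' : Ω' → ℕ} {Q : Ω → Ω' → ℝ}
    (hQ : SmoothKernel z z' Q) : SmoothKernel z z' fun ω μ => |Q ω μ| := by
  simpa only [SmoothKernel, abs_abs] using hQ

/-- Summability in both variables jointly, with a margin `r₁ > 1` in the target variable. Every
later exchange of the two summations rests on it. -/
theorem SmoothKernel.summable_pair {Ω Ω' : Type} {z : Ω → ℕ} {z' : Ω' → ℕ} {Q : Ω → Ω' → ℝ}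
    {W : Ω → ℝ} (hQ : SmoothKernel z z' Q) (hW : SmoothWeight z W) :
    ∃ r₁ : ℝ, 1 < r₁ ∧ Summable fun p : Ω × Ω' => |W p.1 * Q p.1 p.2| * r₁ ^ z' p.2 := by
  obtain ⟨R, hR, hQ⟩ := hQ
  obtain ⟨r, hr, hs⟩ := hW
  obtain ⟨q, hqr, hqR, hq⟩ : ∃ q, q ≤ r ∧ q ≤ R ∧ 1 < q :=
    ⟨min r R, min_le_left _ _, min_le_right _ _, lt_min hr hR⟩
  obtain ⟨r₁, h1, h2⟩ := exists_between hq
  obtain ⟨C, hC, hQ⟩ := hQ r₁ q h1.le h2 hqR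
  have hr₁ : 0 < r₁ := by linarith
  have hnn : ∀ ω μ, 0 ≤ |Q ω μ| * r₁ ^ z' μ := fun ω μ =>
    mul_nonneg (abs_nonneg _) (pow_nonneg hr₁.le _)
  refine ⟨r₁, h1, ?_⟩
  have e : (fun p : Ω × Ω' => |W p.1 * Q p.1 p.2| * r₁ ^ z' p.2)
      = fun p => |W p.1| * (|Q p.1 p.2| * r₁ ^ z' p.2) :=
    funext fun p => by rw [abs_mul, mul_assoc]
  have hnn' : ∀ p : Ω × Ω', 0 ≤ |W p.1| * (|Q p.1 p.2| * r₁ ^ z' p.2) :=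
    fun p => mul_nonneg (abs_nonneg _) (hnn p.1 p.2)
  have hs1 : ∀ ω, Summable fun μ => |W ω| * (|Q ω μ| * r₁ ^ z' μ) :=
    fun ω => (hQ ω).1.mul_left |W ω|
  rw [e, summable_prod_of_nonneg hnn']
  refine ⟨hs1, Summable.of_nonneg_of_le (fun ω => tsum_nonneg fun μ => hnn' (ω, μ)) (fun ω => ?_)
    (hs.mul_left C)⟩
  change ∑' μ, |W ω| * (|Q ω μ| * r₁ ^ z' μ) ≤ _
  rw [tsum_mul_left]
  calc |W ω| * ∑' μ, |Q ω μ| * r₁ ^ z' μ ≤ |W ω| * (C * q ^ z ω) :=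
        mul_le_mul_of_nonneg_left (hQ ω).2 (abs_nonneg _)
    _ ≤ |W ω| * (C * r ^ z ω) := by grind [mul_le_mul_of_nonneg_left, abs_nonneg, pow_le_pow_left₀]
    _ = C * (|W ω| * r ^ z ω) := by ring

theorem SmoothKernel.push {Ω Ω' : Type} {z : Ω → ℕ} {z' : Ω' → ℕ} {Q : Ω → Ω' → ℝ}
    {W : Ω → ℝ} (hQ : SmoothKernel z z' Q) (hW : SmoothWeight z W) :
    SmoothWeight z' (fun μ => ∑' ω, W ω * Q ω μ) ∧
      ∀ μ, Summable fun ω => W ω * Q ω μ := by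
  obtain ⟨r₁, hr₁, hs⟩ := hQ.summable_pair hW
  have hs' := (Equiv.prodComm Ω' Ω).summable_iff.2 hs
  have hs2 := (summable_prod_of_nonneg fun p => by
    simp only [Function.comp_apply, Equiv.prodComm_apply, Pi.zero_apply]; positivity).1 hs'
  simp only [Function.comp_apply, Equiv.prodComm_apply, Prod.swap_prod_mk] at hs2
  have hsum : ∀ μ, Summable fun ω => |W ω * Q ω μ| := fun μ => by
    have hpos : (0 : ℝ) < r₁ ^ z' μ := by positivity
    exact (summable_mul_right_iff hpos.ne').1 (hs2.1 μ)
  refine ⟨⟨r₁, hr₁, Summable.of_nonneg_of_le (fun _ => by positivity) (fun μ => ?_) hs2.2⟩,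
    fun μ => (hsum μ).of_abs⟩
  rw [tsum_mul_right]
  refine mul_le_mul_of_nonneg_right ?_ (by positivity)
  simpa only [Real.norm_eq_abs] using norm_tsum_le_tsum_norm (f := fun ω => W ω * Q ω μ)
    (by simp_all)

/-- The total weight of a chain with inserted functions is computed by pushing
the weights down level by level. -/
theorem exists_chain_weights : ∀ {M : ℕ} (Ω : Fin (M + 1) → Type) (z : ∀ m, Ω m → ℕ)
    (ρ : Ω (Fin.last M) → ℝ) (_ : SmoothWeight (z _) ρ)
    (Q : ∀ m : Fin M, Ω m.succ → Ω m.castSucc → ℝ)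
    (_ : ∀ m, SmoothKernel (z _) (z _) (Q m))
    (f : ∀ m, Ω m → ℝ) (_ : ∀ m, Tempered (z m) (f m)),
    ∃ Wt : ∀ m, Ω m → ℝ, Wt (Fin.last M) = ρ ∧ (∀ m, SmoothWeight (z m) (Wt m)) ∧
      (∀ m : Fin M, ∀ μ, Wt m.castSucc μ = ∑' ω, Wt m.succ ω * f m.succ ω * Q m ω μ) ∧
      HasSum (fun om : ∀ m, Ω m => ρ (om (Fin.last M)) *
        (∏ m : Fin M, Q m (om m.succ) (om m.castSucc)) * ∏ m, f m (om m))
        (∑' μ, Wt 0 μ * f 0 μ)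
  | 0, Ω, z, ρ, hρ, Q, hQ, f, hf => by
    refine ⟨fun m => (Fin.cases ρ (fun i => i.elim0) m : Ω m → ℝ), rfl, fun m => ?_,
      fun m => m.elim0, ?_⟩
    · refine Fin.cases ?_ (fun i => i.elim0) m
      exact hρ
    · have h1 : HasSum (fun μ => ρ μ * f 0 μ) (∑' μ, ρ μ * f 0 μ) :=
        (hρ.mul_tempered (hf 0)).summable.hasSum
      let e : Ω 0 ≃ ∀ m, Ω m :=
        { toFun := fun μ m => Fin.cases μ (fun i => i.elim0) m
          invFun := fun om => om 0
          left_inv := fun μ => rfl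
          right_inv := fun om => funext fun m => by
            refine Fin.cases rfl (fun i => i.elim0) m }
      rw [← e.hasSum_iff]
      aesop
  | M + 1, Ω, z, ρ, hρ, Q, hQ, f, hf => by
    have hstep := fun (ρ : Ω (Fin.last (M + 1)) → ℝ) (hρ : SmoothWeight (z _) ρ)
      (Q : Ω (Fin.last M).succ → Ω (Fin.last M).castSucc → ℝ)
      (hQ : SmoothKernel (z _) (z _) Q)
      (f : Ω (Fin.last (M + 1)) → ℝ) (hf : Tempered (z _) f) =>
      hQ.push (W := fun ω => ρ ω * f ω) (hρ.mul_tempered hf)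
    have ih := fun ρ' hρ' Q' hQ' f' hf' => exists_chain_weights (M := M)
      (fun m => Ω m.castSucc) (fun m => z m.castSucc) ρ' hρ' Q' hQ' f' hf'
    obtain ⟨hW', hWs⟩ := hstep ρ hρ (Q (Fin.last M)) (hQ _) (f _) (hf _)
    -- The weights are signed, so the same construction is carried out in parallel for absolute
    -- values; it supplies the absolute summability needed for Fubini.
    obtain ⟨hA', hAs⟩ := hstep (fun ω => |ρ ω|) (by simpa only [SmoothWeight, abs_abs] using hρ)
      (fun ω μ => |Q (Fin.last M) ω μ|) (hQ _).abs (fun ω => |f _ ω|) (hf _).abs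
    obtain ⟨Wt, hWl, hWsm, hWrec, hWsum⟩ := ih _ hW' (fun m => Q m.castSucc)
      (fun m => hQ m.castSucc) (fun m => f m.castSucc) (fun m => hf _)
    obtain ⟨_, _, _, _, hAsum⟩ := ih _ hA' (fun m ω μ => |Q m.castSucc ω μ|)
      (fun m => (hQ m.castSucc).abs) (fun m ω => |f m.castSucc ω|) (fun m => (hf _).abs)
    let Wt' : ∀ m, Ω m → ℝ := fun m => Fin.lastCases (motive := fun m => Ω m → ℝ) ρ Wt m
    have hWt'l : Wt' (Fin.last (M + 1)) = ρ := Fin.lastCases_last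
    have hWt'c : ∀ m : Fin (M + 1), Wt' m.castSucc = Wt m := fun m => Fin.lastCases_castSucc m
    refine ⟨Wt', hWt'l, fun m => ?_, fun m => ?_, ?_⟩
    · refine Fin.lastCases ?_ (fun m => ?_) m
      · rw [hWt'l]; exact hρ
      · rw [hWt'c]; exact hWsm m
    · refine Fin.lastCases ?_ (fun m => ?_) m
      · intro μ
        rw [hWt'c, hWl]
        change _ = ∑' ω : Ω (Fin.last (M + 1)), Wt' (Fin.last (M + 1)) ω * _ * _
        rw [hWt'l]
        rfl
      · intro μ
        rw [hWt'c, hWrec]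
        change _ = ∑' ω : Ω m.succ.castSucc, Wt' m.succ.castSucc ω * _ * _
        rw [hWt'c]
        rfl
    · have h0 : Wt' 0 = Wt 0 := hWt'c 0
      rw [h0]
      let α : Type := ∀ m : Fin (M + 1), Ω m.castSucc
      let R : α → ℝ := fun om => (∏ m : Fin M, Q m.castSucc (om m.succ) (om m.castSucc)) *
        ∏ m, f m.castSucc (om m)
      let T : α × Ω (Fin.last (M + 1)) → ℝ := fun p =>
        ρ p.2 * f _ p.2 * Q (Fin.last M) p.2 (p.1 (Fin.last M)) * R p.1
      -- For a fixed lower part of the chain, summation over the top level gives the pushed absolute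
      -- weight; the induction hypothesis for absolute values then sums over the lower part.
      have hT : Summable fun p => |T p| := by
        refine (summable_prod_of_nonneg fun p => abs_nonneg _).2 ⟨fun om => ?_, ?_⟩
        · have := (hAs (om (Fin.last M))).mul_right |R om|
          grind
        · refine hAsum.summable.congr fun om => ?_
          rw [mul_assoc, ← tsum_mul_right]
          grind [tsum_congr, abs_prod]
      have hT2 : HasSum T (∑' μ, Wt 0 μ * f 0 μ) := by
        have h1 := hT.of_abs.hasSum
        have h2 := h1.prod_fiberwise (g := fun om : α =>
          (∑' ω, ρ ω * f _ ω * Q (Fin.last M) ω (om (Fin.last M))) * R om)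
          fun om => (hWs (om (Fin.last M))).hasSum.mul_right (R om)
        have h3 := hWsum.congr_arg (g := fun om : α =>
          (∑' ω, ρ ω * f _ ω * Q (Fin.last M) ω (om (Fin.last M))) * R om)
          fun om => by simp only [R, mul_assoc]
        have h4 := h2.unique h3
        rw [h4] at h1
        exact h1
      rw [← ((Equiv.prodComm _ _).trans (Fin.snocEquiv Ω)).hasSum_iff]
      refine hT2.congr_arg fun p => ?_
      obtain ⟨om, ω⟩ := p
      have hl : (Fin.snoc om ω : ∀ i, Ω i) (Fin.last (M + 1)) = ω := Fin.snoc_last _ _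
      have hc : ∀ m : Fin (M + 1), (Fin.snoc om ω : ∀ i, Ω i) m.castSucc = om m :=
        fun m => Fin.snoc_castSucc (α := Ω) _ _ _
      have hsn : ((Equiv.prodComm _ _).trans (Fin.snocEquiv Ω)) (om, ω)
          = (Fin.snoc om ω : ∀ i, Ω i) := rfl
      simp only [Function.comp_apply, hsn]
      rw [Fin.prod_univ_castSucc, Fin.prod_univ_castSucc (n := M + 1)]
      grind

end Chain

end

section

open Finset Function
open Equiv (Perm)

/-! ### Differential operators on Taylor series of Laurent monomials -/

section JetMonomials

open MvPowerSeries

variable {J : Type} [DecidableEq J]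

/-- The Taylor series at `1` of a Laurent monomial. -/
def jetMon (w : J →₀ ℤ) : MvPowerSeries J ℂ := fun α => jetCoeff w α

theorem coeff_jetMon (w : J →₀ ℤ) (α : J →₀ ℕ) : coeff α (jetMon w) = jetCoeff w α := rfl

theorem hasJet_mon (w : J →₀ ℤ) : HasJet (mon w) (jetMon w) := by
  have h : LaurentRep 2 (fun _ : Unit => (1 : ℝ)) (fun _ => w) (mon w) :=
    ⟨(hasSum_fintype _).summable, fun x _ => by
      simp⟩
  have h1 := h.hasJet one_lt_two
  have : laurentJet (fun _ : Unit => (1 : ℝ)) (fun _ => w) = jetMon w := by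
    ext α
    rw [coeff_laurentJet, coeff_jetMon]
    simp
  rwa [this] at h1

theorem pderiv_jetMon (w : J →₀ ℤ) (j : J) :
    pderiv ℂ j (jetMon w) = (w j : ℂ) • jetMon (w - Finsupp.single j 1) := by
  ext α
  rw [coeff_pderiv, map_smul, coeff_jetMon, coeff_jetMon, jetCoeff_add_single, smul_eq_mul]

theorem one_add_X_mul_jetMon (w : J →₀ ℤ) (j : J) :
    (1 + X j) * jetMon w = jetMon (w + Finsupp.single j 1) := by
  refine ((hasJet_coord j).mul (hasJet_mon w)).unique
    ((hasJet_mon (w + Finsupp.single j 1)).congr (δ := 1) one_pos fun x hx => ?_)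
  have h0 : ∀ i, x i ≠ 0 := fun i h => by
    have := hx i
    simp_all
  rw [mon_add h0, mul_comm]
  congr 1
  simp [mon]

/-- The falling factorial `z (z - 1) ⋯ (z - k + 1)`. -/
def fallingC (z : ℂ) (k : ℕ) : ℂ := ∏ i ∈ range k, (z - i)

theorem iterate_pderiv_jetMon (w : J →₀ ℤ) (j : J) (k : ℕ) :
    (pderiv ℂ j)^[k] (jetMon w) = fallingC (w j) k • jetMon (w - Finsupp.single j (k : ℤ)) := by
  induction k with
  | zero => simp [fallingC]
  | succ k ih =>
    simp_all [Function.iterate_succ_apply', Derivation.map_smul, pderiv_jetMon, smul_smul, sub_sub,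
        Finsupp.single_add, fallingC, prod_range_succ]

theorem one_add_X_pow_mul_jetMon (w : J →₀ ℤ) (j : J) (k : ℕ) :
    (1 + X j) ^ k * jetMon w = jetMon (w + Finsupp.single j (k : ℤ)) := by
  induction k with
  | zero => simp
  | succ k ih =>
    rw [pow_succ', mul_assoc, ih, one_add_X_mul_jetMon, add_assoc, ← Finsupp.single_add]
    simp

/-- The formal version of `x^k ∂^k x^w = w (w - 1) ⋯ (w - k + 1) x^w`; the coordinate `x_j` has
Taylor series `1 + X_j`. -/
theorem euler_jetMon (w : J →₀ ℤ) (j : J) (k : ℕ) :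
    (1 + X j) ^ k * (pderiv ℂ j)^[k] (jetMon w) = fallingC (w j) k • jetMon w := by
  rw [iterate_pderiv_jetMon, mul_smul_comm, one_add_X_pow_mul_jetMon, sub_add_cancel]

theorem HasJet.pderiv_eq_zero {G : (J → ℂ) → ℂ} {g : MvPowerSeries J ℂ} (h : HasJet G g) (j : J)
    (hG : ∀ x t, G (update x j t) = G x) : pderiv ℂ j g = 0 := by
  have h1 : partialDeriv j G = fun _ => 0 := by
    funext x
    unfold partialDeriv
    simp [hG]
  have h2 := h.deriv j
  rw [h1] at h2
  have h3 := h2.unique (hasJet_const 0)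
  rw [h3, map_zero]

theorem iterate_pderiv_mul_of_pderiv_eq_zero {g : MvPowerSeries J ℂ} {j : J}
    (hg : pderiv ℂ j g = 0) (f : MvPowerSeries J ℂ) (k : ℕ) :
    (pderiv ℂ j)^[k] (f * g) = (pderiv ℂ j)^[k] f * g := by
  induction k with
  | zero => rfl
  | succ k ih => simp_all [Function.iterate_succ_apply', Derivation.leibniz, mul_comm]

/-- Coefficientwise convergent sums of power series. -/
def CoeffHasSum {Λ : Type} (f : Λ → MvPowerSeries J ℂ) (g : MvPowerSeries J ℂ) : Prop :=
  ∀ α, HasSum (fun l => coeff α (f l)) (coeff α g)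

theorem CoeffHasSum.unique {Λ : Type} {f : Λ → MvPowerSeries J ℂ} {g g' : MvPowerSeries J ℂ}
    (h : CoeffHasSum f g) (h' : CoeffHasSum f g') : g = g' := by
  ext α; exact (h α).unique (h' α)

theorem CoeffHasSum.pderiv {Λ : Type} {f : Λ → MvPowerSeries J ℂ} {g : MvPowerSeries J ℂ}
    (h : CoeffHasSum f g) (j : J) :
    CoeffHasSum (fun l => pderiv ℂ j (f l)) (pderiv ℂ j g) := by
  intro α
  simp only [coeff_pderiv]
  exact (h _).mul_right _

theorem CoeffHasSum.iterate_pderiv {Λ : Type} {f : Λ → MvPowerSeries J ℂ}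
    {g : MvPowerSeries J ℂ} (h : CoeffHasSum f g) (j : J) (k : ℕ) :
    CoeffHasSum (fun l => (MvPowerSeries.pderiv ℂ j)^[k] (f l))
      ((MvPowerSeries.pderiv ℂ j)^[k] g) := by
  induction k with
  | zero => exact h
  | succ k ih =>
    simp only [Function.iterate_succ_apply']
    exact ih.pderiv j

theorem CoeffHasSum.mul_left {Λ : Type} {f : Λ → MvPowerSeries J ℂ} {g : MvPowerSeries J ℂ}
    (h : CoeffHasSum f g) (p : MvPowerSeries J ℂ) : CoeffHasSum (fun l => p * f l) (p * g) := by
  intro α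
  simp only [coeff_mul]
  exact hasSum_sum fun q _ => (h q.2).mul_left _

theorem CoeffHasSum.sum {Λ ι : Type} (s : Finset ι) {f : ι → Λ → MvPowerSeries J ℂ}
    {g : ι → MvPowerSeries J ℂ} (h : ∀ i ∈ s, CoeffHasSum (f i) (g i)) :
    CoeffHasSum (fun l => ∑ i ∈ s, f i l) (∑ i ∈ s, g i) := by
  intro α
  simp only [map_sum]
  exact hasSum_sum fun i hi => h i hi α

end JetMonomials

/-! ### Generating functions of weights and the eigenvalue equation -/

section WeightGF

open MvPowerSeries

variable {H : ℕ}

/-- Tuples of signatures. -/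
abbrev MultiSig (ν : Fin H → ℕ) : Type := (h : Fin H) → Sig (ν h)

/-- The size of a tuple of signatures. -/
def multiNorm {ν : Fin H → ℕ} (ω : MultiSig ν) : ℕ := ∑ h, sigNorm (ω h).1

/-- The product of normalized Schur functions. -/
def multiSchur {ν : Fin H → ℕ} (ω : MultiSig ν) (x : Fin H × ℕ → ℂ) : ℂ :=
  ∏ h, normSchur (ω h) fun i => x (h, i)

/-- The generating function of a signed weight. -/
def weightGF {ν : Fin H → ℕ} (W : MultiSig ν → ℝ) (x : Fin H × ℕ → ℂ) : ℂ :=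
  ∑' ω, (W ω : ℂ) * multiSchur ω x

theorem prodMk_injective (h : Fin H) : Injective fun i : ℕ => (h, i) :=
  fun _ _ hij => (Prod.mk.inj hij).2

theorem isLaurent_multiSchur {ν : Fin H → ℕ} {r : ℝ} (hr : 1 ≤ r) (ω : MultiSig ν) :
    IsLaurent r (r ^ multiNorm ω) (multiSchur ω) := by
  have h := IsLaurent.prod (univ : Finset (Fin H)) hr
    fun h _ => (isLaurent_normSchur hr (ω h)).comp (prodMk_injective h)
  rw [prod_pow_eq_pow_sum] at h
  exact h

theorem multiSchur_one {ν : Fin H → ℕ} (ω : MultiSig ν) : multiSchur ω (fun _ => 1) = 1 := by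
  simp [multiSchur, normSchur_one]

/-- The Taylor series at `1` of the product of normalized Schur functions. -/
def jetSchur {ν : Fin H → ℕ} (ω : MultiSig ν) : MvPowerSeries (Fin H × ℕ) ℂ :=
  Classical.choose ((isLaurent_multiSchur one_le_two ω).exists_hasJet one_lt_two)

theorem hasJet_multiSchur {ν : Fin H → ℕ} (ω : MultiSig ν) :
    HasJet (multiSchur ω) (jetSchur ω) :=
  Classical.choose_spec ((isLaurent_multiSchur one_le_two ω).exists_hasJet one_lt_two)

theorem SmoothWeight.weightGF {ν : Fin H → ℕ} {W : MultiSig ν → ℝ}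
    (hW : SmoothWeight multiNorm W) :
    ∃ r B : ℝ, 1 < r ∧ IsLaurent r B (weightGF W) ∧ ∃ s, HasJet (weightGF W) s ∧
      CoeffHasSum (fun ω => (W ω : ℂ) • jetSchur ω) s := by
  obtain ⟨r, hr, hs⟩ := hW
  obtain ⟨_, h2, h3⟩ := IsLaurent.family (W := W) (by linarith : 0 < r)
    (fun ω => isLaurent_multiSchur hr.le ω) hs
  obtain ⟨s, h4, h5⟩ := h3 hr jetSchur hasJet_multiSchur
  exact ⟨r, _, hr, h2, s, h4, fun α => by simp_all⟩

theorem weightGF_one {ν : Fin H → ℕ} (W : MultiSig ν → ℝ) :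
    weightGF W (fun _ => 1) = ((∑' ω, W ω : ℝ) : ℂ) := by
  unfold weightGF
  simp only [multiSchur_one, mul_one]
  rw [Complex.ofReal_tsum]

/-- The Vandermonde product in the variables of the group `h`. -/
def vdmSeries (n : ℕ) (h : Fin H) : MvPowerSeries (Fin H × ℕ) ℂ :=
  ∏ a ∈ range n, ∏ b ∈ range a, (X (h, b) - X (h, a))

theorem hasJet_vdm (n : ℕ) (h : Fin H) :
    HasJet (fun x : Fin H × ℕ → ℂ => vdm n fun i => x (h, i)) (vdmSeries n h) := by
  unfold vdm vdmSeries
  refine HasJet.prod _ fun a _ => HasJet.prod _ fun b _ => ?_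
  have h1 := (hasJet_coord ((h, b) : Fin H × ℕ)).add
    ((hasJet_const (-1)).mul (hasJet_coord ((h, a) : Fin H × ℕ)))
  grind

/-- The operator `∑_i x_i^k ∂_i^k` over the variables of the group `h`. -/
def eulerSum (n : ℕ) (h : Fin H) (k : ℕ) (f : MvPowerSeries (Fin H × ℕ) ℂ) :
    MvPowerSeries (Fin H × ℕ) ℂ :=
  ∑ i ∈ range n, (1 + X (h, i)) ^ k * (pderiv ℂ (h, i))^[k] f

theorem CoeffHasSum.eulerSum {Λ : Type} {f : Λ → MvPowerSeries (Fin H × ℕ) ℂ}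
    {g : MvPowerSeries (Fin H × ℕ) ℂ} (hf : CoeffHasSum f g) (n : ℕ) (h : Fin H) (k : ℕ) :
    CoeffHasSum (fun l => eulerSum n h k (f l)) (eulerSum n h k g) :=
  CoeffHasSum.sum _ fun i _ => (hf.iterate_pderiv (h, i) k).mul_left _

/-- The factorial power sums of the shifted coordinates. -/
def fallingSum {n : ℕ} (lam : Sig n) (k : ℕ) : ℝ :=
  ∑ i, ∏ j ∈ range k, ((shifted lam.1 i : ℝ) - j)

theorem ofReal_fallingSum {n : ℕ} (lam : Sig n) (k : ℕ) :
    (fallingSum lam k : ℂ) = ∑ i, fallingC (shifted lam.1 i) k := by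
  unfold fallingSum fallingC
  push_cast
  rfl

theorem eulerSum_add (n : ℕ) (h : Fin H) (k : ℕ) (f g : MvPowerSeries (Fin H × ℕ) ℂ) :
    eulerSum n h k (f + g) = eulerSum n h k f + eulerSum n h k g := by
  unfold eulerSum
  simp only [iterate_map_add, mul_add, sum_add_distrib]

theorem iterate_pderiv_smul {J : Type} [DecidableEq J] (j : J) (a : ℂ) (f : MvPowerSeries J ℂ)
    (k : ℕ) : (pderiv ℂ j)^[k] (a • f) = a • (pderiv ℂ j)^[k] f := by
  induction k with
  | zero => rfl
  | succ k ih => simp_all [Function.iterate_succ_apply', Derivation.map_smul]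

theorem eulerSum_smul (n : ℕ) (h : Fin H) (k : ℕ) (a : ℂ) (f : MvPowerSeries (Fin H × ℕ) ℂ) :
    eulerSum n h k (a • f) = a • eulerSum n h k f := by
  unfold eulerSum
  simp only [iterate_pderiv_smul, mul_smul_comm, smul_sum]

theorem eulerSum_zero (n : ℕ) (h : Fin H) (k : ℕ) :
    eulerSum n h k (0 : MvPowerSeries (Fin H × ℕ) ℂ) = 0 := by
  have := eulerSum_smul n h k 0 0
  simpa using this

theorem eulerSum_sum {ι : Type*} (s : Finset ι) (n : ℕ) (h : Fin H) (k : ℕ)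
    (f : ι → MvPowerSeries (Fin H × ℕ) ℂ) :
    eulerSum n h k (∑ i ∈ s, f i) = ∑ i ∈ s, eulerSum n h k (f i) := by
  classical
  induction s using Finset.induction_on with
  | empty => simpa using eulerSum_zero n h k
  | insert a s ha ih => simp_all [sum_insert, eulerSum_add]

/-- Exponents of the group `h`. -/
def groupExp {n : ℕ} (h : Fin H) (u : Fin n → ℤ) : Fin H × ℕ →₀ ℤ :=
  ∑ j : Fin n, Finsupp.single (h, (j : ℕ)) (u j)

theorem groupExp_apply {n : ℕ} (h : Fin H) (u : Fin n → ℤ) (j : Fin n) :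
    groupExp h u (h, (j : ℕ)) = u j := by
  unfold groupExp
  rw [Finsupp.finsetSum_apply, sum_eq_single j]
  · simp
  · grind
  · simp

theorem mon_groupExp {n : ℕ} (h : Fin H) (u : Fin n → ℤ) {x : Fin H × ℕ → ℂ}
    (hx : ∀ j, x j ≠ 0) : mon (groupExp h u) x = monFin u fun i => x (h, i) := by
  unfold groupExp monFin
  have : ∀ s : Finset (Fin n), mon (∑ j ∈ s, Finsupp.single (h, (j : ℕ)) (u j)) x
      = ∏ j ∈ s, x (h, (j : ℕ)) ^ u j := by
    intro s
    induction s using Finset.induction_on with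
    | empty => simp [mon]
    | insert a s ha ih =>
      rw [sum_insert ha, mon_add hx, ih, prod_insert ha]
      congr 1
      simp [mon]
  exact this _

/-- The Schur functions are eigenfunctions of the conjugated differential operators. -/
theorem eulerSum_vdm_mul_jetSchur {ν : Fin H → ℕ} (ω : MultiSig ν) (h : Fin H) (k : ℕ) :
    eulerSum (ν h) h k (vdmSeries (ν h) h * jetSchur ω)
      = (fallingSum (ω h) k : ℂ) • (vdmSeries (ν h) h * jetSchur ω) := by
  set l := shifted (ω h).1 with hl
  -- the factor of the other groups
  let G : (Fin H × ℕ → ℂ) → ℂ := fun x =>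
    ∏ h' ∈ univ.erase h, normSchur (ω h') fun i => x (h', i)
  have hGL := IsLaurent.prod (univ.erase h) one_le_two
    fun h' _ => (isLaurent_normSchur one_le_two (ω h')).comp (prodMk_injective h')
  obtain ⟨g, hg⟩ := hGL.exists_hasJet one_lt_two
  replace hg : HasJet G g := hg
  have hg0 : ∀ i, pderiv ℂ (h, i) g = 0 := by
    intro i
    refine hg.pderiv_eq_zero (h, i) fun x t => ?_
    refine prod_congr rfl fun h' hh' => ?_
    grind
  let a : ℂ := (gtCount (ν h) (ω h).1 : ℂ)⁻¹
  -- The bialternant formula on the level of Taylor series: monomials in the variables of the group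
  -- `h` times a factor `g` that does not involve them. On each such term the operator acts by a
  -- scalar.
  have hjet : vdmSeries (ν h) h * jetSchur ω = ∑ τ : Perm (Fin (ν h)),
      (a * ((Perm.sign τ : ℤ) : ℂ)) • (jetMon (groupExp h (l ∘ τ)) * g) := by
    refine ((hasJet_vdm (ν h) h).mul (hasJet_multiSchur ω)).unique ?_
    have h1 : HasJet (fun x => ∑ τ : Perm (Fin (ν h)),
        (a * ((Perm.sign τ : ℤ) : ℂ)) * (mon (groupExp h (l ∘ τ)) x * G x))
        (∑ τ : Perm (Fin (ν h)),
          C (a * ((Perm.sign τ : ℤ) : ℂ)) * (jetMon (groupExp h (l ∘ τ)) * g)) :=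
      HasJet.sum _ fun τ _ => (hasJet_const _).mul ((hasJet_mon _).mul hg)
    simp only [← smul_eq_C_mul] at h1
    refine h1.congr one_pos fun x hx => ?_
    have h0 : ∀ i, x i ≠ 0 := fun i h => by
      have := hx i
      simp_all
    have h2 := vdm_mul_schurFun (ν h) (ω h).2 (x := fun i => x (h, i)) fun j => h0 _
    have h3 : multiSchur ω x = normSchur (ω h) (fun i => x (h, i)) * G x :=
      (mul_prod_erase univ _ (mem_univ h)).symm
    simp only [mon_groupExp h _ h0]
    rw [h3, normSchur_eq]
    have h4 : vdm (ν h) (fun i => x (h, i)) * ((((gtCount (ν h) (ω h).1 : ℝ)⁻¹ : ℝ) : ℂ) *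
        schurFun (ν h) (ω h).1 (fun i => x (h, i)) * G x)
        = a * G x * (vdm (ν h) (fun i => x (h, i)) *
          schurFun (ν h) (ω h).1 (fun i => x (h, i))) := by
      simp only [a]; push_cast; ring
    rw [h4, h2, alternant_eq_sum, mul_sum]
    grind
  rw [hjet, eulerSum_sum, smul_sum]
  refine sum_congr rfl fun τ _ => ?_
  rw [eulerSum_smul, smul_comm]
  congr 1
  unfold eulerSum
  -- The eigenvalue is a symmetric function of the exponents, hence the same for every permutation
  -- `τ`.
  rw [ofReal_fallingSum, ← Equiv.sum_comp τ, sum_range, sum_smul]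
  refine sum_congr rfl fun i _ => ?_
  rw [iterate_pderiv_mul_of_pderiv_eq_zero (hg0 _), ← mul_assoc, euler_jetMon, groupExp_apply,
    smul_mul_assoc]
  rfl

theorem tempered_shifted {ν : Fin H → ℕ} (h : Fin H) (i : Fin (ν h)) :
    Tempered multiNorm fun ω : MultiSig ν => (shifted (ω h).1 i : ℝ) := by
  intro r hr
  obtain ⟨K, hK0, hK⟩ := exists_poly_mul_pow_le 1 (ν h) one_pos hr
  refine ⟨K, hK0, fun ω => ?_⟩
  have h1 := hK (multiNorm ω)
  simp only [pow_one, one_pow, mul_one] at h1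
  refine le_trans ?_ h1
  have h2 : ((ω h).1 i).natAbs ≤ multiNorm ω := by
    unfold multiNorm sigNorm
    exact (single_le_sum (f := fun i => ((ω h).1 i).natAbs) (fun _ _ => Nat.zero_le _)
      (mem_univ i)).trans (single_le_sum
        (f := fun h => ∑ i, ((ω h).1 i).natAbs) (fun _ _ => Nat.zero_le _) (mem_univ h))
  have h3 : |(ω h).1 i + (ν h : ℤ) - 1 - (i : ℕ)| ≤ (multiNorm ω : ℤ) + (ν h : ℤ) := by grind
  have h4 : ((|shifted (ω h).1 i| : ℤ) : ℝ) ≤ (((multiNorm ω : ℤ) + (ν h : ℤ) : ℤ) : ℝ) :=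
    Int.cast_le.2 h3
  push_cast at h4
  exact h4

theorem tempered_const {Ω : Type} {z : Ω → ℕ} (c : ℝ) : Tempered z fun _ => c := fun _ hr =>
  ⟨|c|, abs_nonneg _, fun _ => le_mul_of_one_le_right (abs_nonneg _) (one_le_pow₀ hr.le)⟩

theorem tempered_fallingSum {ν : Fin H → ℕ} (h : Fin H) (k : ℕ) :
    Tempered multiNorm fun ω : MultiSig ν => fallingSum (ω h) k := by
  unfold fallingSum
  refine Tempered.sum _ fun i _ => Tempered.prod _ fun j _ => ?_
  have := Tempered.sum (z := multiNorm (ν := ν)) (univ : Finset Bool)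
    (f := fun b ω => if b then (shifted (ω h).1 i : ℝ) else -(j : ℝ)) fun b _ => by
      cases b
      · simpa using tempered_const (-(j : ℝ))
      · simpa using tempered_shifted h i
  aesop

/-- The eigenvalue equation summed over all signatures. The factor `V` stays on both sides, because
`V` vanishes at one and has no inverse power series in general. -/
theorem hasJet_weightGF_mul_fallingSum {ν : Fin H → ℕ} {W : MultiSig ν → ℝ}
    (hW : SmoothWeight multiNorm W) {s : MvPowerSeries (Fin H × ℕ) ℂ}
    (hs : HasJet (weightGF W) s) (h : Fin H) (k : ℕ) :
    ∃ s', HasJet (weightGF fun ω => W ω * fallingSum (ω h) k) s' ∧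
      vdmSeries (ν h) h * s' = eulerSum (ν h) h k (vdmSeries (ν h) h * s) := by
  obtain ⟨_, _, _, _, s₀, hs₀, hsum⟩ := hW.weightGF
  obtain rfl := hs.unique hs₀
  obtain ⟨_, _, _, _, s', hs', hsum'⟩ := (hW.mul_tempered (tempered_fallingSum h k)).weightGF
  refine ⟨s', hs', ?_⟩
  have h1 := hsum'.mul_left (vdmSeries (ν h) h)
  have h2 := (hsum.mul_left (vdmSeries (ν h) h)).eulerSum (ν h) h k
  refine h1.unique ?_
  have e : (fun ω => vdmSeries (ν h) h * ((W ω * fallingSum (ω h) k : ℝ) : ℂ) • jetSchur ω)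
      = fun ω => eulerSum (ν h) h k (vdmSeries (ν h) h * (W ω : ℂ) • jetSchur ω) := by
    funext ω
    rw [mul_smul_comm, mul_smul_comm, eulerSum_smul, eulerSum_vdm_mul_jetSchur, smul_smul]
    push_cast
    rfl
  rw [e]
  exact h2

end WeightGF

/-! ### Generating functions under one step of the chain -/

section LevelChange

open MvPowerSeries

variable {H : ℕ}

theorem exists_common_radius {H : ℕ} {R : Fin H → ℝ} (hR : ∀ h, 1 < R h) :
    ∃ q, 1 < q ∧ ∀ h, q ≤ R h := by
  cases H with
  | zero => exact ⟨2, one_lt_two, fun h => h.elim0⟩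
  | succ n => aesop

theorem tsum_eq_tsum_of_fibers {α β : Type} {T : α × β → ℂ} (hT : Summable T) {a : α → ℂ}
    {b : β → ℂ} (ha : ∀ x, HasSum (fun y => T (x, y)) (a x))
    (hb : ∀ y, HasSum (fun x => T (x, y)) (b y)) : ∑' x, a x = ∑' y, b y := by
  have h1 : HasSum a (∑' p, T p) := hT.hasSum.prod_fiberwise ha
  have h2 : HasSum (T ∘ Equiv.prodComm β α) (∑' p, T p) :=
    (Equiv.prodComm β α).hasSum_iff.2 hT.hasSum
  have h3 : HasSum b (∑' p, T p) := h2.prod_fiberwise hb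
  rw [h1.tsum_eq, h3.tsum_eq]

/-- The transition kernel of independent coordinates. -/
def multiKernel {ν' ν : Fin H → ℕ} (σ : ∀ h, PMF (Sig (ν h))) (ω : MultiSig ν')
    (μ : MultiSig ν) : ℝ := ∏ h, transCoeff (sgf (σ h)) (ω h) (μ h)

theorem multiKernel_spec {ν' ν : Fin H → ℕ} (hν : ∀ h, ν h ≤ ν' h) {σ : ∀ h, PMF (Sig (ν h))}
    (hσ : ∀ h, IsSmooth (σ h)) :
    ∃ R : ℝ, 1 < R ∧ ∀ r₁ r, 1 ≤ r₁ → r₁ < r → r ≤ R →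
      (∃ C : ℝ, 0 ≤ C ∧ ∀ ω : MultiSig ν',
        (Summable fun μ => |multiKernel σ ω μ| * r₁ ^ multiNorm μ) ∧
        ∑' μ, |multiKernel σ ω μ| * r₁ ^ multiNorm μ ≤ C * r ^ multiNorm ω) ∧
      ∀ (ω : MultiSig ν'), ∀ x ∈ annulus (Fin H × ℕ) r₁,
        HasSum (fun μ => (multiKernel σ ω μ : ℂ) * multiSchur μ x)
          (∏ h, branchFun (ν h) (sgf (σ h)) (ω h) fun i => x (h, i)) := by
  choose R hR hspec using fun h => transCoeff_spec (hν h) (hσ h)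
  obtain ⟨q, hq, hqR⟩ := exists_common_radius hR
  refine ⟨q, hq, fun r₁ r hr₁ hrr hr => ?_⟩
  choose C hC hC' using fun h => hspec h r₁ r hr₁ hrr (hr.trans (hqR h))
  have hr0 : 0 < r₁ := by linarith
  refine ⟨⟨∏ h, C h, prod_nonneg fun h _ => hC h, fun ω => ?_⟩, fun ω x hx => ?_⟩
  · have h1 := hasSum_pi_prod (f := fun h (μ : Sig (ν h)) =>
      |transCoeff (sgf (σ h)) (ω h) μ| * r₁ ^ sigNorm μ.1)
      (fun h => ((hC' h (ω h)).1).norm) (fun h => ((hC' h (ω h)).1).hasSum)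
    have e : ∀ μ : MultiSig ν, ∏ h, |transCoeff (sgf (σ h)) (ω h) (μ h)| * r₁ ^ sigNorm (μ h).1
        = |multiKernel σ ω μ| * r₁ ^ multiNorm μ := by
      intro μ
      rw [prod_mul_distrib, prod_pow_eq_pow_sum, multiKernel, abs_prod]
      rfl
    have h2 := h1.2
    simp only [e] at h2
    refine ⟨h2.summable, ?_⟩
    rw [h2.tsum_eq]
    refine (Finset.prod_le_prod (fun h _ => tsum_nonneg fun μ => by positivity)
      fun h _ => (hC' h (ω h)).2.1).trans (le_of_eq ?_)
    rw [prod_mul_distrib, prod_pow_eq_pow_sum]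
    rfl
  · have hxh : ∀ h, (fun i => x (h, i)) ∈ annulus ℕ r₁ := fun h i => hx _
    have h1 := hasSum_pi_prod (f := fun h (μ : Sig (ν h)) =>
      (transCoeff (sgf (σ h)) (ω h) μ : ℂ) * normSchur μ fun i => x (h, i)) (fun h => ?_)
      (fun h => (hC' h (ω h)).2.2 _ (hxh h))
    · refine h1.2.congr_arg fun μ => ?_
      simp [multiKernel, multiSchur, prod_mul_distrib]
    · refine Summable.of_nonneg_of_le (fun _ => norm_nonneg _) (fun μ => ?_) (hC' h (ω h)).1
      rw [norm_mul, Complex.norm_real, Real.norm_eq_abs]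
      exact mul_le_mul_of_nonneg_left
        ((isLaurent_normSchur hr₁ μ).norm_le hr0 (hxh h)) (abs_nonneg _)

theorem smoothKernel_multiKernel {ν' ν : Fin H → ℕ} (hν : ∀ h, ν h ≤ ν' h)
    {σ : ∀ h, PMF (Sig (ν h))} (hσ : ∀ h, IsSmooth (σ h)) :
    SmoothKernel multiNorm multiNorm (multiKernel (ν' := ν') σ) := by
  obtain ⟨R, hR, h⟩ := multiKernel_spec hν hσ
  exact ⟨R, hR, fun r₁ r h1 h2 h3 => (h r₁ r h1 h2 h3).1⟩

/-- Summing over the lower signature first reproduces the defining expansion of the transition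
coefficients, so by Fubini the pushed weight has the old generating function with the superfluous
variables set to one, times the functions `g`. -/
theorem hasJet_weightGF_push {ν' ν : Fin H → ℕ} (hν : ∀ h, ν h ≤ ν' h)
    {σ : ∀ h, PMF (Sig (ν h))} (hσ : ∀ h, IsSmooth (σ h)) {W : MultiSig ν' → ℝ}
    (hW : SmoothWeight multiNorm W) {s : MvPowerSeries (Fin H × ℕ) ℂ}
    (hs : HasJet (weightGF W) s) {γ : Fin H → MvPowerSeries (Fin H × ℕ) ℂ}
    (hγ : ∀ h, HasJet (fun x : Fin H × ℕ → ℂ => sgf (σ h) fun i => x (h, i)) (γ h)) :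
    HasJet (weightGF fun μ => ∑' ω, W ω * multiKernel σ ω μ)
      (restr (fun j : Fin H × ℕ => j.2 < ν j.1) s * ∏ h, γ h) := by
  obtain ⟨ρ, B, hρ, hL, _⟩ := hW.weightGF
  have h1 : HasJet (fun x => weightGF W (setOne (fun j : Fin H × ℕ => j.2 < ν j.1) x) *
      ∏ h, sgf (σ h) fun i => x (h, i)) _ :=
    (HasJet.setOne (fun j : Fin H × ℕ => j.2 < ν j.1) hρ hL hs).mul
      (HasJet.prod univ fun h _ => hγ h)
  obtain ⟨R, hR, hspec⟩ := multiKernel_spec hν hσ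
  have hK : SmoothKernel multiNorm multiNorm (multiKernel (ν' := ν') σ) :=
    smoothKernel_multiKernel hν hσ
  have hpush := (hK.push hW).2
  obtain ⟨r₁, hr₁, hpair⟩ := hK.summable_pair hW
  obtain ⟨q, hq1, hq⟩ := exists_between (lt_min hr₁ hR)
  have hqr : q ≤ r₁ := (hq.trans_le (min_le_left _ _)).le
  have hqR : q < R := hq.trans_le (min_le_right _ _)
  have hq0 : 0 < q := by linarith
  have hexp := (hspec q R hq1.le hqR le_rfl).2
  have hδ : 0 < 1 - q⁻¹ := by
    have := inv_lt_one_of_one_lt₀ hq1; linarith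
  refine h1.congr hδ fun x hx' => ?_
  have hx := polydisc_subset_annulus hq1 hx'
  let T : MultiSig ν' × MultiSig ν → ℂ := fun p =>
    ((W p.1 * multiKernel σ p.1 p.2 : ℝ) : ℂ) * multiSchur p.2 x
  have hT : Summable T := by
    refine Summable.of_norm_bounded hpair fun p => ?_
    simp only [T]
    rw [norm_mul, Complex.norm_real, Real.norm_eq_abs]
    refine mul_le_mul_of_nonneg_left ?_ (abs_nonneg _)
    exact ((isLaurent_multiSchur hq1.le p.2).norm_le hq0 hx).trans
      (pow_le_pow_left₀ hq0.le hqr _)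
  have hA : ∀ ω, HasSum (fun μ => T (ω, μ))
      ((W ω : ℂ) * ∏ h, branchFun (ν h) (sgf (σ h)) (ω h) fun i => x (h, i)) := by
    intro ω
    refine ((hexp ω x hx).mul_left (W ω : ℂ)).congr_arg fun μ => ?_
    simp only [T]; push_cast; ring
  have hB : ∀ μ, HasSum (fun ω => T (ω, μ))
      (((∑' ω, W ω * multiKernel σ ω μ : ℝ) : ℂ) * multiSchur μ x) := by
    intro μ
    have h3 : Summable fun ω => W ω * multiKernel σ ω μ := hpush μ
    have h4 : HasSum (fun ω => ((W ω * multiKernel σ ω μ : ℝ) : ℂ))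
      ((∑' ω, W ω * multiKernel σ ω μ : ℝ) : ℂ) := Complex.hasSum_ofReal.2 h3.hasSum
    exact h4.mul_right (multiSchur μ x)
  have e2 : ∑' ω, (W ω : ℂ) * ∏ h, branchFun (ν h) (sgf (σ h)) (ω h) (fun i => x (h, i))
      = weightGF (fun μ => ∑' ω, W ω * multiKernel σ ω μ) x := tsum_eq_tsum_of_fibers hT hA hB
  rw [← e2]
  unfold weightGF
  rw [← tsum_mul_right]
  refine tsum_congr fun ω => ?_
  rw [mul_assoc]
  congr 1
  unfold branchFun multiSchur
  rw [← prod_mul_distrib]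
  rfl

end LevelChange

end

section

open Finset Function

/-! ### An abstract partial fraction identity -/

section PartialFractions

/-- Partial fractions in abstract form. -/
theorem prod_one_add_mul_eq {ι R : Type*} [CommRing R] [DecidableEq ι] (g : ι → ι → R) (t : R)
    (S : Finset ι) : (∀ i ∈ S, ∀ j ∈ S, i ≠ j → g i j = -g j i) →
    (∀ i ∈ S, ∀ j ∈ S, ∀ m ∈ S, i ≠ j → m ≠ i → m ≠ j →
      g m i * g m j = g i j * (g m i - g m j)) →
    ∀ f : ι → R, (∀ i ∈ S, ∀ j ∈ S, i ≠ j → f i * f j = g i j * (f i - f j)) →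
    ∏ l ∈ S, (1 + t * f l) = 1 + t * ∑ i ∈ S, f i * ∏ l ∈ S.erase i, (1 + t * g i l) := by
  induction S using Finset.induction_on with
  | empty => intro _ _ f _; simp
  | insert m S hm ih =>
    intro hanti hg f hf
    have hne : ∀ i ∈ S, m ≠ i := fun i hi h => hm (h ▸ hi)
    have ih' := ih (fun i hi j hj => hanti i (by simp [hi]) j (by simp [hj]))
      (fun i hi j hj k hk => hg i (by simp [hi]) j (by simp [hj]) k (by simp [hk]))
    have ihf := ih' f fun i hi j hj => hf i (by simp [hi]) j (by simp [hj])
    -- The functions `l ↦ g m l` satisfy the relation imposed on `f`, so the induction hypothesis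
    -- also evaluates the correction terms caused by the new index `m`.
    have ihg := ih' (g m) fun i hi j hj hij =>
      hg i (by simp [hi]) j (by simp [hj]) m (by simp) hij (hne i hi) (hne j hj)
    have hS : ∀ i ∈ S, f i * ∏ l ∈ (insert m S).erase i, (1 + t * g i l)
        = f i * ∏ l ∈ S.erase i, (1 + t * g i l)
          + t * (f m * (f i * ∏ l ∈ S.erase i, (1 + t * g i l)))
          - t * (f m * (g m i * ∏ l ∈ S.erase i, (1 + t * g i l))) := by
      intro i hi
      rw [erase_insert_of_ne (hne i hi), prod_insert
        (fun h => hm (mem_of_mem_erase h)),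
        hanti i (by simp [hi]) m (by simp) (hne i hi).symm]
      grind
    rw [prod_insert hm, sum_insert hm, erase_insert hm, ihg,
      sum_congr rfl hS, sum_sub_distrib, sum_add_distrib, ← mul_sum,
      ← mul_sum, ← mul_sum, ← mul_sum, ihf]
    ring

end PartialFractions

/-! ### The Taylor shift `exp (t ∂)` -/

section TaylorShift

variable {B : Type*} [CommRing B] [Algebra ℂ B]

/-- The Taylor coefficients of `exp (t ∂)`. -/
def taylorCoeff (d : Derivation ℂ B B) (n : ℕ) (f : B) : B :=
  ((n.factorial : ℂ)⁻¹) • (d^[n]) f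

theorem taylorCoeff_zero (d : Derivation ℂ B B) (f : B) : taylorCoeff d 0 f = f := by
  simp [taylorCoeff]

theorem deriv_taylorCoeff (d : Derivation ℂ B B) (n : ℕ) (f : B) :
    d (taylorCoeff d n f) = ((n : ℂ) + 1) • taylorCoeff d (n + 1) f := by
  unfold taylorCoeff
  rw [Derivation.map_smul, Function.iterate_succ_apply', smul_smul, Nat.factorial_succ]
  grind [Nat.cast_add_one_ne_zero, Nat.cast_ne_zero]

theorem taylorCoeff_mul (d : Derivation ℂ B B) (n : ℕ) (f g : B) :
    taylorCoeff d n (f * g)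
      = ∑ p ∈ antidiagonal n, taylorCoeff d p.1 f * taylorCoeff d p.2 g := by
  induction n with
  | zero => simp [taylorCoeff_zero]
  | succ n ih =>
    have h1 : ((n : ℂ) + 1) ≠ 0 := Nat.cast_add_one_ne_zero n
    have hinj : Injective fun y : B => ((n : ℂ) + 1) • y :=
      fun a b hab => by simp_all
    apply hinj
    change ((n : ℂ) + 1) • _ = ((n : ℂ) + 1) • _
    rw [← deriv_taylorCoeff, ih, map_sum]
    simp only [Derivation.leibniz, deriv_taylorCoeff, smul_eq_mul]
    rw [smul_sum]
    have h2 : ∀ p ∈ antidiagonal (n + 1),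
        ((n : ℂ) + 1) • (taylorCoeff d p.1 f * taylorCoeff d p.2 g)
        = (p.1 : ℂ) • (taylorCoeff d p.1 f * taylorCoeff d p.2 g)
          + (p.2 : ℂ) • (taylorCoeff d p.1 f * taylorCoeff d p.2 g) := by
      intro p hp
      rw [← add_smul]
      congr 1
      have := mem_antidiagonal.1 hp
      exact_mod_cast this.symm
    have h3 : ∑ p ∈ antidiagonal (n + 1),
        (p.1 : ℂ) • (taylorCoeff d p.1 f * taylorCoeff d p.2 g)
        = ∑ p ∈ antidiagonal n,
          taylorCoeff d p.2 g * ((p.1 : ℂ) + 1) • taylorCoeff d (p.1 + 1) f := by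
      rw [Finset.Nat.sum_antidiagonal_succ, Nat.cast_zero, zero_smul, zero_add]
      refine sum_congr rfl fun p _ => ?_
      simp [mul_comm]
    have h4 : ∑ p ∈ antidiagonal (n + 1),
        (p.2 : ℂ) • (taylorCoeff d p.1 f * taylorCoeff d p.2 g)
        = ∑ p ∈ antidiagonal n,
          taylorCoeff d p.1 f * ((p.2 : ℂ) + 1) • taylorCoeff d (p.2 + 1) g := by
      rw [Finset.Nat.sum_antidiagonal_succ', Nat.cast_zero, zero_smul, zero_add]
      simp
    rw [sum_congr rfl h2, sum_add_distrib, sum_add_distrib, h3, h4, add_comm]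

/-- The Taylor shift as a power series. -/
def taylorSeries (d : Derivation ℂ B B) (f : B) : PowerSeries B :=
  PowerSeries.mk fun n => taylorCoeff d n f

/-- By Leibniz' rule in divided form the shift is multiplicative, so all derivatives of a product of
linear factors are obtained at once. -/
theorem taylorSeries_mul (d : Derivation ℂ B B) (f g : B) :
    taylorSeries d (f * g) = taylorSeries d f * taylorSeries d g := by
  ext n
  simp [taylorSeries, PowerSeries.coeff_mk, taylorCoeff_mul, PowerSeries.coeff_mul]

theorem taylorSeries_linear (d : Derivation ℂ B B) {f c : B} (hf : d f = c) (hc : d c = 0) :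
    taylorSeries d f = PowerSeries.C f + PowerSeries.C c * PowerSeries.X := by
  have h0 : ∀ n, d^[n + 2] f = 0 := by simp_all
  ext n
  rw [taylorSeries, PowerSeries.coeff_mk, map_add, PowerSeries.coeff_C, PowerSeries.coeff_C_mul,
    PowerSeries.coeff_X]
  match n with
  | 0 => simp [taylorCoeff_zero]
  | 1 => simp [taylorCoeff, hf]
  | n + 2 => simp [taylorCoeff, h0 n, -Function.iterate_succ]

theorem taylorSeries_one (d : Derivation ℂ B B) : taylorSeries d 1 = 1 := by
  simp [taylorSeries_linear]

theorem taylorSeries_prod {ι : Type*} (d : Derivation ℂ B B) (s : Finset ι) (f : ι → B) :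
    taylorSeries d (∏ i ∈ s, f i) = ∏ i ∈ s, taylorSeries d (f i) := by
  classical
  induction s using Finset.induction_on with
  | empty => simpa using taylorSeries_one d
  | insert a s ha ih => simp_all [prod_insert, taylorSeries_mul]

end TaylorShift

/-! ### Derivatives of the Vandermonde product -/

section Vandermonde

open MvPowerSeries

variable {H : ℕ}

theorem vdmSeries_ne_zero (n : ℕ) (h : Fin H) : vdmSeries n h ≠ 0 := by
  grind [vdmSeries, prod_ne_zero_iff, MvPowerSeries.X_inj, sub_eq_zero, Prod.mk.inj]

/-- The product runs over unordered pairs, but only the pairs containing `i` contribute; these are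
indexed by the other member of the pair. -/
theorem prod_pairs_eq {R : Type*} [CommRing R] {n i : ℕ} (hi : i < n) (φ : ℕ → ℕ → R)
    (h : ∀ a b, a ≠ i → b ≠ i → φ a b = 1) (ψ : ℕ → R) (h1 : ∀ b, b < i → φ i b = ψ b)
    (h2 : ∀ a, i < a → φ a i = ψ a) :
    ∏ a ∈ range n, ∏ b ∈ range a, φ a b = ∏ l ∈ (range n).erase i, ψ l := by
  have hin : ∀ a, a ≠ i → ∏ b ∈ range a, φ a b = if i < a then ψ a else 1 := by
    intro a ha
    split_ifs with hia
    · rw [prod_eq_single i (fun b _ hb => h a b ha hb) (by simp [hia]), h2 a hia]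
    grind [prod_eq_one]
  rw [← mul_prod_erase _ _ (mem_range.2 hi),
    prod_congr rfl fun a ha => hin a (mem_erase.1 ha).1, ← prod_filter]
  rw [prod_congr rfl fun b hb => h1 b (mem_range.1 hb)]
  rw [← prod_filter_mul_prod_filter_not ((range n).erase i) (fun l => i < l),
    mul_comm]
  congr 1
  refine prod_congr ?_ fun _ _ => rfl
  grind

/-- The geometric series `u / (1 - x u)`. -/
def geomSeries {R : Type*} [CommRing R] (x : R) : PowerSeries R :=
  PowerSeries.X * PowerSeries.mk fun n => x ^ n

theorem geomSeries_mul {R : Type*} [CommRing R] (x : R) :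
    geomSeries x * (1 - PowerSeries.C x * PowerSeries.X) = PowerSeries.X := by
  unfold geomSeries
  have : (PowerSeries.mk fun n => x ^ n) * (1 - PowerSeries.C x * PowerSeries.X) = 1 := by
    ext n
    rw [mul_sub, mul_one, ← mul_assoc, map_sub]
    cases n with
    | zero => simp
    | succ n =>
      rw [PowerSeries.coeff_succ_mul_X, mul_comm, PowerSeries.coeff_C_mul]
      simp [PowerSeries.coeff_one, pow_succ']
  rw [mul_assoc, this, mul_one]

theorem geomSeries_mul_geomSeries {K : Type*} [Field K] {x y : K} (hxy : x ≠ y) :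
    geomSeries x * geomSeries y
      = PowerSeries.C (x - y)⁻¹ * (geomSeries x - geomSeries y) := by
  have hx := geomSeries_mul x
  have hy := geomSeries_mul y
  have h0 : (1 - PowerSeries.C x * PowerSeries.X : PowerSeries K) ≠ 0 := by
    intro h
    have := congrArg (PowerSeries.coeff 0) h
    simp at this
  have h1 : (1 - PowerSeries.C y * PowerSeries.X : PowerSeries K) ≠ 0 := by grind
  have hc : PowerSeries.C (x - y)⁻¹ * (PowerSeries.C x - PowerSeries.C y) = 1 := by
    rw [← map_sub, ← map_mul, inv_mul_cancel₀ (sub_ne_zero.2 hxy), map_one]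
  grind

/-- The elementary symmetric functions, from their generating function. -/
def esymmGen {ι R : Type*} [CommRing R] (S : Finset ι) (f : ι → R) (m : ℕ) : R :=
  PowerSeries.coeff m (∏ l ∈ S, (1 + PowerSeries.X * PowerSeries.C (f l)))

theorem map_esymmGen {ι R R' : Type*} [CommRing R] [CommRing R'] (φ : R →+* R') (S : Finset ι)
    (f : ι → R) (m : ℕ) : φ (esymmGen S f m) = esymmGen S (fun l => φ (f l)) m := by
  unfold esymmGen
  rw [← PowerSeries.coeff_map, map_prod]
  simp

theorem map_geomSeries {R R' : Type*} [CommRing R] [CommRing R'] (φ : R →+* R') (x : R) :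
    PowerSeries.map φ (geomSeries x) = geomSeries (φ x) := by
  unfold geomSeries
  rw [map_mul, PowerSeries.map_X]
  congr 1
  ext n
  simp

theorem inv_sub_mul_inv_sub {K : Type*} [Field K] {a b c : K} (h1 : c - a ≠ 0) (h2 : c - b ≠ 0)
    (h3 : a - b ≠ 0) :
    (c - a)⁻¹ * (c - b)⁻¹ = (a - b)⁻¹ * ((c - a)⁻¹ - (c - b)⁻¹) := by grind

/-- Shifting `x_i` by `t` changes only the factors that contain `x_i`: `V(x_i + t) / V = ∏_{l ≠ i}
(1 + t / (x_i - x_l))`. The embedding `φ` into a field makes the quotients meaningful. -/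
theorem vdmSeries_taylor {K : Type*} [Field K] (φ : MvPowerSeries (Fin H × ℕ) ℂ →+* K)
    (hφ : Injective φ) {n i : ℕ} (hi : i < n) (h : Fin H) :
    PowerSeries.map φ (taylorSeries (pderiv ℂ (h, i)) (vdmSeries n h))
      = PowerSeries.C (φ (vdmSeries n h)) * ∏ l ∈ (range n).erase i,
        (1 + PowerSeries.X * PowerSeries.C (φ (X (h, i)) - φ (X (h, l)))⁻¹) := by
  let c : ℕ → ℕ → ℂ := fun a b => (if b = i then 1 else 0) - (if a = i then 1 else 0)
  have hlin : ∀ a b, taylorSeries (pderiv ℂ (h, i))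
      (X (h, b) - X (h, a) : MvPowerSeries (Fin H × ℕ) ℂ)
      = PowerSeries.C (X (h, b) - X (h, a)) + PowerSeries.C (C (c a b)) * PowerSeries.X := by
    intro a b
    refine taylorSeries_linear _ ?_ ?_
    · aesop
    · simp
  have hne : ∀ a b, a ≠ b → φ (X (h, b)) - φ (X (h, a)) ≠ 0 := by
    intro a b hab h0
    have h1 := MvPowerSeries.X_inj.1 (hφ (sub_eq_zero.1 h0))
    grind
  let θ : ℕ → ℕ → PowerSeries K := fun a b =>
    1 + PowerSeries.X * PowerSeries.C (φ (C (c a b)) * (φ (X (h, b)) - φ (X (h, a)))⁻¹)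
  have hmap : PowerSeries.map φ (taylorSeries (pderiv ℂ (h, i)) (vdmSeries n h))
      = PowerSeries.C (φ (vdmSeries n h)) *
        ∏ a ∈ range n, ∏ b ∈ range a, θ a b := by
    unfold vdmSeries
    rw [taylorSeries_prod, map_prod, map_prod, map_prod, ← prod_mul_distrib]
    refine prod_congr rfl fun a _ => ?_
    rw [taylorSeries_prod, map_prod, map_prod, map_prod, ← prod_mul_distrib]
    refine prod_congr rfl fun b hb => ?_
    have hab : a ≠ b := by have := mem_range.1 hb; omega
    rw [hlin]
    simp only [map_add, map_mul, map_sub, PowerSeries.map_C, PowerSeries.map_X, θ]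
    grind
  rw [hmap, prod_pairs_eq hi θ (ψ := fun l =>
    1 + PowerSeries.X * PowerSeries.C (φ (X (h, i)) - φ (X (h, l)))⁻¹)]
  · grind
  · grind
  grind

/-- The derivatives of the Vandermonde product in terms of elementary symmetric functions. -/
theorem vdmSeries_mul_esymmGen (n : ℕ) (h : Fin H) (j : ℕ) :
    PowerSeries.C (vdmSeries n h) *
        esymmGen (range n)
          (fun l => geomSeries (X (h, l) : MvPowerSeries (Fin H × ℕ) ℂ)) (j + 1)
      = ∑ i ∈ range n, geomSeries (X (h, i) : MvPowerSeries (Fin H × ℕ) ℂ) *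
        PowerSeries.C (taylorCoeff (pderiv ℂ (h, i)) j (vdmSeries n h)) := by
  -- Differences of variables have to be inverted, so the identity is proved in the fraction field
  -- and pulled back by injectivity.
  let K := FractionRing (MvPowerSeries (Fin H × ℕ) ℂ)
  let φ : MvPowerSeries (Fin H × ℕ) ℂ →+* K := algebraMap _ _
  have hφ : Injective φ := IsFractionRing.injective _ _
  apply PowerSeries.map_injective φ hφ
  rw [map_mul, map_sum, map_esymmGen]
  simp only [map_mul, PowerSeries.map_C, map_geomSeries]
  let x : ℕ → K := fun l => φ (X (h, l))
  have hx : ∀ a b, a ≠ b → x a ≠ x b := by grind [Prod.mk.inj, MvPowerSeries.X_inj]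
  let g : ℕ → ℕ → PowerSeries (PowerSeries K) := fun i l =>
    PowerSeries.C (PowerSeries.C (x i - x l)⁻¹)
  -- Partial fractions for `f_l = u / (1 - x_l u)` and `g_{il} = 1 / (x_i - x_l)`. Both hypotheses
  -- are the identity for a product of two simple fractions.
  have hpf := prod_one_add_mul_eq g PowerSeries.X (range n)
    (fun i _ j _ hij => by
      simp only [g]
      rw [← map_neg, ← map_neg, ← inv_neg, neg_sub])
    (fun i _ j _ m _ hij hmi hmj => by
      simp only [g]
      have h1 := sub_ne_zero.2 (hx m i hmi)
      have h2 := sub_ne_zero.2 (hx m j hmj)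
      have h3 := sub_ne_zero.2 (hx i j hij)
      have h4 : (x m - x i)⁻¹ * (x m - x j)⁻¹
          = (x i - x j)⁻¹ * ((x m - x i)⁻¹ - (x m - x j)⁻¹) := inv_sub_mul_inv_sub h1 h2 h3
      have h5 := congrArg (fun t => (PowerSeries.C (PowerSeries.C t) :
        PowerSeries (PowerSeries K))) h4
      simpa only [map_mul, map_sub] using h5)
    (fun l => PowerSeries.C (geomSeries (x l)))
    (fun i _ j _ hij => by
      simp only [g]
      rw [← map_mul, geomSeries_mul_geomSeries (hx i j hij), map_mul, map_sub])
  have hcoef := congrArg (PowerSeries.coeff (j + 1)) hpf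
  -- The coefficient of `t^j` in `V ∏_{l ≠ i} (1 + t / (x_i - x_l))` is the `j`-th Taylor
  -- coefficient of `V` in `x_i`. The shift from `j` to `j + 1` in the claim comes from the factor
  -- `t` in front of the partial fraction sum.
  have hV : ∀ i ∈ range n, PowerSeries.C (φ (vdmSeries n h)) *
      PowerSeries.coeff j (∏ l ∈ (range n).erase i, (1 + PowerSeries.X * g i l))
      = PowerSeries.C (φ (taylorCoeff (pderiv ℂ (h, i)) j (vdmSeries n h))) := by
    intro i hi
    have h1 := vdmSeries_taylor φ hφ (mem_range.1 hi) h
    have h2 := congrArg (PowerSeries.map (PowerSeries.C (R := K))) h1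
    rw [map_mul, map_prod] at h2
    simp only [map_add, map_one, map_mul, PowerSeries.map_C, PowerSeries.map_X] at h2
    have h3 := congrArg (PowerSeries.coeff j) h2
    rw [PowerSeries.coeff_C_mul, PowerSeries.coeff_map, PowerSeries.coeff_map, taylorSeries,
      PowerSeries.coeff_mk] at h3
    exact h3.symm
  unfold esymmGen
  rw [hcoef, map_add, PowerSeries.coeff_one, if_neg (Nat.succ_ne_zero j), zero_add,
    PowerSeries.coeff_succ_X_mul, map_sum, mul_sum]
  refine sum_congr rfl fun i hi => ?_
  rw [PowerSeries.coeff_C_mul, ← hV i hi]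
  ring

end Vandermonde

end

section

open Finset

/-! ### Calculus modulo terms of high degree -/

section OrderBound

open MvPowerSeries

variable {J : Type} [DecidableEq J]

/-- All coefficients of degree less than `n` vanish. -/
def OrdGE (n : ℤ) (f : MvPowerSeries J ℂ) : Prop := ∀ α : J →₀ ℕ, (α.degree : ℤ) < n → coeff α f = 0

theorem OrdGE.mono {n m : ℤ} (h : m ≤ n) {f : MvPowerSeries J ℂ} (hf : OrdGE n f) : OrdGE m f :=
  fun α hα => hf α (hα.trans_le h)

theorem ordGE_zero (n : ℤ) : OrdGE n (0 : MvPowerSeries J ℂ) := fun α _ => by simp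

theorem ordGE_of_nonpos {n : ℤ} (hn : n ≤ 0) (f : MvPowerSeries J ℂ) : OrdGE n f :=
  fun α hα => by omega

theorem OrdGE.add {n : ℤ} {f g : MvPowerSeries J ℂ} (hf : OrdGE n f) (hg : OrdGE n g) :
    OrdGE n (f + g) := fun α hα => by rw [map_add, hf α hα, hg α hα, add_zero]

theorem OrdGE.smul {n : ℤ} {f : MvPowerSeries J ℂ} (hf : OrdGE n f) (c : ℂ) : OrdGE n (c • f) :=
  fun α hα => by aesop

theorem OrdGE.sum {ι : Type*} {n : ℤ} (s : Finset ι) {f : ι → MvPowerSeries J ℂ}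
    (hf : ∀ i ∈ s, OrdGE n (f i)) : OrdGE n (∑ i ∈ s, f i) :=
  fun α hα => by rw [map_sum]; exact sum_eq_zero fun i hi => hf i hi α hα

theorem OrdGE.mul {n m : ℤ} {f g : MvPowerSeries J ℂ} (hf : OrdGE n f) (hg : OrdGE m g) :
    OrdGE (n + m) (f * g) := by
  intro α hα
  rw [coeff_mul]
  refine sum_eq_zero fun p hp => ?_
  have h1 : p.1 + p.2 = α := mem_antidiagonal.1 hp
  have h2 : (p.1.degree : ℤ) + p.2.degree = α.degree := by grind
  by_cases h3 : (p.1.degree : ℤ) < n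
  · rw [hf _ h3, zero_mul]
  · rw [hg _ (by omega), mul_zero]

theorem OrdGE.mul_left {n : ℤ} {f : MvPowerSeries J ℂ} (hf : OrdGE n f) (g : MvPowerSeries J ℂ) :
    OrdGE n (g * f) := by
  have := (ordGE_of_nonpos le_rfl g).mul hf
  rwa [zero_add] at this

theorem OrdGE.mul_right {n : ℤ} {f : MvPowerSeries J ℂ} (hf : OrdGE n f) (g : MvPowerSeries J ℂ) :
    OrdGE n (f * g) := by
  rw [mul_comm]; exact hf.mul_left g

theorem OrdGE.pderiv {n : ℤ} {f : MvPowerSeries J ℂ} (hf : OrdGE n f) (j : J) :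
    OrdGE (n - 1) (pderiv ℂ j f) := by
  intro α hα
  rw [coeff_pderiv, hf, zero_mul]
  rw [map_add, Finsupp.degree_single]
  push_cast
  omega

theorem OrdGE.iterate_pderiv {n : ℤ} {f : MvPowerSeries J ℂ} (hf : OrdGE n f) (j : J) (k : ℕ) :
    OrdGE (n - k) ((MvPowerSeries.pderiv ℂ j)^[k] f) := by
  induction k with
  | zero => simpa using hf
  | succ k ih =>
    rw [Function.iterate_succ_apply']
    have := ih.pderiv j
    grind

theorem ordGE_order {f : MvPowerSeries J ℂ} (hf : f ≠ 0) : OrdGE f.order.toNat f := by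
  intro α hα
  refine coeff_of_lt_order ?_
  have h1 : f.order ≠ ⊤ := fun h => hf (order_eq_top_iff.1 h)
  rw [← ENat.natCast_toNat h1]
  exact_mod_cast hα

/-- Orders of power series over a field are additive. This replaces division by the Vandermonde
product: whatever degree the factor `V` contributes is recovered exactly when `V` is cancelled. -/
theorem OrdGE.of_mul {V f : MvPowerSeries J ℂ} (hV : V ≠ 0) {n : ℤ}
    (h : OrdGE (V.order.toNat + n) (V * f)) : OrdGE n f := by
  intro α hα
  refine coeff_of_lt_order ?_
  have h1 : V.order ≠ ⊤ := fun h => hV (order_eq_top_iff.1 h)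
  have h2 : (((V.order.toNat : ℤ) + n).toNat : ℕ∞) ≤ (V * f).order :=
    le_order fun β hβ => h β (by simp_all)
  rw [order_mul, ← ENat.natCast_toNat h1] at h2
  by_contra hcon
  rw [not_lt] at hcon
  have h3 : (((V.order.toNat : ℤ) + n).toNat : ℕ∞) ≤ ((V.order.toNat + α.degree : ℕ) : ℕ∞) := by
    refine h2.trans ?_
    simp_all
  have h4 : ((V.order.toNat : ℤ) + n).toNat ≤ V.order.toNat + α.degree := by exact_mod_cast h3
  omega

theorem OrdGE.restr {n : ℤ} {f : MvPowerSeries J ℂ} (hf : OrdGE n f) (p : J → Prop)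
    [DecidablePred p] : OrdGE n (restr p f) := by
  intro α hα
  unfold _root_.restr
  aesop

end OrderBound

/-! ### Newton's identities for generating functions -/

section Newton

variable {R : Type*} [CommRing R]

/-- Compares coefficients in the logarithmic derivative of `∏ (1 + t f_l)`, where `q a` is the
expansion of `a / (1 + t a)`. -/
theorem newton_esymmGen {ι : Type*} (S : Finset ι) (f : ι → R) (j : ℕ) :
    ((j : R) + 1) * esymmGen S f (j + 1)
      = ∑ m ∈ range (j + 1), (-1) ^ m * esymmGen S f (j - m) * ∑ l ∈ S, f l ^ (m + 1) := by
  classical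
  let q : R → PowerSeries R := fun a => PowerSeries.mk fun m => (-1) ^ m * a ^ (m + 1)
  have hq : ∀ a : R, (1 + PowerSeries.X * PowerSeries.C a) * q a = PowerSeries.C a := by
    intro a
    ext n
    rw [add_mul, one_mul, map_add, mul_assoc]
    cases n with
    | zero => simp [q]
    | succ n =>
      rw [PowerSeries.coeff_succ_X_mul, PowerSeries.coeff_C_mul]
      simp only [q, PowerSeries.coeff_mk, PowerSeries.coeff_C, if_neg (Nat.succ_ne_zero n)]
      ring
  have key : PowerSeries.derivative R (∏ l ∈ S, (1 + PowerSeries.X * PowerSeries.C (f l)))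
      = (∏ l ∈ S, (1 + PowerSeries.X * PowerSeries.C (f l))) * ∑ l ∈ S, q (f l) := by
    induction S using Finset.induction_on with
    | empty => simp
    | insert a S ha ih =>
      rw [prod_insert ha, sum_insert ha, Derivation.leibniz, ih]
      have h1 : PowerSeries.derivative R (1 + PowerSeries.X * PowerSeries.C (f a))
          = PowerSeries.C (f a) := by simp
      grind [smul_eq_mul, PowerSeries.X, PowerSeries.C]
  have h := congrArg (PowerSeries.coeff j) key
  rw [PowerSeries.coeff_derivative, PowerSeries.coeff_mul] at h
  unfold esymmGen
  rw [mul_comm, h, Finset.Nat.sum_antidiagonal_eq_sum_range_succ_mk, ← sum_range_reflect]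
  refine sum_congr rfl fun m hm => ?_
  grind [Nat.lt_succ_iff, Nat.sub_sub_self, map_sum, PowerSeries.coeff_mk, mul_sum]

theorem geomSeries_pow (x : R) (m : ℕ) :
    geomSeries x ^ (m + 1) = PowerSeries.X ^ (m + 1) *
      PowerSeries.mk fun n => ((m + n).choose m : R) * x ^ n := by
  unfold geomSeries
  rw [mul_pow]
  congr 1
  have h1 : (PowerSeries.mk fun n => x ^ n) = PowerSeries.rescale x (PowerSeries.mk (1 : ℕ → R)) := by
    aesop
  rw [h1, ← map_pow, PowerSeries.mk_one_pow_eq_mk_choose_add]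
  ext n
  simp [PowerSeries.coeff_rescale, mul_comm]

end Newton

end

section

open Finset
open LinearMap (mulLeft mulLeft_apply)
open scoped Polynomial

/-! ### Differential operators acting on polynomials in formal power sums -/

section PowerSumRing

variable {H : ℕ}

/-- The ring of polynomials in formal power sums; the variable `(h, a)` stands for the power sum of
exponent `a + 1` of the variables of the group `h`. -/
abbrev PSRing (H : ℕ) : Type := MvPolynomial (Fin H × ℕ) ℂ

/-- The realization of formal power sums in finitely many variables. -/
def realize (ν : Fin H → ℕ) : PSRing H →ₐ[ℂ] MvPowerSeries (Fin H × ℕ) ℂ :=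
  MvPolynomial.aeval fun p => ∑ i ∈ range (ν p.1), MvPowerSeries.X (p.1, i) ^ (p.2 + 1)

/-- The realization of polynomials in `z` over formal power sums, `z` being a given variable. -/
def realizeAt (ν : Fin H → ℕ) (j : Fin H × ℕ) :
    (PSRing H)[X] →+* MvPowerSeries (Fin H × ℕ) ℂ :=
  Polynomial.eval₂RingHom (realize ν).toRingHom (MvPowerSeries.X j)

theorem realizeAt_monomial (ν : Fin H → ℕ) (j : Fin H × ℕ) (b : ℕ) (a : PSRing H) :
    realizeAt ν j (Polynomial.monomial b a) = realize ν a * MvPowerSeries.X j ^ b := by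
  simp [realizeAt]

theorem realizeAt_smul (ν : Fin H → ℕ) (j : Fin H × ℕ) (c : ℂ) (y : (PSRing H)[X]) :
    realizeAt ν j (c • y) = c • realizeAt ν j y := by
  induction y using Polynomial.induction_on' with
  | add p q hp hq => simp_all
  | monomial b a =>
    rw [Polynomial.smul_monomial, realizeAt_monomial, realizeAt_monomial, map_smul, smul_mul_assoc]

/-- Normalized power sums. -/
def phat (h : Fin H) (η : ℂ) : ℕ → PSRing H
  | 0 => 1
  | c + 1 => η • MvPolynomial.X (h, c)

theorem realize_phat {ν : Fin H → ℕ} {h : Fin H} {η : ℂ} (hη : η * ν h = 1) (n : ℕ) :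
    realize ν (phat h η n) = η • ∑ i ∈ range (ν h), MvPowerSeries.X (h, i) ^ n := by
  cases n with
  | zero =>
    simp only [phat, map_one, pow_zero, sum_const, card_range]
    rw [← Nat.cast_smul_eq_nsmul ℂ, smul_smul, hη, one_smul]
  | succ c => simp [phat, map_smul, realize]

/-- The power sums of the geometric series `u / (1 - x_l u)`. -/
def powGen (h : Fin H) (η : ℂ) (m : ℕ) : PowerSeries (PSRing H) :=
  PowerSeries.X ^ (m + 1) *
    PowerSeries.mk fun n => ((m + n).choose m : PSRing H) * phat h η n

/-- The elementary symmetric functions of the geometric series `u / (1 - x_l u)`. -/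
def elemGen (h : Fin H) (η : ℂ) : ℕ → PowerSeries (PSRing H)
  | 0 => 1
  | j + 1 => ∑ m : Fin (j + 1),
      (((j : ℂ) + 1)⁻¹ * (-η) ^ (m : ℕ)) • (elemGen h η (j - m) * powGen h η m)
  decreasing_by omega

theorem realize_powGen {ν : Fin H → ℕ} {h : Fin H} {η : ℂ} (hη : η * ν h = 1) (m : ℕ) :
    PowerSeries.map (realize ν).toRingHom (powGen h η m)
      = η • ∑ l ∈ range (ν h),
        geomSeries (MvPowerSeries.X (h, l) : MvPowerSeries (Fin H × ℕ) ℂ) ^ (m + 1) := by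
  unfold powGen
  simp only [geomSeries_pow]
  rw [← mul_sum, map_mul, map_pow, PowerSeries.map_X, ← mul_smul_comm]
  congr 1
  ext1 n
  rw [PowerSeries.coeff_map, PowerSeries.coeff_mk]
  have : (realize ν).toRingHom (((m + n).choose m : PSRing H) * phat h η n)
      = ((m + n).choose m : MvPowerSeries (Fin H × ℕ) ℂ) * realize ν (phat h η n) := by simp
  rw [this, realize_phat hη, PowerSeries.coeff_smul, map_sum, mul_smul_comm, mul_sum]
  simp

/-- Newton's recursion with each quantity scaled by its size: elementary symmetric functions of
degree `j` in `n` variables are of order `n^j`, power sums of order `n`. In the product `e_{j-m}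
p_{m+1}` the surplus `η^m` remains; hence only `m = 0` matters in the limit. -/
theorem realize_elemGen {ν : Fin H → ℕ} {h : Fin H} {η : ℂ} (hη : η * ν h = 1) (j : ℕ) :
    PowerSeries.map (realize ν).toRingHom (elemGen h η j)
      = η ^ j • esymmGen (range (ν h))
        (fun l => geomSeries (MvPowerSeries.X (h, l) : MvPowerSeries (Fin H × ℕ) ℂ)) j := by
  induction j using Nat.strong_induction_on with
  | _ j ih =>
    cases j with
    | zero => simp [elemGen, esymmGen]
    | succ j =>
      have hsm : ∀ (c : ℂ) (f : PowerSeries (PSRing H)),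
          PowerSeries.map (realize ν).toRingHom (c • f)
            = c • PowerSeries.map (realize ν).toRingHom f := by
        intro c f
        ext1 n
        simp
      have hj : ((j : ℂ) + 1) ≠ 0 := Nat.cast_add_one_ne_zero j
      have hN := newton_esymmGen (range (ν h))
        (fun l => geomSeries (MvPowerSeries.X (h, l) : MvPowerSeries (Fin H × ℕ) ℂ)) j
      rw [elemGen, map_sum]
      have hterm : ∀ m : Fin (j + 1), PowerSeries.map (realize ν).toRingHom
          ((((j : ℂ) + 1)⁻¹ * (-η) ^ (m : ℕ)) • (elemGen h η (j - m) * powGen h η m))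
          = (((j : ℂ) + 1)⁻¹ * η ^ (j + 1)) • ((-1) ^ (m : ℕ) *
            esymmGen (range (ν h))
              (fun l => geomSeries (MvPowerSeries.X (h, l) : MvPowerSeries (Fin H × ℕ) ℂ)) (j - m) *
            ∑ l ∈ range (ν h),
              geomSeries (MvPowerSeries.X (h, l) : MvPowerSeries (Fin H × ℕ) ℂ) ^ ((m : ℕ) + 1)) := by
        intro m
        have hm := m.2
        rw [hsm, map_mul, ih _ (by omega), realize_powGen hη, smul_mul_smul_comm, smul_smul]
        have e : ((j : ℂ) + 1)⁻¹ * (-η) ^ (m : ℕ) * (η ^ (j - (m : ℕ)) * η)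
            = ((j : ℂ) + 1)⁻¹ * η ^ (j + 1) * (-1) ^ (m : ℕ) := by
          have : η ^ (j + 1) = η ^ (m : ℕ) * (η ^ (j - (m : ℕ)) * η) := by
            rw [← pow_succ, ← pow_add]; congr 1; omega
          rw [this, neg_pow]; ring
        rw [e, mul_smul]
        congr 1
        have h2 : ((-1 : ℂ) ^ (m : ℕ)) • (1 : PowerSeries (MvPowerSeries (Fin H × ℕ) ℂ))
            = (-1) ^ (m : ℕ) := by
          rcases neg_one_pow_eq_or ℂ (m : ℕ) with h3 | h3 <;>
            rcases Nat.even_or_odd (m : ℕ) with h4 | h4 <;>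
            simp [h4.neg_one_pow]
        rw [mul_assoc, ← h2, smul_mul_assoc, one_mul]
      rw [sum_congr rfl fun m _ => hterm m, ← smul_sum,
        ← sum_range (fun m => (-1) ^ m *
            esymmGen (range (ν h))
              (fun l => geomSeries (MvPowerSeries.X (h, l) : MvPowerSeries (Fin H × ℕ) ℂ)) (j - m) *
            ∑ l ∈ range (ν h),
              geomSeries (MvPowerSeries.X (h, l) : MvPowerSeries (Fin H × ℕ) ℂ) ^ (m + 1)), ← hN]
      have h5 : ((j : PowerSeries (MvPowerSeries (Fin H × ℕ) ℂ)) + 1)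
          = ((j : ℂ) + 1) • (1 : PowerSeries (MvPowerSeries (Fin H × ℕ) ℂ)) := by
        rw [add_smul, one_smul, Nat.cast_smul_eq_nsmul, nsmul_eq_mul, mul_one]
      rw [h5, smul_mul_assoc, one_mul, smul_smul]
      congr 1
      field_simp

/-- The derivation `P(h', a) ↦ δ_{h h'} (a + 1) z^a`. -/
def deltaDer (h : Fin H) : Derivation ℂ (PSRing H) (PSRing H)[X] :=
  MvPolynomial.mkDerivation ℂ fun p =>
    if p.1 = h then Polynomial.monomial p.2 ((p.2 : PSRing H) + 1) else 0

/-- The extension of `deltaDer` to polynomials in `z`, killing `z`. -/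
def deltaPoly (h : Fin H) : (PSRing H)[X] →ₗ[ℂ] (PSRing H)[X] :=
  Polynomial.lsum fun b =>
    (LinearMap.mulRight ℂ (Polynomial.X ^ b)) ∘ₗ (deltaDer h).toLinearMap

/-- The total derivative along one of the variables of the group `h`. -/
def totalDer (h : Fin H) : (PSRing H)[X] →ₗ[ℂ] (PSRing H)[X] :=
  Polynomial.derivative.restrictScalars ℂ + deltaPoly h

theorem deltaPoly_monomial (h : Fin H) (b : ℕ) (a : PSRing H) :
    deltaPoly h (Polynomial.monomial b a) = deltaDer h a * Polynomial.X ^ b := by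
  simp [deltaPoly, Polynomial.lsum_apply, Polynomial.sum_monomial_index]

/-- The chain rule: `∂_i` of the power sum of exponent `a + 1` is `(a + 1) X_i^a`, with `z` standing
for `X_i`. The same element of the ring thus describes the derivative along any variable of the
group. -/
theorem pderiv_realize {ν : Fin H → ℕ} {h : Fin H} {i : ℕ} (hi : i < ν h) (a : PSRing H) :
    MvPowerSeries.pderiv ℂ (h, i) (realize ν a) = realizeAt ν (h, i) (deltaDer h a) := by
  induction a using MvPolynomial.induction_on with
  | C c => simp
  | add p q hp hq => grind
  | mul_X p j hp =>
    rw [map_mul, Derivation.leibniz, Derivation.leibniz, hp, map_add]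
    have hX : realize ν (MvPolynomial.X j)
        = ∑ i ∈ range (ν j.1), MvPowerSeries.X (j.1, i) ^ (j.2 + 1) := by
      simp [realize]
    have hsm : ∀ (a : PSRing H) (y : (PSRing H)[X]),
        realizeAt ν (h, i) (a • y) = realize ν a * realizeAt ν (h, i) y := by
      simp [Polynomial.smul_eq_C_mul, map_mul, realizeAt]
    rw [hsm, hsm, smul_eq_mul, smul_eq_mul]
    congr 2
    rw [hX, deltaDer, MvPolynomial.mkDerivation_X, map_sum]
    simp only [MvPowerSeries.pderiv_pow, MvPowerSeries.pderiv_X]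
    by_cases hj : j.1 = h
    · obtain ⟨j1, j2⟩ := j
      simp only at hj
      subst hj
      rw [if_pos rfl, sum_eq_single i]
      · simp [realizeAt_monomial]
        ring
      · grind
      grind
    simp_all

theorem pderiv_realizeAt {ν : Fin H → ℕ} {h : Fin H} {i : ℕ} (hi : i < ν h)
    (y : (PSRing H)[X]) :
    MvPowerSeries.pderiv ℂ (h, i) (realizeAt ν (h, i) y) = realizeAt ν (h, i) (totalDer h y) := by
  induction y using Polynomial.induction_on' with
  | add p q hp hq => grind
  | monomial b a =>
    rw [realizeAt_monomial, Derivation.leibniz, pderiv_realize hi, MvPowerSeries.pderiv_pow,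
      MvPowerSeries.pderiv_X, Pi.single_eq_same, totalDer, LinearMap.add_apply,
      deltaPoly_monomial, map_add, map_mul, map_pow, LinearMap.restrictScalars_apply,
      Polynomial.derivative_monomial, realizeAt_monomial]
    have h1 : realizeAt ν (h, i) (Polynomial.X) = MvPowerSeries.X (h, i) := by simp [realizeAt]
    grind [smul_eq_mul, map_natCast]

/-- The operators conjugate to the partial derivatives. -/
def nOp (h : Fin H) (η : ℂ) (w : (PSRing H)[X]) :
    (PSRing H)[X] →ₗ[ℂ] (PSRing H)[X] :=
  η • (totalDer h + mulLeft ℂ w)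

/-- The operators summing over the variables of a group against derivatives of the Vandermonde
product. -/
def qOp (h : Fin H) (η : ℂ) (j : ℕ) : (PSRing H)[X] →ₗ[ℂ] PSRing H :=
  Polynomial.lsum fun b =>
    LinearMap.mulRight ℂ (PowerSeries.coeff (b + 1) (elemGen h η (j + 1)))

/-- The operators conjugate to the differential operators `V⁻¹ (∑_i x_i^k ∂_i^k) V`. -/
def tOp (h : Fin H) (η : ℂ) (w : (PSRing H)[X]) (k : ℕ) : PSRing H →ₗ[ℂ] PSRing H :=
  (k.factorial : ℂ) • ∑ p ∈ antidiagonal k, ((p.2.factorial : ℂ)⁻¹) •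
    (qOp h η p.1 ∘ₗ mulLeft ℂ ((1 + Polynomial.X) ^ k) ∘ₗ (nOp h η w ^ p.2) ∘ₗ
      (Polynomial.monomial 0).restrictScalars ℂ)

theorem qOp_monomial (h : Fin H) (η : ℂ) (j b : ℕ) (a : PSRing H) :
    qOp h η j (Polynomial.monomial b a)
      = a * PowerSeries.coeff (b + 1) (elemGen h η (j + 1)) := by
  simp [qOp, Polynomial.lsum_apply, Polynomial.sum_monomial_index]

-- The coefficient of `u^(b+1)` in `u / (1 - X_i u)` is `X_i^b`, so the identity for derivatives of
-- the Vandermonde product evaluates `∑_i (∂_i^j V / j!) X_i^b` as `V` times a polynomial in power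
-- sums.
open MvPowerSeries in
theorem vdmSeries_mul_realize_qOp {ν : Fin H → ℕ} {h : Fin H} {η : ℂ} (hη : η * ν h = 1) (j : ℕ)
    (y : (PSRing H)[X]) :
    vdmSeries (ν h) h * realize ν (qOp h η j y)
      = η ^ (j + 1) • ∑ i ∈ range (ν h),
        taylorCoeff (pderiv ℂ (h, i)) j (vdmSeries (ν h) h) * realizeAt ν (h, i) y := by
  induction y using Polynomial.induction_on' with
  | add p q hp hq =>
    simp only [map_add, mul_add, hp, hq, sum_add_distrib, smul_add]
  | monomial b a =>
    rw [qOp_monomial, map_mul]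
    have h1 := congrArg (PowerSeries.coeff (b + 1)) (realize_elemGen hη (j + 1))
    rw [PowerSeries.coeff_map, PowerSeries.coeff_smul] at h1
    change realize ν _ = _ at h1
    have h2 := congrArg (PowerSeries.coeff (b + 1)) (vdmSeries_mul_esymmGen (ν h) h j)
    rw [PowerSeries.coeff_C_mul, map_sum] at h2
    rw [h1, mul_smul_comm, mul_smul_comm, mul_left_comm, h2, mul_sum]
    congr 1
    refine sum_congr rfl fun i _ => ?_
    rw [PowerSeries.coeff_mul_C, realizeAt_monomial, geomSeries, PowerSeries.coeff_succ_X_mul,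
      PowerSeries.coeff_mk]
    ring

-- Conjugation by `s` replaces `∂` by `∂ + w` with `w = ∂ log s`. As `w` is only known up to degree
-- `D`, each differentiation lowers the degree of validity by one.
open MvPowerSeries in
theorem ordGE_iterate_pderiv {ν : Fin H → ℕ} {h : Fin H} {i : ℕ} (hi : i < ν h)
    {s : MvPowerSeries (Fin H × ℕ) ℂ} {w : (PSRing H)[X]} {D : ℤ}
    (hw : OrdGE D (pderiv ℂ (h, i) s - s * realizeAt ν (h, i) w)) (y : (PSRing H)[X])
    (m : ℕ) :
    OrdGE (D - m) ((pderiv ℂ (h, i))^[m] (s * realizeAt ν (h, i) y) -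
      s * realizeAt ν (h, i) (((totalDer h + mulLeft ℂ w) ^ m) y)) := by
  induction m with
  | zero => simpa using ordGE_zero D
  | succ m ih =>
    rw [Function.iterate_succ_apply', pow_succ', Module.End.mul_apply]
    set y' := ((totalDer h + mulLeft ℂ w) ^ m) y with hy'
    have h1 := ih.pderiv (h, i)
    rw [map_sub, Derivation.leibniz, pderiv_realizeAt hi] at h1
    have h2 := (hw.mul_right (realizeAt ν (h, i) y')).mono
      (show D - (m + 1 : ℕ) ≤ D by push_cast; omega)
    have h3 := (h1.mono (show D - (m + 1 : ℕ) ≤ D - m - 1 by push_cast; omega)).add h2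
    grind [LinearMap.add_apply, mulLeft_apply, smul_eq_mul]

theorem sum_smul_add_split {B ι κ : Type*} [CommRing B] [Algebra ℂ B] (S : Finset ι) (T : Finset κ)
    (c : ι → B) (t : ι → κ → B) (r : κ → ℂ) (A E : ι → κ → B) :
    ∑ i ∈ S, ∑ p ∈ T, c i * (t i p * (r p • (A i p + E i p)))
      = ∑ i ∈ S, ∑ p ∈ T, c i * (t i p * (r p • A i p)) +
        ∑ i ∈ S, ∑ p ∈ T, c i * (t i p * (r p • E i p)) := by
  simp only [smul_add, mul_add, sum_add_distrib]

set_option maxHeartbeats 1600000 in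
open MvPowerSeries in
/-- The realization of `tOp`, up to terms of high degree. -/
theorem ordGE_realize_tOp {ν : Fin H → ℕ} {h : Fin H} {η : ℂ} (hη : η * ν h = 1)
    {s : MvPowerSeries (Fin H × ℕ) ℂ} {w : (PSRing H)[X]} {D : ℤ}
    (hw : ∀ i < ν h, OrdGE D (pderiv ℂ (h, i) s - s * realizeAt ν (h, i) w)) (Y : PSRing H)
    {f f' : MvPowerSeries (Fin H × ℕ) ℂ} (hf : OrdGE D (f - s * realize ν Y)) (k : ℕ)
    (hf' : vdmSeries (ν h) h * f' = eulerSum (ν h) h k (vdmSeries (ν h) h * f)) :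
    OrdGE (D - k) (η ^ (k + 1) • f' - s * realize ν (tOp h η w k Y)) := by
  set V := vdmSeries (ν h) h with hVd
  have hV : V ≠ 0 := vdmSeries_ne_zero _ _
  have hVo := ordGE_order hV
  set v : ℤ := (V.order.toNat : ℤ) with hv
  -- Everything is compared after multiplication by `V`, which raises the required order by the
  -- order of `V`.
  apply OrdGE.of_mul hV
  rw [← hv]
  -- the error terms
  let y : ℕ → (PSRing H)[X] := fun m =>
    ((totalDer h + mulLeft ℂ w) ^ m) (Polynomial.monomial 0 Y)
  let err : ℕ → ℕ → MvPowerSeries (Fin H × ℕ) ℂ := fun i m =>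
    (pderiv ℂ (h, i))^[m] (s * realize ν Y) - s * realizeAt ν (h, i) (y m)
  have herr : ∀ i < ν h, ∀ m : ℕ, OrdGE (D - (m : ℤ)) (err i m) := by
    intro i hi m
    have := ordGE_iterate_pderiv hi (hw i hi) (Polynomial.monomial 0 Y) m
    rw [realizeAt_monomial, pow_zero, mul_one] at this
    exact this
  have hk0 : (k.factorial : ℂ) ≠ 0 := Nat.cast_ne_zero.2 (Nat.factorial_ne_zero k)
  have hiter : ∀ (i : ℕ) (g : MvPowerSeries (Fin H × ℕ) ℂ),
      (pderiv ℂ (h, i))^[k] g = (k.factorial : ℂ) • taylorCoeff (pderiv ℂ (h, i)) k g := by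
    intro i g
    unfold taylorCoeff
    rw [smul_smul, mul_inv_cancel₀ hk0, one_smul]
  -- the exact part
  have hmain : V * (s * realize ν (tOp h η w k Y)) = η ^ (k + 1) • ((k.factorial : ℂ) •
      ∑ i ∈ range (ν h), ∑ p ∈ antidiagonal k,
        (1 + X (h, i)) ^ k * (taylorCoeff (pderiv ℂ (h, i)) p.1 V *
          ((p.2.factorial : ℂ)⁻¹ • (s * realizeAt ν (h, i) (y p.2))))) := by
    unfold tOp
    rw [LinearMap.smul_apply, map_smul, mul_smul_comm, mul_smul_comm,
      smul_comm (η ^ (k + 1)) (k.factorial : ℂ)]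
    congr 1
    rw [LinearMap.sum_apply, map_sum, mul_sum, mul_sum, sum_comm,
      smul_sum]
    refine sum_congr rfl fun p hp => ?_
    have hp' : p.1 + p.2 = k := mem_antidiagonal.1 hp
    rw [LinearMap.smul_apply, map_smul, mul_smul_comm, mul_smul_comm, mul_left_comm]
    simp only [LinearMap.comp_apply]
    rw [vdmSeries_mul_realize_qOp hη]
    have hN : (nOp h η w ^ p.2) (((Polynomial.monomial 0).restrictScalars ℂ :
        PSRing H →ₗ[ℂ] (PSRing H)[X]) Y) = η ^ p.2 • y p.2 := by
      unfold nOp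
      rw [smul_pow]
      rfl
    rw [hN, mul_smul_comm, smul_smul, mul_sum, smul_sum, smul_sum]
    refine sum_congr rfl fun i _ => ?_
    rw [mulLeft_apply, mul_smul_comm, realizeAt_smul, map_mul, map_pow, map_add, map_one]
    have h1 : realizeAt ν (h, i) (Polynomial.X) = MvPowerSeries.X (h, i) := by simp [realizeAt]
    rw [h1]
    simp only [mul_smul_comm, smul_smul]
    have e : (p.2.factorial : ℂ)⁻¹ * η ^ (p.1 + 1) * η ^ p.2
        = η ^ (k + 1) * (p.2.factorial : ℂ)⁻¹ := by
      rw [← hp']; ring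
    rw [e]
    congr 1
    ring
  -- Leibniz' rule in divided form distributes the `k` derivatives between `V` and the function;
  -- those that fall on `s · Y` are replaced by their model value plus the error `err`.
  have heuler : eulerSum (ν h) h k (V * f) = eulerSum (ν h) h k (V * (f - s * realize ν Y)) +
      (k.factorial : ℂ) • ∑ i ∈ range (ν h),
        ∑ p ∈ antidiagonal k, (1 + X (h, i)) ^ k *
          (taylorCoeff (pderiv ℂ (h, i)) p.1 V *
            ((p.2.factorial : ℂ)⁻¹ • (s * realizeAt ν (h, i) (y p.2) + err i p.2))) := by
    have h1 : V * f = V * (f - s * realize ν Y) + V * (s * realize ν Y) := by ring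
    rw [h1, eulerSum_add]
    congr 1
    unfold eulerSum
    rw [smul_sum]
    refine sum_congr rfl fun i _ => ?_
    rw [hiter, taylorCoeff_mul, mul_smul_comm, mul_sum]
    congr 1
    refine sum_congr rfl fun p _ => ?_
    congr 2
    simp only [err, add_sub_cancel]
    rfl
  have hdiff : V * (η ^ (k + 1) • f' - s * realize ν (tOp h η w k Y))
      = η ^ (k + 1) • eulerSum (ν h) h k (V * (f - s * realize ν Y)) +
        η ^ (k + 1) • ((k.factorial : ℂ) • ∑ i ∈ range (ν h),
          ∑ p ∈ antidiagonal k, (1 + X (h, i)) ^ k *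
            (taylorCoeff (pderiv ℂ (h, i)) p.1 V * ((p.2.factorial : ℂ)⁻¹ • err i p.2))) := by
    have hsplit := sum_smul_add_split (range (ν h))
      (antidiagonal k) (fun i => (1 + X (h, i)) ^ k)
      (fun i p => taylorCoeff (pderiv ℂ (h, i)) p.1 V) (fun p => ((p.2.factorial : ℂ)⁻¹))
      (fun i p => s * realizeAt ν (h, i) (y p.2)) (fun i p => err i p.2)
    rw [hsplit] at heuler
    rw [mul_sub, hmain, mul_smul_comm, hf', heuler]
    generalize eulerSum (ν h) h k (V * (f - s * realize ν Y)) = e0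
    rw [smul_add (η ^ (k + 1)), smul_add (k.factorial : ℂ), smul_add (η ^ (k + 1)), add_sub_assoc,
      add_sub_cancel_left]
  rw [hdiff]
  -- In both error terms exactly `k` derivatives are spent, on `V` or on a series of order at least
  -- `D`, so order `v + D - k` is left.
  refine OrdGE.add (OrdGE.smul ?_ _) (OrdGE.smul (OrdGE.smul ?_ _) _)
  · unfold eulerSum
    refine OrdGE.sum _ fun i _ => OrdGE.mul_left ?_ _
    exact ((hVo.mul hf).iterate_pderiv (h, i) k).mono (by omega)
  · refine OrdGE.sum _ fun i hi => OrdGE.sum _ fun p hp => OrdGE.mul_left ?_ _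
    have hp' : p.1 + p.2 = k := mem_antidiagonal.1 hp
    have h1 : OrdGE (v - p.1) (taylorCoeff (pderiv ℂ (h, i)) p.1 V) :=
      (hVo.iterate_pderiv (h, i) p.1).smul _
    exact (h1.mul ((herr i (mem_range.1 hi) p.2).smul _)).mono (by omega)

end PowerSumRing

end

section

open Finset Function
open Equiv (Perm)

/-! ### Sums over tuples of distinct indices -/

section InjectiveSums

theorem injective_cons_iff {Q : Type*} {s : ℕ} (q : Q) (p : Fin s → Q) :
    Injective (Fin.cons q p : Fin (s + 1) → Q) ↔ q ∉ Set.range p ∧ Injective p :=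
  Fin.cons_injective_iff

/-- Adding one index to a sum over injective functions. -/
theorem sum_injective_succ {Q T R : Type*} [CommRing R] [DecidableEq Q] (S : Finset Q)
    (χ : T → Q → R) (mrg : T → T → T) (cmp : T → T → Prop) [∀ x y, Decidable (cmp x y)]
    (hχ : ∀ x y q, χ x q * χ y q = if cmp x y then χ (mrg x y) q else 0) {s : ℕ}
    (τ : Fin (s + 1) → T) :
    ∑ p ∈ (Fintype.piFinset fun _ : Fin (s + 1) => S) with Injective p,
        ∏ t, χ (τ t) (p t)
      = (∑ q ∈ S, χ (τ 0) q) * (∑ p ∈ (Fintype.piFinset fun _ : Fin s => S) with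
          Injective p, ∏ t, χ (τ t.succ) (p t)) -
        ∑ t : Fin s, if cmp (τ 0) (τ t.succ) then
          ∑ p ∈ (Fintype.piFinset fun _ : Fin s => S) with Injective p,
            ∏ t', χ (update (fun t : Fin s => τ t.succ) t (mrg (τ 0) (τ t.succ)) t') (p t')
          else 0 := by
  have h1 : ∑ p ∈ (Fintype.piFinset fun _ : Fin (s + 1) => S) with Injective p,
        ∏ t, χ (τ t) (p t)
      = ∑ q ∈ S, ∑ p ∈ (Fintype.piFinset fun _ : Fin s => S) with Injective p,
          if q ∈ Set.range p then 0 else χ (τ 0) q * ∏ t, χ (τ t.succ) (p t) := by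
    rw [sum_sigma', ← sum_filter_of_ne (p := fun x : (_ : Q) × (Fin s → Q) =>
      x.1 ∉ Set.range x.2)]
    swap
    · grind
    refine sum_bij' (fun p _ => ⟨p 0, Fin.tail p⟩) (fun x _ => Fin.cons x.1 x.2) ?_ ?_ ?_ ?_ ?_
    · intro p hp
      rw [mem_filter, Fintype.mem_piFinset] at hp
      have h2 := hp.2
      rw [← Fin.cons_self_tail p, injective_cons_iff] at h2
      aesop
    · rintro ⟨q, p⟩ hp
      simp only [mem_filter, mem_sigma, Fintype.mem_piFinset] at hp ⊢
      exact ⟨fun t => by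
        refine Fin.cases ?_ (fun t => ?_) t
        · exact hp.1.1
        · exact hp.1.2.1 t, (injective_cons_iff q p).2 ⟨hp.2, hp.1.2.2⟩⟩
    · simp
    · simp
    · intro p hp
      rw [mem_filter] at hp
      have h2 := hp.2
      rw [← Fin.cons_self_tail p, injective_cons_iff] at h2
      rw [if_neg h2.1, Fin.prod_univ_succ]
      rfl
  have h2 : ∀ p ∈ (Fintype.piFinset fun _ : Fin s => S).filter Injective,
      ∑ q ∈ S, (if q ∈ Set.range p then 0 else χ (τ 0) q * ∏ t, χ (τ t.succ) (p t))
        = (∑ q ∈ S, χ (τ 0) q) * ∏ t, χ (τ t.succ) (p t) -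
          ∑ t : Fin s, if cmp (τ 0) (τ t.succ) then
            ∏ t', χ (update (fun t : Fin s => τ t.succ) t (mrg (τ 0) (τ t.succ)) t') (p t')
            else 0 := by
    intro p hp
    rw [mem_filter, Fintype.mem_piFinset] at hp
    have h3 : ∀ q, (if q ∈ Set.range p then 0 else χ (τ 0) q * ∏ t, χ (τ t.succ) (p t))
        = χ (τ 0) q * ∏ t, χ (τ t.succ) (p t) -
          if q ∈ Set.range p then χ (τ 0) q * ∏ t, χ (τ t.succ) (p t) else 0 := by
      intro q; split_ifs <;> simp
    rw [sum_congr rfl fun q _ => h3 q, sum_sub_distrib, ← sum_mul]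
    congr 1
    rw [← sum_filter]
    have h4 : S.filter (fun q => q ∈ Set.range p) = univ.image p := by grind
    rw [h4, sum_image fun a _ b _ h => hp.2 h]
    refine sum_congr rfl fun t _ => ?_
    rw [← mul_prod_erase _ _ (mem_univ t), ← mul_assoc, hχ,
      ← mul_prod_erase _ (fun t' => χ (update (fun t : Fin s => τ t.succ) t
        (mrg (τ 0) (τ t.succ)) t') (p t')) (mem_univ t), update_self]
    have h5 : ∀ t' ∈ univ.erase t, χ (update (fun t : Fin s => τ t.succ) t
        (mrg (τ 0) (τ t.succ)) t') (p t') = χ (τ t'.succ) (p t') := by grind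
    rw [prod_congr rfl h5]
    split_ifs <;> simp
  rw [h1, sum_comm, sum_congr rfl h2, sum_sub_distrib, ← mul_sum,
    sum_comm]
  simp

/-- Accounts for the factor `1 / s!` in `gammaPoly`: a set of `s` variables is enumerated in `s!`
ways. -/
theorem card_injective_image {Q : Type*} [DecidableEq Q] {S T : Finset Q} (hT : T ⊆ S) (s : ℕ) :
    ((Fintype.piFinset fun _ : Fin s => S).filter fun p =>
      Injective p ∧ univ.image p = T).card
      = if T.card = s then s.factorial else 0 := by
  split_ifs with h
  · have h1 : Fintype.card (Fin s ↪ T) = s.factorial := by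
      rw [Fintype.card_embedding_eq, Fintype.card_fin, Fintype.card_coe, h, Nat.descFactorial_self]
    rw [← h1, ← card_univ]
    symm
    refine card_bij (fun e _ t => (e t : Q)) ?_ ?_ ?_
    · intro e _
      have hinj : Injective fun t => (e t : Q) :=
        Subtype.val_injective.comp e.injective
      rw [mem_filter, Fintype.mem_piFinset]
      refine ⟨fun t => hT (e t).2, hinj, ?_⟩
      refine eq_of_subset_of_card_le ?_ ?_
      · grind
      · rw [card_image_of_injective _ hinj, h, card_univ, Fintype.card_fin]
    · intro e _ e' _ hee
      ext t
      exact congrFun hee t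
    · intro p hp
      rw [mem_filter] at hp
      refine ⟨⟨fun t => ⟨p t, ?_⟩, fun a b hab => hp.2.1 (Subtype.mk.inj hab)⟩, mem_univ _,
        rfl⟩
      grind
  · rw [card_eq_zero, filter_eq_empty_iff]
    rintro p _ ⟨hp, rfl⟩
    exact h (by rw [card_image_of_injective _ hp, card_univ, Fintype.card_fin])

theorem exists_perm_extend {n s : ℕ} (hs : s ≤ n) (c : Fin s → Prop) (f : Fin s → ℕ)
    (hf : ∀ t, c t → f t < n) (hinj : ∀ t t', c t → c t' → f t = f t' → t = t') :
    ∃ σ : Perm ℕ, (∀ i, n ≤ i → σ i = i) ∧ ∀ t, c t → σ t = f t := by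
  classical
  let S : Finset (Fin n) := univ.filter fun i => ∃ h : (i : ℕ) < s, c ⟨i, h⟩
  let f' : Fin n → Fin n := fun i =>
    if h : ∃ h : (i : ℕ) < s, c ⟨i, h⟩ then ⟨f ⟨i, h.1⟩, hf _ h.2⟩ else i
  obtain ⟨g, hg⟩ := exists_equiv_extend_of_card_eq (α := Fin n) (β := Fin n)
    (t := univ) (by simp) (s := S) (f := f') (subset_univ _) (by
      intro a ha b hb hab
      grind)
  let π : Perm (Fin n) := g.trans (Equiv.subtypeUnivEquiv mem_univ)
  let π' : Perm {i : ℕ // i < n} := Fin.equivSubtype.permCongr π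
  refine ⟨Perm.ofSubtype π', fun i hi => ?_, fun t ht => ?_⟩
  · exact Perm.ofSubtype_apply_of_not_mem _ (by omega)
  · have htn : (t : ℕ) < n := t.2.trans_le hs
    rw [Perm.ofSubtype_apply_of_mem π' (a := (t : ℕ)) htn]
    aesop

end InjectiveSums

end

section

open Finset Function

/-! ### Symmetric power series as polynomials in power sums -/

section PowerSumExpansion

open MvPowerSeries

variable {H : ℕ}

/-- The polynomial in power sums whose realization is the sum of the monomials with the given
groups and exponents (diminished by one) over tuples of distinct variables. -/
def injSum : (s : ℕ) → (Fin s → Fin H × ℕ) → PSRing H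
  | 0, _ => 1
  | s + 1, τ => MvPolynomial.X (τ 0) * injSum s (fun t => τ t.succ) -
      ∑ t : Fin s, if (τ 0).1 = (τ t.succ).1 then
        injSum s (update (fun t : Fin s => τ t.succ) t
          ((τ 0).1, (τ 0).2 + (τ t.succ).2 + 1)) else 0

/-- The power of a variable prescribed by a label, if it is in the right group. -/
def labelMonomial (x q : Fin H × ℕ) : MvPowerSeries (Fin H × ℕ) ℂ :=
  if q.1 = x.1 then X q ^ (x.2 + 1) else 0

/-- The variables in use. -/
def activeVars (ν : Fin H → ℕ) : Finset (Fin H × ℕ) :=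
  (univ ×ˢ range (∑ h, ν h)).filter fun q => q.2 < ν q.1

theorem mem_activeVars {ν : Fin H → ℕ} {q : Fin H × ℕ} : q ∈ activeVars ν ↔ q.2 < ν q.1 := by
  unfold activeVars
  rw [mem_filter, mem_product, mem_range]
  have : ν q.1 ≤ ∑ h, ν h := single_le_sum (f := ν) (fun _ _ => Nat.zero_le _)
    (mem_univ q.1)
  grind

theorem realize_X (ν : Fin H → ℕ) (x : Fin H × ℕ) :
    realize ν (MvPolynomial.X x) = ∑ q ∈ activeVars ν, labelMonomial x q := by
  have h1 : realize ν (MvPolynomial.X x)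
      = ∑ i ∈ range (ν x.1), X (x.1, i) ^ (x.2 + 1) := by
    simp [realize]
  rw [h1]
  unfold labelMonomial
  rw [← sum_filter]
  symm
  refine sum_bij' (fun q _ => q.2) (fun i _ => (x.1, i)) ?_ ?_ ?_ ?_ ?_
  · grind [mem_activeVars]
  · intro i hi
    rw [mem_filter, mem_activeVars]
    grind
  · grind
  · intro i _
    rfl
  grind

/-- The recursion for `injSum` is inclusion–exclusion: a first index that collides with a later one
multiplies two powers of the same variable, which is again a power of it, with label exponent `a + b
+ 1`. -/
theorem realize_injSum (ν : Fin H → ℕ) (s : ℕ) (τ : Fin s → Fin H × ℕ) :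
    realize ν (injSum s τ)
      = ∑ p ∈ (Fintype.piFinset fun _ : Fin s => activeVars ν) with Injective p,
        ∏ t, labelMonomial (τ t) (p t) := by
  induction s with
  | zero =>
    simp [injSum, map_one, univ_eq_empty, prod_empty, sum_const, filter_true_of_mem,
        Function.injective_of_subsingleton]
  | succ s ih =>
    rw [sum_injective_succ (activeVars ν) labelMonomial (fun x y => (x.1, x.2 + y.2 + 1))
      (fun x y => x.1 = y.1) ?_ τ, injSum, map_sub, map_mul, ih, realize_X, map_sum]
    · grind
    · intro x y q
      unfold labelMonomial
      grind

/-- The multi-index of a labelled tuple of variables. -/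
def tupleIndex {s : ℕ} (τ : Fin s → Fin H × ℕ) (p : Fin s → Fin H × ℕ) : Fin H × ℕ →₀ ℕ :=
  ∑ t, Finsupp.single (p t) ((τ t).2 + 1)

/-- The multi-index which uses the `t`-th variable for the `t`-th label. -/
def stdIndex {s : ℕ} (τ : Fin s → Fin H × ℕ) : Fin H × ℕ →₀ ℕ :=
  tupleIndex τ fun t => ((τ t).1, t)

theorem prod_labelMonomial {s : ℕ} (τ : Fin s → Fin H × ℕ) (p : Fin s → Fin H × ℕ) :
    ∏ t, labelMonomial (τ t) (p t)
      = if ∀ t, (p t).1 = (τ t).1 then monomial (tupleIndex τ p) (1 : ℂ) else 0 := by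
  unfold labelMonomial tupleIndex
  split_ifs with h
  · have h1 := MvPowerSeries.prod_monomial (fun t => Finsupp.single (p t) ((τ t).2 + 1))
      (fun _ => (1 : ℂ)) univ
    rw [prod_const_one] at h1
    rw [← h1]
    refine prod_congr rfl fun t _ => ?_
    rw [if_pos (h t), X_pow_eq]
  · push Not at h
    obtain ⟨t, ht⟩ := h
    exact prod_eq_zero (mem_univ t) (if_neg ht)

theorem tupleIndex_apply {s : ℕ} (τ : Fin s → Fin H × ℕ) {p : Fin s → Fin H × ℕ}
    (hp : Injective p) (t : Fin s) : tupleIndex τ p (p t) = (τ t).2 + 1 := by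
  unfold tupleIndex
  rw [Finsupp.finsetSum_apply, sum_eq_single t]
  · simp
  · grind
  · simp

theorem tupleIndex_support {s : ℕ} (τ : Fin s → Fin H × ℕ) {p : Fin s → Fin H × ℕ}
    (hp : Injective p) : (tupleIndex τ p).support = univ.image p := by
  ext q
  rw [Finsupp.mem_support_iff, mem_image]
  constructor
  · grind [tupleIndex, Finsupp.finsetSum_apply, sum_eq_zero, Finsupp.single_eq_of_ne]
  · rintro ⟨t, _, rfl⟩
    rw [tupleIndex_apply τ hp]
    omega

/-- The truncated expansion in power sums of a series with given coefficients. -/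
def gammaPoly (D : ℕ) (G : (Fin H × ℕ →₀ ℕ) → ℂ) : PSRing H :=
  ∑ s ∈ range (D + 1), ((s.factorial : ℂ)⁻¹) • ∑ τ : Fin s → Fin H × Fin D,
    G (stdIndex fun t => ((τ t).1, ((τ t).2 : ℕ))) •
      injSum s fun t => ((τ t).1, ((τ t).2 : ℕ))

/-- Invariance under permutations of the variables below `ν` in each group. -/
def SymBelow (ν : Fin H → ℕ) (g : MvPowerSeries (Fin H × ℕ) ℂ) : Prop :=
  ∀ σ : Fin H → Equiv.Perm ℕ, (∀ h i, ν h ≤ i → σ h i = i) →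
    ∀ α, coeff (α.mapDomain (Equiv.prodCongrRight σ)) g = coeff α g

/-- Within each group a permutation of the first `ν h` variables carries the standard variables to
those of `p`. This needs at least `s` variables per group, which is one reason why `L` has to be
large later on. -/
theorem SymBelow.coeff_tupleIndex {ν : Fin H → ℕ} {g : MvPowerSeries (Fin H × ℕ) ℂ}
    (hg : SymBelow ν g) {s : ℕ} (hs : ∀ h, s ≤ ν h) (τ : Fin s → Fin H × ℕ)
    {p : Fin s → Fin H × ℕ} (hp : Injective p) (hpν : ∀ t, p t ∈ activeVars ν)
    (hpτ : ∀ t, (p t).1 = (τ t).1) :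
    coeff (tupleIndex τ p) g = coeff (stdIndex τ) g := by
  have h1 : ∀ h : Fin H, ∃ σ : Equiv.Perm ℕ, (∀ i, ν h ≤ i → σ i = i) ∧
      ∀ t : Fin s, (p t).1 = h → σ t = (p t).2 := by
    intro h
    refine exists_perm_extend (hs h) (fun t => (p t).1 = h) (fun t => (p t).2) ?_ ?_
    · rintro t rfl
      exact mem_activeVars.1 (hpν t)
    grind
  choose σ hσ hσ' using h1
  rw [← hg σ hσ (stdIndex τ)]
  refine congrArg (fun β => coeff β g) ?_
  unfold stdIndex tupleIndex
  rw [Finsupp.mapDomain_finsetSum (M := ℕ)]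
  refine sum_congr rfl fun t _ => ?_
  rw [Finsupp.mapDomain_single]
  have h2 : (Equiv.prodCongrRight σ) ((τ t).1, (t : ℕ)) = p t :=
    Prod.ext (hpτ t).symm (hσ' _ t (hpτ t))
  rw [h2]

theorem coeff_restr (p : Fin H × ℕ → Prop) [DecidablePred p] (f : MvPowerSeries (Fin H × ℕ) ℂ)
    (α : Fin H × ℕ →₀ ℕ) :
    coeff α (restr p f) = if ∀ j ∈ α.support, p j then coeff α f else 0 := by
  unfold restr
  rw [coeff_rescale]
  split_ifs with h
  · have : (α.prod fun s m => (if p s then (1 : ℂ) else 0) ^ m) = 1 :=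
      prod_eq_one fun j hj => by simp_all
    rw [this, one_mul]
  · push Not at h
    obtain ⟨j, hj, hpj⟩ := h
    have : (α.prod fun s m => (if p s then (1 : ℂ) else 0) ^ m) = 0 := by
      refine prod_eq_zero hj ?_
      simp_all
    rw [this, zero_mul]

/-- Given the variables, at most one labelling has the index `α`: the exponents are read off from
`α`. They lie below `D` because the degree of `α` is at most `D`. -/
theorem sum_labels_eq {α : Fin H × ℕ →₀ ℕ} {D : ℕ} (hα : α.degree ≤ D) {s : ℕ}
    {p : Fin s → Fin H × ℕ} (hp : Injective p) (c : ℂ) :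
    ∑ τ : Fin s → Fin H × Fin D,
      (if (∀ t, (p t).1 = (τ t).1) ∧ tupleIndex (fun t => ((τ t).1, ((τ t).2 : ℕ))) p = α
        then c else 0)
      = if univ.image p = α.support then c else 0 := by
  split_ifs with h
  · have h0 : ∀ t, α (p t) ≠ 0 := fun t => by
      rw [← Finsupp.mem_support_iff, ← h]
      simp
    have h1 : ∀ t, α (p t) - 1 < D := fun t => by
      have h2 := h0 t
      have h3 := Finsupp.le_degree (p t) α
      omega
    rw [sum_eq_single fun t => ((p t).1, ⟨α (p t) - 1, h1 t⟩)]
    · rw [if_pos]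
      refine ⟨fun t => rfl, ?_⟩
      ext q
      by_cases hq : q ∈ univ.image p
      · obtain ⟨t, _, rfl⟩ := mem_image.1 hq
        rw [tupleIndex_apply _ hp]
        grind
      grind [tupleIndex_support, Finsupp.notMem_support_iff]
    · intro τ _ hτ
      rw [if_neg]
      rintro ⟨h2, h3⟩
      apply hτ
      funext t
      have h4 := tupleIndex_apply (fun t => ((τ t).1, ((τ t).2 : ℕ))) hp t
      grind
    simp
  · refine sum_eq_zero fun τ _ => if_neg ?_
    grind [tupleIndex_support]

/-- Symmetric power series are polynomials in power sums, up to terms of high degree. -/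
theorem ordGE_sub_realize_gammaPoly {ν : Fin H → ℕ} {g : MvPowerSeries (Fin H × ℕ) ℂ}
    (hg : SymBelow ν g) (D : ℕ) (hD : ∀ h, D ≤ ν h) :
    OrdGE ((D : ℤ) + 1) (restr (fun j : Fin H × ℕ => j.2 < ν j.1) g -
      realize ν (gammaPoly D fun α => coeff α g)) := by
  intro α hα
  have hαD : α.degree ≤ D := by omega
  rw [map_sub, sub_eq_zero, coeff_restr]
  unfold gammaPoly
  simp only [map_sum, map_smul, realize_injSum, smul_eq_mul]
  -- The summand `s` sees exactly the monomials with `s` distinct variables; each arises from `s!`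
  -- injective tuples with one labelling each, and by symmetry always with the same coefficient.
  have h1 : ∀ s ∈ range (D + 1), ((s.factorial : ℂ)⁻¹) * ∑ τ : Fin s → Fin H × Fin D,
      coeff (stdIndex fun t => ((τ t).1, ((τ t).2 : ℕ))) g *
        ∑ p ∈ (Fintype.piFinset fun _ : Fin s => activeVars ν) with Injective p,
          coeff α (∏ t, labelMonomial ((τ t).1, ((τ t).2 : ℕ)) (p t))
      = if (∀ j ∈ α.support, j.2 < ν j.1) ∧ α.support.card = s then coeff α g else 0 := by
    intro s hs
    have hsν : ∀ h, s ≤ ν h := fun h => (by have := mem_range.1 hs; omega : s ≤ D).trans (hD h)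
    simp only [mul_sum]
    rw [sum_comm]
    have h2 : ∀ p ∈ (Fintype.piFinset fun _ : Fin s => activeVars ν).filter Injective,
        ∑ τ : Fin s → Fin H × Fin D, ((s.factorial : ℂ)⁻¹) *
          (coeff (stdIndex fun t => ((τ t).1, ((τ t).2 : ℕ))) g *
            coeff α (∏ t, labelMonomial ((τ t).1, ((τ t).2 : ℕ)) (p t)))
        = if univ.image p = α.support then ((s.factorial : ℂ)⁻¹) * coeff α g else 0 := by
      intro p hp
      rw [mem_filter, Fintype.mem_piFinset] at hp
      rw [← sum_labels_eq hαD hp.2]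
      refine sum_congr rfl fun τ _ => ?_
      rw [prod_labelMonomial (fun t => ((τ t).1, ((τ t).2 : ℕ)))]
      by_cases h3 : ∀ t, (p t).1 = (τ t).1
      · rw [if_pos h3, coeff_monomial]
        by_cases h4 : tupleIndex (fun t => ((τ t).1, ((τ t).2 : ℕ))) p = α
        · rw [if_pos h4.symm, if_pos ⟨h3, h4⟩, ← hg.coeff_tupleIndex hsν
            (fun t => ((τ t).1, ((τ t).2 : ℕ))) hp.2 hp.1 h3, h4, mul_one]
        grind
      grind
    rw [sum_congr rfl h2, ← sum_filter, filter_filter, sum_const]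
    by_cases h3 : ∀ j ∈ α.support, j.2 < ν j.1
    · rw [card_injective_image fun j hj => mem_activeVars.2 (h3 j hj)]
      by_cases h4 : α.support.card = s
      · rw [if_pos h4, if_pos ⟨h3, h4⟩, nsmul_eq_mul, ← mul_assoc, mul_inv_cancel₀, one_mul]
        exact Nat.cast_ne_zero.2 (Nat.factorial_ne_zero s)
      aesop
    · rw [if_neg fun h => h3 h.1, card_eq_zero.2, zero_smul]
      rw [filter_eq_empty_iff]
      rintro p hp ⟨_, h4⟩
      apply h3
      intro j hj
      rw [← h4] at hj
      obtain ⟨t, _, rfl⟩ := mem_image.1 hj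
      exact mem_activeVars.1 (Fintype.mem_piFinset.1 hp t)
  rw [sum_congr rfl h1]
  by_cases h3 : ∀ j ∈ α.support, j.2 < ν j.1
  · have h4 : α.support.card ≤ α.degree := by
      rw [Finsupp.degree_apply, card_eq_sum_ones]
      exact sum_le_sum fun j hj => Nat.one_le_iff_ne_zero.2 (Finsupp.mem_support_iff.1 hj)
    rw [if_pos h3, sum_eq_single α.support.card]
    · rw [if_pos ⟨h3, rfl⟩]
    · grind
    grind
  · rw [if_neg h3]
    exact (sum_eq_zero fun s _ => if_neg fun h => h3 h.1).symm

end PowerSumExpansion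

end

section

open Finset

/-! ### Moments, cumulants and the Wick formula -/

section Cumulants

variable {ι : Type} [DecidableEq ι]

open Classical in
/-- The set partitions of a finite set. -/
def setPartitions (V : Finset ι) : Finset (Finset (Finset ι)) :=
  V.powerset.powerset.filter fun P =>
    ∅ ∉ P ∧ (P : Set (Finset ι)).PairwiseDisjoint id ∧ P.biUnion id = V

theorem mem_setPartitions {V : Finset ι} {P : Finset (Finset ι)} :
    P ∈ setPartitions V ↔
      ∅ ∉ P ∧ (P : Set (Finset ι)).PairwiseDisjoint id ∧ P.biUnion id = V := by
  grind [setPartitions, subset_biUnion_of_mem, id]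

/-- The weight of a set partition with `t` blocks in the formula for cumulants. -/
def cumWeight (t : ℕ) : ℂ := (-1) ^ (t - 1) * ((t - 1).factorial : ℂ)

/-- The cumulants of a function of finite sets. -/
def cumulant (m : Finset ι → ℂ) (V : Finset ι) : ℂ :=
  ∑ P ∈ setPartitions V, cumWeight P.card * ∏ U ∈ P, m U

theorem sum_finpartition_eq_cumulant (m : Finset ι → ℂ) (V : Finset ι) :
    ∑ P : Finpartition V, cumWeight P.parts.card * ∏ U ∈ P.parts, m U = cumulant m V := by
  unfold cumulant
  refine sum_bij (fun P _ => P.parts) ?_ ?_ ?_ ?_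
  · intro P _
    rw [mem_setPartitions]
    exact ⟨P.bot_notMem, P.disjoint, P.biUnion_parts⟩
  · aesop
  · intro P hP
    rw [mem_setPartitions] at hP
    refine ⟨⟨P, supIndep_iff_pairwiseDisjoint.2 hP.2.1, ?_, hP.1⟩, mem_univ _, rfl⟩
    rw [sup_eq_biUnion, hP.2.2]
  · intro P _
    rfl

theorem existsUnique_block {S : Finset ι} {P : Finset (Finset ι)} (hP : P ∈ setPartitions S)
    {i : ι} (hi : i ∈ S) : (P.filter fun B => i ∉ B).card = P.card - 1 := by
  rw [mem_setPartitions] at hP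
  rw [← hP.2.2, mem_biUnion] at hi
  obtain ⟨B₀, hB₀, hiB⟩ := hi
  have : (P.filter fun B => i ∉ B) = P.erase B₀ := by
    ext B
    rw [mem_filter, mem_erase]
    constructor
    · grind
    · rintro ⟨h1, h2⟩
      exact ⟨h2, fun h => disjoint_left.1 (hP.2.1 h2 hB₀ h1) h hiB⟩
  grind

/-- The relation between moments and cumulants. -/
theorem sum_cumulant_mul {m : Finset ι → ℂ} (hm : m ∅ = 1) {S : Finset ι} {i : ι} (hi : i ∈ S) :
    ∑ V ∈ S.powerset with i ∈ V, cumulant m V * m (S \ V) = m S := by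
  have hS : S ∈ S.powerset.filter fun V => i ∈ V :=
    mem_filter.2 ⟨mem_powerset_self S, hi⟩
  rw [← add_sum_erase _ _ hS, Finset.sdiff_self, hm, mul_one]
  -- A partition of a proper subset `V` together with the block `S \ V` is the same as a partition
  -- of `S` with a marked block not containing `i`.
  have h1 : ∑ V ∈ (S.powerset.filter fun V => i ∈ V).erase S, cumulant m V * m (S \ V)
      = ∑ P ∈ setPartitions S, ∑ B ∈ P with i ∉ B, cumWeight (P.card - 1) * ∏ U ∈ P, m U := by
    unfold cumulant
    simp only [sum_mul]
    rw [sum_sigma', sum_sigma']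
    refine sum_bij' (fun x _ => ⟨insert (S \ x.1) x.2, S \ x.1⟩)
      (fun y _ => ⟨S \ y.2, y.1.erase y.2⟩) ?_ ?_ ?_ ?_ ?_
    · rintro ⟨V, P⟩ h
      simp only [mem_sigma, mem_erase, mem_filter, mem_powerset,
        mem_setPartitions] at h ⊢
      obtain ⟨⟨hVS, hV, hiV⟩, h0, hd, hu⟩ := h
      refine ⟨⟨?_, ?_, ?_⟩, mem_insert_self _ _, fun h => (Finset.mem_sdiff.1 h).2 hiV⟩
      · grind
      · rw [coe_insert, Set.pairwiseDisjoint_insert]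
        refine ⟨hd, fun U hU _ => ?_⟩
        have : U ⊆ V := by grind
        exact sdiff_disjoint.mono_right this
      grind
    · rintro ⟨P, B⟩ h
      simp only [mem_sigma, mem_erase, mem_filter, mem_powerset,
        mem_setPartitions] at h ⊢
      obtain ⟨⟨h0, hd, hu⟩, hB, hiB⟩ := h
      have hBS : B ⊆ S := by grind
      refine ⟨⟨?_, sdiff_subset, Finset.mem_sdiff.2 ⟨hi, hiB⟩⟩, fun h => h0 h.2, ?_, ?_⟩
      · grind [Finset.sdiff_eq_self_iff_disjoint, disjoint_self_iff_empty]
      · exact hd.subset (coe_subset.2 (erase_subset _ _))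
      · ext x
        rw [mem_biUnion, Finset.mem_sdiff, ← hu, mem_biUnion]
        constructor
        · rintro ⟨U, hU, hx⟩
          rw [mem_erase] at hU
          exact ⟨⟨U, hU.2, hx⟩, fun h => disjoint_left.1 (hd hU.2 hB hU.1) hx h⟩
        grind
    · rintro ⟨V, P⟩ h
      simp only [mem_sigma, mem_erase, mem_filter, mem_powerset,
        mem_setPartitions] at h
      obtain ⟨⟨hVS, hV, hiV⟩, h0, hd, hu⟩ := h
      have h2 : S \ (S \ V) = V := Finset.sdiff_sdiff_eq_self hV
      have h3 : S \ V ∉ P := by grind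
      simp_all
    · grind [mem_setPartitions, subset_biUnion_of_mem, id, Finset.sdiff_sdiff_eq_self, insert_erase]
    · rintro ⟨V, P⟩ h
      simp only [mem_sigma, mem_erase, mem_filter, mem_powerset,
        mem_setPartitions] at h
      grind
  rw [h1, cumulant, ← sum_add_distrib]
  -- A partition with `t ≥ 2` blocks occurs once with weight `w(t)` and `t - 1` times with weight
  -- `w(t - 1)`. These cancel because `w(t) = -(t - 1) w(t - 1)`; only the one-block partition
  -- survives.
  have h2 : ∀ P ∈ setPartitions S, cumWeight P.card * ∏ U ∈ P, m U +
      ∑ B ∈ P with i ∉ B, cumWeight (P.card - 1) * ∏ U ∈ P, m U = if P = {S} then m S else 0 := by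
    intro P hP
    rw [sum_const, existsUnique_block hP hi]
    have hP' := mem_setPartitions.1 hP
    obtain ⟨B₀, hB₀, hiB⟩ : ∃ B ∈ P, i ∈ B := by grind
    by_cases h3 : P = {S}
    · rw [if_pos h3, h3]
      simp [cumWeight]
    · rw [if_neg h3]
      have h4 : 2 ≤ P.card := by
        by_contra h5
        have h6 : P.card = 1 := by grind
        obtain ⟨B, rfl⟩ := card_eq_one.1 h6
        grind
      obtain ⟨t, ht⟩ := Nat.exists_eq_add_of_le h4
      rw [ht, nsmul_eq_mul, ← mul_assoc, ← add_mul]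
      have : cumWeight (2 + t) + ((2 + t - 1 : ℕ) : ℂ) * cumWeight (2 + t - 1) = 0 := by
        have e1 : 2 + t - 1 = t + 1 := by omega
        unfold cumWeight
        rw [e1, Nat.add_sub_cancel, Nat.factorial_succ]
        push_cast
        ring
      rw [this, zero_mul]
  rw [sum_congr rfl h2, sum_ite_eq', if_pos]
  rw [mem_setPartitions]
  aesop

/-- Cumulants are determined by their relation to moments. -/
theorem eq_cumulant {m K : Finset ι → ℂ} (hm : m ∅ = 1)
    (hK : ∀ S : Finset ι, S.Nonempty →
      ∃ i ∈ S, ∑ V ∈ S.powerset with i ∈ V, K V * m (S \ V) = m S)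
    (S : Finset ι) (hS : S.Nonempty) : K S = cumulant m S := by
  induction S using strongInduction with
  | H S ih =>
    obtain ⟨i, hi, h1⟩ := hK S hS
    have h2 := sum_cumulant_mul hm hi
    have hS' : S ∈ S.powerset.filter fun V => i ∈ V :=
      mem_filter.2 ⟨mem_powerset_self S, hi⟩
    rw [← add_sum_erase _ _ hS', Finset.sdiff_self, hm, mul_one] at h1 h2
    have h3 : ∀ V ∈ (S.powerset.filter fun V => i ∈ V).erase S,
        K V * m (S \ V) = cumulant m V * m (S \ V) := by grind
    rw [sum_congr rfl h3] at h1
    grind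

/-- Cumulants under the shift of one of the variables by a constant. -/
theorem cumulant_shift {m m' : Finset ι → ℂ} (hm : m ∅ = 1) (j : ι) (a : ℂ)
    (h : ∀ U, m' U = m U + if j ∈ U then a * m (U.erase j) else 0) (S : Finset ι)
    (hS : S.Nonempty) : cumulant m' S = cumulant m S + if S = {j} then a else 0 := by
  symm
  refine eq_cumulant (m := m') (K := fun S => cumulant m S + if S = {j} then a else 0) ?_ ?_ S hS
  · rw [h, hm]; simp
  · intro S hS
    by_cases hj : j ∈ S
    · refine ⟨j, hj, ?_⟩
      -- Cumulants are characterised by the recursion at any one element. At `j` the complement of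
      -- `V` avoids `j`, so its moment is unshifted and the extra term arises from `V = {j}` alone.
      have h1 : ∀ V ∈ S.powerset.filter fun V => j ∈ V,
          (cumulant m V + if V = {j} then a else 0) * m' (S \ V)
            = cumulant m V * m (S \ V) + if V = {j} then a * m (S.erase j) else 0 := by
        simp_all [mem_filter, Finset.mem_sdiff, add_zero, add_mul, erase_eq, zero_mul]
      rw [sum_congr rfl h1, sum_add_distrib, sum_cumulant_mul hm hj, h S, if_pos hj,
        sum_ite_eq', if_pos]
      grind
    · obtain ⟨i, hi⟩ := hS
      refine ⟨i, hi, ?_⟩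
      rw [h S, if_neg hj, add_zero, ← sum_cumulant_mul hm hi]
      refine sum_congr rfl fun V hV => ?_
      grind

/-- Cumulants of order at least three vanish for moments given by a Wick formula. -/
theorem cumulant_wick {W : Finset ι → ℂ} (hW : W ∅ = 1) (s : ι → ℂ) (C : ι → ι → ℂ)
    (h : ∀ S : Finset ι, S.Nonempty → ∃ i ∈ S, ∀ T ⊆ S, i ∈ T →
      W T = s i * W (T.erase i) + ∑ j ∈ T.erase i, C i j * W ((T.erase i).erase j))
    (S : Finset ι) (hS : 3 ≤ S.card) : cumulant W S = 0 := by
  induction S using strongInduction with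
  | H S ih =>
    obtain ⟨i, hi, h1⟩ := h S (card_pos.1 (by omega))
    have h2 := sum_cumulant_mul hW hi
    set T := S.erase i with hT
    have hiT : i ∉ T := notMem_erase i S
    have hST : S = insert i T := (insert_erase hi).symm
    have hcT : 2 ≤ T.card := by grind
    have hsum : ∑ V ∈ S.powerset with i ∈ V, cumulant W V * W (S \ V)
        = ∑ V ∈ T.powerset, cumulant W (insert i V) * W (T \ V) := by
      symm
      refine sum_bij' (fun V _ => insert i V) (fun V _ => V.erase i) ?_ ?_ ?_ ?_ ?_
      · grind
      · grind
      · grind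
      · grind
      · intro V hV
        congr 2
        grind
    have hK1 : cumulant W {i} = s i := by
      have h3 := sum_cumulant_mul hW (mem_singleton_self i)
      have h4 : (({i} : Finset ι).powerset.filter fun V => i ∈ V) = {{i}} := by grind
      rw [h4, sum_singleton, Finset.sdiff_self, hW, mul_one] at h3
      rw [h3, h1 {i} (singleton_subset_iff.2 hi) (mem_singleton_self i)]
      simp [hW]
    have hK2 : ∀ j ∈ T, cumulant W {i, j} = C i j := by
      intro j hj
      have hij : i ≠ j := by rintro rfl; exact hiT hj
      have h3 := sum_cumulant_mul hW (S := {i, j}) (mem_insert_self i {j})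
      have h4 : (({i, j} : Finset ι).powerset.filter fun V => i ∈ V) = {{i}, {i, j}} := by grind
      have h5 : ({i, j} : Finset ι) \ {i} = {j} := by grind
      have h8 : ({i} : Finset ι) ≠ {i, j} := by grind
      grind [sum_pair, Finset.sdiff_self, mul_one, insert_subset_insert, mem_insert_self,
          erase_insert, sum_singleton, erase_singleton, add_left_cancel]
    rw [hsum, h1 S subset_rfl hi] at h2
    -- By induction only `V = ∅`, singletons and `V = T` can contribute. The first two reproduce the
    -- right-hand side of the Wick formula, so the contribution of `T`, which is the cumulant of
    -- `S`, has to vanish.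
    have hsub : insert T (insert ∅ (T.image fun j => ({j} : Finset ι))) ⊆ T.powerset := by
      intro V hV
      grind
    rw [← sum_subset hsub, sum_insert, sum_insert, sum_image] at h2
    · rw [Finset.sdiff_self, hW, mul_one, sdiff_empty, ← hST] at h2
      have h3 : ∑ j ∈ T, cumulant W (insert i {j}) * W (T \ {j})
          = ∑ j ∈ T, C i j * W (T.erase j) :=
        sum_congr rfl fun j hj => by rw [hK2 j hj, ← erase_eq]
      have h4 : insert i (∅ : Finset ι) = {i} := rfl
      grind
    · simp
    · simp
    · grind
    · intro V hV hV'
      rw [mem_powerset] at hV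
      rw [mem_insert, mem_insert, mem_image, not_or, not_or] at hV'
      have h3 : 2 ≤ V.card := by
        by_contra h4
        rcases Nat.lt_or_ge V.card 1 with h5 | h5
        · grind
        · obtain ⟨j, rfl⟩ := card_eq_one.1 (by omega : V.card = 1)
          grind
      have hiV : i ∉ V := fun h => hiT (hV h)
      rw [ih (insert i V) ?_ ?_, zero_mul]
      · grind
      grind

end Cumulants

end

section

open Finset

/-! ### Algebraic convergence of vectors and operators -/

section NullSequences

variable {E F G : Type*} [AddCommGroup E] [Module ℂ E] [AddCommGroup F] [Module ℂ F]
  [AddCommGroup G] [Module ℂ G]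

/-- Finite combinations of fixed vectors with coefficients tending to zero. -/
def NullSeq (u : ℕ → E) : Prop :=
  u ∈ Submodule.span ℂ
    {v : ℕ → E | ∃ c : ℕ → ℂ, Tendsto c atTop (𝓝 0) ∧ ∃ e : E, v = fun L => c L • e}

theorem nullSeq_smul_const {c : ℕ → ℂ} (hc : Tendsto c atTop (𝓝 0)) (e : E) :
    NullSeq fun L => c L • e := Submodule.subset_span ⟨c, hc, e, rfl⟩

theorem nullSeq_zero : NullSeq fun _ : ℕ => (0 : E) := Submodule.zero_mem _

theorem NullSeq.add {u v : ℕ → E} (hu : NullSeq u) (hv : NullSeq v) :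
    NullSeq fun L => u L + v L := Submodule.add_mem _ hu hv

theorem NullSeq.sum {ι : Type*} (s : Finset ι) {u : ι → ℕ → E} (hu : ∀ i ∈ s, NullSeq (u i)) :
    NullSeq fun L => ∑ i ∈ s, u i L := by
  have := Submodule.sum_mem _ hu
  unfold NullSeq
  convert this using 1
  aesop

theorem NullSeq.smul {u : ℕ → E} (hu : NullSeq u) {c : ℕ → ℂ} {l : ℂ}
    (hc : Tendsto c atTop (𝓝 l)) : NullSeq fun L => c L • u L := by
  induction hu using Submodule.span_induction with
  | mem u hu =>
    obtain ⟨b, hb, e, rfl⟩ := hu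
    simp only [smul_smul]
    exact nullSeq_smul_const (by simpa using hc.mul hb) e
  | zero => simpa using nullSeq_zero
  | add u v _ _ hu hv =>
    simpa only [Pi.add_apply, smul_add] using hu.add hv
  | smul a u _ hu =>
    have := Submodule.smul_mem _ a hu
    unfold NullSeq
    convert this using 1
    funext L
    exact smul_comm _ _ _

theorem NullSeq.map {u : ℕ → E} (hu : NullSeq u) (f : E →ₗ[ℂ] F) : NullSeq fun L => f (u L) := by
  induction hu using Submodule.span_induction with
  | mem u hu =>
    obtain ⟨b, hb, e, rfl⟩ := hu
    simp only [map_smul]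
    exact nullSeq_smul_const hb _
  | zero => simpa using nullSeq_zero
  | add u v _ _ hu hv =>
    simpa only [Pi.add_apply, map_add] using hu.add hv
  | smul a u _ hu =>
    have := Submodule.smul_mem _ a hu
    aesop

theorem NullSeq.tendsto {u : ℕ → ℂ} (hu : NullSeq u) : Tendsto u atTop (𝓝 0) := by
  induction hu using Submodule.span_induction with
  | mem u hu =>
    obtain ⟨b, hb, e, rfl⟩ := hu
    simpa using hb.smul_const e
  | zero => exact tendsto_const_nhds
  | add u v _ _ hu hv =>
    have := hu.add hv
    rwa [add_zero] at this
  | smul a u _ hu =>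
    have := hu.const_smul a
    rwa [smul_zero] at this

/-- Convergence of operators on every vector, in the sense of null sequences. -/
def OpLim (X : ℕ → E →ₗ[ℂ] F) (X' : E →ₗ[ℂ] F) : Prop := ∀ y, NullSeq fun L => X L y - X' y

theorem opLim_const (X : E →ₗ[ℂ] F) : OpLim (fun _ => X) X := fun y => by
  simpa using nullSeq_zero

theorem OpLim.add {X Y : ℕ → E →ₗ[ℂ] F} {X' Y' : E →ₗ[ℂ] F} (hX : OpLim X X') (hY : OpLim Y Y') :
    OpLim (fun L => X L + Y L) (X' + Y') := fun y => by
  convert (hX y).add (hY y) using 2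
  simp only [LinearMap.add_apply]
  abel

theorem OpLim.sum {ι : Type*} (s : Finset ι) {X : ι → ℕ → E →ₗ[ℂ] F} {X' : ι → E →ₗ[ℂ] F}
    (hX : ∀ i ∈ s, OpLim (X i) (X' i)) : OpLim (fun L => ∑ i ∈ s, X i L) (∑ i ∈ s, X' i) := by
  intro y
  convert NullSeq.sum s fun i hi => hX i hi y using 2
  simp

theorem OpLim.smul {X : ℕ → E →ₗ[ℂ] F} {X' : E →ₗ[ℂ] F} (hX : OpLim X X') {c : ℕ → ℂ} {l : ℂ}
    (hc : Tendsto c atTop (𝓝 l)) : OpLim (fun L => c L • X L) (l • X') := by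
  intro y
  have h1 : Tendsto (fun L => c L - l) atTop (𝓝 0) := by simpa using hc.sub_const l
  convert ((hX y).smul hc).add (nullSeq_smul_const h1 (X' y)) using 2
  simp only [LinearMap.smul_apply, smul_sub, sub_smul]
  abel

/-- A null sequence lives in the span of finitely many fixed vectors, so pointwise convergence of
the operators suffices. This makes `OpLim` stable under composition without any topology on the
spaces. -/
theorem OpLim.nullSeq {X : ℕ → E →ₗ[ℂ] F} {X' : E →ₗ[ℂ] F} (hX : OpLim X X') {u : ℕ → E}
    (hu : NullSeq u) : NullSeq fun L => X L (u L) := by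
  induction hu using Submodule.span_induction with
  | mem u hu =>
    obtain ⟨b, hb, e, rfl⟩ := hu
    simp only [map_smul]
    convert ((hX e).smul hb).add (nullSeq_smul_const hb (X' e)) using 2
    rw [smul_sub, sub_add_cancel]
  | zero => simpa using nullSeq_zero
  | add u v _ _ hu hv =>
    simpa only [Pi.add_apply, map_add] using hu.add hv
  | smul a u _ hu =>
    have := Submodule.smul_mem _ a hu
    aesop

theorem OpLim.comp {X : ℕ → F →ₗ[ℂ] G} {X' : F →ₗ[ℂ] G} (hX : OpLim X X')
    {Y : ℕ → E →ₗ[ℂ] F} {Y' : E →ₗ[ℂ] F} (hY : OpLim Y Y') :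
    OpLim (fun L => X L ∘ₗ Y L) (X' ∘ₗ Y') := by
  intro y
  convert (hX (Y' y)).add (hX.nullSeq (hY y)) using 2
  simp

theorem OpLim.tendsto {X : ℕ → E →ₗ[ℂ] F} {X' : E →ₗ[ℂ] F} (hX : OpLim X X') (f : F →ₗ[ℂ] ℂ)
    (y : E) : Tendsto (fun L => f (X L y)) atTop (𝓝 (f (X' y))) := by
  have h := ((hX y).map f).tendsto
  simp only [map_sub] at h
  simpa using h.add_const (f (X' y))

theorem OpLim.congr {X : ℕ → E →ₗ[ℂ] F} {X' X'' : E →ₗ[ℂ] F} (hX : OpLim X X')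
    (h : ∀ y, X' y = X'' y) : OpLim X X'' := by
  have : X' = X'' := LinearMap.ext h
  rwa [← this]

/-- First order expansions of operators in a small parameter. -/
def Expands (η : ℕ → ℂ) (X X₀ : ℕ → E →ₗ[ℂ] F) (X₀' X₁ : E →ₗ[ℂ] F) : Prop :=
  ∃ D : ℕ → E →ₗ[ℂ] F, (∀ L, X L = X₀ L + η L • D L) ∧ OpLim X₀ X₀' ∧ OpLim D X₁

theorem OpLim.expands {η : ℕ → ℂ} {X₀ : ℕ → E →ₗ[ℂ] F} {X₀' : E →ₗ[ℂ] F} (h : OpLim X₀ X₀') :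
    Expands η X₀ X₀ X₀' 0 := ⟨fun _ => 0, fun L => by simp, h, opLim_const 0⟩

/-- The product rule to first order; the term `η D D'` is absorbed into the remainder and disappears
in the limit. -/
theorem Expands.comp {η : ℕ → ℂ} (hη : Tendsto η atTop (𝓝 0)) {X X₀ : ℕ → F →ₗ[ℂ] G}
    {X₀' X₁ : F →ₗ[ℂ] G} (hX : Expands η X X₀ X₀' X₁) {Y Y₀ : ℕ → E →ₗ[ℂ] F} {Y₀' Y₁ : E →ₗ[ℂ] F}
    (hY : Expands η Y Y₀ Y₀' Y₁) :
    Expands η (fun L => X L ∘ₗ Y L) (fun L => X₀ L ∘ₗ Y₀ L) (X₀' ∘ₗ Y₀')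
      (X₁ ∘ₗ Y₀' + X₀' ∘ₗ Y₁) := by
  obtain ⟨D, hD, hX0, hD1⟩ := hX
  obtain ⟨D', hD', hY0, hD1'⟩ := hY
  refine ⟨fun L => D L ∘ₗ Y₀ L + X₀ L ∘ₗ D' L + η L • (D L ∘ₗ D' L), fun L => ?_, hX0.comp hY0, ?_⟩
  · simp only
    rw [hD, hD']
    ext y
    grind [LinearMap.comp_apply, LinearMap.add_apply, LinearMap.smul_apply, map_smul, smul_add]
  · refine (((hD1.comp hY0).add (hX0.comp hD1')).add ((hD1.comp hD1').smul hη)).congr fun y => ?_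
    simp

theorem Expands.sum {η : ℕ → ℂ} {ι : Type*} (s : Finset ι) {X X₀ : ι → ℕ → E →ₗ[ℂ] F}
    {X₀' X₁ : ι → E →ₗ[ℂ] F} (h : ∀ i ∈ s, Expands η (X i) (X₀ i) (X₀' i) (X₁ i)) :
    Expands η (fun L => ∑ i ∈ s, X i L) (fun L => ∑ i ∈ s, X₀ i L) (∑ i ∈ s, X₀' i)
      (∑ i ∈ s, X₁ i) := by
  have h' : ∀ i : s, Expands η (X i) (X₀ i) (X₀' i) (X₁ i) := fun i => h i i.2
  choose D hD h0 h1 using h'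
  refine ⟨fun L => ∑ i : s, D i L, fun L => ?_, OpLim.sum s fun i hi => h0 ⟨i, hi⟩, ?_⟩
  · simp only
    rw [← sum_coe_sort s, ← sum_coe_sort s, smul_sum, ← sum_add_distrib]
    grind
  · rw [← sum_coe_sort s]
    exact OpLim.sum univ fun i _ => h1 i

theorem Expands.smul {η : ℕ → ℂ} {X X₀ : ℕ → E →ₗ[ℂ] F} {X₀' X₁ : E →ₗ[ℂ] F}
    (h : Expands η X X₀ X₀' X₁) (c : ℂ) :
    Expands η (fun L => c • X L) (fun L => c • X₀ L) (c • X₀') (c • X₁) := by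
  obtain ⟨D, hD, h0, h1⟩ := h
  refine ⟨fun L => c • D L, fun L => ?_, h0.smul tendsto_const_nhds, h1.smul tendsto_const_nhds⟩
  simp only
  rw [hD, smul_add, smul_comm]

/-- The noncommutative derivative of a power: one factor is perturbed, with limits of the
unperturbed operator on either side. -/
theorem Expands.pow {η : ℕ → ℂ} (hη : Tendsto η atTop (𝓝 0)) {X X₀ : ℕ → E →ₗ[ℂ] E}
    {X₀' X₁ : E →ₗ[ℂ] E} (h : Expands η X X₀ X₀' X₁) (n : ℕ) :
    Expands η (fun L => X L ^ n) (fun L => X₀ L ^ n) (X₀' ^ n)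
      (∑ i ∈ range n, X₀' ^ (n - 1 - i) * X₁ * X₀' ^ i) := by
  induction n with
  | zero =>
    simp only [pow_zero, range_zero, sum_empty]
    exact (opLim_const (1 : E →ₗ[ℂ] E)).expands
  | succ n ih =>
    have h1 := h.comp hη ih
    simp only [pow_succ']
    have h2 : ∑ i ∈ range (n + 1), X₀' ^ (n + 1 - 1 - i) * X₁ * X₀' ^ i
        = X₁ ∘ₗ X₀' ^ n + X₀' ∘ₗ ∑ i ∈ range n, X₀' ^ (n - 1 - i) * X₁ * X₀' ^ i := ?_
    · rw [h2]
      exact h1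
    rw [sum_range_succ, add_comm]
    congr 1
    · aesop
    · change _ = X₀' * _
      rw [mul_sum]
      refine sum_congr rfl fun i hi => ?_
      have := mem_range.1 hi
      rw [← mul_assoc, ← mul_assoc, ← pow_succ']
      congr 3
      omega

end NullSequences

end

section

open Finset

/-! ### Elementary symmetric functions to first order in the parameter -/

section OperatorAsymptotics

variable {H : ℕ}

/-- The generating function of the power sums of a group. -/
def psGen (h : Fin H) : PowerSeries (PSRing H) :=
  PowerSeries.mk fun n => if n < 2 then 0 else MvPolynomial.X (h, n - 2)

/-- Scalar power series. -/
def scalarSeries : PowerSeries ℂ →ₐ[ℂ] PowerSeries (PSRing H) :=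
  PowerSeries.mapAlgHom (Algebra.ofId ℂ (PSRing H))

theorem coeff_scalarSeries (σ : PowerSeries ℂ) (n : ℕ) :
    PowerSeries.coeff n (scalarSeries σ : PowerSeries (PSRing H))
      = algebraMap ℂ (PSRing H) (PowerSeries.coeff n σ) := rfl

theorem scalarSeries_X : (scalarSeries PowerSeries.X : PowerSeries (PSRing H)) = PowerSeries.X :=
  PowerSeries.map_X _

theorem algebraMap_series (c : ℂ) (f : PowerSeries (PSRing H)) :
    algebraMap ℂ (PowerSeries (PSRing H)) c * f = c • f := (Algebra.smul_def c f).symm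

theorem coeff_zero_neg_X_pow_mul {R : Type*} [CommRing R] (m : ℕ) (Q : Polynomial R) :
    ((-Polynomial.X) ^ m * Q).coeff 0 = if m = 0 then Q.coeff 0 else 0 := by
  split_ifs with h
  · rw [h, pow_zero, one_mul]
  · rw [Polynomial.mul_coeff_zero, Polynomial.coeff_zero_eq_eval_zero, Polynomial.eval_pow,
      Polynomial.eval_neg, Polynomial.eval_X, neg_zero, zero_pow h, zero_mul]

theorem coeff_one_neg_X_pow_mul {R : Type*} [CommRing R] (m : ℕ) (Q : Polynomial R) :
    ((-Polynomial.X) ^ m * Q).coeff 1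
      = if m = 0 then Q.coeff 1 else if m = 1 then -Q.coeff 0 else 0 := by
  cases m with
  | zero => simp
  | succ n =>
    have e1 : (-Polynomial.X) ^ (n + 1) * Q = Polynomial.X * ((-Polynomial.X) ^ n * -Q) := by ring
    rw [e1, Polynomial.coeff_X_mul, coeff_zero_neg_X_pow_mul, Polynomial.coeff_neg,
      if_neg (Nat.succ_ne_zero n)]
    simp

/-- `powGen` as a polynomial in the parameter. -/
theorem exists_powGen_poly (h : Fin H) (m : ℕ) :
    ∃ P : Polynomial (PowerSeries (PSRing H)),
      (∀ η : ℂ, P.eval (algebraMap ℂ _ η) = powGen h η m) ∧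
      P.coeff 0 = PowerSeries.X ^ (m + 1) ∧ (m = 0 → P.coeff 1 = psGen h) := by
  refine ⟨Polynomial.C (PowerSeries.X ^ (m + 1)) + Polynomial.X * Polynomial.C
    (PowerSeries.X ^ (m + 1) * PowerSeries.mk fun n =>
      if n = 0 then 0 else ((m + n).choose m : PSRing H) * MvPolynomial.X (h, n - 1)),
    fun η => ?_, ?_, ?_⟩
  · rw [Polynomial.eval_add, Polynomial.eval_mul, Polynomial.eval_C, Polynomial.eval_C,
      Polynomial.eval_X, algebraMap_series, powGen, ← mul_smul_comm]
    conv_lhs => rw [← mul_one (PowerSeries.X ^ (m + 1)), mul_assoc, one_mul, ← mul_add]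
    congr 1
    ext1 n
    rw [map_add, PowerSeries.coeff_smul, PowerSeries.coeff_mk, PowerSeries.coeff_mk,
      PowerSeries.coeff_one]
    cases n with
    | zero => simp [phat]
    | succ c => simp [phat]
  · rw [Polynomial.coeff_add, Polynomial.coeff_C_zero, Polynomial.coeff_X_mul_zero, add_zero]
  · rintro rfl
    simp only [zero_add, pow_one, Polynomial.coeff_add, Polynomial.coeff_C_succ,
      Polynomial.coeff_X_mul, Polynomial.coeff_C]
    rw [if_pos trivial]
    ext1 n
    unfold psGen
    cases n with
    | zero => simp
    | succ n => simp

/-- `elemGen` as a polynomial in the parameter. -/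
theorem exists_elemGen_poly (h : Fin H) (j : ℕ) :
    ∃ E : Polynomial (PowerSeries (PSRing H)),
      (∀ η : ℂ, E.eval (algebraMap ℂ _ η) = elemGen h η j) ∧
      E.coeff 0 = ((j.factorial : ℂ)⁻¹) • PowerSeries.X ^ j ∧
      ∃ σ : PowerSeries ℂ, E.coeff 1 = (if j = 0 then 0 else
        (((j - 1).factorial : ℂ)⁻¹) • (PowerSeries.X ^ (j - 1) * psGen h)) + scalarSeries σ := by
  induction j using Nat.strong_induction_on with
  | _ j ih =>
    cases j with
    | zero =>
      refine ⟨1, fun η => by simp [elemGen], by simp, 0, ?_⟩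
      aesop
    | succ j =>
      choose! E hE hE0 σ hE1 using ih
      choose P hP hP0 hP1 using exists_powGen_poly h
      have hj1 : ((j : ℂ) + 1) ≠ 0 := Nat.cast_add_one_ne_zero j
      -- Newton's recursion with `η` replaced by an indeterminate. The factor `(-η)^m` shows that
      -- the order zero involves only `m = 0` and the first order only `m ≤ 1`.
      refine ⟨∑ m ∈ range (j + 1), Polynomial.C (algebraMap ℂ _ (((j : ℂ) + 1)⁻¹)) *
        ((-Polynomial.X) ^ m * (E (j - m) * P m)), fun η => ?_, ?_, ?_⟩
      · rw [elemGen, Polynomial.eval_finsetSum, sum_range]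
        refine sum_congr rfl fun m _ => ?_
        rw [Polynomial.eval_mul, Polynomial.eval_C, Polynomial.eval_mul, Polynomial.eval_pow,
          Polynomial.eval_neg, Polynomial.eval_X, Polynomial.eval_mul, hE _ (by omega), hP, ← map_neg,
          ← map_pow, ← mul_assoc, ← map_mul, algebraMap_series]
      · simp only [Polynomial.finsetSum_coeff, Polynomial.coeff_C_mul, coeff_zero_neg_X_pow_mul]
        rw [sum_eq_single 0]
        · rw [if_pos rfl, Polynomial.mul_coeff_zero, Nat.sub_zero, hE0 j (by omega), hP0,
            algebraMap_series, smul_mul_assoc, smul_smul, zero_add, pow_one,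
            ← pow_succ, Nat.factorial_succ]
          grind
        · grind
        simp
      -- The terms with `m ≥ 1` contribute to first order only through constant terms of their
      -- factors, which contain no power sums; they are collected in a scalar series.
      · obtain ⟨τ, hτ⟩ : ∃ τ : PowerSeries ℂ, ∑ m ∈ range j, (algebraMap ℂ
            (PowerSeries (PSRing H)) (((j : ℂ) + 1)⁻¹)) * (if m + 1 = 0 then
              (E (j - (m + 1)) * P (m + 1)).coeff 1
              else if m + 1 = 1 then -(E (j - (m + 1)) * P (m + 1)).coeff 0 else 0)
            = scalarSeries τ := by
          refine ⟨∑ m ∈ range j, ((j : ℂ) + 1)⁻¹ • if m + 1 = 1 then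
            -(((j - (m + 1)).factorial : ℂ)⁻¹ • (PowerSeries.X ^ (j - (m + 1)) *
              PowerSeries.X ^ (m + 1 + 1))) else 0, ?_⟩
          rw [map_sum]
          refine sum_congr rfl fun m hm => ?_
          rw [if_neg (Nat.succ_ne_zero m), algebraMap_series, map_smul]
          grind [Polynomial.mul_coeff_zero, map_smul, scalarSeries_X, smul_mul_assoc]
        simp only [Polynomial.finsetSum_coeff, Polynomial.coeff_C_mul, coeff_one_neg_X_pow_mul]
        rw [sum_range_succ', hτ, if_pos rfl, Nat.sub_zero, Polynomial.mul_coeff_one,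
          hE0 j (by omega), hP0, hE1 j (by omega), hP1 0 rfl, algebraMap_series,
          if_neg (Nat.succ_ne_zero j), Nat.add_sub_cancel, zero_add, pow_one]
        refine ⟨τ + ((j : ℂ) + 1)⁻¹ • (σ j * PowerSeries.X), ?_⟩
        rw [map_add, map_smul, map_mul, scalarSeries_X]
        generalize (scalarSeries τ : PowerSeries (PSRing H)) = t
        generalize (scalarSeries (σ j) : PowerSeries (PSRing H)) = t'
        cases j with
        | zero =>
          simp [Nat.factorial_zero, Nat.cast_one, inv_one, one_smul, pow_zero, one_mul, zero_add,
              add_left_comm]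
        | succ i =>
          rw [if_neg (Nat.succ_ne_zero i), Nat.add_sub_cancel, add_mul, smul_mul_assoc,
            smul_mul_assoc]
          have e1 : PowerSeries.X ^ i * psGen h * PowerSeries.X
              = PowerSeries.X ^ (i + 1) * psGen h := by ring
          rw [e1]
          generalize PowerSeries.X ^ (i + 1) * psGen h = y
          -- The summand `m = 0` has two first-order parts, from the perturbation of either factor,
          -- and their coefficients `1/(i+1)!` and `1/i!` add up to `(i + 2)/(i + 1)!`.
          have e2 : (((i + 1).factorial : ℂ))⁻¹ = (((i + 1 : ℕ) : ℂ) + 1)⁻¹ *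
              (((i + 1).factorial : ℂ)⁻¹ + ((i.factorial : ℂ))⁻¹) := by
            have h1 : ((i : ℂ) + 1) ≠ 0 := Nat.cast_add_one_ne_zero i
            have h2 : (i.factorial : ℂ) ≠ 0 := Nat.cast_ne_zero.2 (Nat.factorial_ne_zero i)
            rw [Nat.factorial_succ]
            grind
          conv_rhs => rw [e2]
          generalize (((i + 1 : ℕ) : ℂ) + 1)⁻¹ = c
          module

end OperatorAsymptotics

end

section

open Finset
open LinearMap (mulLeft mulLeft_apply)
open scoped Polynomial

/-! ### First order expansion of the operators `qOp`, `nOp` and `tOp` -/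

section OperatorExpansion

variable {H : ℕ}

/-- Polynomials in `z` with scalar coefficients. -/
def liftPoly : ℂ[X] →ₐ[ℂ] (PSRing H)[X] :=
  Polynomial.mapAlgHom (Algebra.ofId ℂ (PSRing H))

theorem liftPoly_monomial (b : ℕ) (c : ℂ) :
    (liftPoly (Polynomial.monomial b c) : (PSRing H)[X])
      = Polynomial.monomial b (algebraMap ℂ (PSRing H) c) := Polynomial.map_monomial _

theorem coeff_liftPoly (f : ℂ[X]) (b : ℕ) :
    (liftPoly f : (PSRing H)[X]).coeff b = algebraMap ℂ (PSRing H) (f.coeff b) :=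
  Polynomial.coeff_map _ _

theorem liftPoly_X : (liftPoly Polynomial.X : (PSRing H)[X]) = Polynomial.X :=
  Polynomial.map_X _

/-- The coefficients at the negative powers of a formal variable replaced by power sums. -/
def tailSum (h : Fin H) (j : ℕ) : ℂ[X] →ₗ[ℂ] PSRing H :=
  Polynomial.lsum fun b => LinearMap.toSpanSingleton ℂ (PSRing H)
    (if j + 1 ≤ b then MvPolynomial.X (h, b - j - 1) else 0)

theorem tailSum_monomial (h : Fin H) (j b : ℕ) (c : ℂ) :
    tailSum h j (Polynomial.monomial b c)
      = c • if j + 1 ≤ b then MvPolynomial.X (h, b - j - 1) else 0 := by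
  simp [tailSum, Polynomial.lsum_apply, Polynomial.sum_monomial_index]

/-- To leading order `elemGen` is `u^(j+1) / (j+1)!`, so `qOp` merely extracts the coefficient of
`z^j`. The first-order term `u^j psGen / j!` replaces higher powers of `z` by power sums, which is
`tailSum`; the scalar series only yields the number `t`. -/
theorem exists_expands_qOp (h : Fin H) {η : ℕ → ℂ} (hη : Tendsto η atTop (𝓝 0)) (j : ℕ) :
    ∃ Q : (PSRing H)[X] →ₗ[ℂ] PSRing H,
      Expands η (fun L => qOp h (η L) j)
        (fun _ => (((j + 1).factorial : ℂ)⁻¹) •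
          (Polynomial.lcoeff (PSRing H) j).restrictScalars ℂ)
        ((((j + 1).factorial : ℂ)⁻¹) • (Polynomial.lcoeff (PSRing H) j).restrictScalars ℂ) Q ∧
      ∀ f : ℂ[X], ∃ t : ℂ, ∀ a : PSRing H,
        Q (liftPoly f * Polynomial.C a)
          = (((j.factorial : ℂ)⁻¹) • tailSum h j f) * a + t • a := by
  obtain ⟨E, hE, hE0, σ, hE1⟩ := exists_elemGen_poly h (j + 1)
  rw [if_neg (Nat.succ_ne_zero j), Nat.add_sub_cancel] at hE1
  -- `divX` is the difference quotient of the polynomial in `η` at zero, so its constant coefficient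
  -- is the derivative at `η = 0`.
  have heval : ∀ e : ℂ, elemGen h e (j + 1) = E.coeff 0 +
      e • E.divX.eval (algebraMap ℂ (PowerSeries (PSRing H)) e) := by
    intro e
    rw [← hE, ← algebraMap_series]
    grind [Polynomial.divX_mul_X_add, Polynomial.eval_add, Polynomial.eval_mul, Polynomial.eval_X,
        Polynomial.eval_C]
  let D : PowerSeries (PSRing H) → (PSRing H)[X] →ₗ[ℂ] PSRing H := fun g =>
    Polynomial.lsum fun b => LinearMap.mulRight ℂ (PowerSeries.coeff (b + 1) g)
  have hD : ∀ g b a, D g (Polynomial.monomial b a) = a * PowerSeries.coeff (b + 1) g := by aesop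
  refine ⟨D (E.coeff 1), ⟨fun L => D (E.divX.eval (algebraMap ℂ _ (η L))), fun L => ?_,
    opLim_const _, fun y => ?_⟩, fun f => ?_⟩
  · refine LinearMap.ext fun y => ?_
    induction y using Polynomial.induction_on' with
    | add p q hp hq => rw [map_add, map_add, hp, hq]
    | monomial b a =>
      simp_all [LinearMap.add_apply, LinearMap.smul_apply, LinearMap.restrictScalars_apply,
          qOp_monomial, map_add, mul_add, PowerSeries.coeff_X_pow, Polynomial.lcoeff_apply,
          Polynomial.coeff_monomial, mul_one, smul_zero, mul_zero]
  · have h0 : NullSeq fun L => E.divX.eval (algebraMap ℂ (PowerSeries (PSRing H)) (η L)) -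
        E.coeff 1 := by
      have h1 : ∀ L, E.divX.eval (algebraMap ℂ (PowerSeries (PSRing H)) (η L)) - E.coeff 1
          = ∑ i ∈ range E.divX.natDegree, (η L) ^ (i + 1) • E.divX.coeff (i + 1) := by
        intro L
        rw [Polynomial.eval_eq_sum_range, sum_range_succ', pow_zero, mul_one,
          Polynomial.coeff_divX, add_sub_cancel_right]
        refine sum_congr rfl fun i _ => ?_
        rw [mul_comm, ← map_pow, algebraMap_series]
      simp only [h1]
      refine NullSeq.sum _ fun i _ => nullSeq_smul_const ?_ _
      simpa using hη.pow (i + 1)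
    induction y using Polynomial.induction_on' with
    | add p q hp hq =>
      convert hp.add hq using 2
      grind
    | monomial b a =>
      simp only [hD]
      convert h0.map ((mulLeft ℂ a) ∘ₗ
        (PowerSeries.coeff (R := PSRing H) (b + 1)).restrictScalars ℂ) using 2
      simp only [LinearMap.comp_apply, mulLeft_apply, LinearMap.restrictScalars_apply,
        map_sub]
  · induction f using Polynomial.induction_on' with
    | add p q hp hq =>
      obtain ⟨t, ht⟩ := hp
      obtain ⟨t', ht'⟩ := hq
      refine ⟨t + t', fun a => ?_⟩
      grind [add_mul, smul_add, add_smul]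
    | monomial b c =>
      refine ⟨c * PowerSeries.coeff (b + 1) σ, fun a => ?_⟩
      rw [liftPoly_monomial, Polynomial.monomial_mul_C, hD, hE1, tailSum_monomial, map_add,
        PowerSeries.coeff_smul, coeff_scalarSeries, mul_add]
      have h1 : PowerSeries.coeff (b + 1) (PowerSeries.X ^ j * psGen h)
          = if j + 1 ≤ b then MvPolynomial.X (h, b - j - 1) else 0 := by
        rw [PowerSeries.coeff_X_pow_mul']
        unfold psGen
        rw [PowerSeries.coeff_mk]
        grind
      rw [h1]
      simp only [Algebra.algebraMap_eq_smul_one]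
      simp [MvPolynomial.X, PSRing, mul_one, smul_smul, mul_comm, PowerSeries.coeff]

theorem totalDer_liftPoly_mul (h : Fin H) (p : ℂ[X]) (a : PSRing H) :
    totalDer h (liftPoly p * Polynomial.C a)
      = liftPoly (Polynomial.derivative p) * Polynomial.C a + liftPoly p * deltaDer h a := by
  induction p using Polynomial.induction_on' with
  | add p q hp hq => grind [add_mul]
  | monomial b c =>
    grind [liftPoly_monomial, Polynomial.derivative_monomial, Polynomial.monomial_mul_C, totalDer,
        LinearMap.add_apply, deltaPoly_monomial, LinearMap.restrictScalars_apply, map_natCast,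
        Derivation.leibniz, Derivation.map_algebraMap, smul_zero, add_zero,
        Polynomial.smul_eq_C_mul, Polynomial.C_mul_X_pow_eq_monomial]

/-- The part of first order of the powers of `nOp`. -/
theorem exists_expands_nOp_pow (h : Fin H) {η : ℕ → ℂ} (hη : Tendsto η atTop (𝓝 0))
    {w w₁ : ℕ → (PSRing H)[X]} {v : ℕ → ℂ[X]} {v' : ℂ[X]}
    {w₁' : (PSRing H)[X]} (hw : ∀ L, η L • w L = liftPoly (v L) + η L • w₁ L)
    (hv : NullSeq fun L => v L - v') (hw₁ : NullSeq fun L => w₁ L - w₁') (b : ℕ) :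
    ∃ N : (PSRing H)[X] →ₗ[ℂ] (PSRing H)[X],
      Expands η (fun L => nOp h (η L) (w L) ^ b)
        (fun L => mulLeft ℂ (liftPoly (v L ^ b)))
        (mulLeft ℂ (liftPoly (v' ^ b))) N ∧
      ∃ q : ℂ[X], ∀ a : PSRing H, N (Polynomial.C a)
        = liftPoly q * Polynomial.C a + liftPoly ((b : ℂ) • v' ^ (b - 1)) *
          (deltaDer h a + w₁' * Polynomial.C a) := by
  have h1 : Expands η (fun L => nOp h (η L) (w L)) (fun L => mulLeft ℂ (liftPoly (v L)))
      (mulLeft ℂ (liftPoly v')) (totalDer h + mulLeft ℂ w₁') := by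
    refine ⟨fun L => totalDer h + mulLeft ℂ (w₁ L), fun L => ?_, fun y => ?_, fun y => ?_⟩
    · refine LinearMap.ext fun y => ?_
      simp only [nOp, LinearMap.add_apply, LinearMap.smul_apply, mulLeft_apply, smul_add,
        ← smul_mul_assoc, hw, add_mul]
      abel
    · convert hv.map ((LinearMap.mulRight ℂ y) ∘ₗ (liftPoly (H := H)).toLinearMap) using 2
      simp [sub_mul]
    · convert hw₁.map (LinearMap.mulRight ℂ y) using 2
      simp [sub_mul]
  have h2 := h1.pow hη b
  have hpow : ∀ (p : ℂ[X]) (n : ℕ), (mulLeft ℂ (liftPoly p) ^ n :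
      (PSRing H)[X] →ₗ[ℂ] (PSRing H)[X]) = mulLeft ℂ (liftPoly (p ^ n)) := by simp
  simp only [hpow] at h2
  -- When a derivative in `z` falls on a power of `v'`, the result has scalar coefficients and does
  -- not affect `a`; all such terms are collected here. The rest consists of `b` equal terms.
  refine ⟨_, h2, ∑ i ∈ range b, v' ^ (b - 1 - i) * Polynomial.derivative (v' ^ i),
    fun a => ?_⟩
  rw [LinearMap.sum_apply, map_sum, sum_mul]
  have hterm : ∀ i ∈ range b,
      (mulLeft ℂ (liftPoly (v' ^ (b - 1 - i))) * (totalDer h + mulLeft ℂ w₁') *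
        mulLeft ℂ (liftPoly (v' ^ i)) :
          (PSRing H)[X] →ₗ[ℂ] (PSRing H)[X]) (Polynomial.C a)
      = liftPoly (v' ^ (b - 1 - i) * Polynomial.derivative (v' ^ i)) * Polynomial.C a +
        liftPoly (v' ^ (b - 1)) * (deltaDer h a + w₁' * Polynomial.C a) := by
    intro i hi
    have hi' := mem_range.1 hi
    have e : b - 1 = (b - 1 - i) + i := by omega
    have e2 : (liftPoly (v' ^ (b - 1)) : (PSRing H)[X])
        = liftPoly (v' ^ (b - 1 - i)) * liftPoly (v' ^ i) := by grind
    grind [Module.End.mul_apply, mulLeft_apply, LinearMap.add_apply, totalDer_liftPoly_mul]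
  rw [sum_congr rfl hterm, sum_add_distrib, sum_const, card_range,
    ← Nat.cast_smul_eq_nsmul ℂ, map_smul, smul_mul_assoc]

/-- The leading coefficient of the operators `tOp`. -/
def leadCoeff (k : ℕ) (v : ℂ[X]) : ℂ :=
  (k.factorial : ℂ) * ∑ p ∈ antidiagonal k,
    ((p.2.factorial : ℂ)⁻¹ * ((p.1 + 1).factorial : ℂ)⁻¹) *
      ((1 + Polynomial.X) ^ k * v ^ p.2).coeff p.1

/-- The functional giving the dependence of the operators `tOp` on the derivations. -/
def dualFun (k : ℕ) (v : ℂ[X]) : (PSRing H)[X] →ₗ[PSRing H] PSRing H :=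
  ∑ p ∈ antidiagonal k,
    ((k.factorial : ℂ) * ((p.2.factorial : ℂ)⁻¹ * ((p.1 + 1).factorial : ℂ)⁻¹) * (p.2 : ℂ)) •
      (Polynomial.lcoeff (PSRing H) p.1 ∘ₗ mulLeft (PSRing H)
        (liftPoly ((1 + Polynomial.X) ^ k * v ^ (p.2 - 1))))

/-- The multiplication part of the limit of the operators `tOp`. -/
def mulPart (h : Fin H) (k : ℕ) (v : ℂ[X]) : PSRing H :=
  ∑ p ∈ antidiagonal k,
    ((k.factorial : ℂ) * ((p.2.factorial : ℂ)⁻¹ * (p.1.factorial : ℂ)⁻¹)) •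
      tailSum h p.1 ((1 + Polynomial.X) ^ k * v ^ p.2)

-- At order zero every factor has scalar coefficients in the power sums, so `tOp` is a scalar. At
-- first order one factor is perturbed: `qOp` produces `mulPart`, while a power of `nOp` produces
-- `dualFun` applied to `deltaDer a + w₁' a`. What is left over is again scalar.
set_option maxHeartbeats 400000 in
theorem exists_expands_tOp (h : Fin H) {η : ℕ → ℂ} (hη : Tendsto η atTop (𝓝 0))
    {w w₁ : ℕ → (PSRing H)[X]} {v : ℕ → ℂ[X]} {v' : ℂ[X]}
    {w₁' : (PSRing H)[X]} (hw : ∀ L, η L • w L = liftPoly (v L) + η L • w₁ L)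
    (hv : NullSeq fun L => v L - v') (hw₁ : NullSeq fun L => w₁ L - w₁') (k : ℕ) :
    ∃ (T : PSRing H →ₗ[ℂ] PSRing H) (s : ℂ),
      Expands η (fun L => tOp h (η L) (w L) k) (fun L => leadCoeff k (v L) • LinearMap.id)
        (leadCoeff k v' • LinearMap.id) T ∧
      ∀ a, T a = s • a + (mulPart h k v' + dualFun k v' w₁') * a + dualFun k v' (deltaDer h a) := by
  choose Q hQ t ht using exists_expands_qOp h hη
  choose N hN q hq using exists_expands_nOp_pow h hη hw hv hw₁
  let C₀ : PSRing H →ₗ[ℂ] (PSRing H)[X] := (Polynomial.monomial 0).restrictScalars ℂ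
  let M : (PSRing H)[X] →ₗ[ℂ] (PSRing H)[X] :=
    mulLeft ℂ ((1 + Polynomial.X) ^ k)
  have hterm := fun p : ℕ × ℕ =>
    (((hQ p.1).comp hη ((opLim_const M).expands.comp hη
      ((hN p.2).comp hη (opLim_const C₀).expands))).smul ((p.2.factorial : ℂ)⁻¹))
  have hsum := (Expands.sum (antidiagonal k) fun p _ => hterm p).smul
    (k.factorial : ℂ)
  have hM : (1 + Polynomial.X : (PSRing H)[X]) ^ k
      = liftPoly ((1 + Polynomial.X) ^ k) := by
    rw [map_pow, map_add, map_one, liftPoly_X]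
  have hlead : ∀ u : ℂ[X], ((k.factorial : ℂ) • ∑ p ∈ antidiagonal k,
      ((p.2.factorial : ℂ)⁻¹) • (((((p.1 + 1).factorial : ℂ)⁻¹) •
        (Polynomial.lcoeff (PSRing H) p.1).restrictScalars ℂ) ∘ₗ M ∘ₗ
          mulLeft ℂ (liftPoly (u ^ p.2)) ∘ₗ C₀) : PSRing H →ₗ[ℂ] PSRing H)
      = leadCoeff k u • LinearMap.id := by
    intro u
    refine LinearMap.ext fun a => ?_
    unfold leadCoeff
    simp only [LinearMap.smul_apply, LinearMap.sum_apply, LinearMap.id_apply, mul_smul,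
      sum_smul]
    congr 1
    refine sum_congr rfl fun p _ => ?_
    congr 1
    simp only [LinearMap.comp_apply, LinearMap.smul_apply, LinearMap.restrictScalars_apply, M, C₀,
      mulLeft_apply]
    congr 1
    rw [hM, ← mul_assoc, ← map_mul, Polynomial.monomial_zero_left, Polynomial.lcoeff_apply,
      Polynomial.coeff_mul_C, coeff_liftPoly, Algebra.smul_def]
  simp only [hlead] at hsum
  refine ⟨_, (k.factorial : ℂ) * ∑ p ∈ antidiagonal k,
    ((p.2.factorial : ℂ)⁻¹) * (t p.1 ((1 + Polynomial.X) ^ k * v' ^ p.2) +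
      ((p.1 + 1).factorial : ℂ)⁻¹ * ((1 + Polynomial.X) ^ k * q p.2).coeff p.1), hsum, fun a => ?_⟩
  have hdual : (mulPart h k v' + dualFun k v' w₁') * a + dualFun k v' (deltaDer h a)
      = mulPart h k v' * a + dualFun k v' (deltaDer h a + w₁' * Polynomial.C a) := by
    have h1 : w₁' * Polynomial.C a = a • w₁' := by rw [Polynomial.smul_eq_C_mul, mul_comm]
    rw [h1, map_add, map_smul, smul_eq_mul]
    ring
  rw [add_assoc, hdual]
  have hq' := fun b => hq b a
  generalize deltaDer h a + w₁' * Polynomial.C a = y at hq'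
  have hQ' : ∀ p : ℕ × ℕ, Q p.1 (M (mulLeft ℂ (liftPoly (v' ^ p.2)) (C₀ a)))
      = (((p.1.factorial : ℂ)⁻¹) • tailSum h p.1 ((1 + Polynomial.X) ^ k * v' ^ p.2)) * a +
        t p.1 ((1 + Polynomial.X) ^ k * v' ^ p.2) • a := by
    intro p
    rw [← ht]
    refine congrArg (Q p.1) ?_
    simp only [M, C₀, mulLeft_apply, LinearMap.restrictScalars_apply,
      Polynomial.monomial_zero_left]
    rw [hM, map_mul, mul_assoc]
  have hN' : ∀ p : ℕ × ℕ, (Polynomial.lcoeff (PSRing H) p.1) (M (N p.2 (C₀ a)))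
      = ((1 + Polynomial.X) ^ k * q p.2).coeff p.1 • a + (p.2 : ℂ) •
        (Polynomial.lcoeff (PSRing H) p.1) (liftPoly ((1 + Polynomial.X) ^ k * v' ^ (p.2 - 1)) * y) := by
    intro p
    have h1 : C₀ a = Polynomial.C a := rfl
    rw [h1, hq']
    simp only [M, mulLeft_apply]
    rw [hM, mul_add, ← mul_assoc, ← mul_assoc, ← map_mul, ← map_mul, map_add,
      Polynomial.lcoeff_apply, Polynomial.coeff_mul_C, coeff_liftPoly, ← Algebra.smul_def,
      mul_smul_comm (p.2 : ℂ) ((1 + Polynomial.X) ^ k : ℂ[X]) (v' ^ (p.2 - 1)),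
      map_smul liftPoly, smul_mul_assoc, Polynomial.lcoeff_apply, Polynomial.lcoeff_apply,
      Polynomial.coeff_smul]
  have hterm' : ∀ p : ℕ × ℕ, ((p.2.factorial : ℂ)⁻¹ •
      (Q p.1 ∘ₗ M ∘ₗ mulLeft ℂ (liftPoly (v' ^ p.2)) ∘ₗ C₀ +
        ((((p.1 + 1).factorial : ℂ)⁻¹) • (Polynomial.lcoeff (PSRing H) p.1).restrictScalars ℂ) ∘ₗ
          ((0 : (PSRing H)[X] →ₗ[ℂ] (PSRing H)[X]) ∘ₗ
            mulLeft ℂ (liftPoly (v' ^ p.2)) ∘ₗ C₀ +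
            M ∘ₗ (N p.2 ∘ₗ C₀ + mulLeft ℂ (liftPoly (v' ^ p.2)) ∘ₗ
              (0 : PSRing H →ₗ[ℂ] (PSRing H)[X])))) : PSRing H →ₗ[ℂ] PSRing H) a
      = (p.2.factorial : ℂ)⁻¹ • (((((p.1.factorial : ℂ)⁻¹) •
            tailSum h p.1 ((1 + Polynomial.X) ^ k * v' ^ p.2)) * a +
          t p.1 ((1 + Polynomial.X) ^ k * v' ^ p.2) • a) +
        (((p.1 + 1).factorial : ℂ)⁻¹) • (((1 + Polynomial.X) ^ k * q p.2).coeff p.1 • a +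
          (p.2 : ℂ) • (Polynomial.lcoeff (PSRing H) p.1) (liftPoly ((1 + Polynomial.X) ^ k * v' ^ (p.2 - 1)) * y))) := by
    intro p
    rw [← hQ', ← hN']
    simp
  rw [LinearMap.smul_apply, LinearMap.sum_apply, sum_congr rfl fun p _ => hterm' p]
  unfold mulPart dualFun
  rw [LinearMap.sum_apply, smul_sum, mul_sum, sum_smul, sum_mul,
    ← sum_add_distrib, ← sum_add_distrib]
  refine sum_congr rfl fun p _ => ?_
  rw [LinearMap.smul_apply, LinearMap.comp_apply, mulLeft_apply]
  generalize (Polynomial.lcoeff (PSRing H) p.1) (liftPoly ((1 + Polynomial.X) ^ k * v' ^ (p.2 - 1)) * y) = e₁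
  generalize tailSum h p.1 ((1 + Polynomial.X) ^ k * v' ^ p.2) = e₂
  simp only [smul_mul_assoc]
  module

end OperatorExpansion

end

section

open Finset
open LinearMap (mulLeft mulLeft_apply)
open scoped Polynomial

/-! ### From factorial power sums to power sums -/

section PowerOperators

variable {H : ℕ}

theorem pow_eq_sum_stirlingSecond {R : Type*} [CommRing R] (x : R) (k : ℕ) :
    x ^ k = ∑ s ∈ range (k + 1), (k.stirlingSecond s : R) *
      ∏ j ∈ range s, (x - (j : R)) := by
  induction k with
  | zero => simp
  | succ k ih =>
    rw [pow_succ, ih, sum_range_succ' _ (k + 1), Nat.stirlingSecond_succ_zero, Nat.cast_zero,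
      zero_mul, add_zero, sum_mul]
    have h1 : ∀ s, (k.stirlingSecond s : R) * (∏ j ∈ range s, (x - (j : R))) * x
        = (k.stirlingSecond s : R) * (∏ j ∈ range (s + 1), (x - (j : R))) +
          (s : R) * ((k.stirlingSecond s : R) * ∏ j ∈ range s, (x - (j : R))) := by
      grind [prod_range_succ]
    have h2 : ∀ s, ((k + 1).stirlingSecond (s + 1) : R) *
          (∏ j ∈ range (s + 1), (x - (j : R)))
        = (k.stirlingSecond s : R) * (∏ j ∈ range (s + 1), (x - (j : R))) +
          ((s + 1 : ℕ) : R) * ((k.stirlingSecond (s + 1) : R) *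
            ∏ j ∈ range (s + 1), (x - (j : R))) := by
      intro s
      rw [Nat.stirlingSecond_succ_succ]
      push_cast
      ring
    simp only [h1, h2, sum_add_distrib]
    congr 1
    rw [sum_range_succ' (fun s => (s : R) * ((k.stirlingSecond s : R) *
      ∏ j ∈ range s, (x - (j : R))))]
    simp [range, Nat.stirlingSecond_eq_zero_of_lt]

/-- The operators corresponding to multiplication by the normalized power sums. -/
def popOp (h : Fin H) (η : ℂ) (w : (PSRing H)[X]) (k : ℕ) : PSRing H →ₗ[ℂ] PSRing H :=
  ∑ s ∈ range (k + 1), ((k.stirlingSecond s : ℂ) * η ^ (k - s)) • η⁻¹ • tOp h η w s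

theorem tendsto_leadCoeff {v : ℕ → ℂ[X]} {v' : ℂ[X]}
    (hv : NullSeq fun L => v L - v') (k : ℕ) :
    Tendsto (fun L => leadCoeff k (v L)) atTop (𝓝 (leadCoeff k v')) := by
  have hpow : ∀ n, NullSeq fun L => v L ^ n - v' ^ n := by
    intro n
    have h1 : OpLim (fun L => mulLeft ℂ (v L)) (mulLeft ℂ v') := fun y => by
      convert hv.map (LinearMap.mulRight ℂ y) using 2
      simp [sub_mul]
    induction n with
    | zero => simpa using nullSeq_zero
    | succ n ih =>
      convert (h1.nullSeq ih).add (h1 (v' ^ n)) using 2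
      simp only [mulLeft_apply, pow_succ']
      ring
  unfold leadCoeff
  refine Tendsto.const_mul _ (tendsto_finsetSum _ fun p _ => Tendsto.const_mul _ ?_)
  have h2 := ((hpow p.2).map ((Polynomial.lcoeff ℂ p.1) ∘ₗ
    mulLeft ℂ ((1 + Polynomial.X) ^ k))).tendsto
  have h3 := h2.add_const (((1 + Polynomial.X) ^ k * v' ^ p.2).coeff p.1)
  simpa [mul_sub] using h3

/-- In the Stirling expansion the term `s = k` alone has the prefactor `η⁻¹`. A lower term `s < k`
carries `η^(k-s-1)` and, since `tOp` is scalar to leading order, adds at most a scalar in the limit.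
-/
theorem exists_popOp_expansion (h : Fin H) {η : ℕ → ℂ} (hη : Tendsto η atTop (𝓝 0))
    {w w₁ : ℕ → (PSRing H)[X]} {v : ℕ → ℂ[X]} {v' : ℂ[X]}
    {w₁' : (PSRing H)[X]} (hw : ∀ L, η L • w L = liftPoly (v L) + η L • w₁ L)
    (hv : NullSeq fun L => v L - v') (hw₁ : NullSeq fun L => w₁ L - w₁') (k : ℕ) :
    ∃ (X : ℕ → PSRing H →ₗ[ℂ] PSRing H) (Z : PSRing H →ₗ[ℂ] PSRing H) (s : ℂ),
      (∀ L, η L ≠ 0 → popOp h (η L) (w L) k = ((η L)⁻¹ * leadCoeff k (v L)) • 1 + X L) ∧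
      OpLim X Z ∧
      ∀ a, Z a = s • a + (mulPart h k v' + dualFun k v' w₁') * a + dualFun k v' (deltaDer h a) := by
  choose T s hT hT' using exists_expands_tOp h hη hw hv hw₁
  choose D hD hD0 hD1 using hT
  simp only at hD
  have hc : ∀ t, Tendsto (fun L => (k.stirlingSecond t : ℂ) * η L ^ (k - 1 - t)) atTop
      (𝓝 ((k.stirlingSecond t : ℂ) * 0 ^ (k - 1 - t))) := fun t => (hη.pow _).const_mul _
  have hX := (hD1 k).add (OpLim.sum (range k) fun t _ =>
    (((hD0 t).add ((hD1 t).smul hη)).smul (hc t)))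
  refine ⟨_, _, s k + ∑ t ∈ range k, ((k.stirlingSecond t : ℂ) * 0 ^ (k - 1 - t)) *
    -- The power of zero is one exactly for `t = k - 1`, the only lower term that survives.
    leadCoeff t v', fun L hL => ?_, hX, fun a => ?_⟩
  · unfold popOp
    rw [sum_range_succ, Nat.stirlingSecond_self, Nat.sub_self, pow_zero, Nat.cast_one, mul_one,
      one_smul, hD k, smul_add, smul_smul, smul_smul, inv_mul_cancel₀ hL, one_smul, add_comm,
      ← add_assoc]
    have h1 : ∑ t ∈ range k, ((k.stirlingSecond t : ℂ) * η L ^ (k - t)) • (η L)⁻¹ •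
          tOp h (η L) (w L) t
        = ∑ t ∈ range k, ((k.stirlingSecond t : ℂ) * η L ^ (k - 1 - t)) •
          (leadCoeff t (v L) • LinearMap.id + η L • D t L) := by
      refine sum_congr rfl fun t ht => ?_
      have ht' := mem_range.1 ht
      rw [smul_smul, hD t]
      congr 1
      have e : k - t = (k - 1 - t) + 1 := by omega
      grind
    rw [h1]
    rfl
  grind [LinearMap.add_apply, LinearMap.sum_apply, LinearMap.smul_apply, LinearMap.id_apply,
      zero_smul, add_zero, add_smul, sum_smul, smul_smul]

end PowerOperators

/-! ### Products of operators of the form scalar plus multiplication plus derivation -/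

section WickOperators

variable {A : Type*} [CommRing A] [Algebra ℂ A] {ι : Type} [DecidableEq ι]

/-- The derivation `β_i` commutes with `Z_j` up to the scalar `C i j` and annihilates `1`. Moving it
through the product removes one factor at a time. -/
theorem derivation_prod_wick (Z : ι → A →ₗ[ℂ] A) (s : ι → ℂ) (α : ι → A)
    (β : ι → Derivation ℂ A A) (hZ : ∀ j a, Z j a = s j • a + α j * a + β j a)
    (hβ : ∀ i j a, β i (β j a) = β j (β i a)) (C : ι → ι → ℂ)
    (hC : ∀ i j, β i (α j) = algebraMap ℂ A (C i j)) (i : ι) (l : List ι) (hl : l.Nodup) :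
    β i ((l.map Z).prod 1)
      = (l.map fun j => C i j • (((l.erase j).map Z).prod 1)).sum := by
  induction l with
  | nil => simp
  | cons j l ih =>
    rw [List.nodup_cons] at hl
    rw [List.map_cons, List.prod_cons, Module.End.mul_apply, List.map_cons, List.sum_cons,
      List.erase_cons_head]
    have h1 : ∀ a, β i (Z j a) = C i j • a + Z j (β i a) := by
      intro a
      rw [hZ, hZ, map_add, map_add, Derivation.leibniz, hC, hβ, Derivation.map_smul, smul_eq_mul,
        smul_eq_mul, Algebra.smul_def (C i j)]
      ring
    rw [h1, ih hl.2]
    congr 1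
    have h2 : ∀ l' : List A, Z j l'.sum = (l'.map (Z j)).sum := fun l' => map_list_sum (Z j) l'
    rw [h2, List.map_map]
    congr 1
    refine List.map_congr_left fun j' hj' => ?_
    have hne : j ≠ j' := by rintro rfl; exact hl.1 hj'
    rw [List.erase_cons_tail (by simpa using hne), List.map_cons, List.prod_cons,
      Module.End.mul_apply, Function.comp_apply, map_smul]

/-- The first element of `S` in the order of `l` is also the first of each `T ⊆ S` containing it.
One choice of `i` therefore serves all `T`, as `cumulant_wick` requires. -/
theorem filter_mem_eq_cons {l : List ι} (hl : l.Nodup) (hl' : ∀ j, j ∈ l) {S : Finset ι}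
    (hS : S.Nonempty) : ∃ i ∈ S, ∀ T ⊆ S, i ∈ T →
      l.filter (· ∈ T) = i :: l.filter (· ∈ T.erase i) := by
  have h1 : l.filter (· ∈ S) ≠ [] := by aesop
  obtain ⟨i, t, ht⟩ := List.exists_cons_of_ne_nil h1
  obtain ⟨l₁, l₂, h2, h3, h4, h5⟩ := List.filter_eq_cons_iff.1 ht
  refine ⟨i, by simpa using h4, fun T hT hi => ?_⟩
  have h6 : ∀ x ∈ l₁, x ∉ T := fun x hx hxT => by grind
  have h7 : i ∉ l₂ := by grind
  rw [h2, List.filter_append, List.filter_append, List.filter_cons_of_pos (by simpa using hi),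
    List.filter_cons_of_neg (by simp)]
  have h8 : l₁.filter (· ∈ T) = [] := by simp_all
  have h9 : l₁.filter (· ∈ T.erase i) = [] := by simp_all
  rw [h8, h9, List.nil_append, List.nil_append]
  congr 1
  refine List.filter_congr fun x hx => ?_
  grind

theorem filter_mem_erase {l : List ι} (hl : l.Nodup) (T : Finset ι) (j : ι) :
    (l.filter (· ∈ T)).erase j = l.filter (· ∈ T.erase j) := by
  rw [(hl.filter _).erase_eq_filter, List.filter_filter]
  grind

/-- The moments of a family of operators, multiplied in a given order. -/
def opMoment (φ : A →ₐ[ℂ] ℂ) (l : List ι) (O : ι → A →ₗ[ℂ] A) (S : Finset ι) : ℂ :=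
  φ (((l.filter (· ∈ S)).map O).prod 1)

/-- The outermost operator is split into its three parts: the scalar gives the mean, the
multiplication vanishes under `φ`, and the derivation is contracted with the remaining factors. -/
theorem opMoment_wick (φ : A →ₐ[ℂ] ℂ) {l : List ι} (hl : l.Nodup) (hl' : ∀ j, j ∈ l)
    (Z : ι → A →ₗ[ℂ] A) (s : ι → ℂ) (α : ι → A) (hα : ∀ j, φ (α j) = 0)
    (β : ι → Derivation ℂ A A) (hZ : ∀ j a, Z j a = s j • a + α j * a + β j a)
    (hβ : ∀ i j a, β i (β j a) = β j (β i a)) (C : ι → ι → ℂ)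
    (hC : ∀ i j, β i (α j) = algebraMap ℂ A (C i j)) {S : Finset ι} (hS : S.Nonempty) :
    ∃ i ∈ S, ∀ T ⊆ S, i ∈ T → opMoment φ l Z T = s i * opMoment φ l Z (T.erase i) +
      ∑ j ∈ T.erase i, C i j * opMoment φ l Z ((T.erase i).erase j) := by
  obtain ⟨i, hi, h⟩ := filter_mem_eq_cons hl hl' hS
  refine ⟨i, hi, fun T hT hiT => ?_⟩
  unfold opMoment
  rw [h T hT hiT, List.map_cons, List.prod_cons, Module.End.mul_apply, hZ, map_add, map_add, map_mul,
    hα, zero_mul, add_zero, map_smul, smul_eq_mul,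
    derivation_prod_wick Z s α β hZ hβ C hC i _ (hl.filter _)]
  congr 1
  rw [map_list_sum, List.map_map]
  have h1 : (l.filter (· ∈ T.erase i)).toFinset = T.erase i := by
    ext x
    simp [hl' x]
  have h2 := List.sum_toFinset (fun j => φ (C i j • ((((l.filter (· ∈ T.erase i)).erase j).map
    Z).prod 1))) (hl.filter (· ∈ T.erase i))
  rw [h1] at h2
  refine h2.symm.trans (sum_congr rfl fun j _ => ?_)
  rw [filter_mem_erase hl, map_smul, smul_eq_mul]

theorem prod_map_update {l : List ι} (hl : l.Nodup) (O O' : ι → A →ₗ[ℂ] A) (j : ι) (a : ℂ)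
    (h : ∀ i, i ≠ j → O' i = O i) (hj : O' j = a • 1 + O j) :
    (l.map O').prod = (l.map O).prod +
      if j ∈ l then a • ((l.erase j).map O).prod else 0 := by
  induction l with
  | nil => simp
  | cons i l ih =>
    rw [List.nodup_cons] at hl
    rw [List.map_cons, List.map_cons, List.prod_cons, List.prod_cons]
    by_cases hij : i = j
    · subst hij
      have h1 : l.map O' = l.map O :=
        List.map_congr_left fun x hx => h x (by rintro rfl; exact hl.1 hx)
      rw [h1, hj, if_pos List.mem_cons_self, List.erase_cons_head, add_mul, smul_mul_assoc,
        one_mul, add_comm]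
    aesop

theorem cumulant_opMoment_shift [Fintype ι] (φ : A →ₐ[ℂ] ℂ) {l : List ι} (hl : l.Nodup)
    (hl' : ∀ j, j ∈ l) (O O' : ι → A →ₗ[ℂ] A) (a : ι → ℂ) (h : ∀ j, O' j = a j • 1 + O j)
    {S : Finset ι} (hS : 2 ≤ S.card) :
    cumulant (opMoment φ l O') S = cumulant (opMoment φ l O) S := by
  -- The operators are shifted one at a time. Each shift changes only the cumulant of a singleton,
  -- and `S` has at least two elements.
  have key : ∀ J : Finset ι, cumulant (opMoment φ l fun j => if j ∈ J then O' j else O j) S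
      = cumulant (opMoment φ l O) S := by
    intro J
    induction J using Finset.induction_on with
    | empty => simp
    | insert j J hj ih =>
      rw [← ih, cumulant_shift (m := opMoment φ l fun j => if j ∈ J then O' j else O j)
        (by simp [opMoment]) j (a j) ?_ S (card_pos.1 (by omega)), if_neg, add_zero]
      · rintro rfl
        simp at hS
      · intro U
        unfold opMoment
        rw [prod_map_update (hl.filter _) (fun j => if j ∈ J then O' j else O j) _ j (a j)
          (fun i hi => by simp [mem_insert, hi]) (by simp [hj, h]), LinearMap.add_apply,
          map_add, filter_mem_erase hl]
        aesop
  simpa using key univ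

theorem OpLim.list_prod {E : Type*} [AddCommGroup E] [Module ℂ E] {X : ι → ℕ → E →ₗ[ℂ] E}
    {Z : ι → E →ₗ[ℂ] E} (h : ∀ j, OpLim (X j) (Z j)) (l : List ι) :
    OpLim (fun L => (l.map fun j => X j L).prod) (l.map Z).prod := by
  induction l with
  | nil => exact opLim_const 1
  | cons j l ih =>
    simp only [List.map_cons, List.prod_cons]
    exact (h j).comp ih

theorem tendsto_opMoment (φ : A →ₐ[ℂ] ℂ) (l : List ι) {X : ι → ℕ → A →ₗ[ℂ] A}
    {Z : ι → A →ₗ[ℂ] A} (h : ∀ j, OpLim (X j) (Z j)) (S : Finset ι) :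
    Tendsto (fun L => opMoment φ l (fun j => X j L) S) atTop (𝓝 (opMoment φ l Z S)) :=
  (OpLim.list_prod h _).tendsto φ.toLinearMap 1

theorem tendsto_cumulant {m : ℕ → Finset ι → ℂ} {m' : Finset ι → ℂ}
    (h : ∀ S, Tendsto (fun L => m L S) atTop (𝓝 (m' S))) (S : Finset ι) :
    Tendsto (fun L => cumulant (m L) S) atTop (𝓝 (cumulant m' S)) := by
  unfold cumulant
  exact tendsto_finsetSum _ fun P _ => (tendsto_finsetProd _ fun U _ => h U).const_mul _

end WickOperators

end

section

open Finset
open scoped Polynomial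

/-! ### The logarithm of the generating function in the limit -/

section GammaAsymptotics

variable {H : ℕ}

/-- The polynomial of degree less than `D` with given coefficients. -/
def truncPoly (D : ℕ) (f : ℕ → ℂ) : ℂ[X] :=
  ∑ a ∈ range D, Polynomial.monomial a (f a)

/-- The part of the derivative of `gammaPoly` coming from at least two distinct variables. -/
def restPart (h : Fin H) (D : ℕ) (G : (Fin H × ℕ →₀ ℕ) → ℂ) : (PSRing H)[X] :=
  ∑ s ∈ Finset.Ico 2 (D + 1), ((s.factorial : ℂ)⁻¹) • ∑ τ : Fin s → Fin H × Fin D,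
    G (stdIndex fun t => ((τ t).1, ((τ t).2 : ℕ))) •
      deltaDer h (injSum s fun t => ((τ t).1, ((τ t).2 : ℕ)))

/-- The part of the derivative of `gammaPoly` coming from two distinct variables. -/
def pairPart (h : Fin H) (D : ℕ) (G : Fin H × ℕ → Fin H × ℕ → ℂ) : (PSRing H)[X] :=
  (2 : ℂ)⁻¹ • ∑ τ : Fin 2 → Fin H × Fin D,
    G ((τ 0).1, ((τ 0).2 : ℕ)) ((τ 1).1, ((τ 1).2 : ℕ)) •
      deltaDer h (injSum 2 fun t => ((τ t).1, ((τ t).2 : ℕ)))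

theorem deltaDer_X (h : Fin H) (p : Fin H × ℕ) :
    deltaDer h (MvPolynomial.X p)
      = if p.1 = h then liftPoly (Polynomial.monomial p.2 ((p.2 : ℂ) + 1)) else 0 := by
  simp [deltaDer, MvPolynomial.mkDerivation_X, liftPoly_monomial, map_add, algebraMap, PSRing,
      map_natCast, map_one]

theorem sum_fin_one_arrow {T M : Type*} [Fintype T] [AddCommMonoid M] (F : T → M) :
    ∑ τ : Fin 1 → T, F (τ 0) = ∑ p, F p := (Equiv.funUnique (Fin 1) T).sum_comp F

theorem sum_fin_two_arrow {T M : Type*} [Fintype T] [AddCommMonoid M] (F : T → T → M) :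
    ∑ τ : Fin 2 → T, F (τ 0) (τ 1) = ∑ p, ∑ q, F p q := by
  rw [← Fintype.sum_prod_type']
  exact (finTwoArrowEquiv T).sum_comp fun x => F x.1 x.2

/-- Terms of `log s` in a single variable grow like `n` but are linear in the power sums, so their
derivative is a polynomial in `z` with scalar coefficients. This is the form required by
`exists_popOp_expansion`; all terms in several variables stay in the first-order part. -/
theorem smul_deltaDer_gammaPoly (h : Fin H) {D : ℕ} (hD : 1 ≤ D) (G : (Fin H × ℕ →₀ ℕ) → ℂ)
    (η : ℂ) :
    η • deltaDer h (gammaPoly D G)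
      = liftPoly (truncPoly D fun a => η * ((a + 1 : ℂ) * G (Finsupp.single (h, 0) (a + 1)))) +
        η • restPart h D G := by
  have h0 : deltaDer h (gammaPoly D G) = ∑ s ∈ range (D + 1), ((s.factorial : ℂ)⁻¹) •
      ∑ τ : Fin s → Fin H × Fin D, G (stdIndex fun t => ((τ t).1, ((τ t).2 : ℕ))) •
        deltaDer h (injSum s fun t => ((τ t).1, ((τ t).2 : ℕ))) := by
    unfold gammaPoly
    simp only [map_sum, Derivation.map_smul]
  have h1 : D + 1 = 2 + (D - 1) := by omega
  rw [h0, range_eq_Ico, ← sum_Ico_consecutive _ (Nat.zero_le 2)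
    (show 2 ≤ D + 1 by omega), smul_add]
  congr 1
  rw [← range_eq_Ico, sum_range_succ, sum_range_one]
  have h2 : ∀ τ : Fin 0 → Fin H × Fin D,
      deltaDer h (injSum 0 fun t => ((τ t).1, ((τ t).2 : ℕ))) = 0 := fun τ => by
    rw [injSum]
    simp
  simp only [h2, smul_zero, sum_const_zero, zero_add, Nat.factorial_one, Nat.cast_one,
    inv_one, one_smul]
  have h3 : ∀ τ : Fin 1 → Fin H × Fin D,
      G (stdIndex fun t => ((τ t).1, ((τ t).2 : ℕ))) •
        deltaDer h (injSum 1 fun t => ((τ t).1, ((τ t).2 : ℕ)))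
      = (fun p : Fin H × Fin D => if p.1 = h then liftPoly (Polynomial.monomial (p.2 : ℕ)
          (((p.2 : ℕ) + 1 : ℂ) * G (Finsupp.single (h, 0) ((p.2 : ℕ) + 1)))) else 0) (τ 0) := by
    intro τ
    have e : injSum 1 (fun t => ((τ t).1, ((τ t).2 : ℕ)))
        = MvPolynomial.X ((τ 0).1, ((τ 0).2 : ℕ)) := by simp [injSum]
    rw [e, deltaDer_X]
    simp only
    split_ifs with h4
    · rw [← map_smul, Polynomial.smul_monomial, smul_eq_mul, mul_comm]
      grind [stdIndex, tupleIndex, Fin.sum_univ_one]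
    · rw [smul_zero]
  have h5 := sum_fin_one_arrow (fun p : Fin H × Fin D => if p.1 = h then
    (liftPoly (Polynomial.monomial (p.2 : ℕ) (((p.2 : ℕ) + 1 : ℂ) *
      G (Finsupp.single (h, 0) ((p.2 : ℕ) + 1)))) : (PSRing H)[X]) else 0)
  rw [(sum_congr rfl fun τ _ => h3 τ).trans h5,
    Fintype.sum_prod_type, sum_eq_single h]
  · simp only [if_true]
    unfold truncPoly
    rw [sum_range, map_sum, smul_sum]
    refine sum_congr rfl fun a _ => ?_
    rw [← map_smul, Polynomial.smul_monomial, smul_eq_mul]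
  · intro h' _ hh
    simp [hh]
  simp

theorem nullSeq_truncPoly (D : ℕ) {f : ℕ → ℕ → ℂ} {f' : ℕ → ℂ}
    (hf : ∀ a, Tendsto (fun L => f L a) atTop (𝓝 (f' a))) :
    NullSeq fun L => truncPoly D (f L) - truncPoly D f' := by
  unfold truncPoly
  simp only [← sum_sub_distrib, ← map_sub]
  refine NullSeq.sum _ fun a _ => ?_
  have h1 : Tendsto (fun L => f L a - f' a) atTop (𝓝 0) := by simpa using (hf a).sub_const (f' a)
  convert nullSeq_smul_const h1 (Polynomial.monomial a (1 : ℂ)) using 2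
  rw [Polynomial.smul_monomial, smul_eq_mul, mul_one]

/-- The second and third CLT conditions: terms in two distinct variables converge, those in three or
more disappear. -/
theorem nullSeq_restPart (h : Fin H) {D : ℕ} (hD : 2 ≤ D) {G : ℕ → (Fin H × ℕ →₀ ℕ) → ℂ}
    {G' : Fin H × ℕ → Fin H × ℕ → ℂ}
    (hG2 : ∀ τ : Fin 2 → Fin H × ℕ,
      Tendsto (fun L => G L (stdIndex τ)) atTop (𝓝 (G' (τ 0) (τ 1))))
    (hG3 : ∀ s, 3 ≤ s → ∀ τ : Fin s → Fin H × ℕ,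
      Tendsto (fun L => G L (stdIndex τ)) atTop (𝓝 0)) :
    NullSeq fun L => restPart h D (G L) - pairPart h D G' := by
  unfold restPart pairPart
  have hsplit : ∀ F : ℕ → (PSRing H)[X], ∑ s ∈ Finset.Ico 2 (D + 1), F s
      = F 2 + ∑ s ∈ Finset.Ico 3 (D + 1), F s := fun F =>
    sum_eq_sum_Ico_succ_bot (by omega) F
  simp only [hsplit, Nat.factorial_two, Nat.cast_ofNat, add_sub_right_comm, ← smul_sub,
    ← sum_sub_distrib, ← sub_smul]
  refine NullSeq.add ?_ ?_
  · refine NullSeq.smul (l := (2 : ℂ)⁻¹) (NullSeq.sum _ fun τ _ => nullSeq_smul_const ?_ _)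
      tendsto_const_nhds
    have := (hG2 fun t => ((τ t).1, ((τ t).2 : ℕ))).sub_const
      (G' ((τ 0).1, ((τ 0).2 : ℕ)) ((τ 1).1, ((τ 1).2 : ℕ)))
    simpa using this
  · refine NullSeq.sum _ fun s hs => NullSeq.smul (l := (s.factorial : ℂ)⁻¹)
      (NullSeq.sum _ fun τ _ => nullSeq_smul_const (hG3 s (mem_Ico.1 hs).1 _) _)
      tendsto_const_nhds

/-- The values of `dualFun` on monomials. -/
def dualCoef (k : ℕ) (v : ℂ[X]) (b : ℕ) : ℂ :=
  ∑ p ∈ antidiagonal k,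
    ((k.factorial : ℂ) * ((p.2.factorial : ℂ)⁻¹ * ((p.1 + 1).factorial : ℂ)⁻¹) * (p.2 : ℂ)) *
      ((1 + Polynomial.X) ^ k * v ^ (p.2 - 1) * Polynomial.X ^ b).coeff p.1

theorem dualFun_liftPoly_monomial (k : ℕ) (v : ℂ[X]) (b : ℕ) (c : ℂ) :
    dualFun k v (liftPoly (Polynomial.monomial b c) : (PSRing H)[X])
      = algebraMap ℂ (PSRing H) (c * dualCoef k v b) := by
  unfold dualFun dualCoef
  rw [LinearMap.sum_apply, mul_sum, map_sum]
  refine sum_congr rfl fun p _ => ?_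
  rw [LinearMap.smul_apply, LinearMap.comp_apply, LinearMap.mulLeft_apply, ← map_mul,
    Polynomial.lcoeff_apply, coeff_liftPoly, Algebra.smul_def, ← map_mul,
    ← Polynomial.C_mul_X_pow_eq_monomial]
  congr 1
  have : (1 + Polynomial.X) ^ k * v ^ (p.2 - 1) * (Polynomial.C c * Polynomial.X ^ b)
      = Polynomial.C c * ((1 + Polynomial.X) ^ k * v ^ (p.2 - 1) * Polynomial.X ^ b) := by ring
  grind

/-- The derivation part of the limit operators. -/
def wickDer (h : Fin H) (k : ℕ) (v : ℂ[X]) : Derivation ℂ (PSRing H) (PSRing H) :=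
  (dualFun k v).compDer (deltaDer h)

theorem wickDer_apply (h : Fin H) (k : ℕ) (v : ℂ[X]) (a : PSRing H) :
    wickDer h k v a = dualFun k v (deltaDer h a) := rfl

/-- The coefficients of `wickDer`. -/
def wickCoef (h : Fin H) (k : ℕ) (v : ℂ[X]) (p : Fin H × ℕ) : ℂ :=
  if p.1 = h then ((p.2 : ℂ) + 1) * dualCoef k v p.2 else 0

theorem wickDer_X (h : Fin H) (k : ℕ) (v : ℂ[X]) (p : Fin H × ℕ) :
    wickDer h k v (MvPolynomial.X p) = algebraMap ℂ (PSRing H) (wickCoef h k v p) := by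
  grind [wickCoef, wickDer_apply, deltaDer_X, dualFun_liftPoly_monomial]

/-- Both derivations send the generators to constants, so their commutator annihilates the
generators. -/
theorem wickDer_comm (h h' : Fin H) (k k' : ℕ) (v v' : ℂ[X]) (a : PSRing H) :
    wickDer h k v (wickDer h' k' v' a) = wickDer h' k' v' (wickDer h k v a) := by
  have h1 : ⁅wickDer h k v, wickDer h' k' v'⁆ = 0 := by
    apply MvPolynomial.derivation_ext
    simp [Derivation.commutator_apply, wickDer_X]
  have h2 := DFunLike.congr_fun h1 a
  rw [Derivation.commutator_apply] at h2
  exact sub_eq_zero.1 h2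

/-- Two constant-coefficient derivations see only the quadratic part of `injSum 2`; the correction
for coinciding variables is linear and drops out. -/
theorem wickDer_wickDer_injSum (h h' : Fin H) (k k' : ℕ) (v v' : ℂ[X])
    (τ : Fin 2 → Fin H × ℕ) :
    wickDer h k v (wickDer h' k' v' (injSum 2 τ)) = algebraMap ℂ (PSRing H)
      (wickCoef h k v (τ 0) * wickCoef h' k' v' (τ 1) +
        wickCoef h k v (τ 1) * wickCoef h' k' v' (τ 0)) := by
  have h1 : ∃ e : PSRing H, injSum 2 τ = MvPolynomial.X (τ 0) * MvPolynomial.X (τ 1) - e ∧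
      wickDer h k v (wickDer h' k' v' e) = 0 := by
    refine ⟨if (τ 0).1 = (τ 1).1 then MvPolynomial.X ((τ 0).1, (τ 0).2 + (τ 1).2 + 1) else 0, ?_, ?_⟩
    · simp [injSum]
    grind [wickDer_X, Derivation.map_algebraMap]
  grind [sub_zero, Derivation.leibniz, wickDer_X, smul_eq_mul, Derivation.map_algebraMap, smul_zero]

/-- The two orders in which the derivations can hit the two variables agree by the symmetry of `G`,
which cancels the factor `1/2!`. -/
theorem wickDer_dualFun_pairPart (h h' : Fin H) (k k' : ℕ) (v v' : ℂ[X]) (D : ℕ)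
    {G : Fin H × ℕ → Fin H × ℕ → ℂ} (hG : ∀ p q, G p q = G q p) :
    wickDer h k v (dualFun k' v' (pairPart h' D G)) = algebraMap ℂ (PSRing H)
      (∑ b ∈ range D, ∑ b' ∈ range D, G (h, b) (h', b') *
        ((((b : ℂ) + 1) * dualCoef k v b) * (((b' : ℂ) + 1) * dualCoef k' v' b'))) := by
  have h1 : dualFun k' v' (pairPart h' D G) = (2 : ℂ)⁻¹ • ∑ τ : Fin 2 → Fin H × Fin D,
      G ((τ 0).1, ((τ 0).2 : ℕ)) ((τ 1).1, ((τ 1).2 : ℕ)) •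
        wickDer h' k' v' (injSum 2 fun t => ((τ t).1, ((τ t).2 : ℕ))) := by
    unfold pairPart
    aesop
  rw [h1, Derivation.map_smul, map_sum]
  simp only [Derivation.map_smul, wickDer_wickDer_injSum]
  simp only [Algebra.smul_def, ← map_mul, ← map_sum]
  congr 1
  rw [sum_fin_two_arrow (fun p q : Fin H × Fin D => G (p.1, (p.2 : ℕ)) (q.1, (q.2 : ℕ)) *
      (wickCoef h k v (p.1, (p.2 : ℕ)) * wickCoef h' k' v' (q.1, (q.2 : ℕ)) +
        wickCoef h k v (q.1, (q.2 : ℕ)) * wickCoef h' k' v' (p.1, (p.2 : ℕ))))]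
  simp only [mul_add, sum_add_distrib]
  have h2 : ∑ p : Fin H × Fin D, ∑ q : Fin H × Fin D, G (p.1, (p.2 : ℕ)) (q.1, (q.2 : ℕ)) *
        (wickCoef h k v (q.1, (q.2 : ℕ)) * wickCoef h' k' v' (p.1, (p.2 : ℕ)))
      = ∑ p : Fin H × Fin D, ∑ q : Fin H × Fin D, G (p.1, (p.2 : ℕ)) (q.1, (q.2 : ℕ)) *
        (wickCoef h k v (p.1, (p.2 : ℕ)) * wickCoef h' k' v' (q.1, (q.2 : ℕ))) := by
    rw [sum_comm]
    grind
  rw [h2, ← two_mul, ← mul_assoc, mul_inv_cancel₀ two_ne_zero, one_mul, Fintype.sum_prod_type,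
    sum_eq_single h]
  · rw [sum_range]
    refine sum_congr rfl fun b _ => ?_
    rw [Fintype.sum_prod_type, sum_eq_single h', sum_range]
    · refine sum_congr rfl fun b' _ => ?_
      simp [wickCoef]
    · intro h'' _ hh
      simp [wickCoef, hh]
    simp
  · intro h'' _ hh
    simp [wickCoef, hh]
  simp

/-- The coefficients of `mulPart`. -/
def tailCoef (k : ℕ) (v : ℂ[X]) (b : ℕ) : ℂ :=
  ∑ p ∈ antidiagonal k,
    ((k.factorial : ℂ) * ((p.2.factorial : ℂ)⁻¹ * (p.1.factorial : ℂ)⁻¹)) *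
      ((1 + Polynomial.X) ^ k * v ^ p.2).coeff (p.1 + 1 + b)

/-- `mulPart` is linear in the power sums of its own group, with coefficients `tailCoef`. Hence it
contracts to zero with other groups, and the bound `K` makes the contraction a fixed finite sum. -/
theorem wickDer_mulPart (h h' : Fin H) (k k' : ℕ) (v v' : ℂ[X]) {K : ℕ}
    (hK : ∀ b, K ≤ b → dualCoef k v b = 0) :
    wickDer h k v (mulPart h' k' v') = algebraMap ℂ (PSRing H)
      (if h = h' then ∑ b ∈ range K, ((b : ℂ) + 1) * dualCoef k v b * tailCoef k' v' b
        else 0) := by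
  have h1 : ∀ (j : ℕ) (f : ℂ[X]), wickDer h k v (tailSum h' j f)
      = algebraMap ℂ (PSRing H) (if h = h' then
        ∑ b ∈ range K, ((b : ℂ) + 1) * dualCoef k v b * f.coeff (j + 1 + b) else 0) := by
    intro j f
    induction f using Polynomial.induction_on' with
    | add p q hp hq =>
      rw [map_add, map_add, hp, hq, ← map_add]
      congr 1
      split_ifs
      · rw [← sum_add_distrib]
        refine sum_congr rfl fun b _ => ?_
        rw [Polynomial.coeff_add]
        ring
      · rw [add_zero]
    | monomial c a =>
      rw [tailSum_monomial, Derivation.map_smul]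
      by_cases hc : j + 1 ≤ c
      · rw [if_pos hc, wickDer_X, Algebra.smul_def, ← map_mul]
        congr 1
        unfold wickCoef
        simp only
        by_cases hh : h = h'
        · rw [if_pos hh.symm, if_pos hh]
          by_cases hcK : c - j - 1 < K
          · rw [sum_eq_single (c - j - 1)]
            · rw [Polynomial.coeff_monomial, if_pos (by omega)]
              ring
            · intro b _ hb
              rw [Polynomial.coeff_monomial, if_neg (by omega), mul_zero]
            grind
          · rw [hK _ (by omega), mul_zero, mul_zero]
            symm
            refine sum_eq_zero fun b hb => ?_
            have := mem_range.1 hb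
            rw [Polynomial.coeff_monomial, if_neg (by omega), mul_zero]
        grind
      · rw [if_neg hc, map_zero, smul_zero]
        symm
        rw [← map_zero (algebraMap ℂ (PSRing H))]
        congr 1
        split_ifs
        · refine sum_eq_zero fun b hb => ?_
          rw [Polynomial.coeff_monomial, if_neg (by omega), mul_zero]
        · rfl
  unfold mulPart tailCoef
  rw [map_sum]
  simp only [Derivation.map_smul, h1]
  simp only [Algebra.smul_def, ← map_mul, ← map_sum]
  congr 1
  split_ifs
  · simp only [mul_sum]
    rw [sum_comm]
    grind
  · simp

end GammaAsymptotics

end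

section

open Finset
open scoped Polynomial

/-! ### Inserting power sums at one level -/

section ChainMoments

open MvPowerSeries

variable {H : ℕ}

/-- The power sum of the normalized shifted coordinates of one group. -/
def popVal {ν : Fin H → ℕ} (h : Fin H) (k : ℕ) (ω : MultiSig ν) : ℝ :=
  ∑ i, ((shifted (ω h).1 i : ℝ) / (ν h : ℝ)) ^ k

theorem popVal_eq_sum_fallingSum {ν : Fin H → ℕ} (h : Fin H) (k : ℕ) (ω : MultiSig ν) :
    popVal h k ω = ∑ s ∈ range (k + 1),
      ((k.stirlingSecond s : ℝ) * ((ν h : ℝ)⁻¹) ^ k) * fallingSum (ω h) s := by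
  unfold popVal fallingSum
  simp only [mul_sum]
  rw [sum_comm]
  refine sum_congr rfl fun i _ => ?_
  rw [div_eq_mul_inv, mul_pow, pow_eq_sum_stirlingSecond, sum_mul]
  grind

theorem tempered_popVal {ν : Fin H → ℕ} (h : Fin H) (k : ℕ) :
    Tempered multiNorm fun ω : MultiSig ν => popVal h k ω := by
  simp only [popVal_eq_sum_fallingSum]
  exact Tempered.sum _ fun s _ => (tempered_const _).mul (tempered_fallingSum h s)

theorem hasJet_weightGF_sum {ν : Fin H → ℕ} {ι : Type} (I : Finset ι) {W : ι → MultiSig ν → ℝ}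
    (hW : ∀ i ∈ I, SmoothWeight multiNorm (W i)) {s : ι → MvPowerSeries (Fin H × ℕ) ℂ}
    (hs : ∀ i ∈ I, HasJet (weightGF (W i)) (s i)) (c : ι → ℝ)
    (hsm : SmoothWeight multiNorm fun ω => ∑ i ∈ I, c i * W i ω) :
    HasJet (weightGF fun ω => ∑ i ∈ I, c i * W i ω) (∑ i ∈ I, (c i : ℂ) • s i) := by
  obtain ⟨_, _, _, _, t, ht, hsum⟩ := hsm.weightGF
  have key : CoeffHasSum (fun ω => ((∑ i ∈ I, c i * W i ω : ℝ) : ℂ) • jetSchur ω)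
      (∑ i ∈ I, (c i : ℂ) • s i) := by
    have h1 : CoeffHasSum (fun ω => ∑ i ∈ I, (c i : ℂ) • ((W i ω : ℂ) • jetSchur ω))
        (∑ i ∈ I, (c i : ℂ) • s i) := by
      refine CoeffHasSum.sum _ fun i hi => ?_
      obtain ⟨_, _, _, _, t, ht, hsum⟩ := (hW i hi).weightGF
      obtain rfl := (hs i hi).unique ht
      intro α
      simp only [map_smul, smul_eq_mul]
      exact (by simpa using hsum α : HasSum (fun l => (W i l : ℂ) * coeff α (jetSchur l)) _).mul_left _
    intro α
    refine (h1 α).congr_arg fun ω => ?_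
    rw [map_sum]
    simp only [map_smul, smul_eq_mul]
    push_cast
    rw [sum_mul]
    grind
  rw [← hsum.unique key]
  exact ht

/-- Multiplication of the weight by a power sum is `popOp` on the polynomial `Y`, the factor `s`
being kept. The accuracies of `w` and of `Y` are separate, since that of `Y` decreases by `k` with
every insertion. -/
theorem exists_jet_mul_popVal {ν : Fin H → ℕ} {h : Fin H} {η : ℂ} (hη : η * ν h = 1)
    {W : MultiSig ν → ℝ} (hW : SmoothWeight multiNorm W) {s f : MvPowerSeries (Fin H × ℕ) ℂ}
    (hf : HasJet (weightGF W) f) {D E : ℤ} (hED : E ≤ D) {w : (PSRing H)[X]}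
    (hw : ∀ i < ν h, OrdGE D (pderiv ℂ (h, i) s - s * realizeAt ν (h, i) w)) {Y : PSRing H}
    (hY : OrdGE E (f - s * realize ν Y)) (k : ℕ) :
    ∃ f', HasJet (weightGF fun ω => W ω * popVal h k ω) f' ∧
      OrdGE (E - k) (f' - s * realize ν (popOp h η w k Y)) := by
  choose t ht ht' using fun l => hasJet_weightGF_mul_fallingSum hW hf h l
  have hη0 : η ≠ 0 := left_ne_zero_of_mul_eq_one hη
  have hηi : η = (ν h : ℂ)⁻¹ := eq_inv_of_mul_eq_one_left hη
  have e : ∀ ω, W ω * popVal h k ω = ∑ l ∈ range (k + 1),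
      ((k.stirlingSecond l : ℝ) * ((ν h : ℝ)⁻¹) ^ k) * (W ω * fallingSum (ω h) l) := by
    intro ω
    rw [popVal_eq_sum_fallingSum, mul_sum]
    grind
  refine ⟨∑ l ∈ range (k + 1),
    (((k.stirlingSecond l : ℝ) * ((ν h : ℝ)⁻¹) ^ k : ℝ) : ℂ) • t l, ?_, ?_⟩
  · simp only [e]
    refine hasJet_weightGF_sum (range (k + 1)) (W := fun l ω => W ω * fallingSum (ω h) l)
      (fun l _ => hW.mul_tempered (tempered_fallingSum h l)) (fun l _ => ht l) _ ?_
    have := hW.mul_tempered (tempered_popVal h k)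
    simpa only [e] using this
  · have h1 : ∀ l : ℕ, OrdGE (E - l) (η ^ (l + 1) • t l - s * realize ν (tOp h η w l Y)) := fun l =>
      ordGE_realize_tOp hη (fun i hi => (hw i hi).mono hED) Y hY l (ht' l)
    have h2 : (∑ l ∈ range (k + 1),
          (((k.stirlingSecond l : ℝ) * ((ν h : ℝ)⁻¹) ^ k : ℝ) : ℂ) • t l) -
          s * realize ν (popOp h η w k Y)
        = ∑ l ∈ range (k + 1), ((k.stirlingSecond l : ℂ) * η ^ (k - l) * η⁻¹) •
          (η ^ (l + 1) • t l - s * realize ν (tOp h η w l Y)) := by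
      unfold popOp
      rw [LinearMap.sum_apply, map_sum, mul_sum, ← sum_sub_distrib]
      refine sum_congr rfl fun l hl => ?_
      have hl' : l ≤ k := Nat.lt_succ_iff.1 (mem_range.1 hl)
      rw [smul_sub]
      have e1 : (((k.stirlingSecond l : ℝ) * ((ν h : ℝ)⁻¹) ^ k : ℝ) : ℂ)
          = (k.stirlingSecond l : ℂ) * η ^ (k - l) * η⁻¹ * η ^ (l + 1) := by
        push_cast
        grind [pow_succ, pow_add, Nat.sub_add_cancel]
      rw [e1]
      simp only [LinearMap.smul_apply, map_smul, smul_smul, mul_smul_comm, mul_assoc]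
    rw [h2]
    refine OrdGE.sum _ fun l hl => ((h1 l).mono ?_).smul _
    grind

theorem exists_jet_mul_list_popVal {ι : Type} {ν : Fin H → ℕ} {η : Fin H → ℂ}
    (hη : ∀ h, η h * ν h = 1) {W : MultiSig ν → ℝ} (hW : SmoothWeight multiNorm W)
    {s f : MvPowerSeries (Fin H × ℕ) ℂ} (hf : HasJet (weightGF W) f) {D E : ℤ} (hED : E ≤ D)
    {w : Fin H → (PSRing H)[X]}
    (hw : ∀ h, ∀ i < ν h, OrdGE D (pderiv ℂ (h, i) s - s * realizeAt ν (h, i) (w h)))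
    {Y : PSRing H} (hY : OrdGE E (f - s * realize ν Y)) (c : ι → Fin H) (k : ι → ℕ) (l : List ι) :
    ∃ f', HasJet (weightGF fun ω => W ω * (l.map fun j => popVal (c j) (k j) ω).prod) f' ∧
      OrdGE (E - (l.map k).sum) (f' - s * realize ν
        ((l.map fun j => popOp (c j) (η (c j)) (w (c j)) (k j)).prod Y)) := by
  induction l with
  | nil => aesop
  | cons j l ih =>
    obtain ⟨f₁, h1, h2⟩ := ih
    have hW' : SmoothWeight multiNorm
        fun ω => W ω * (l.map fun j => popVal (c j) (k j) ω).prod := by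
      refine hW.mul_tempered ?_
      clear h1 h2 hY
      induction l with
      | nil => simpa using tempered_one
      | cons j l ih =>
        simp only [List.map_cons, List.prod_cons]
        exact (tempered_popVal _ _).mul ih
    obtain ⟨f', h3, h4⟩ := exists_jet_mul_popVal (hη (c j)) hW' h1 (by omega) (hw (c j)) h2 (k j)
    grind [Module.End.mul_apply]

theorem restr_X (p : Fin H × ℕ → Prop) [DecidablePred p] (j : Fin H × ℕ) :
    restr p (X j : MvPowerSeries (Fin H × ℕ) ℂ) = if p j then X j else 0 := by
  ext α
  rw [coeff_restr, coeff_X]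
  by_cases hα : α = Finsupp.single j 1
  · aesop
  · rw [if_neg hα, ite_self]
    split_ifs <;> simp [coeff_X, hα]

/-- Setting superfluous `X` to zero turns power sums into power sums in fewer variables. The
polynomial in formal power sums therefore passes to the next level unchanged, although the number of
variables differs. -/
theorem restr_realize {ν' ν : Fin H → ℕ} (hν : ∀ h, ν h ≤ ν' h) (a : PSRing H) :
    restr (fun j : Fin H × ℕ => j.2 < ν j.1) (realize ν' a) = realize ν a := by
  induction a using MvPolynomial.induction_on with
  | C c =>
    have h1 : ∀ ν : Fin H → ℕ, realize ν (MvPolynomial.C c) = MvPowerSeries.C c := fun ν => by aesop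
    rw [h1, h1]
    ext α
    grind [coeff_restr, coeff_C]
  | add p q hp hq => grind
  | mul_X p j hp =>
    rw [map_mul, map_mul, hp, map_mul]
    congr 1
    rw [realize, realize, MvPolynomial.aeval_X, MvPolynomial.aeval_X, map_sum]
    rw [← sum_subset (range_mono (hν j.1))]
    · refine sum_congr rfl fun i hi => ?_
      rw [map_pow, restr_X, if_pos (mem_range.1 hi)]
    simp_all [map_pow, restr_X, if_neg, zero_pow]

theorem constantCoeff_realize (ν : Fin H → ℕ) (a : PSRing H) :
    constantCoeff (realize ν a) = MvPolynomial.aeval (fun _ => (0 : ℂ)) a := by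
  induction a using MvPolynomial.induction_on with
  | C c => aesop
  | add p q hp hq => grind
  | mul_X p j hp => simp [map_mul, realize]

/-- In a list sorted by level, passing from level `b` to its predecessor `a` prepends the factors of
level `a`; their operators are applied after those of the higher levels. -/
theorem filter_le_eq_append {ι α : Type} [LinearOrder α] (lev : ι → α) {a b : α} (hab : a < b)
    (h : ∀ x, a < x → b ≤ x) {l : List ι} (hl : l.Pairwise fun i j => lev i ≤ lev j) :
    l.filter (fun j => a ≤ lev j)
      = l.filter (fun j => lev j = a) ++ l.filter (fun j => b ≤ lev j) := by
  induction l with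
  | nil => rfl
  | cons j l ih =>
    rw [List.pairwise_cons] at hl
    have ih := ih hl.2
    rcases lt_trichotomy (lev j) a with hj | hj | hj
    · grind
    · grind
    · have h1 : (j :: l).filter (fun j => decide (lev j = a)) = [] := by
        rw [List.filter_eq_nil_iff]
        grind
      grind

theorem prod_filter_map_prod {ι α : Type} [Fintype α] [DecidableEq α] {R : Type*} [CommMonoid R]
    (lev : ι → α) (l : List ι) (g : α → ι → R) :
    ∏ a, ((l.filter fun j => lev j = a).map (g a)).prod = (l.map fun j => g (lev j) j).prod := by
  induction l with
  | nil => simp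
  | cons j l ih =>
    rw [List.map_cons, List.prod_cons, ← ih]
    rw [← mul_prod_erase _ _ (mem_univ (lev j)),
      ← mul_prod_erase univ _ (mem_univ (lev j)),
      List.filter_cons_of_pos (by simp), List.map_cons, List.prod_cons, mul_assoc]
    refine congrArg _ (congrArg _ (prod_congr rfl fun a ha => ?_))
    grind

end ChainMoments

end

section

open scoped Polynomial

/-! ### Joint moments over all levels as products of operators -/

section MultilevelMoments

open MvPowerSeries

variable {H : ℕ}

theorem tempered_list_popVal {ι : Type} {ν : Fin H → ℕ} (c : ι → Fin H) (k : ι → ℕ) (l : List ι) :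
    Tempered multiNorm fun ω : MultiSig ν => (l.map fun j => popVal (c j) (k j) ω).prod := by
  induction l with
  | nil => simpa using tempered_one
  | cons j l ih =>
    simp only [List.map_cons, List.prod_cons]
    exact (tempered_popVal _ _).mul ih

/-- The joint weights of the levels of the chain. -/
def chainWeight {M : ℕ} {n : Fin H → Fin (M + 1) → ℕ} (ρ : MultiSig (fun h => n h (Fin.last M)) → ℝ)
    (σ : ∀ (h : Fin H) (m : Fin M), PMF (Sig (n h m.castSucc)))
    (om : ∀ m, MultiSig fun h => n h m) : ℝ :=
  ρ (om (Fin.last M)) * ∏ m : Fin M, multiKernel (fun h => σ h m) (om m.succ) (om m.castSucc)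

theorem summable_chainWeight_mul {ι : Type} {M : ℕ} {n : Fin H → Fin (M + 1) → ℕ}
    (hn : ∀ h (m : Fin M), n h m.castSucc ≤ n h m.succ)
    {ρ : MultiSig (fun h => n h (Fin.last M)) → ℝ} (hρ : SmoothWeight multiNorm ρ)
    {σ : ∀ (h : Fin H) (m : Fin M), PMF (Sig (n h m.castSucc))} (hσ : ∀ h m, IsSmooth (σ h m))
    (c : ι → Fin H) (lev : ι → Fin (M + 1)) (k : ι → ℕ) (l : List ι) :
    Summable fun om => chainWeight ρ σ om *
      (l.map fun j => popVal (c j) (k j) (om (lev j))).prod := by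
  obtain ⟨_, _, _, _, h⟩ := exists_chain_weights (fun m => MultiSig fun h => n h m)
    (fun _ => multiNorm) ρ hρ (fun m => multiKernel fun h => σ h m)
    (fun m => smoothKernel_multiKernel (fun h => hn h m) fun h => hσ h m)
    (fun m ω => ((l.filter fun j => lev j = m).map fun j => popVal (c j) (k j) ω).prod)
    (fun m => tempered_list_popVal c k _)
  refine h.summable.congr fun om => ?_
  rw [prod_filter_map_prod lev l fun m j => popVal (c j) (k j) (om m)]
  rfl

/-- The weight is carried down the chain in the form `s · Y`: insertions change `Y`, steps down
change `s`. The conditions on `η` and `w` are only asked for a nonempty list, so that the total mass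
is obtained for every `L`, even if some levels are small or empty. -/
theorem hasSum_chainWeight_mul {ι : Type} {M : ℕ} {n : Fin H → Fin (M + 1) → ℕ}
    (hn : ∀ h (m : Fin M), n h m.castSucc ≤ n h m.succ)
    {ρ : MultiSig (fun h => n h (Fin.last M)) → ℝ} (hρ : SmoothWeight multiNorm ρ)
    {σ : ∀ (h : Fin H) (m : Fin M), PMF (Sig (n h m.castSucc))} (hσ : ∀ h m, IsSmooth (σ h m))
    {η : Fin H → Fin (M + 1) → ℂ} {s : Fin (M + 1) → MvPowerSeries (Fin H × ℕ) ℂ}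
    (hs : HasJet (weightGF ρ) (s (Fin.last M)))
    {γ : Fin H → Fin M → MvPowerSeries (Fin H × ℕ) ℂ}
    (hγ : ∀ h m, HasJet (fun x : Fin H × ℕ → ℂ => sgf (σ h m) fun i => x (h, i)) (γ h m))
    (hsγ : ∀ m : Fin M, s m.castSucc =
      restr (fun j : Fin H × ℕ => j.2 < n j.1 m.castSucc) (s m.succ) * ∏ h, γ h m)
    (hs1 : constantCoeff (s 0) = 1) {D : ℤ} {w : Fin H → Fin (M + 1) → (PSRing H)[X]}
    (c : ι → Fin H) (lev : ι → Fin (M + 1)) (k : ι → ℕ) {l : List ι} (hl0 : l ≠ [] → 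
      (∀ h m, η h m * n h m = 1) ∧ (∀ m h, ∀ i < n h m, OrdGE D
      (pderiv ℂ (h, i) (s m) - s m * realizeAt (fun h => n h m) (h, i) (w h m))))
    (hl : l.Pairwise fun i j => lev i ≤ lev j) (hD : ((l.map k).sum : ℤ) < D) :
    ∃ E : ℝ, HasSum (fun om => chainWeight ρ σ om *
        (l.map fun j => popVal (c j) (k j) (om (lev j))).prod) E ∧
      (E : ℂ) = MvPolynomial.aeval (fun _ => (0 : ℂ)) ((l.map fun j =>
        popOp (c j) (η (c j) (lev j)) (w (c j) (lev j)) (k j)).prod 1) := by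
  set O : ι → PSRing H →ₗ[ℂ] PSRing H := fun j =>
    popOp (c j) (η (c j) (lev j)) (w (c j) (lev j)) (k j) with hO
  set f : ∀ m, MultiSig (fun h => n h m) → ℝ := fun m ω =>
    ((l.filter fun j => lev j = m).map fun j => popVal (c j) (k j) ω).prod with hf
  have hft : ∀ m, Tempered multiNorm (f m) := fun m => tempered_list_popVal c k _
  obtain ⟨Wt, hW0, hW1, hW2, hsum⟩ := exists_chain_weights (fun m => MultiSig fun h => n h m)
    (fun _ => multiNorm) ρ hρ (fun m => multiKernel fun h => σ h m)
    (fun m => smoothKernel_multiKernel (fun h => hn h m) fun h => hσ h m) f hft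
  have hsublist : ∀ p : ι → Bool, ((l.filter p).map k).sum ≤ (l.map k).sum := fun p =>
    (List.filter_sublist.map k).sum_le_sum fun _ _ => Nat.zero_le _
  -- one level, given the jet of the weight before multiplication by the power sums
  have level : ∀ m F Y, HasJet (weightGF (Wt m)) F → ∀ E : ℤ, E ≤ D →
      OrdGE E (F - s m * realize (fun h => n h m) Y) →
      ∃ F', HasJet (weightGF fun ω => Wt m ω * f m ω) F' ∧
        OrdGE (E - ((l.filter fun j => lev j = m).map k).sum)
          (F' - s m * realize (fun h => n h m) (((l.filter fun j => lev j = m).map O).prod Y)) := by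
    intro m F Y hF E hE hFY
    by_cases hlnil : l = []
    · subst hlnil
      exact ⟨F, by simpa [hf] using hF, by simpa using hFY⟩
    obtain ⟨hη, hw⟩ := hl0 hlnil
    obtain ⟨F', h1, h2⟩ := exists_jet_mul_list_popVal (η := fun h => η h m) (fun h => hη h m) (hW1 m)
      hF hE (w := fun h => w h m) (hw m) hFY c k (l.filter fun j => lev j = m)
    grind [popOp, List.map_congr_left]
  -- Downward induction over the levels. The accuracy drops by the exponents inserted so far, while
  -- restriction and multiplication by the `γ` do not impair it.
  have key : ∀ m, ∃ F, HasJet (weightGF fun ω => Wt m ω * f m ω) F ∧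
      OrdGE (D - ((l.filter fun j => m ≤ lev j).map k).sum)
        (F - s m * realize (fun h => n h m) (((l.filter fun j => m ≤ lev j).map O).prod 1)) := by
    intro m
    induction m using Fin.reverseInduction with
    | last =>
      have e : (l.filter fun j => Fin.last M ≤ lev j) = l.filter fun j => lev j = Fin.last M :=
        List.filter_congr fun j _ => by simp [Fin.last_le_iff]
      rw [e]
      refine level _ (s (Fin.last M)) 1 (by rw [hW0]; exact hs) D le_rfl ?_
      rw [map_one, mul_one, sub_self]
      exact ordGE_zero _
    | cast m ih =>
      obtain ⟨F, h1, h2⟩ := ih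
      have e := filter_le_eq_append lev (Fin.castSucc_lt_succ (i := m))
        (fun x hx => Fin.castSucc_lt_iff_succ_le.1 hx) hl
      have h3 := hasJet_weightGF_push (fun h => hn h m) (σ := fun h => σ h m) (fun h => hσ h m)
        ((hW1 m.succ).mul_tempered (hft m.succ)) h1 (fun h => hγ h m)
      have h4 : HasJet (weightGF (Wt m.castSucc))
          (restr (fun j : Fin H × ℕ => j.2 < n j.1 m.castSucc) F * ∏ h, γ h m) := by
        have : Wt m.castSucc = fun μ => ∑' ω, Wt m.succ ω * f m.succ ω *
          multiKernel (fun h => σ h m) ω μ := funext (hW2 m)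
        rw [this]
        exact h3
      obtain ⟨F', h5, h6⟩ := level m.castSucc _ (((l.filter fun j => m.succ ≤ lev j).map O).prod 1)
        h4 (D - ((l.filter fun j => m.succ ≤ lev j).map k).sum) (by omega) (by
          have := (h2.restr (fun j : Fin H × ℕ => j.2 < n j.1 m.castSucc)).mul_right (∏ h, γ h m)
          grind [restr_realize])
      refine ⟨F', h5, ?_⟩
      rw [e, List.map_append, List.map_append, List.prod_append, List.sum_append,
        Module.End.mul_apply]
      grind
  obtain ⟨F, h1, h2⟩ := key 0
  have e0 : (l.filter fun j => (0 : Fin (M + 1)) ≤ lev j) = l :=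
    List.filter_eq_self.2 fun j _ => by simp
  rw [e0] at h2
  refine ⟨∑' μ, Wt 0 μ * f 0 μ, ?_, ?_⟩
  · refine hsum.congr_arg fun om => ?_
    rw [prod_filter_map_prod lev l fun m j => popVal (c j) (k j) (om m)]
    rfl
  · rw [← weightGF_one, h1.value]
    -- The remaining accuracy `D - ∑ k` is positive, so the constant coefficient, which is the
    -- expectation, is exact.
    have h3 := h2 0 (by simpa using hD)
    rw [map_sub, sub_eq_zero] at h3
    have h4 : constantCoeff F = constantCoeff (s 0 * realize (fun h => n h 0)
      ((l.map O).prod 1)) := h3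
    rw [h4, map_mul, hs1, one_mul, constantCoeff_realize]

end MultilevelMoments

end

section

open Finset

/-! ### Taylor series of the generating functions of the levels -/

section LevelJets

open MvPowerSeries

/-- The symmetry is available on the annulus only. Replacing `F` by zero outside this invariant set
makes it hold everywhere and leaves `F` unchanged near one. -/
theorem HasJet.coeff_mapDomain_of_annulus {J : Type} [DecidableEq J] {F : (J → ℂ) → ℂ}
    {f : MvPowerSeries J ℂ} (h : HasJet F f) (e : J ≃ J)
    (he : ∀ x ∈ annulus J 2, F (x ∘ e) = F x) (α : J →₀ ℕ) :
    coeff (α.mapDomain e) f = coeff α f := by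
  classical
  have hmem : ∀ x : J → ℂ, x ∘ e ∈ annulus J 2 ↔ x ∈ annulus J 2 := fun x =>
    ⟨fun hx j => by simpa using hx (e.symm j), fun hx j => hx _⟩
  have h1 : HasJet (fun x => if x ∈ annulus J 2 then F x else 0) f :=
    h.congr (δ := 1 - 2⁻¹) (by norm_num) fun x hx => by
      rw [if_pos (polydisc_subset_annulus one_lt_two hx)]
  refine h1.coeff_mapDomain e (fun x => ?_) α
  grind

theorem constantCoeff_restr {J : Type} (p : J → Prop) [DecidablePred p] (f : MvPowerSeries J ℂ) :
    constantCoeff (restr p f) = constantCoeff f := by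
  rw [← coeff_zero_eq_constantCoeff_apply, restr, coeff_rescale]
  simp

variable {H : ℕ}

theorem pderiv_restr {p : Fin H × ℕ → Prop} [DecidablePred p] {j : Fin H × ℕ} (hj : p j)
    (f : MvPowerSeries (Fin H × ℕ) ℂ) : pderiv ℂ j (restr p f) = restr p (pderiv ℂ j f) := by
  ext α
  grind [coeff_pderiv, coeff_restr, Finsupp.single, Finsupp.add_apply, Finsupp.single_eq_of_ne,
      add_zero]

theorem restr_restr {p q : Fin H × ℕ → Prop} [DecidablePred p] [DecidablePred q]
    (h : ∀ j, p j → q j) (f : MvPowerSeries (Fin H × ℕ) ℂ) : restr p (restr q f) = restr p f := by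
  ext α
  rw [coeff_restr, coeff_restr, coeff_restr]
  grind

theorem multiSGF_perm {ν : Fin H → ℕ} (ρ : PMF (MultiSig ν)) {σ : Fin H → Equiv.Perm ℕ}
    (hσ : ∀ h i, ν h ≤ i → σ h i = i) {x : Fin H × ℕ → ℂ} (hx : x ∈ annulus (Fin H × ℕ) 2) :
    multiSGF ρ (x ∘ Equiv.prodCongrRight σ) = multiSGF ρ x :=
  tsum_congr fun lam => congrArg _ (prod_congr rfl fun h _ =>
    normSchur_perm (lam h) (hσ h) one_le_two (x := fun i => x (h, i)) fun _ => hx _)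

theorem multiSGF_one {ν : Fin H → ℕ} (ρ : PMF (MultiSig ν)) : multiSGF ρ (fun _ => 1) = 1 := by
  unfold multiSGF
  simp only [normSchur_one, prod_const_one, mul_one]
  rw [← Complex.ofReal_tsum, ← ENNReal.tsum_toReal_eq (fun a => ρ.apply_ne_top a), ρ.tsum_coe]
  simp

theorem IsSmoothMulti.smoothWeight {ν : Fin H → ℕ} {ρ : PMF (MultiSig ν)} (hρ : IsSmoothMulti ρ) :
    SmoothWeight multiNorm fun ω => (ρ ω).toReal := by
  obtain ⟨r, hr, hs⟩ := hρ
  refine ⟨r, hr, hs.congr fun ω => ?_⟩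
  rw [abs_of_nonneg ENNReal.toReal_nonneg]
  have : ∑ h, ∑ i, |(ω h).1 i| = ((multiNorm ω : ℕ) : ℤ) := by simp [multiNorm, sigNorm]
  rw [this, zpow_natCast]

theorem sgf_comp_spec {n : ℕ} {σ : PMF (Sig n)} (hσ : IsSmooth σ) (h : Fin H) :
    ∃ γ ℓ : MvPowerSeries (Fin H × ℕ) ℂ,
      HasJet (fun x : Fin H × ℕ → ℂ => sgf σ fun i => x (h, i)) γ ∧
      HasJet (fun x : Fin H × ℕ → ℂ => Complex.log (sgf σ fun i => x (h, i))) ℓ ∧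
      (∀ j, pderiv ℂ j γ = γ * pderiv ℂ j ℓ) ∧ constantCoeff γ = 1 ∧
      ∀ p : Fin H × ℕ → Prop, ∀ [DecidablePred p], (∀ i < n, p (h, i)) → restr p γ = γ := by
  obtain ⟨R, hR, G, hG⟩ := sgf_spec hσ
  have h1 : IsLaurent R G fun x : Fin H × ℕ → ℂ => sgf σ fun i => x (h, i) :=
    hG.comp (prodMk_injective h)
  obtain ⟨γ, hγ⟩ := h1.exists_hasJet hR
  obtain ⟨ℓ, hℓ, hd⟩ := h1.exists_log hR (sgf_one σ) hγ
  refine ⟨γ, ℓ, hγ, hℓ, hd, ?_, fun p _ hp => ?_⟩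
  · rw [← hγ.value]
    exact sgf_one σ
  · have h2 := HasJet.setOne p hR h1 hγ
    refine h2.unique ?_
    simp_all [sgf_congr, setOne]

theorem symBelow_log_sgf {n : ℕ} {σ : PMF (Sig n)} {h : Fin H} {ℓ : MvPowerSeries (Fin H × ℕ) ℂ}
    (hℓ : HasJet (fun x : Fin H × ℕ → ℂ => Complex.log (sgf σ fun i => x (h, i))) ℓ)
    {ν : Fin H → ℕ} (hν : ν h ≤ n) : SymBelow ν ℓ := by
  intro τ hτ α
  refine hℓ.coeff_mapDomain_of_annulus _ (fun x hx => ?_) α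
  refine congrArg Complex.log ?_
  exact sgf_perm σ (fun i hi => hτ h i (hν.trans hi)) one_le_two (x := fun i => x (h, i))
    fun i => hx _

theorem SymBelow.add {ν : Fin H → ℕ} {f g : MvPowerSeries (Fin H × ℕ) ℂ} (hf : SymBelow ν f)
    (hg : SymBelow ν g) : SymBelow ν (f + g) := fun τ hτ α => by
  rw [map_add, map_add, hf τ hτ, hg τ hτ]

theorem SymBelow.sum {ν : Fin H → ℕ} {ι : Type} (s : Finset ι)
    {f : ι → MvPowerSeries (Fin H × ℕ) ℂ} (hf : ∀ i ∈ s, SymBelow ν (f i)) :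
    SymBelow ν (∑ i ∈ s, f i) := fun τ hτ α => by
  rw [map_sum, map_sum]
  exact sum_congr rfl fun i hi => hf i hi τ hτ α

theorem pderiv_prod_of_log {J ι : Type} [DecidableEq J] (s : Finset ι)
    {γ ℓ : ι → MvPowerSeries J ℂ} (j : J) (h : ∀ i ∈ s, pderiv ℂ j (γ i) = γ i * pderiv ℂ j (ℓ i)) :
    pderiv ℂ j (∏ i ∈ s, γ i) = (∏ i ∈ s, γ i) * pderiv ℂ j (∑ i ∈ s, ℓ i) := by
  classical
  induction s using Finset.induction_on with
  | empty => simp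
  | insert a s ha ih =>
    grind [prod_insert, sum_insert, Derivation.leibniz, mem_insert_of_mem, mem_insert_self,
        smul_eq_mul]

/-- The joint moments of the power sums of the chain in terms of the operators `popOp`. -/
theorem exists_jets_chain_moments {M : ℕ} {n : Fin H → Fin (M + 1) → ℕ} (hn : ∀ h, Monotone (n h))
    {ρ : PMF (MultiSig fun h => n h (Fin.last M))} (hρ : IsSmoothMulti ρ)
    {σ : ∀ (h : Fin H) (m : Fin M), PMF (Sig (n h m.castSucc))} (hσ : ∀ h m, IsSmooth (σ h m)) :
    ∃ (g : MvPowerSeries (Fin H × ℕ) ℂ) (ℓ : Fin H → Fin M → MvPowerSeries (Fin H × ℕ) ℂ),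
      HasJet (fun x => Complex.log (multiSGF ρ x)) g ∧
      (∀ h m, HasJet (fun x : Fin H × ℕ → ℂ => Complex.log (sgf (σ h m) fun i => x (h, i)))
        (ℓ h m)) ∧
      ∀ {ι : Type} (D : ℕ) (c : ι → Fin H) (lev : ι → Fin (M + 1)) (k : ι → ℕ) (l : List ι),
        l.Pairwise (fun i j => lev i ≤ lev j) → (l.map k).sum < D →
        (l ≠ [] → ∀ h m, D ≤ n h m) →
        ∃ E : ℝ, HasSum (fun om => chainWeight (fun ω => (ρ ω).toReal) σ om *
            (l.map fun j => popVal (c j) (k j) (om (lev j))).prod) E ∧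
          (E : ℂ) = MvPolynomial.aeval (fun _ => (0 : ℂ)) ((l.map fun j =>
            popOp (c j) ((n (c j) (lev j) : ℂ)⁻¹) (deltaDer (c j) (gammaPoly D fun α =>
              coeff α (g + ∑ q : Fin M with lev j ≤ q.castSucc, ∑ h, ℓ h q))) (k j)).prod 1) := by
  have hW := hρ.smoothWeight
  obtain ⟨R, B, hR, hL, s, hs, _⟩ := hW.weightGF
  have hsgf : weightGF (fun ω => (ρ ω).toReal) = multiSGF ρ := rfl
  have hone : weightGF (fun ω => (ρ ω).toReal) (fun _ => 1) = 1 := multiSGF_one ρ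
  obtain ⟨g, hg, hgd⟩ := hL.exists_log hR hone hs
  choose γ ℓ hγ hℓ hd hγ1 hγr using fun h m => sgf_comp_spec (H := H) (hσ h m) h
  refine ⟨g, ℓ, hg, hℓ, ?_⟩
  intro ι D c lev k l hl hD hDn
  let p : Fin (M + 1) → Fin H × ℕ → Prop := fun m j => j.2 < n j.1 m
  -- The generating function at level `m`, before superfluous variables are removed, with logarithm
  -- `G m`. All restrictions may be postponed to the end, because each `γ` already lives in the
  -- variables of its own level and later restrictions are stronger.
  let S : Fin (M + 1) → MvPowerSeries (Fin H × ℕ) ℂ := fun m =>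
    s * ∏ q : Fin M with m ≤ q.castSucc, ∏ h, γ h q
  let G : Fin (M + 1) → MvPowerSeries (Fin H × ℕ) ℂ := fun m =>
    g + ∑ q : Fin M with m ≤ q.castSucc, ∑ h, ℓ h q
  have hlast : (univ.filter fun q : Fin M => Fin.last M ≤ q.castSucc) = ∅ := by simp
  have hsucc : ∀ m : Fin M, (univ.filter fun q : Fin M => m.castSucc ≤ q.castSucc)
      = insert m (univ.filter fun q : Fin M => m.succ ≤ q.castSucc) := by grind
  have hnot : ∀ m : Fin M, m ∉ univ.filter fun q : Fin M => m.succ ≤ q.castSucc := by simp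
  have hrestr : restr (p (Fin.last M)) s = s := by
    refine (HasJet.setOne (p (Fin.last M)) hR hL hs).unique ?_
    convert hs using 2 with x
    refine tsum_congr fun ω => congrArg _ (prod_congr rfl fun h _ =>
      normSchur_congr _ fun i hi => ?_)
    simp [setOne, p, hi]
  have hder : ∀ m j, pderiv ℂ j (S m) = S m * pderiv ℂ j (G m) := by
    grind [pderiv_prod_of_log, univ, Derivation.leibniz, smul_eq_mul]
  have hsym : ∀ m, SymBelow (fun h => n h m) (G m) := by
    intro m
    refine SymBelow.add ?_ (SymBelow.sum _ fun q hq => SymBelow.sum _ fun h _ =>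
      symBelow_log_sgf (hℓ h q) (hn h (mem_filter.1 hq).2))
    intro τ hτ α
    refine hg.coeff_mapDomain_of_annulus _ (fun x hx => ?_) α
    exact congrArg Complex.log
      (multiSGF_perm ρ (fun h i hi => hτ h i ((hn h (Fin.le_last m)).trans hi)) hx)
  refine hasSum_chainWeight_mul (η := fun h m => (n h m : ℂ)⁻¹) (s := fun m => restr (p m) (S m))
    (γ := γ) (D := D) (w := fun h m => deltaDer h (gammaPoly D fun α => coeff α (G m)))
    (fun h m => hn h (Fin.castSucc_lt_succ (i := m)).le) hW hσ ?_ hγ ?_ ?_ c lev k ?_ hl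
    (by exact_mod_cast hD)
  · aesop
  · intro m
    have h1 : ∀ h, restr (p m.castSucc) (γ h m) = γ h m := fun h => hγr h m _ fun i hi => hi
    have h2 : S m.castSucc = S m.succ * ∏ h, γ h m := by
      simp only [S]
      rw [hsucc, prod_insert (hnot m)]
      ring
    have h3 : restr (p m.castSucc) (restr (p m.succ) (S m.succ)) = restr (p m.castSucc) (S m.succ) :=
      restr_restr (fun j hj => lt_of_lt_of_le hj (hn j.1 (Fin.castSucc_lt_succ (i := m)).le)) _
    show restr (p m.castSucc) (S m.castSucc) = restr (p m.castSucc) (restr (p m.succ) (S m.succ)) * _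
    simp_all
  · rw [constantCoeff_restr]
    simp only [S]
    rw [map_mul, map_prod, ← hs.value, hone, one_mul]
    simp_all
  · intro hlnil
    have hDn := hDn hlnil
    refine ⟨fun h m => inv_mul_cancel₀ ?_, fun m h i hi => ?_⟩
    · grind [Nat.cast_ne_zero]
    · have hpi : p m (h, i) := hi
      have h1 := ((ordGE_sub_realize_gammaPoly (hsym m) D fun h => hDn h m).pderiv (h, i)).mul_left
        (restr (p m) (S m))
      rw [add_sub_cancel_right, map_sub, pderiv_realize (ν := fun h => n h m) hi] at h1
      have h2 : pderiv ℂ (h, i) (restr (p m) (S m))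
          = restr (p m) (S m) * pderiv ℂ (h, i) (restr (p m) (G m)) := by
        simp_all [pderiv_restr, map_mul]
      grind

end LevelJets

end

section

/-! ### Translation to the law of the configurations -/

section ConfigMoments

open MvPowerSeries

variable {H M : ℕ} {n : Fin H → Fin (M + 1) → ℕ}

theorem chainProb_eq_chainWeight (ρ : PMF (MultiSig fun h => n h (Fin.last M)))
    (σ : ∀ (h : Fin H) (m : Fin M), PMF (Sig (n h m.castSucc))) (om : Config n) :
    chainProb ρ (fun h m => sgf (σ h m)) om
      = chainWeight (fun ω => (ρ ω).toReal) σ fun m h => om h m := by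
  unfold chainProb chainWeight multiKernel
  rw [Finset.prod_comm]

theorem powerSum_eq_popVal (k : ℕ) (h : Fin H) (m : Fin (M + 1)) (om : Config n) :
    powerSum k h m om = popVal (ν := fun h => n h m) h k fun h => om h m := by
  unfold powerSum popVal shifted
  refine Finset.sum_congr rfl fun i _ => ?_
  push_cast
  congr 2
  ring

theorem hasSum_config_iff {f : (∀ m, MultiSig fun h => n h m) → ℝ} {E : ℝ} :
    HasSum (fun om : Config n => f fun m h => om h m) E ↔ HasSum f E :=
  (Equiv.piComm fun (h : Fin H) (m : Fin (M + 1)) => Sig (n h m)).hasSum_iff (f := f)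

theorem prod_filter_mem_eq {ι R : Type*} [DecidableEq ι] [CommMonoid R] {l : List ι} (hl : l.Nodup)
    (hl' : ∀ j, j ∈ l) (U : Finset ι) (f : ι → R) :
    ((l.filter (· ∈ U)).map f).prod = ∏ j ∈ U, f j := by
  have h1 : (l.filter (· ∈ U)).toFinset = U := by
    ext x
    simp [hl' x]
  rw [← List.prod_toFinset f (hl.filter _), h1]

theorem summable_chainProb_mul_powerSum (hn : ∀ h, Monotone (n h))
    {ρ : PMF (MultiSig fun h => n h (Fin.last M))} (hρ : IsSmoothMulti ρ)
    {σ : ∀ (h : Fin H) (m : Fin M), PMF (Sig (n h m.castSucc))} (hσ : ∀ h m, IsSmooth (σ h m))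
    {r : ℕ} (t : Fin r → ℕ × Fin H × Fin (M + 1)) :
    Summable fun om : Config n => chainProb ρ (fun h m => sgf (σ h m)) om *
      ∏ j, powerSum (t j).1 (t j).2.1 (t j).2.2 om := by
  have h1 := summable_chainWeight_mul (fun h m => hn h (Fin.castSucc_lt_succ (i := m)).le)
    hρ.smoothWeight hσ (fun j => (t j).2.1) (fun j => (t j).2.2) (fun j => (t j).1)
    (List.finRange r)
  have h2 := (hasSum_config_iff.2 h1.hasSum).summable
  refine h2.congr fun om => ?_
  rw [chainProb_eq_chainWeight, ← List.prod_ofFn, List.ofFn_eq_map]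
  simp only [powerSum_eq_popVal]

/-- The evaluation of polynomials in the power sums at the origin. -/
def evalZero (H : ℕ) : PSRing H →ₐ[ℂ] ℂ := MvPolynomial.aeval fun _ => 0

theorem exists_jets_expect_powerSum (hn : ∀ h, Monotone (n h))
    {ρ : PMF (MultiSig fun h => n h (Fin.last M))} (hρ : IsSmoothMulti ρ)
    {σ : ∀ (h : Fin H) (m : Fin M), PMF (Sig (n h m.castSucc))} (hσ : ∀ h m, IsSmooth (σ h m)) :
    HasSum (chainProb ρ fun h m => sgf (σ h m)) 1 ∧
    ∃ (g : MvPowerSeries (Fin H × ℕ) ℂ) (ℓ : Fin H → Fin M → MvPowerSeries (Fin H × ℕ) ℂ),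
      HasJet (fun x => Complex.log (multiSGF ρ x)) g ∧
      (∀ h m, HasJet (fun x : Fin H × ℕ → ℂ => Complex.log (sgf (σ h m) fun i => x (h, i)))
        (ℓ h m)) ∧
      ∀ {ι : Type} [DecidableEq ι] (D : ℕ) (t : ι → ℕ × Fin H × Fin (M + 1)) (l : List ι),
        l.Nodup → (∀ j, j ∈ l) → l.Pairwise (fun i j => (t i).2.2 ≤ (t j).2.2) →
        (l.map fun j => (t j).1).sum < D → (∀ h m, D ≤ n h m) → ∀ U : Finset ι,
        (expect (chainProb ρ fun h m => sgf (σ h m))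
            (fun om => ∏ j ∈ U, powerSum (t j).1 (t j).2.1 (t j).2.2 om) : ℂ)
          = opMoment (evalZero H) l (fun j => popOp (t j).2.1 ((n (t j).2.1 (t j).2.2 : ℂ)⁻¹)
            (deltaDer (t j).2.1 (gammaPoly D fun α => coeff α
              (g + ∑ q : Fin M with (t j).2.2 ≤ q.castSucc, ∑ h, ℓ h q))) (t j).1) U := by
  obtain ⟨g, ℓ, hg, hℓ, h⟩ := exists_jets_chain_moments hn hρ hσ
  refine ⟨?_, g, ℓ, hg, hℓ, ?_⟩
  -- The empty list of insertions gives the total mass, without any assumption on the sizes of the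
  -- levels.
  · obtain ⟨E, h1, h2⟩ := h (ι := Empty) 1 Empty.elim Empty.elim Empty.elim [] List.Pairwise.nil
      (by simp) (by simp)
    have hE : E = 1 := by simpa using h2
    subst hE
    refine (hasSum_config_iff.2 h1).congr_arg fun om => ?_
    rw [chainProb_eq_chainWeight]
    simp
  · intro ι _ D t l hl hl' hsort hD hDn U
    obtain ⟨E, h1, h2⟩ := h D (fun j => (t j).2.1) (fun j => (t j).2.2) (fun j => (t j).1)
      (l.filter (· ∈ U)) (hsort.filter _)
      (lt_of_le_of_lt ((List.filter_sublist.map _).sum_le_sum fun _ _ => Nat.zero_le _) hD)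
      fun _ => hDn
    have h3 : expect (chainProb ρ fun h m => sgf (σ h m))
        (fun om => ∏ j ∈ U, powerSum (t j).1 (t j).2.1 (t j).2.2 om) = E := by
      refine HasSum.tsum_eq ((hasSum_config_iff.2 h1).congr_arg fun om => ?_)
      rw [chainProb_eq_chainWeight]
      beta_reduce
      rw [← prod_filter_mem_eq hl hl']
      simp only [powerSum_eq_popVal]
    rw [h3, h2]
    rfl

end ConfigMoments

end

section

open Finset Function

/-! ### CLT-appropriateness in terms of Taylor coefficients -/

section JetAsymptotics

open MvPowerSeries

/-- The iterated derivatives at the origin of a formal power series. -/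
def jetDeriv {J : Type} (l : List J) : MvPowerSeries J ℂ →ₗ[ℂ] ℂ :=
  multiFactorial (listIndex l) • coeff (listIndex l)

theorem jetDeriv_apply {J : Type} (l : List J) (f : MvPowerSeries J ℂ) :
    jetDeriv l f = multiFactorial (listIndex l) * coeff (listIndex l) f := rfl

theorem HasJet.derivAtOne_eq_jetDeriv {J : Type} [DecidableEq J] {F : (J → ℂ) → ℂ}
    {f : MvPowerSeries J ℂ} (h : HasJet F f) (l : List J) : derivAtOne l F = jetDeriv l f :=
  h.derivAtOne_coeff l

theorem listIndex_append {J : Type} (l l' : List J) :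
    listIndex (l ++ l') = listIndex l + listIndex l' := by
  unfold listIndex
  simp

theorem listIndex_replicate {J : Type} (k : ℕ) (j : J) :
    listIndex (List.replicate k j) = Finsupp.single j k := by
  unfold listIndex
  simp

theorem listIndex_apply_ne_zero {J : Type} {l : List J} {j : J} (hj : j ∈ l) :
    listIndex l j ≠ 0 := by
  induction l with
  | nil => simp at hj
  | cons i l ih =>
    have h1 : listIndex (i :: l) = Finsupp.single i 1 + listIndex l := by simp [listIndex]
    aesop

theorem jetDeriv_eq_zero {J : Type} [DecidableEq J] {f : MvPowerSeries J ℂ} {l : List J} {j : J}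
    (hj : j ∈ l) (hf : pderiv ℂ j f = 0) : jetDeriv l f = 0 := by
  have h0 := listIndex_apply_ne_zero hj
  have h1 : coeff (listIndex l - Finsupp.single j 1) (pderiv ℂ j f) = 0 := by rw [hf, map_zero]
  rw [coeff_pderiv, tsub_add_cancel_of_le] at h1
  · simp_all [jetDeriv_apply, mul_eq_zero_of_right, mul_eq_zero, Nat.cast_add_one_ne_zero]
  · rw [Finsupp.single_le_iff]; omega

variable {H : ℕ}

/-- The conditions of `CLTAppropriate` on the Taylor series at `1`, with prescribed limits. -/
structure JetCLT (ν : ℕ → Fin H → ℝ) (g : ℕ → MvPowerSeries (Fin H × ℕ) ℂ) (c : ℕ → Fin H → ℝ)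
    (d : ℕ → Fin H → ℕ → Fin H → ℝ) : Prop where
  one : ∀ k, 1 ≤ k → ∀ h i, Tendsto (fun L => (1 / (ν L h : ℂ)) *
    jetDeriv (List.replicate k (h, i)) (g L)) atTop (𝓝 (c k h : ℂ))
  two : ∀ k m, 1 ≤ k → 1 ≤ m → ∀ h f i j, (h, i) ≠ (f, j) → Tendsto (fun L =>
    jetDeriv (List.replicate k (h, i) ++ List.replicate m (f, j)) (g L)) atTop (𝓝 (d k h m f : ℂ))
  three : ∀ l : List (Fin H × ℕ), 3 ≤ l.toFinset.card →
    Tendsto (fun L => jetDeriv l (g L)) atTop (𝓝 0)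

theorem JetCLT.add {ν : ℕ → Fin H → ℝ} {g g' : ℕ → MvPowerSeries (Fin H × ℕ) ℂ}
    {c c' : ℕ → Fin H → ℝ} {d d' : ℕ → Fin H → ℕ → Fin H → ℝ} (h : JetCLT ν g c d)
    (h' : JetCLT ν g' c' d') : JetCLT ν (fun L => g L + g' L) (fun k h => c k h + c' k h)
      fun k h m f => d k h m f + d' k h m f := by
  refine ⟨fun k hk a i => ?_, fun k m hk hm a f i j hij => ?_, fun l hl => ?_⟩
  · simp only [map_add, mul_add]
    push_cast
    exact (h.one k hk a i).add (h'.one k hk a i)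
  · simp only [map_add]
    push_cast
    exact (h.two k m hk hm a f i j hij).add (h'.two k m hk hm a f i j hij)
  · simp only [map_add]
    simpa using (h.three l hl).add (h'.three l hl)

theorem jetCLT_zero (ν : ℕ → Fin H → ℝ) : JetCLT ν (fun _ => 0) (fun _ _ => 0) fun _ _ _ _ => 0 :=
  ⟨by simp, by simp, by simp⟩

theorem JetCLT.sum {ι : Type} {ν : ℕ → Fin H → ℝ} (s : Finset ι)
    {g : ι → ℕ → MvPowerSeries (Fin H × ℕ) ℂ} {c : ι → ℕ → Fin H → ℝ}
    {d : ι → ℕ → Fin H → ℕ → Fin H → ℝ} (h : ∀ i ∈ s, JetCLT ν (g i) (c i) (d i)) :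
    JetCLT ν (fun L => ∑ i ∈ s, g i L) (fun k h => ∑ i ∈ s, c i k h)
      fun k h m f => ∑ i ∈ s, d i k h m f := by
  classical
  induction s using Finset.induction_on with
  | empty => simpa using jetCLT_zero ν
  | insert a s ha ih => simp_all [sum_insert, add]

theorem JetCLT.rescale {ν ν' : ℕ → Fin H → ℝ} {g : ℕ → MvPowerSeries (Fin H × ℕ) ℂ}
    {c : ℕ → Fin H → ℝ} {d : ℕ → Fin H → ℕ → Fin H → ℝ} (h : JetCLT ν g c d) {κ : Fin H → ℝ}
    (hν : ∀ h, ∀ᶠ L in atTop, ν L h ≠ 0)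
    (hκ : ∀ h, Tendsto (fun L => ν L h / ν' L h) atTop (𝓝 (κ h))) :
    JetCLT ν' g (fun k h => κ h * c k h) d := by
  refine ⟨fun k hk a i => ?_, h.two, h.three⟩
  push_cast
  refine (((Complex.continuous_ofReal.tendsto _).comp (hκ a)).mul (h.one k hk a i)).congr' ?_
  filter_upwards [hν a] with L hL
  have : (ν L a : ℂ) ≠ 0 := Complex.ofReal_ne_zero.2 hL
  simp only [Function.comp_apply]
  push_cast
  field_simp

theorem CLTAppropriate.jetCLT {n : ℕ → Fin H → ℕ} {S : ℕ → (Fin H × ℕ → ℂ) → ℂ}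
    (hS : CLTAppropriate n S) {g : ℕ → MvPowerSeries (Fin H × ℕ) ℂ}
    (hg : ∀ L, HasJet (fun x => Complex.log (S L x)) (g L)) :
    ∃ c d, JetCLT (fun L h => (n L h : ℝ)) g c d := by
  obtain ⟨c, d, h1, h2, h3⟩ := hS
  simp only [fun L l => (hg L).derivAtOne_eq_jetDeriv l] at h1 h2 h3
  exact ⟨c, d, by simpa using h1, h2, h3⟩

/-- A measure on a single coordinate is regarded as a function of the variables of all coordinates.
Derivatives along foreign variables vanish, so the limits are extended by zero. -/
theorem CLTAppropriate.jetCLT_comp {n : ℕ → ℕ} {S : ℕ → (ℕ → ℂ) → ℂ}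
    (hS : CLTAppropriate (fun L (_ : Unit) => n L) fun L x => S L fun i => x ((), i)) (h₀ : Fin H)
    {g : ℕ → MvPowerSeries (Fin H × ℕ) ℂ}
    (hg : ∀ L, HasJet (fun x : Fin H × ℕ → ℂ => Complex.log (S L fun i => x (h₀, i))) (g L))
    {ν : ℕ → Fin H → ℝ} (hν : ∀ L, ν L h₀ = n L) :
    ∃ c d, JetCLT ν g c d := by
  obtain ⟨c, d, h1, h2, h3⟩ := hS
  have hinj : Injective fun u : Unit × ℕ => (h₀, u.2) := by
    rintro ⟨_, i⟩ ⟨_, j⟩ h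
    grind
  have key : ∀ L (l : List (Unit × ℕ)), derivAtOne l (fun x => Complex.log (S L fun i => x ((), i)))
      = jetDeriv (l.map fun u => (h₀, u.2)) (g L) := by
    intro L l
    rw [← (hg L).derivAtOne_eq_jetDeriv]
    exact (derivAtOne_comp hinj l fun x => Complex.log (S L fun i => x ((), i))).symm
  have hzero : ∀ L (l : List (Fin H × ℕ)) (j : Fin H × ℕ), j ∈ l → j.1 ≠ h₀ →
      jetDeriv l (g L) = 0 := by
    intro L l j hj hne
    refine jetDeriv_eq_zero hj ((hg L).pderiv_eq_zero j fun x t => ?_)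
    grind
  simp only [key] at h1 h2 h3
  refine ⟨fun k h => if h = h₀ then c k () else 0,
    fun k h m f => if h = h₀ ∧ f = h₀ then d k () m () else 0, fun k hk h i => ?_,
    fun k m hk hm h f i j hij => ?_, fun l hl => ?_⟩
  · by_cases hh : h = h₀
    · simp_all
    · simp only [if_neg hh, fun L => hzero L (List.replicate k (h, i)) (h, i)
        (by simp; omega) hh, mul_zero]
      simp
  · by_cases hh : h = h₀ ∧ f = h₀
    · simp_all
    · rw [if_neg hh]
      have : ∀ L, jetDeriv (List.replicate k (h, i) ++ List.replicate m (f, j)) (g L) = 0 := by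
        intro L
        by_cases h5 : h = h₀
        · exact hzero L _ (f, j) (by simp; omega) fun h6 => hh ⟨h5, h6⟩
        · exact hzero L _ (h, i) (by simp; omega) h5
      simp [this]
  · by_cases hall : ∀ j ∈ l, j.1 = h₀
    · have e : l = (l.map fun j : Fin H × ℕ => ((), j.2)).map fun u => (h₀, u.2) := by
        rw [List.map_map]
        conv_lhs => rw [← List.map_id l]
        exact List.map_congr_left fun j hj => Prod.ext (hall j hj) rfl
      rw [e]
      refine h3 _ ?_
      have e' : l.toFinset = (l.map fun j : Fin H × ℕ => ((), j.2)).toFinset.image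
          fun u => (h₀, u.2) := by
        conv_lhs => rw [e]
        ext x
        simp only [List.mem_toFinset, List.mem_map, mem_image]
      grind
    · push Not at hall
      obtain ⟨j, hj, hne⟩ := hall
      simp [fun L => hzero L l j hj hne]

theorem JetCLT.symm {ν : ℕ → Fin H → ℝ} {g : ℕ → MvPowerSeries (Fin H × ℕ) ℂ}
    {c : ℕ → Fin H → ℝ} {d : ℕ → Fin H → ℕ → Fin H → ℝ} (h : JetCLT ν g c d) {k m : ℕ} (hk : 1 ≤ k)
    (hm : 1 ≤ m) (a f : Fin H) : d k a m f = d m f k a := by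
  have h1 := h.two k m hk hm a f 0 1 (by simp)
  have h2 := h.two m k hm hk f a 1 0 (by simp)
  have e : ∀ L, jetDeriv (List.replicate k (a, 0) ++ List.replicate m (f, 1)) (g L)
      = jetDeriv (List.replicate m (f, 1) ++ List.replicate k (a, 0)) (g L) := by
    simp [jetDeriv_apply, listIndex_append, add_comm]
  simp only [e] at h1
  exact_mod_cast tendsto_nhds_unique h1 h2

/-- The factor `a + 1`, which stems from differentiating the power sum of exponent `a + 1`, turns
`1/(a+1)!` into the `1/a!` of the series `F`. -/
theorem JetCLT.tendsto_coeff_single {ν : ℕ → Fin H → ℝ} {g : ℕ → MvPowerSeries (Fin H × ℕ) ℂ}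
    {c : ℕ → Fin H → ℝ} {d : ℕ → Fin H → ℕ → Fin H → ℝ} (h : JetCLT ν g c d) (f : Fin H) (a : ℕ) :
    Tendsto (fun L => (ν L f : ℂ)⁻¹ * ((a + 1 : ℂ) * coeff (Finsupp.single (f, 0) (a + 1)) (g L)))
      atTop (𝓝 ((c (a + 1) f : ℂ) / a.factorial)) := by
  have h1 := (h.one (a + 1) (by omega) f 0).div_const (a.factorial : ℂ)
  refine h1.congr fun L => ?_
  rw [jetDeriv_apply, listIndex_replicate, multiFactorial, Finsupp.prod_single_index (by simp),
    Nat.factorial_succ]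
  grind [Nat.cast_ne_zero]

theorem JetCLT.tendsto_coeff_pair {ν : ℕ → Fin H → ℝ} {g : ℕ → MvPowerSeries (Fin H × ℕ) ℂ}
    {c : ℕ → Fin H → ℝ} {d : ℕ → Fin H → ℕ → Fin H → ℝ} (h : JetCLT ν g c d)
    (τ : Fin 2 → Fin H × ℕ) :
    Tendsto (fun L => coeff (stdIndex τ) (g L)) atTop
      (𝓝 ((d ((τ 0).2 + 1) (τ 0).1 ((τ 1).2 + 1) (τ 1).1 : ℂ) /
        (((τ 0).2 + 1).factorial * ((τ 1).2 + 1).factorial))) := by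
  have h1 := (h.two ((τ 0).2 + 1) ((τ 1).2 + 1) (by omega) (by omega) (τ 0).1 (τ 1).1 0 1
    (by simp)).div_const ((((τ 0).2 + 1).factorial * ((τ 1).2 + 1).factorial : ℂ))
  refine h1.congr fun L => ?_
  have e : listIndex (List.replicate ((τ 0).2 + 1) ((τ 0).1, 0) ++
      List.replicate ((τ 1).2 + 1) ((τ 1).1, 1)) = stdIndex τ := by
    simp [listIndex_append, listIndex_replicate, stdIndex, tupleIndex, Fin.sum_univ_two]
  have e2 : multiFactorial (stdIndex τ) =
      (((τ 0).2 + 1).factorial * ((τ 1).2 + 1).factorial : ℂ) := by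
    rw [← e, listIndex_append, listIndex_replicate, listIndex_replicate, multiFactorial,
      Finsupp.prod_add_index_of_disjoint, Finsupp.prod_single_index (by simp),
      Finsupp.prod_single_index (by simp)]
    grind [Finsupp.support_single_disjoint]
  grind [jetDeriv_apply, mul_div_cancel_left₀, multiFactorial_ne_zero]

theorem JetCLT.tendsto_coeff_many {ν : ℕ → Fin H → ℝ} {g : ℕ → MvPowerSeries (Fin H × ℕ) ℂ}
    {c : ℕ → Fin H → ℝ} {d : ℕ → Fin H → ℕ → Fin H → ℝ} (h : JetCLT ν g c d) {s : ℕ} (hs : 3 ≤ s)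
    (τ : Fin s → Fin H × ℕ) :
    Tendsto (fun L => coeff (stdIndex τ) (g L)) atTop (𝓝 0) := by
  classical
  have hinj : Injective fun t : Fin s => ((τ t).1, (t : ℕ)) := fun t t' ht =>
    Fin.ext (Prod.mk.inj ht).2
  have h1 := h.three (Finsupp.toMultiset (stdIndex τ)).toList (by
    have h2 : (univ.image fun t : Fin s => ((τ t).1, (t : ℕ))) ⊆
        (Finsupp.toMultiset (stdIndex τ)).toList.toFinset := by
      intro j hj
      obtain ⟨t, _, rfl⟩ := mem_image.1 hj
      rw [List.mem_toFinset, Multiset.mem_toList, Finsupp.mem_toMultiset, Finsupp.mem_support_iff]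
      have h3 : Finsupp.single ((τ t).1, (t : ℕ)) ((τ t).2 + 1) ≤ stdIndex τ := by
        refine single_le_sum (f := fun t : Fin s =>
          Finsupp.single ((τ t).1, (t : ℕ)) ((τ t).2 + 1)) (fun _ _ => zero_le) (mem_univ t)
      have h4 := h3 ((τ t).1, (t : ℕ))
      grind
    have h5 := card_le_card h2
    grind [card_image_of_injective, card_univ, Fintype.card_fin])
  have h6 := h1.const_mul (multiFactorial (stdIndex τ))⁻¹
  simp_all [mul_zero, jetDeriv_apply, listIndex_toList, multiFactorial_ne_zero]

end JetAsymptotics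

end

section

open Finset
open scoped Polynomial

/-! ### Operator coefficients as coefficients of powers of `F` -/

section LaurentCoefficients

open PowerSeries

/-- The power series `(1 + z) (1 + z V(z))`. -/
def qSer {R : Type*} [CommRing R] (V : PowerSeries R) : PowerSeries R := (1 + X) * (1 + X * V)

theorem map_qSer {R S : Type*} [CommRing R] [CommRing S] (f : R →+* S) (V : PowerSeries R) :
    PowerSeries.map f (qSer V) = qSer (PowerSeries.map f V) := by
  simp [qSer]

theorem coeff_mul_X_mul_pow {R : Type*} [CommRing R] (V W : PowerSeries R) (n j : ℕ) :
    coeff n (W * (X * V) ^ j) = if j ≤ n then coeff (n - j) (W * V ^ j) else 0 := by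
  rw [mul_pow, mul_left_comm, PowerSeries.coeff_X_pow_mul']

theorem coeff_mul_one_add_pow {R : Type*} [CommRing R] (V W : PowerSeries R) (n m : ℕ) :
    coeff n (W * (1 + X * V) ^ m) = ∑ p ∈ antidiagonal m,
      (m.choose p.1 : R) * if p.2 ≤ n then coeff (n - p.2) (W * V ^ p.2) else 0 := by
  rw [(Commute.all _ _).add_pow', mul_sum, map_sum]
  refine sum_congr rfl fun p _ => ?_
  rw [one_pow, one_mul, mul_smul_comm, map_nsmul, coeff_mul_X_mul_pow, nsmul_eq_mul]

theorem choose_eq_factorial_inv {p₁ p₂ m : ℕ} (h : p₁ + p₂ = m) :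
    (m.choose p₁ : ℂ) = m.factorial * ((p₂.factorial : ℂ)⁻¹ * (p₁.factorial : ℂ)⁻¹) := by
  subst h
  have := Nat.add_choose_mul_factorial_mul_factorial p₁ p₂
  have h1 : (p₁.factorial : ℂ) ≠ 0 := Nat.cast_ne_zero.2 p₁.factorial_ne_zero
  have h2 : (p₂.factorial : ℂ) ≠ 0 := Nat.cast_ne_zero.2 p₂.factorial_ne_zero
  rw [← this, Nat.choose_symm_add]
  push_cast
  field_simp

theorem coeff_coe_polynomial (k j n : ℕ) (v : ℂ[X]) :
    ((1 + Polynomial.X) ^ k * v ^ j : ℂ[X]).coeff n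
      = coeff n ((1 + X) ^ k * (v : PowerSeries ℂ) ^ j) := by
  rw [← Polynomial.coeff_coe]
  push_cast
  rfl

/-- The sum over the antidiagonal is the binomial expansion of `(1 + z V)^k`. As `F = z⁻¹ qSer`, the
value is the coefficient of `z^(b+1)` in `F^k`. -/
theorem tailCoef_eq (k : ℕ) (v : ℂ[X]) (b : ℕ) :
    tailCoef k v b = coeff (k + b + 1) (qSer (v : PowerSeries ℂ) ^ k) := by
  unfold tailCoef qSer
  rw [mul_pow, coeff_mul_one_add_pow]
  refine sum_congr rfl fun p hp => ?_
  have hp' := mem_antidiagonal.1 hp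
  rw [coeff_coe_polynomial, choose_eq_factorial_inv hp', if_pos (by omega)]
  grind

/-- Here `(p₁ + 1)!` in place of `p₁!` calls for the binomial expansion of exponent `k + 1`. Its
extra term involves `z^(k+1)` and does not reach degree `k`. -/
theorem leadCoeff_eq (k : ℕ) (v : ℂ[X]) :
    leadCoeff k v = ((k : ℂ) + 1)⁻¹ *
      coeff k ((1 + X) ^ k * (1 + X * (v : PowerSeries ℂ)) ^ (k + 1)) := by
  unfold leadCoeff
  rw [coeff_mul_one_add_pow, Finset.Nat.sum_antidiagonal_succ, if_neg (by simp), mul_zero,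
    zero_add, mul_sum, mul_sum]
  refine sum_congr rfl fun p hp => ?_
  have hp' := mem_antidiagonal.1 hp
  rw [coeff_coe_polynomial, choose_eq_factorial_inv (p₁ := p.1 + 1) (p₂ := p.2) (by omega),
    if_pos (by omega), Nat.factorial_succ k]
  grind [Nat.cast_add_one_ne_zero]

/-- The factor `p₂` lowers `p₂!` to `(p₂ - 1)!` while `(p₁ + 1)!` raises the other index, so again a
binomial expansion of exponent `k` results. Its top term is of too high degree to count. The value
is the coefficient of `z⁻¹` in `F^k z^b`. -/
theorem dualCoef_eq {k : ℕ} (hk : 1 ≤ k) (v : ℂ[X]) (b : ℕ) :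
    dualCoef k v b = coeff (k - 1) (qSer (v : PowerSeries ℂ) ^ k * X ^ b) := by
  obtain ⟨k, rfl⟩ : ∃ k', k = k' + 1 := ⟨k - 1, by omega⟩
  unfold dualCoef qSer
  rw [Finset.Nat.sum_antidiagonal_succ', mul_pow, mul_right_comm _ _ (X ^ b : PowerSeries ℂ), coeff_mul_one_add_pow,
    Finset.Nat.sum_antidiagonal_succ, if_neg (by simp)]
  simp only [Nat.cast_zero, mul_zero, zero_mul, zero_add, Nat.add_sub_cancel]
  refine sum_congr rfl fun p hp => ?_
  have hp' := mem_antidiagonal.1 hp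
  have e : ((1 + Polynomial.X) ^ (k + 1) * v ^ p.2 * Polynomial.X ^ b : ℂ[X]).coeff p.1
      = coeff p.1 ((1 + X) ^ (k + 1) * X ^ b * (v : PowerSeries ℂ) ^ p.2) := by
    rw [← Polynomial.coeff_coe]
    push_cast
    rw [mul_right_comm]
  rw [e, if_pos (by omega), choose_eq_factorial_inv (p₁ := p.1 + 1) (p₂ := p.2) (by omega),
    Nat.factorial_succ p.2]
  grind [Nat.cast_add_one_ne_zero]

theorem dualCoef_eq_zero {k : ℕ} (hk : 1 ≤ k) (v : ℂ[X]) {b : ℕ} (hb : k ≤ b) :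
    dualCoef k v b = 0 := by
  rw [dualCoef_eq hk, PowerSeries.coeff_mul_X_pow', if_neg (by omega)]

/-- Working modulo `z^D` transfers coefficients of degree below `D` from the truncated series in the
operators to the full series in the limit formulas. -/
theorem X_pow_dvd_sub_truncPoly (D : ℕ) (f : ℕ → ℂ) :
    (X : PowerSeries ℂ) ^ D ∣ (truncPoly D f : PowerSeries ℂ) - PowerSeries.mk f := by
  rw [PowerSeries.X_pow_dvd_iff]
  intro m hm
  rw [map_sub, Polynomial.coeff_coe, PowerSeries.coeff_mk, truncPoly, Polynomial.finsetSum_coeff]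
  simp_all [Polynomial.coeff_monomial, sum_ite_eq', range, sub_self]

theorem coeff_eq_of_dvd_sub {R : Type*} [CommRing R] {D n : ℕ} {A B : PowerSeries R}
    (h : (X : PowerSeries R) ^ D ∣ A - B) (hn : n < D) : coeff n A = coeff n B := by
  simp_all [PowerSeries.X_pow_dvd_iff, map_sub, sub_eq_zero]

theorem dvd_qSer_pow_sub {R : Type*} [CommRing R] {d A B : PowerSeries R} (h : d ∣ A - B) (k : ℕ) :
    d ∣ qSer A ^ k - qSer B ^ k := by
  refine dvd_trans ?_ (sub_dvd_pow_sub_pow _ _ k)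
  have : qSer A - qSer B = (1 + X) * X * (A - B) := by unfold qSer; ring
  rw [this]
  exact h.mul_left _

theorem tailCoef_truncPoly {D k b : ℕ} (hD : k + b + 1 < D) (f : ℕ → ℂ) :
    tailCoef k (truncPoly D f) b = coeff (k + b + 1) (qSer (PowerSeries.mk f) ^ k) := by
  rw [tailCoef_eq]
  exact coeff_eq_of_dvd_sub (dvd_qSer_pow_sub (X_pow_dvd_sub_truncPoly D f) k) hD

theorem dualCoef_truncPoly {D k : ℕ} (hk : 1 ≤ k) (hD : k < D) (f : ℕ → ℂ) (b : ℕ) :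
    dualCoef k (truncPoly D f) b = coeff (k - 1) (qSer (PowerSeries.mk f) ^ k * X ^ b) := by
  rw [dualCoef_eq hk]
  refine coeff_eq_of_dvd_sub (D := D) ?_ (by omega)
  rw [← sub_mul]
  exact (dvd_qSer_pow_sub (X_pow_dvd_sub_truncPoly D f) k).mul_right _

theorem leadCoeff_truncPoly {D k : ℕ} (hD : k < D) (f : ℕ → ℂ) :
    leadCoeff k (truncPoly D f) = ((k : ℂ) + 1)⁻¹ *
      coeff k ((1 + X) ^ k * (1 + X * PowerSeries.mk f) ^ (k + 1)) := by
  rw [leadCoeff_eq]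
  refine congrArg _ (coeff_eq_of_dvd_sub (D := D) ?_ (by omega))
  rw [← mul_sub]
  refine Dvd.dvd.mul_left (dvd_trans ?_ (sub_dvd_pow_sub_pow _ _ _)) _
  rw [add_sub_add_left_eq_sub, ← mul_sub]
  exact (X_pow_dvd_sub_truncPoly D f).mul_left _

variable {K : Type} [Field K]

/-- The Taylor series in the definition of `laurentF`. -/
def cSer (c : ℕ → K) : PowerSeries K := PowerSeries.mk fun a => c (a + 1) / (a.factorial : K)

theorem map_cSer {K' : Type} [Field K'] (f : K →+* K') (c : ℕ → K) :
    PowerSeries.map f (cSer c) = cSer fun a => f (c a) := by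
  ext n
  simp [cSer]

theorem laurentF_eq (c : ℕ → K) :
    laurentF c = HahnSeries.single (-1 : ℤ) (1 : K) * HahnSeries.ofPowerSeries ℤ K (qSer (cSer c)) := by
  have h1 : HahnSeries.single (-1 : ℤ) (1 : K) * HahnSeries.single (1 : ℤ) (1 : K) = 1 := by simp
  show (1 + HahnSeries.single (1 : ℤ) (1 : K)) * (HahnSeries.single (-1 : ℤ) (1 : K) +
    HahnSeries.ofPowerSeries ℤ K (cSer c)) = _
  grind [qSer, HahnSeries.ofPowerSeries, HahnSeries.ofPowerSeries_X, HahnSeries.single, cSer]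

theorem laurentF_pow (c : ℕ → K) (k : ℕ) :
    laurentF c ^ k = HahnSeries.single (-(k : ℤ)) (1 : K) *
      HahnSeries.ofPowerSeries ℤ K (qSer (cSer c) ^ k) := by
  rw [laurentF_eq, mul_pow, HahnSeries.single_pow, one_pow, map_pow]
  simp

theorem coeff_single_mul_ofPowerSeries (k n : ℕ) (j : ℤ) (h : j + k = n) (A : PowerSeries K) :
    (HahnSeries.single (-(k : ℤ)) (1 : K) * HahnSeries.ofPowerSeries ℤ K A).coeff j
      = coeff n A := by
  rw [HahnSeries.coeff_single_mul, one_mul, sub_neg_eq_add, h, LaurentSeries.coeff_coe_powerSeries]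

theorem limitMean_eq (c : ℕ → ℝ) (k : ℕ) :
    limitMean c k = ((k : ℝ) + 1)⁻¹ * coeff k ((1 + X) ^ k * (1 + X * cSer c) ^ (k + 1)) := by
  unfold limitMean
  rw [one_div]
  refine congrArg _ ?_
  have h0 : (1 + HahnSeries.single (1 : ℤ) (1 : ℝ)) ≠ 0 := by
    intro h
    have := congrArg (fun f => HahnSeries.coeff f 0) h
    simp at this
  have e : (1 + HahnSeries.single (1 : ℤ) (1 : ℝ))⁻¹ * laurentF c ^ (k + 1)
      = HahnSeries.single (-((k + 1 : ℕ) : ℤ)) (1 : ℝ) *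
        HahnSeries.ofPowerSeries ℤ ℝ ((1 + X) ^ k * (1 + X * cSer c) ^ (k + 1)) := by
    rw [inv_mul_eq_iff_eq_mul₀ h0, laurentF_pow]
    have : qSer (cSer c) ^ (k + 1) = (1 + X) * ((1 + X) ^ k * (1 + X * cSer c) ^ (k + 1)) := by
      unfold qSer
      rw [mul_pow, pow_succ (1 + X : PowerSeries ℝ)]
      ring
    grind [X, HahnSeries.ofPowerSeries, HahnSeries.ofPowerSeries_X]
  rw [e, coeff_single_mul_ofPowerSeries (k + 1) k]
  push_cast
  ring

theorem coeff_laurentF_pow_mul_ofPowerSeries {k : ℕ} (hk : 1 ≤ k) (c : ℕ → K) (A : PowerSeries K) :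
    (laurentF c ^ k * HahnSeries.ofPowerSeries ℤ K A).coeff (-1)
      = ∑ b ∈ range k, coeff (k - 1) (qSer (cSer c) ^ k * X ^ b) * coeff b A := by
  rw [laurentF_pow, mul_assoc, ← map_mul, coeff_single_mul_ofPowerSeries k (k - 1)
    (-1) (by omega), PowerSeries.coeff_mul, Finset.Nat.sum_antidiagonal_eq_sum_range_succ_mk]
  obtain ⟨k, rfl⟩ : ∃ k', k = k' + 1 := ⟨k - 1, by omega⟩
  rw [Nat.add_sub_cancel, ← sum_range_reflect]
  refine sum_congr rfl fun b hb => ?_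
  have hb' := mem_range.1 hb
  simp only [Nat.succ_eq_add_one]
  rw [PowerSeries.coeff_mul_X_pow', if_pos (by omega)]
  grind

end LaurentCoefficients

end

section

open Finset
open scoped Polynomial

/-! ### The covariance formula as a finite contraction -/

section LimitCovariance

open PowerSeries

/-- A series in `w` is a scalar for Laurent series in `z`, so the coefficient of `z⁻¹` can be
extracted first, as a finite sum over the powers of `z` in the kernel. -/
theorem coeff_coeff_laurentF_mul {k : ℕ} (hk : 1 ≤ k) (c : ℕ → ℝ) (B : LaurentSeries ℝ)
    (A : PowerSeries (LaurentSeries ℝ)) :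
    ((laurentF (fun a => (HahnSeries.C (c a) : LaurentSeries ℝ)) ^ k * HahnSeries.C B *
        HahnSeries.ofPowerSeries ℤ (LaurentSeries ℝ) A).coeff (-1)).coeff (-1)
      = ∑ b ∈ range k, coeff (k - 1) (qSer (cSer c) ^ k * X ^ b) *
        (B * coeff b A).coeff (-1) := by
  have h1 : laurentF (fun a => (HahnSeries.C (c a) : LaurentSeries ℝ)) ^ k * HahnSeries.C B *
        HahnSeries.ofPowerSeries ℤ (LaurentSeries ℝ) A
      = B • (laurentF (fun a => (HahnSeries.C (c a) : LaurentSeries ℝ)) ^ k *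
        HahnSeries.ofPowerSeries ℤ (LaurentSeries ℝ) A) := by
    rw [← HahnSeries.C_mul_eq_smul]
    ring
  have h2 : ∀ b, coeff (k - 1) (qSer (cSer fun a => (HahnSeries.C (c a) : LaurentSeries ℝ)) ^ k *
      X ^ b) = HahnSeries.C (coeff (k - 1) (qSer (cSer c) ^ k * X ^ b)) := by
    intro b
    rw [← map_cSer, ← map_qSer, ← PowerSeries.coeff_map]
    refine congrArg _ ?_
    rw [map_mul, map_pow, map_pow, PowerSeries.map_X]
  rw [h1, HahnSeries.coeff_smul, coeff_laurentF_pow_mul_ofPowerSeries hk, smul_eq_mul,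
    mul_sum, HahnSeries.coeff_sum]
  refine sum_congr rfl fun b _ => ?_
  rw [h2, mul_left_comm, HahnSeries.C_mul_eq_smul, HahnSeries.coeff_smul, smul_eq_mul]

/-- Each of the `b + 1` ways to write `b` as a sum contributes the same power `w^(-2-b)`. -/
theorem geomKernel_sq : geomKernel ^ 2 = HahnSeries.ofPowerSeries ℤ (LaurentSeries ℝ)
    (PowerSeries.mk fun b => HahnSeries.single (-2 - (b : ℤ)) ((b : ℝ) + 1)) := by
  unfold geomKernel
  rw [← map_pow]
  refine congrArg _ (PowerSeries.ext fun b => ?_)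
  rw [pow_two, PowerSeries.coeff_mul, PowerSeries.coeff_mk]
  have h : ∀ p ∈ antidiagonal b,
      coeff p.1 (PowerSeries.mk fun a => HahnSeries.single (-1 - (a : ℤ)) (1 : ℝ)) *
        coeff p.2 (PowerSeries.mk fun a => HahnSeries.single (-1 - (a : ℤ)) (1 : ℝ))
      = HahnSeries.single (-2 - (b : ℤ)) (1 : ℝ) := by
    intro p hp
    have hp' := mem_antidiagonal.1 hp
    rw [PowerSeries.coeff_mk, PowerSeries.coeff_mk, HahnSeries.single_mul_single, mul_one]
    refine congrArg (fun j => HahnSeries.single j (1 : ℝ)) ?_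
    omega
  rw [sum_congr rfl h, sum_const, Finset.Nat.card_antidiagonal]
  have h3 : HahnSeries.single (-2 - (b : ℤ)) ((b + 1) • (1 : ℝ))
      = (b + 1) • HahnSeries.single (-2 - (b : ℤ)) (1 : ℝ) :=
    map_nsmul (HahnSeries.single.addMonoidHom (R := ℝ) (-2 - (b : ℤ))) (b + 1) 1
  rw [← h3, nsmul_eq_mul, mul_one, Nat.cast_add, Nat.cast_one]

theorem limitCov_eq {k₁ k₂ : ℕ} (hk₁ : 1 ≤ k₁) (hk₂ : 1 ≤ k₂) (c₁ c₂ : ℕ → ℝ) (d : ℕ → ℕ → ℝ)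
    (same : Prop) [Decidable same] :
    limitCov c₁ c₂ d same k₁ k₂
      = (if same then ∑ b ∈ range k₁, ((b : ℝ) + 1) *
          coeff (k₁ - 1) (qSer (cSer c₁) ^ k₁ * X ^ b) *
            coeff (k₂ + b + 1) (qSer (cSer c₂) ^ k₂) else 0) +
        ∑ b ∈ range k₁, ∑ b' ∈ range k₂,
          d (b + 1) (b' + 1) / ((b.factorial : ℝ) * (b'.factorial : ℝ)) *
            (coeff (k₁ - 1) (qSer (cSer c₁) ^ k₁ * X ^ b) *
              coeff (k₂ - 1) (qSer (cSer c₂) ^ k₂ * X ^ b')) := by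
  unfold limitCov
  rw [mul_add, HahnSeries.coeff_add, HahnSeries.coeff_add]
  congr 1
  · split_ifs with hs
    · rw [geomKernel_sq, coeff_coeff_laurentF_mul hk₁]
      refine sum_congr rfl fun b _ => ?_
      rw [PowerSeries.coeff_mk, laurentF_pow]
      have h1 : (HahnSeries.single (-(k₂ : ℤ)) (1 : ℝ) *
          HahnSeries.ofPowerSeries ℤ ℝ (qSer (cSer c₂) ^ k₂) *
          HahnSeries.single (-2 - (b : ℤ)) ((b : ℝ) + 1)).coeff (-1)
          = ((b : ℝ) + 1) * coeff (k₂ + b + 1) (qSer (cSer c₂) ^ k₂) := by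
        rw [mul_comm, HahnSeries.coeff_single_mul,
          coeff_single_mul_ofPowerSeries k₂ (k₂ + b + 1) _ (by push_cast; ring)]
      rw [h1]
      ring
    · simp
  · unfold doubleSeries
    rw [coeff_coeff_laurentF_mul hk₁]
    refine sum_congr rfl fun b _ => ?_
    rw [PowerSeries.coeff_mk, coeff_laurentF_pow_mul_ofPowerSeries hk₂, mul_sum]
    refine sum_congr rfl fun b' _ => ?_
    rw [PowerSeries.coeff_mk]
    ring

/-- The polynomial approximating the logarithmic derivative in one variable. -/
def cPoly (D : ℕ) (c : ℕ → ℝ) : ℂ[X] := truncPoly D fun a => (c (a + 1) : ℂ) / a.factorial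

theorem mk_eq_map_cSer (c : ℕ → ℝ) :
    (PowerSeries.mk fun a => (c (a + 1) : ℂ) / a.factorial)
      = PowerSeries.map Complex.ofRealHom (cSer c) := by
  rw [map_cSer]
  rfl

theorem leadCoeff_cPoly {D k : ℕ} (hD : k < D) (c : ℕ → ℝ) :
    leadCoeff k (cPoly D c) = (limitMean c k : ℂ) := by
  have h : (1 + X) ^ k * (1 + X * PowerSeries.map Complex.ofRealHom (cSer c)) ^ (k + 1)
      = PowerSeries.map Complex.ofRealHom ((1 + X) ^ k * (1 + X * cSer c) ^ (k + 1)) := by simp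
  unfold cPoly
  rw [leadCoeff_truncPoly hD, limitMean_eq, mk_eq_map_cSer, h, PowerSeries.coeff_map]
  push_cast
  rfl

theorem dualCoef_cPoly {D k : ℕ} (hk : 1 ≤ k) (hD : k < D) (c : ℕ → ℝ) (b : ℕ) :
    dualCoef k (cPoly D c) b = ((coeff (k - 1) (qSer (cSer c) ^ k * X ^ b) : ℝ) : ℂ) := by
  have h : qSer (PowerSeries.map Complex.ofRealHom (cSer c)) ^ k * X ^ b
      = PowerSeries.map Complex.ofRealHom (qSer (cSer c) ^ k * X ^ b) := by
    rw [map_mul, map_pow, map_pow, map_qSer, PowerSeries.map_X]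
  unfold cPoly
  rw [dualCoef_truncPoly hk hD, mk_eq_map_cSer, h, PowerSeries.coeff_map]
  rfl

theorem tailCoef_cPoly {D k b : ℕ} (hD : k + b + 1 < D) (c : ℕ → ℝ) :
    tailCoef k (cPoly D c) b = ((coeff (k + b + 1) (qSer (cSer c) ^ k) : ℝ) : ℂ) := by
  unfold cPoly
  rw [tailCoef_truncPoly hD, mk_eq_map_cSer, ← map_qSer, ← map_pow, PowerSeries.coeff_map]
  rfl

/-- The limiting covariance as a contraction of Wick operators. -/
theorem limitCov_eq_contraction {D k₁ k₂ : ℕ} (hk₁ : 1 ≤ k₁) (hk₂ : 1 ≤ k₂) (hD : k₁ + k₂ < D)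
    (c₁ c₂ : ℕ → ℝ) (d : ℕ → ℕ → ℝ) (same : Prop) [Decidable same] :
    (limitCov c₁ c₂ d same k₁ k₂ : ℂ)
      = (if same then ∑ b ∈ range k₁, ((b : ℂ) + 1) * dualCoef k₁ (cPoly D c₁) b *
            tailCoef k₂ (cPoly D c₂) b else 0) +
        ∑ b ∈ range D, ∑ b' ∈ range D,
          (d (b + 1) (b' + 1) : ℂ) / (((b + 1).factorial : ℂ) * ((b' + 1).factorial : ℂ)) *
            ((((b : ℂ) + 1) * dualCoef k₁ (cPoly D c₁) b) *
              (((b' : ℂ) + 1) * dualCoef k₂ (cPoly D c₂) b')) := by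
  have hr : ∀ {k : ℕ}, k < D → range k ⊆ range D := fun h =>
    range_mono h.le
  have hz : ∀ {k : ℕ} (c : ℕ → ℝ) {b : ℕ}, 1 ≤ k → b ∉ range k →
      dualCoef k (cPoly D c) b = 0 := by
    intro k c b hk hb
    exact dualCoef_eq_zero hk _ (by simpa using hb)
  rw [limitCov_eq hk₁ hk₂, ← sum_subset (hr (show k₁ < D by omega)) fun b _ hb => by
    simp [hz c₁ hk₁ hb]]
  push_cast
  congr 1
  · split_ifs
    · push_cast
      refine sum_congr rfl fun b hb => ?_
      have := mem_range.1 hb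
      rw [dualCoef_cPoly hk₁ (by omega), tailCoef_cPoly (by omega)]
    · simp
  · refine sum_congr rfl fun b _ => ?_
    rw [← sum_subset (hr (show k₂ < D by omega)) fun b' _ hb' => by simp [hz c₂ hk₂ hb']]
    refine sum_congr rfl fun b' _ => ?_
    rw [dualCoef_cPoly hk₁ (by omega), dualCoef_cPoly hk₂ (by omega), Nat.factorial_succ,
      Nat.factorial_succ]
    have h1 : (b : ℂ) + 1 ≠ 0 := Nat.cast_add_one_ne_zero b
    have h2 : (b' : ℂ) + 1 ≠ 0 := Nat.cast_add_one_ne_zero b'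
    have h3 : (b.factorial : ℂ) ≠ 0 := Nat.cast_ne_zero.2 b.factorial_ne_zero
    have h4 : (b'.factorial : ℂ) ≠ 0 := Nat.cast_ne_zero.2 b'.factorial_ne_zero
    push_cast
    field_simp

end LimitCovariance

end

section

open scoped Polynomial

/-! ### The operators of the chain and their limits -/

section ChainOperators

open MvPowerSeries

variable {H M : ℕ}

/-- The operator of multiplication by the power sum `p_{k;h,m}`, `t = (k, h, m)`. -/
def chainOp (n : ℕ → Fin H → Fin (M + 1) → ℕ) (G : ℕ → Fin (M + 1) → MvPowerSeries (Fin H × ℕ) ℂ)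
    (D : ℕ) (t : ℕ × Fin H × Fin (M + 1)) (L : ℕ) : PSRing H →ₗ[ℂ] PSRing H :=
  popOp t.2.1 ((n L t.2.1 t.2.2 : ℂ)⁻¹)
    (deltaDer t.2.1 (gammaPoly D fun α => coeff α (G L t.2.2))) t.1

/-- The limiting second-order coefficients. -/
def pairCoef (d : ℕ → Fin H → ℕ → Fin H → ℝ) (p q : Fin H × ℕ) : ℂ :=
  (d (p.2 + 1) p.1 (q.2 + 1) q.1 : ℂ) / ((p.2 + 1).factorial * (q.2 + 1).factorial)

/-- The multiplication part of the limit of the operators `chainOp`. -/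
def wickMul (c : ℕ → Fin H → Fin (M + 1) → ℝ) (d : Fin (M + 1) → ℕ → Fin H → ℕ → Fin H → ℝ)
    (D : ℕ) (t : ℕ × Fin H × Fin (M + 1)) : PSRing H :=
  mulPart t.2.1 t.1 (cPoly D fun k => c k t.2.1 t.2.2) +
    dualFun t.1 (cPoly D fun k => c k t.2.1 t.2.2) (pairPart t.2.1 D (pairCoef (d t.2.2)))

/-- The limiting covariances. -/
def wickCov (c : ℕ → Fin H → Fin (M + 1) → ℝ) (d : Fin (M + 1) → ℕ → Fin H → ℕ → Fin H → ℝ)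
    (t t' : ℕ × Fin H × Fin (M + 1)) : ℝ :=
  limitCov (fun k => c k t.2.1 t.2.2) (fun k => c k t'.2.1 t'.2.2)
    (fun k k' => d t'.2.2 k t.2.1 k' t'.2.1) (t.2.1 = t'.2.1) t.1 t'.1

variable {n : ℕ → Fin H → Fin (M + 1) → ℕ} {G : ℕ → Fin (M + 1) → MvPowerSeries (Fin H × ℕ) ℂ}
  {c : ℕ → Fin H → Fin (M + 1) → ℝ} {d : Fin (M + 1) → ℕ → Fin H → ℕ → Fin H → ℝ}

/-- Combines the expansion of `popOp` with the CLT conditions: the one-variable data enter through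
the polynomial `cPoly`, the two-variable data through `pairPart`, and the divergent scalar divided
by `n` is the limiting mean. -/
theorem exists_chainOp_expansion (hn : ∀ h m, Tendsto (fun L => (n L h m : ℝ)) atTop atTop)
    (hG : ∀ m, JetCLT (fun L h => (n L h m : ℝ)) (fun L => G L m) (fun k h => c k h m) (d m))
    {D : ℕ} (hD : 2 ≤ D) (t : ℕ × Fin H × Fin (M + 1)) (ht : t.1 < D) :
    ∃ (X : ℕ → PSRing H →ₗ[ℂ] PSRing H) (Z : PSRing H →ₗ[ℂ] PSRing H) (s : ℂ) (a : ℕ → ℂ),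
      (∀ L, n L t.2.1 t.2.2 ≠ 0 → chainOp n G D t L = a L • 1 + X L) ∧ OpLim X Z ∧
      (∀ y, Z y = s • y + wickMul c d D t * y +
        wickDer t.2.1 t.1 (cPoly D fun k => c k t.2.1 t.2.2) y) ∧
      Tendsto (fun L => (n L t.2.1 t.2.2 : ℂ)⁻¹ * a L) atTop
        (𝓝 (limitMean (fun k => c k t.2.1 t.2.2) t.1 : ℂ)) := by
  obtain ⟨k, h, m⟩ := t
  simp only at ht ⊢
  have hη : Tendsto (fun L => (n L h m : ℂ)⁻¹) atTop (𝓝 0) := by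
    have := (Complex.continuous_ofReal.tendsto _).comp (tendsto_inv_atTop_zero.comp (hn h m))
    refine (by simpa using this : Tendsto _ _ _).congr fun L => ?_
    simp
  let v : ℕ → ℂ[X] := fun L => truncPoly D fun a =>
    (n L h m : ℂ)⁻¹ * ((a + 1 : ℂ) * coeff (Finsupp.single (h, 0) (a + 1)) (G L m))
  have hv : NullSeq fun L => v L - cPoly D fun k => c k h m :=
    nullSeq_truncPoly D fun a => by simpa using (hG m).tendsto_coeff_single h a
  obtain ⟨X, Z, s, h1, h2, h3⟩ := exists_popOp_expansion h hη
    (w := fun L => deltaDer h (gammaPoly D fun α => coeff α (G L m)))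
    (w₁ := fun L => restPart h D fun α => coeff α (G L m)) (v := v)
    (v' := cPoly D fun k => c k h m) (w₁' := pairPart h D (pairCoef (d m)))
    (fun L => smul_deltaDer_gammaPoly h (by omega) _ _) hv
    (nullSeq_restPart h hD (fun τ => (hG m).tendsto_coeff_pair τ)
      fun s hs τ => (hG m).tendsto_coeff_many hs τ) k
  refine ⟨X, Z, s, fun L => (((n L h m : ℂ)⁻¹)⁻¹ * leadCoeff k (v L)), fun L hL => ?_, h2, h3, ?_⟩
  · exact h1 L (inv_ne_zero (Nat.cast_ne_zero.2 hL))
  · rw [← leadCoeff_cPoly ht]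
    refine (tendsto_leadCoeff hv k).congr' ?_
    filter_upwards [(hn h m).eventually_gt_atTop 0] with L hL
    have : (n L h m : ℂ) ≠ 0 := by
      have : (n L h m : ℝ) ≠ 0 := hL.ne'
      exact_mod_cast this
    rw [inv_inv, inv_mul_cancel_left₀ this]

/-- The contraction of the multiplication part belonging to `t'` by the derivation belonging to `t`:
`mulPart` yields the kernel term of the covariance, `pairPart` the term with the second-order
coefficients. -/
theorem wickDer_wickMul (hG : ∀ m, ∀ k k', 1 ≤ k → 1 ≤ k' → ∀ h h', d m k h k' h' = d m k' h' k h)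
    {D : ℕ} {t t' : ℕ × Fin H × Fin (M + 1)} (ht : 1 ≤ t.1) (ht' : 1 ≤ t'.1) (hD : t.1 + t'.1 < D) :
    wickDer t.2.1 t.1 (cPoly D fun k => c k t.2.1 t.2.2) (wickMul c d D t')
      = algebraMap ℂ (PSRing H) (wickCov c d t t') := by
  unfold wickMul wickCov
  rw [map_add, wickDer_mulPart _ _ _ _ _ _ (K := t.1) fun b hb => dualCoef_eq_zero ht _ hb,
    wickDer_dualFun_pairPart _ _ _ _ _ _ _ fun p q => ?_, ← map_add,
    limitCov_eq_contraction ht ht' hD]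
  · refine congrArg _ (congrArg₂ _ ?_ rfl)
    split_ifs <;> rfl
  · unfold pairCoef
    rw [hG _ _ _ (by omega) (by omega), mul_comm (_ : ℂ)]

end ChainOperators

end

section

/-! ### Limits of means, covariances and cumulants of the operators -/

section ChainOperatorLimits

open MvPowerSeries

variable {H M : ℕ} {n : ℕ → Fin H → Fin (M + 1) → ℕ}
  {G : ℕ → Fin (M + 1) → MvPowerSeries (Fin H × ℕ) ℂ}
  {c : ℕ → Fin H → Fin (M + 1) → ℝ} {d : Fin (M + 1) → ℕ → Fin H → ℕ → Fin H → ℝ}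

theorem eventually_ne_zero (hn : ∀ h m, Tendsto (fun L => (n L h m : ℝ)) atTop atTop) (h : Fin H)
    (m : Fin (M + 1)) : ∀ᶠ L in atTop, n L h m ≠ 0 := by
  filter_upwards [(hn h m).eventually_gt_atTop 0] with L hL
  exact_mod_cast hL.ne'

theorem tendsto_mean_chainOp (hn : ∀ h m, Tendsto (fun L => (n L h m : ℝ)) atTop atTop)
    (hG : ∀ m, JetCLT (fun L h => (n L h m : ℝ)) (fun L => G L m) (fun k h => c k h m) (d m))
    {D : ℕ} (hD : 2 ≤ D) (t : ℕ × Fin H × Fin (M + 1)) (ht : t.1 < D) :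
    Tendsto (fun L => (n L t.2.1 t.2.2 : ℂ)⁻¹ * evalZero H (chainOp n G D t L 1)) atTop
      (𝓝 (limitMean (fun k => c k t.2.1 t.2.2) t.1 : ℂ)) := by
  obtain ⟨X, Z, s, a, h1, h2, _, h4⟩ := exists_chainOp_expansion hn hG hD t ht
  have h5 := h2.tendsto (evalZero H).toLinearMap 1
  have h6 : Tendsto (fun L => (n L t.2.1 t.2.2 : ℂ)⁻¹) atTop (𝓝 0) := by
    have := (Complex.continuous_ofReal.tendsto _).comp
      (tendsto_inv_atTop_zero.comp (hn t.2.1 t.2.2))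
    refine (by simpa using this : Tendsto _ _ _).congr fun L => ?_
    simp
  have h7 := h4.add (h6.mul h5)
  rw [zero_mul, add_zero] at h7
  refine h7.congr' ?_
  filter_upwards [eventually_ne_zero hn t.2.1 t.2.2] with L hL
  rw [h1 L hL, LinearMap.add_apply, LinearMap.smul_apply, Module.End.one_apply, map_add, map_smul,
    map_one (evalZero H), smul_eq_mul, mul_one, mul_add]
  rfl

/-- The divergent scalars drop out of the covariance. In the limit `Z (Z' 1)` exceeds the product of
`Z 1` and `Z' 1` at the origin exactly by the derivation of `Z` applied to the multiplication part
of `Z'`. -/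
theorem tendsto_cov_chainOp (hn : ∀ h m, Tendsto (fun L => (n L h m : ℝ)) atTop atTop)
    (hG : ∀ m, JetCLT (fun L h => (n L h m : ℝ)) (fun L => G L m) (fun k h => c k h m) (d m))
    {D : ℕ} (hD : 2 ≤ D) {t t' : ℕ × Fin H × Fin (M + 1)} (ht : 1 ≤ t.1) (ht' : 1 ≤ t'.1)
    (hD' : t.1 + t'.1 < D) :
    Tendsto (fun L => evalZero H (chainOp n G D t L (chainOp n G D t' L 1)) -
        evalZero H (chainOp n G D t L 1) * evalZero H (chainOp n G D t' L 1)) atTop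
      (𝓝 (wickCov c d t t' : ℂ)) := by
  obtain ⟨X, Z, s, a, h1, h2, h3, _⟩ := exists_chainOp_expansion hn hG hD t (by omega)
  obtain ⟨X', Z', s', a', h1', h2', h3', _⟩ := exists_chainOp_expansion hn hG hD t' (by omega)
  have h5 := ((h2.comp h2').tendsto (evalZero H).toLinearMap 1).sub
    ((h2.tendsto (evalZero H).toLinearMap 1).mul (h2'.tendsto (evalZero H).toLinearMap 1))
  have hC := wickDer_wickMul (c := c) (d := d)
    (fun m k k' hk hk' h h' => (hG m).symm hk hk' h h') ht ht' hD'
  have e : evalZero H (Z (Z' 1)) - evalZero H (Z 1) * evalZero H (Z' 1) = (wickCov c d t t' : ℂ) := by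
    rw [h3 (Z' 1), h3 1, h3' 1]
    simp only [map_add, map_smul, map_mul, mul_one, map_one, Derivation.map_one_eq_zero,
      add_zero, Derivation.map_smul, hC, smul_zero, zero_add, smul_eq_mul, AlgHom.commutes,
      Algebra.algebraMap_self, RingHom.id_apply]
    ring
  have h6 : Tendsto (fun L => evalZero H (X L (X' L 1)) - evalZero H (X L 1) * evalZero H (X' L 1))
      atTop (𝓝 (evalZero H (Z (Z' 1)) - evalZero H (Z 1) * evalZero H (Z' 1))) := h5
  rw [e] at h6
  refine h6.congr' ?_
  filter_upwards [eventually_ne_zero hn t.2.1 t.2.2, eventually_ne_zero hn t'.2.1 t'.2.2]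
    with L hL hL'
  rw [h1 L hL, h1' L hL']
  simp only [LinearMap.add_apply, LinearMap.smul_apply, Module.End.one_apply, map_add, map_smul,
    map_one, smul_eq_mul, mul_one]
  ring

theorem tendsto_cumulant_chainOp (hn : ∀ h m, Tendsto (fun L => (n L h m : ℝ)) atTop atTop)
    (hG : ∀ m, JetCLT (fun L h => (n L h m : ℝ)) (fun L => G L m) (fun k h => c k h m) (d m))
    {ι : Type} [Fintype ι] [DecidableEq ι] (hι : 3 ≤ Fintype.card ι) {D : ℕ}
    {t : ι → ℕ × Fin H × Fin (M + 1)} (ht : ∀ j, 1 ≤ (t j).1)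
    (hD : ∀ i j, (t i).1 + (t j).1 < D) {l : List ι} (hl : l.Nodup) (hl' : ∀ j, j ∈ l) :
    Tendsto (fun L => cumulant (opMoment (evalZero H) l fun j => chainOp n G D (t j) L)
      Finset.univ) atTop (𝓝 0) := by
  have hD2 : 2 ≤ D := by
    obtain ⟨j⟩ : Nonempty ι := Fintype.card_pos_iff.1 (by omega)
    have := hD j j
    have := ht j
    omega
  choose X Z s a h1 h2 h3 _ using fun j => exists_chainOp_expansion hn hG hD2 (t j) (by
    have := hD j j
    omega)
  let φ := evalZero H
  -- The multiplication parts need not vanish at the origin, because coinciding variables leave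
  -- constants; these are moved into the scalar parts.
  have hwick := fun (S : Finset ι) (hS : S.Nonempty) => opMoment_wick φ hl hl' Z
    (fun j => s j + φ (wickMul c d D (t j)))
    (fun j => wickMul c d D (t j) - algebraMap ℂ _ (φ (wickMul c d D (t j))))
    (fun j => by simp)
    (fun j => wickDer (t j).2.1 (t j).1 (cPoly D fun k => c k (t j).2.1 (t j).2.2))
    (fun j y => by
      rw [h3, add_smul, sub_mul, ← Algebra.smul_def]
      abel)
    (fun i j y => wickDer_comm _ _ _ _ _ _ y) (fun i j => (wickCov c d (t i) (t j) : ℂ))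
    (fun i j => by
      rw [map_sub, Derivation.map_algebraMap, sub_zero]
      exact wickDer_wickMul (fun m k k' hk hk' h h' => (hG m).symm hk hk' h h') (ht i) (ht j)
        (hD i j)) hS
  have hzero : cumulant (opMoment φ l Z) Finset.univ = 0 :=
    cumulant_wick (by simp [opMoment]) _ _ hwick _ (by simpa using hι)
  have hlim := tendsto_cumulant (fun S => tendsto_opMoment φ l h2 S) Finset.univ
  rw [hzero] at hlim
  refine hlim.congr' ?_
  have hev : ∀ᶠ L in atTop, ∀ j, n L (t j).2.1 (t j).2.2 ≠ 0 :=
    eventually_all.2 fun j => eventually_ne_zero hn _ _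
  filter_upwards [hev] with L hL
  exact (cumulant_opMoment_shift φ hl hl' (fun j => X j L) _ (fun j => a j L)
    (fun j => h1 j L (hL j)) (by rw [Finset.card_univ]; omega)).symm

/-- For distinct coordinates the kernel, the only term that distinguishes `z` from `w`, is absent.
-/
theorem limitCov_swap {k₁ k₂ : ℕ} (hk₁ : 1 ≤ k₁) (hk₂ : 1 ≤ k₂) (c₁ c₂ : ℕ → ℝ) (d : ℕ → ℕ → ℝ)
    {same same' : Prop} [Decidable same] [Decidable same'] (h : ¬same) (h' : ¬same') :
    limitCov c₁ c₂ d same k₁ k₂ = limitCov c₂ c₁ (fun a b => d b a) same' k₂ k₁ := by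
  rw [limitCov_eq hk₁ hk₂, limitCov_eq hk₂ hk₁, if_neg h, if_neg h', Finset.sum_comm]
  refine congrArg _ (Finset.sum_congr rfl fun b _ => Finset.sum_congr rfl fun b' _ => ?_)
  ring

theorem jointCumulant_eq_cumulant {Om : Type} (w : Om → ℝ) {r : ℕ} (ξ : Fin r → Om → ℝ) :
    (jointCumulant w ξ : ℂ)
      = cumulant (fun U => (expect w fun om => ∏ j ∈ U, ξ j om : ℂ)) Finset.univ := by
  rw [← sum_finpartition_eq_cumulant]
  unfold jointCumulant cumWeight
  push_cast
  rfl

theorem exists_sorted_list {ι α : Type} [Fintype ι] [LinearOrder α] (lev : ι → α) :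
    ∃ l : List ι, l.Nodup ∧ (∀ j, j ∈ l) ∧ l.Pairwise fun i j => lev i ≤ lev j := by
  refine ⟨(Finset.univ : Finset ι).toList.mergeSort fun i j => decide (lev i ≤ lev j), ?_, ?_, ?_⟩
  · exact (List.mergeSort_perm _ _).nodup_iff.2 (Finset.nodup_toList _)
  · intro j
    exact (List.mergeSort_perm _ _).mem_iff.2 (by simp)
  · have := List.pairwise_mergeSort (le := fun i j => decide (lev i ≤ lev j))
      (fun a b c h1 h2 => by simp only [decide_eq_true_eq] at *; exact h1.trans h2)
      (fun a b => by simpa using le_total _ _) (Finset.univ : Finset ι).toList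
    simpa using this

end ChainOperatorLimits

end

section

open Finset Function

/-! ### CLT conditions for all levels of the chain -/

section LevelAsymptotics

open MvPowerSeries

theorem tendsto_of_tendsto_ofReal {x : ℕ → ℝ} {y : ℝ}
    (h : Tendsto (fun L => (x L : ℂ)) atTop (𝓝 (y : ℂ))) : Tendsto x atTop (𝓝 y) := by
  exact (Complex.continuous_re.tendsto _).comp h

theorem tendsto_atTop_of_div {N : ℕ → ℕ} {κ : ℝ} (hκ : 0 < κ)
    (h : Tendsto (fun L => (N L : ℝ) / (L : ℝ)) atTop (𝓝 κ)) :
    Tendsto (fun L => (N L : ℝ)) atTop atTop := by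
  refine (h.pos_mul_atTop hκ tendsto_natCast_atTop_atTop).congr' ?_
  filter_upwards [eventually_gt_atTop 0] with L hL
  have : (L : ℝ) ≠ 0 := Nat.cast_ne_zero.2 hL.ne'
  field_simp

theorem tendsto_floor_mul_atTop {N : ℕ → ℕ} (hN : Tendsto (fun L => (N L : ℝ)) atTop atTop) {a : ℝ}
    (ha : 0 < a) : Tendsto (fun L => (⌊a * (N L : ℝ)⌋₊ : ℝ)) atTop atTop :=
  tendsto_natCast_atTop_atTop.comp (tendsto_nat_floor_atTop.comp (hN.const_mul_atTop ha))

theorem tendsto_floor_mul_div {N : ℕ → ℕ} (hN : Tendsto (fun L => (N L : ℝ)) atTop atTop)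
    {a b : ℝ} (ha : 0 < a) :
    Tendsto (fun L => (⌊a * (N L : ℝ)⌋₊ : ℝ) / (b * (N L : ℝ))) atTop (𝓝 (a / b)) := by
  have h := ((tendsto_nat_floor_mul_div_atTop ha.le).comp hN).div_const b
  refine h.congr fun L => ?_
  simp only [Function.comp_apply]
  rw [div_div, mul_comm b]

variable {H M : ℕ}

theorem jetDeriv_log_sgf_eq_zero {n : ℕ} {σ : PMF (Sig n)} {h : Fin H}
    {ℓ : MvPowerSeries (Fin H × ℕ) ℂ}
    (hℓ : HasJet (fun x : Fin H × ℕ → ℂ => Complex.log (sgf σ fun i => x (h, i))) ℓ)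
    {l : List (Fin H × ℕ)} {j : Fin H × ℕ} (hj : j ∈ l) (hne : j.1 ≠ h) : jetDeriv l ℓ = 0 := by
  refine jetDeriv_eq_zero hj (hℓ.pderiv_eq_zero j fun x t => ?_)
  refine congrArg (fun y => Complex.log (sgf σ y)) (funext fun i => ?_)
  rw [update_of_ne]
  rintro rfl
  exact hne rfl

/-- The Taylor series of the logarithm of the generating functions of the level `m`. -/
def levelJet (g : MvPowerSeries (Fin H × ℕ) ℂ) (ℓ : Fin H → Fin M → MvPowerSeries (Fin H × ℕ) ℂ)
    (m : Fin (M + 1)) : MvPowerSeries (Fin H × ℕ) ℂ :=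
  g + ∑ q : Fin M with m ≤ q.castSucc, ∑ h, ℓ h q

/-- Each measure satisfies its condition relative to its own rank. Ranks of different levels have
convergent ratios, so sums can be normalized uniformly: by `a N` for the constants of the theorem,
by the integer part for the operators. -/
theorem exists_levelJet_clt {N : ℕ → Fin H → ℕ}
    (hN : ∀ h, Tendsto (fun L => (N L h : ℝ)) atTop atTop) {a : Fin H → Fin (M + 1) → ℝ}
    (ha : ∀ h m, 0 < a h m) {g : ℕ → MvPowerSeries (Fin H × ℕ) ℂ}
    {ℓ : ℕ → Fin H → Fin M → MvPowerSeries (Fin H × ℕ) ℂ}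
    (hg : ∃ c d, JetCLT (fun L h => (⌊a h (Fin.last M) * (N L h : ℝ)⌋₊ : ℝ)) g c d)
    (hℓ : ∀ f q, ∃ c d, JetCLT (fun L h => (⌊a h q.castSucc * (N L h : ℝ)⌋₊ : ℝ))
      (fun L => ℓ L f q) c d) :
    ∃ (c : ℕ → Fin H → Fin (M + 1) → ℝ) (d : Fin (M + 1) → ℕ → Fin H → ℕ → Fin H → ℝ),
      ∀ m, JetCLT (fun L h => a h m * (N L h : ℝ)) (fun L => levelJet (g L) (ℓ L) m)
          (fun k h => c k h m) (d m) ∧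
        JetCLT (fun L h => (⌊a h m * (N L h : ℝ)⌋₊ : ℝ)) (fun L => levelJet (g L) (ℓ L) m)
          (fun k h => c k h m) (d m) := by
  obtain ⟨cg, dg, hg⟩ := hg
  choose cl dl hl using hℓ
  have hne : ∀ h m, ∀ᶠ L in atTop, (⌊a h m * (N L h : ℝ)⌋₊ : ℝ) ≠ 0 := fun h m => by
    filter_upwards [(tendsto_floor_mul_atTop (hN h) (ha h m)).eventually_gt_atTop 0] with L hL
    exact hL.ne'
  have hne' : ∀ h m, ∀ᶠ L in atTop, a h m * (N L h : ℝ) ≠ 0 := fun h m => by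
    filter_upwards [(hN h).eventually_gt_atTop 0] with L hL
    exact (mul_pos (ha h m) hL).ne'
  have key := fun m => (hg.rescale (ν' := fun L h => a h m * (N L h : ℝ)) (fun h => hne h _)
    fun h => tendsto_floor_mul_div (hN h) (ha h _)).add
      (JetCLT.sum (univ.filter fun q : Fin M => m ≤ q.castSucc) fun q _ =>
        JetCLT.sum univ fun f _ => (hl f q).rescale (ν' := fun L h => a h m * (N L h : ℝ))
          (fun h => hne h _) fun h => tendsto_floor_mul_div (hN h) (ha h _))
  refine ⟨fun k h m => _, fun m => _, fun m => ⟨key m, ?_⟩⟩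
  have h1 := (key m).rescale (ν' := fun L h => (⌊a h m * (N L h : ℝ)⌋₊ : ℝ)) (κ := fun _ => 1)
    (fun h => hne' h m) fun h => by
      have := (tendsto_floor_mul_div (b := a h m) (hN h) (ha h m)).inv₀
        (by rw [div_self (ha h m).ne']; exact one_ne_zero)
      rw [div_self (ha h m).ne', inv_one] at this
      exact this.congr fun L => inv_div _ _
  simp only [one_mul] at h1
  exact h1

end LevelAsymptotics

end

end

/-! ### Assembly of the theorem -/

theorem theorem3p10
    (H M : ℕ)
    -- ranks: `N L h` tends to infinity linearly in `L`
    (N : ℕ → Fin H → ℕ) (calN : Fin H → ℝ) (hcalN : ∀ h, 0 < calN h)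
    (hN : ∀ h, Tendsto (fun L => (N L h : ℝ) / (L : ℝ)) atTop (𝓝 (calN h)))
    -- `0 < a_{h,0} ≤ a_{h,1} ≤ ⋯ ≤ a_{h,M} = 1`: there are `M + 1` levels, the top one of rank `N L h`
    (a : Fin H → Fin (M + 1) → ℝ) (ha_pos : ∀ h m, 0 < a h m) (ha_mono : ∀ h, Monotone (a h))
    (ha_top : ∀ h, a h (Fin.last M) = 1)
    -- the initial measures
    (rho : ∀ L, PMF ((h : Fin H) → Sig ⌊a h (Fin.last M) * (N L h : ℝ)⌋₊))
    (hrho_smooth : ∀ L, IsSmoothMulti (rho L))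
    (hrho : CLTAppropriate (fun L h => ⌊a h (Fin.last M) * (N L h : ℝ)⌋₊)
      (fun L => multiSGF (rho L)))
    -- the measures whose Schur generating functions are the functions `g_{h,m}`
    (sigma : ∀ (L : ℕ) (h : Fin H) (m : Fin M), PMF (Sig ⌊a h m.castSucc * (N L h : ℝ)⌋₊))
    (hsigma_smooth : ∀ L h m, IsSmooth (sigma L h m))
    (hsigma : ∀ h m, CLTAppropriate (fun L (_ : Unit) => ⌊a h m.castSucc * (N L h : ℝ)⌋₊)
      (fun L x => sgf (sigma L h m) (fun i => x ((), i))))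
    -- the law of the multilevel chain
    (prob : ∀ L, Config (fun h m => ⌊a h m * (N L h : ℝ)⌋₊) → ℝ)
    (hprob : prob = fun L => chainProb (rho L) (fun h m => sgf (sigma L h m))) :
    -- the transition coefficients are the coefficients of the defining expansions
    (∀ L h (m : Fin M) (lam : Sig ⌊a h m.succ * (N L h : ℝ)⌋₊),
      IsSchurExpansion (branchFun ⌊a h m.castSucc * (N L h : ℝ)⌋₊ (sgf (sigma L h m)) lam)
        (transCoeff (k := ⌊a h m.castSucc * (N L h : ℝ)⌋₊) (sgf (sigma L h m)) lam)) ∧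
    -- the weights sum up to one, and all joint moments of the power sums exist
    (∀ L, HasSum (prob L) 1) ∧
    (∀ (L r : ℕ) (t : Fin r → ℕ × Fin H × Fin (M + 1)),
      Summable fun om => prob L om * ∏ j, powerSum (t j).1 (t j).2.1 (t j).2.2 om) ∧
    ∃ (c : ℕ → Fin H → Fin (M + 1) → ℝ)
      (d : ℕ → Fin H → Fin (M + 1) → ℕ → Fin H → Fin (M + 1) → ℝ),
      -- the numbers `c_{k;h,m}`
      (∀ k, 1 ≤ k → ∀ h m (i : ℕ),
        Tendsto (fun L => (1 / ((a h m * (N L h : ℝ) : ℝ) : ℂ)) *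
            derivAtOne (List.replicate k (h, i)) (fun x : Fin H × ℕ → ℂ =>
              Complex.log (multiSGF (rho L) x) +
                ∑ q : Fin M with m ≤ q.castSucc,
                  Complex.log (sgf (sigma L h q) (fun j => x (h, j)))))
          atTop (𝓝 (c k h m : ℂ))) ∧
      -- the numbers `d_{k,h,m;k',h',m'}`
      (∀ k k', 1 ≤ k → 1 ≤ k' → ∀ h m h' m' (i i' : ℕ), (h, i) ≠ (h', i') →
        Tendsto (fun L =>
            derivAtOne (List.replicate k (h, i) ++ List.replicate k' (h', i'))
              (fun x : Fin H × ℕ → ℂ =>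
                Complex.log (multiSGF (rho L) x) +
                  if h = h' then
                    ∑ q : Fin M with max m m' ≤ q.castSucc,
                      Complex.log (sgf (sigma L h q) (fun j => x (h, j)))
                  else 0))
          atTop (𝓝 (d k h m k' h' m' : ℂ))) ∧
      -- law of large numbers
      (∀ k, 1 ≤ k → ∀ h m,
        Tendsto (fun L => (1 / (a h m * (N L h : ℝ))) * expect (prob L) (powerSum k h m))
          atTop (𝓝 (limitMean (fun b => c b h m) k))) ∧
      -- covariances; for two levels of the same coordinate, `z` goes with the lower level
      -- (the covariance being symmetric, this covers all pairs)
      (∀ k k', 1 ≤ k → 1 ≤ k' → ∀ h m h' m', (h = h' → m ≤ m') →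
        Tendsto (fun L =>
            expect (prob L) (fun om => powerSum k h m om * powerSum k' h' m' om) -
              expect (prob L) (powerSum k h m) * expect (prob L) (powerSum k' h' m'))
          atTop (𝓝 (limitCov (fun b => c b h m) (fun b => c b h' m')
            (fun b b' => d b h m b' h' m') (h = h') k k'))) ∧
      -- higher cumulants vanish in the limit
      (∀ r, 2 < r → ∀ t : Fin r → ℕ × Fin H × Fin (M + 1), (∀ j, 1 ≤ (t j).1) →
        Tendsto (fun L => jointCumulant (prob L)
            (fun j => powerSum (t j).1 (t j).2.1 (t j).2.2))
          atTop (𝓝 0)) := by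
  subst hprob
  have hNt : ∀ h, Tendsto (fun L => (N L h : ℝ)) atTop atTop := fun h =>
    tendsto_atTop_of_div (hcalN h) (hN h)
  let n : ℕ → Fin H → Fin (M + 1) → ℕ := fun L h m => ⌊a h m * (N L h : ℝ)⌋₊
  have hmono : ∀ L h, Monotone (n L h) := fun L h m m' hm =>
    Nat.floor_mono (mul_le_mul_of_nonneg_right (ha_mono h hm) (Nat.cast_nonneg _))
  have hnt : ∀ h m, Tendsto (fun L => (n L h m : ℝ)) atTop atTop := fun h m =>
    tendsto_floor_mul_atTop (hNt h) (ha_pos h m)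
  have hmom := fun L => exists_jets_expect_powerSum (n := n L) (hmono L) (hrho_smooth L)
    (σ := sigma L) (hsigma_smooth L)
  have hone := fun L => (hmom L).1
  choose g ℓ hg hℓ hE using fun L => (hmom L).2
  obtain ⟨c, d, hclt⟩ := exists_levelJet_clt hNt ha_pos (hrho.jetCLT hg) (ℓ := ℓ) fun f q =>
    (hsigma f q).jetCLT_comp (S := fun L => sgf (sigma L f q)) f (fun L => hℓ L f q)
      (ν := fun L h => (⌊a h q.castSucc * (N L h : ℝ)⌋₊ : ℝ)) fun L => rfl
  let G : ℕ → Fin (M + 1) → MvPowerSeries (Fin H × ℕ) ℂ := fun L m => levelJet (g L) (ℓ L) m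
  have hG : ∀ m, JetCLT (fun L h => (n L h m : ℝ)) (fun L => G L m) (fun k h => c k h m) (d m) :=
    fun m => (hclt m).2
  have hlarge : ∀ D : ℕ, ∀ᶠ L in atTop, ∀ h m, D ≤ n L h m := fun D =>
    eventually_all.2 fun h => eventually_all.2 fun m => by
      filter_upwards [(hnt h m).eventually_ge_atTop (D : ℝ)] with L hL
      exact_mod_cast hL
  -- As soon as one variable of a coordinate is differentiated, only the functions `g` of that
  -- coordinate survive; this is how the sum over all coordinates in `levelJet` reduces to the one
  -- in the theorem.
  have hvanish : ∀ L (l : List (Fin H × ℕ)) (j : Fin H × ℕ), j ∈ l → ∀ m,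
      jetDeriv l (G L m) = jetDeriv l (g L + ∑ q : Fin M with m ≤ q.castSucc, ℓ L j.1 q) := by
    intro L l j hj m
    simp only [G, levelJet]
    rw [map_add, map_add, map_sum, map_sum]
    refine congrArg _ (Finset.sum_congr rfl fun q _ => ?_)
    rw [map_sum, Finset.sum_eq_single j.1]
    · exact fun f _ hf => jetDeriv_log_sgf_eq_zero (hℓ L f q) hj hf.symm
    · simp
  let P : ∀ L, Config (n L) → ℝ := fun L =>
    chainProb (n := n L) (rho L) fun h m => sgf (sigma L h m)
  have hE' : ∀ L {r : ℕ} (D : ℕ) (t : Fin r → ℕ × Fin H × Fin (M + 1)) (l : List (Fin r)),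
      l.Nodup → (∀ j, j ∈ l) → l.Pairwise (fun i j => (t i).2.2 ≤ (t j).2.2) →
      (l.map fun j => (t j).1).sum < D → (∀ h m, D ≤ n L h m) → ∀ U : Finset (Fin r),
      (expect (P L) (fun om => ∏ j ∈ U, powerSum (t j).1 (t j).2.1 (t j).2.2 om) : ℂ)
        = opMoment (evalZero H) l (fun j => chainOp n G D (t j) L) U :=
    fun L _ D t l h1 h2 h3 h4 h5 U => hE L D t l h1 h2 h3 h4 h5 U
  -- For `m ≤ m'` the list is already sorted by level, regardless of the coordinates. The
  -- second-order data are then those of the higher level `m'`.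
  have hcov : ∀ k k', 1 ≤ k → 1 ≤ k' → ∀ h m h' m', m ≤ m' →
      Tendsto (fun L =>
        expect (P L) (fun om => powerSum k h m om * powerSum k' h' m' om) -
          expect (P L) (powerSum k h m) * expect (P L) (powerSum k' h' m'))
        atTop (𝓝 (wickCov c d (k, h, m) (k', h', m'))) := by
    intro k k' hk hk' h m h' m' hm
    refine tendsto_of_tendsto_ofReal ?_
    have h1 := tendsto_cov_chainOp hnt hG (D := k + k' + 2) (by omega) (t := (k, h, m))
      (t' := (k', h', m')) hk hk' (by simp only; omega)
    refine h1.congr' ?_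
    filter_upwards [hlarge (k + k' + 2)] with L hL
    have h2 := hE' L (k + k' + 2) ![(k, h, m), (k', h', m')] [0, 1] (by simp)
      (fun j => by fin_cases j <;> simp) (by simpa using hm) (by simp) hL
    have e01 := h2 Finset.univ
    have e0 := h2 {0}
    have e1 := h2 {1}
    simp only [Fin.prod_univ_two, Finset.prod_singleton, Matrix.cons_val_zero,
      Matrix.cons_val_one] at e01 e0 e1
    push_cast
    rw [e01, e0, e1]
    simp [opMoment]
  refine ⟨fun L h m lam => isSchurExpansion_transCoeff
      (hmono L h (Fin.castSucc_lt_succ (i := m)).le) (hsigma_smooth L h m) lam, hone,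
    fun L r t => summable_chainProb_mul_powerSum (hmono L) (hrho_smooth L) (hsigma_smooth L) t,
    -- The functions `g` contributing to both levels are those at or above the higher one.
    c, fun k h m k' h' m' => d (max m m') k h k' h', ?_, ?_, ?_, ?_, ?_⟩
  · intro k hk h m i
    refine ((hclt m).1.one k hk h i).congr fun L => ?_
    have h1 := HasJet.derivAtOne_eq_jetDeriv ((hg L).add (HasJet.sum
      (Finset.univ.filter fun q : Fin M => m ≤ q.castSucc) fun q _ => hℓ L h q))
      (List.replicate k (h, i))
    rw [h1]
    exact congrArg _ (hvanish L _ (h, i) (by simp; omega) m)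
  · intro k k' hk hk' h m h' m' i i' hi
    refine ((hclt (max m m')).1.two k k' hk hk' h h' i i' hi).congr fun L => ?_
    have hmem : (h, i) ∈ List.replicate k (h, i) ++ List.replicate k' (h', i') := by simp; omega
    have hmem' : (h', i') ∈ List.replicate k (h, i) ++ List.replicate k' (h', i') := by simp; omega
    by_cases hh : h = h'
    · simp only [if_pos hh]
      rw [HasJet.derivAtOne_eq_jetDeriv ((hg L).add (HasJet.sum
        (Finset.univ.filter fun q : Fin M => max m m' ≤ q.castSucc) fun q _ => hℓ L h q))]
      exact hvanish L _ (h, i) hmem _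
    · simp only [if_neg hh, add_zero]
      rw [HasJet.derivAtOne_eq_jetDeriv (hg L)]
      refine (hvanish L _ (h, i) hmem _).trans ?_
      rw [map_add, map_sum, Finset.sum_eq_zero, add_zero]
      exact fun q _ => jetDeriv_log_sgf_eq_zero (hℓ L h q) hmem' (Ne.symm hh)
  · intro k hk h m
    refine tendsto_of_tendsto_ofReal ?_
    have h1 := tendsto_mean_chainOp hnt hG (D := k + 2) (by omega) (k, h, m) (by simp only; omega)
    have h2 := (Complex.continuous_ofReal.tendsto _).comp
      (tendsto_floor_mul_div (b := a h m) (hNt h) (ha_pos h m))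
    rw [div_self (ha_pos h m).ne'] at h2
    have h3 := h2.mul h1
    rw [Complex.ofReal_one, one_mul] at h3
    refine h3.congr' ?_
    filter_upwards [hlarge (k + 2)] with L hL
    have h4 := hE' L (k + 2) (fun _ : Fin 1 => (k, h, m)) [0] (by simp)
      (fun j => by simp [Subsingleton.elim j 0]) (by simp) (by simp) hL Finset.univ
    simp only [Finset.univ_unique, Finset.prod_singleton] at h4
    push_cast
    rw [h4]
    have hn0 : (n L h m : ℂ) ≠ 0 := Nat.cast_ne_zero.2 (by have := hL h m; omega)
    have h5 : opMoment (evalZero H) [(0 : Fin 1)] (fun _ => chainOp n G (k + 2) (k, h, m) L)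
        Finset.univ = evalZero H (chainOp n G (k + 2) (k, h, m) L 1) := by
      simp [opMoment]
    refine Eq.trans ?_ (congrArg _ h5.symm)
    simp only [Function.comp_apply]
    push_cast
    have h6 : ((⌊a h m * (N L h : ℝ)⌋₊ : ℕ) : ℂ) = (n L h m : ℂ) := rfl
    rw [h6]
    field_simp
  · intro k k' hk hk' h m h' m' hm
    by_cases hle : m ≤ m'
    · have h1 := hcov k k' hk hk' h m h' m' hle
      unfold wickCov at h1
      beta_reduce
      rw [max_eq_right hle]
      exact h1
    -- Levels in the wrong order are only admitted for distinct coordinates, where the covariance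
    -- formula is symmetric.
    · have hne : h ≠ h' := fun heq => hle (hm heq)
      have h1 := hcov k' k hk' hk h' m' h m (le_of_not_ge hle)
      unfold wickCov at h1
      rw [limitCov_swap hk' hk _ _ _ (same := h' = h) (same' := h = h') hne.symm hne] at h1
      have hsymm : ∀ b b', 1 ≤ b → 1 ≤ b' → d m b' h' b h = d m b h b' h' := fun b b' hb hb' =>
        (hG m).symm hb' hb _ _
      beta_reduce
      rw [max_eq_left (le_of_not_ge hle)]
      have e : limitCov (fun k => c k h m) (fun k => c k h' m') (fun b b' => d m b' h' b h)
          (h = h') k k' = limitCov (fun k => c k h m) (fun k => c k h' m')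
          (fun b b' => d m b h b' h') (h = h') k k' := by
        rw [limitCov_eq hk hk', limitCov_eq hk hk']
        simp only [fun b b' : ℕ => hsymm (b + 1) (b' + 1) (by omega) (by omega)]
      simp only at h1
      rw [e] at h1
      refine h1.congr fun L => ?_
      rw [mul_comm (expect _ (powerSum k' h' m'))]
      simp only [mul_comm (powerSum k' h' m' _)]
      rfl
  · intro r hr t ht
    refine tendsto_of_tendsto_ofReal ?_
    obtain ⟨l, hl, hl', hsort⟩ := exists_sorted_list fun j => (t j).2.2
    have hle : ∀ j, (t j).1 ≤ ∑ i, (t i).1 := fun j =>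
      Finset.single_le_sum (f := fun i => (t i).1) (fun _ _ => Nat.zero_le _) (Finset.mem_univ j)
    have hlsum : (l.map fun j => (t j).1).sum = ∑ i, (t i).1 := by
      rw [← List.sum_toFinset _ hl]
      congr 1
      ext j
      simp [hl' j]
    -- The truncation order exceeds both the sum of all exponents, for exact moments, and any `k_i +
    -- k_j`, including `i = j`, for the contractions.
    have h1 := tendsto_cumulant_chainOp hnt hG (by rw [Fintype.card_fin]; omega)
      (D := 2 * (∑ i, (t i).1) + 1) (t := t) ht
      (fun i j => by have := hle i; have := hle j; omega) hl hl'
    rw [Complex.ofReal_zero]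
    refine h1.congr' ?_
    filter_upwards [hlarge (2 * (∑ i, (t i).1) + 1)] with L hL
    rw [jointCumulant_eq_cumulant]
    refine congrArg (fun f => cumulant f Finset.univ) (funext fun U => ?_)
    exact (hE' L _ t l hl hl' hsort (by omega) hL U).symm
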